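/- **Setting.** Let $g\in\mathbb R\setminus\{0\}$, $m>0$, $\mathfrak b=\frac12\frac{g^2}{8\pi+g^2}\in(0,\frac12)$, $\hat{\mathfrak b}=\frac12-\mathfrak b$ and $S(\beta)=\frac{\sinh\beta-i\sin 2\pi\mathfrak b}{\sinh\beta+i\sin 2\pi\mathfrak b}$. On $\mathbb R^{1,1}$ put $x\cdot y=x_0y_0-x_1y_1$; for a real vector $\gamma$ let $\bar p(\gamma)=\sum_a(m\cosh\gamma_a,m\sinh\gamma_a)$. If $B'$ is a reordering of the vector $B$, $S(B\mid B')$ is the product of $S(x-y)$ over the pairs of entries $x,y$ with $x$ before $y$ in $B$ and $y$ before $x$ in $B'$. $\overleftarrow{B}$ is the reversed vector, and $\cup$ denotes concatenation of vectors. *Operators.* A local operator $O$ is given by $s_O\in\mathbb C$, $\mathfrak w_O\in\mathbb R$, $\omega_O\in\mathbb R$ and functions $p_n(\beta\mid\ell)$, $n\ge 0$, $\beta\in\mathbb C^n$, $\ell\in\{0,1\}^n$, that are entire and $2i\pi$-periodic in each $\beta_a$, invariant under simultaneous permutations of the entries of $\beta$ and $\ell$, and such that: $p_n(\beta_2+i\pi,\beta_2,\dots,\beta_n\mid\ell)=g(\ell_1,\ell_2)\,p_{n-2}(\beta_3,\dots,\beta_n\mid\ell_3,\dots,\ell_n)+h(\ell_1,\ell_2\mid\beta_2,\dots,\beta_n)$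 for some functions $g,h$ with $g(0,1)=g(1,0)=-1/(\sin(2\pi\mathfrak b)\,\mathrm F(i\pi))$; $p_n(\beta+\theta(1,\dots,1)\mid\ell)=e^{\theta s_O}p_n(\beta\mid\ell)$ for $\theta\in\mathbb R$; $|p_n(\beta\mid\ell)|\le C_n\prod_a\cosh(\Re\beta_a)^{\mathfrak w_O}$. Here, with $\mathfrak z=i\beta/2\pi$ and $G$ the Barnes function, $$\mathrm F(\beta)=\frac{1}{\Gamma(1+\mathfrak z)\Gamma(-\mathfrak z)}\prod_{c\in\{\mathfrak b,\hat{\mathfrak b}\}}\frac{G(1-c-\mathfrak z)\,G(2-c+\mathfrak z)}{G(c-\mathfrak z)\,G(1+c+\mathfrak z)} .$$ Its form factors are $$\mathcal F^{(O)}(\beta)=\prod_{a<b}\mathrm F(\beta_a-\beta_b)\sum_{\ell\in\{0,1\}^n}(-1)^{\sum_a\ell_a}\prod_{a<b}\Big\{1-i\tfrac{(\ell_a-\ell_b)\sin 2\pi\mathfrak b}{\sinh(\beta_a-\beta_b)}\Big\}\,p_n(\beta\mid\ell),\qquad \beta\in\mathbb C^n .$$ *Action.* Let $\mathbb R^n_>=\{\beta_1>\dots>\beta_n\}$,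 and let $\bar e_\varepsilon=(1-\varepsilon/\pi)(1,\dots,1)$. For Schwartz $g$ on $\mathbb R^{1,1}$ and $f=(f^{(0)},f^{(1)},\dots)$ with $f^{(m)}$ a function on $\mathbb R^m_>$, $O^{(n)}[g]\cdot f=\sum_{m\ge0}M^{(m)}_O[g,f^{(m)}]$ where, for almost every $\alpha\in\mathbb R^n_>$, $$M^{(m)}_O[g,f^{(m)}](\alpha)=e^{-2i\pi n\omega_O}\lim_{\varepsilon\to0^+}\sum_{A_1,A_2,B_1,B_2}\int_{\mathbb R^m_>}\frac{d^m\beta}{(2\pi)^m}\,\Delta(A_1\mid B_1)\,S(\overleftarrow{\alpha}\mid\overleftarrow{A_2}\cup\overleftarrow{A_1})\,S(\beta\mid B_1\cup B_2)\,\mathcal F^{(O)}(\overleftarrow{A_2}+i\pi\bar e_\varepsilon,B_2)\,\hat g(\alpha,\beta)\,f^{(m)}(\beta),$$ $\hat g(\alpha,\beta)=\int d^2x\,e^{i[\bar p(\alpha)-\bar p(\beta)]\cdot x}g(x)$. The sum runs over the partitions of the entries of $\alpha$ into $A_1,A_2$ and of those of $\beta$ into $B_1,B_2$ with $|A_1|=|B_1|$,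 where $A_1,A_2,B_2$ keep the original order and $B_1$ comes in any order; $\Delta(A_1\mid B_1)=\prod_a 2\pi\delta\big((A_1)_a-(B_1)_a\big)$. For $r\in\mathbb N$, $O^{(r)}[g]\cdot f$ is also identified with the vector having this function as its only non-zero component, in the $r$-particle sector. Finally $f_{\rm vac}=(1,0,0,\dots)$, and the scalar product with $f_{\rm vac}$ selects the zero-particle component. **Proposition.** Let $k\ge1$, let $O_1,\dots,O_k$ be local operators, $g_1,\dots,g_k$ Schwartz functions on $\mathbb R^{1,1}$, $G_k(x_1,\dots,x_k)=\prod_s g_s(x_s)$ and $r=(r_1,\dots,r_{k-1})\in\mathbb N^{k-1}$. Let $$\mathcal N_r=\Big\{n=(n_{ba})_{1\le a<b\le k}\in\mathbb N^{k(k-1)/2}:\ \sum_{u=p+1}^k\sum_{s=1}^p n_{us}=r_p,\ p=1,\dots,k-1\Big\}.$$ For $n\in\mathcal N_r$ and $\gamma=(\gamma^{(ba)})_{b>a}$ with $\gamma^{(ba)}\in\mathbb R^{n_{ba}}$, put $$\mathcal S(\gamma)=\prod_{1\le s<u<p<v\le k}S\big(\gamma^{(vu)}\cup\gamma^{(ps)}\mid\gamma^{(ps)}\cup\gamma^{(vu)}\big),\qquad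 \mathcal R[G](\gamma)=\int_{(\mathbb R^{1,1})^k}\prod_s dx_s\,G(x_1,\dots,x_k)\prod_{b>a}e^{i\bar p(\gamma^{(ba)})\cdot(x_b-x_a)},$$ $$\mathcal F_{{\rm tot};\varepsilon}(\gamma)=\prod_{p=1}^k\mathcal F^{(O_p)}\Big(\overleftarrow{\gamma^{(p\,p-1)}}\cup\dots\cup\overleftarrow{\gamma^{(p1)}}+i\pi\bar e_{\varepsilon_p},\ \gamma^{(kp)}\cup\dots\cup\gamma^{(p+1\,p)}\Big),$$ $$\mathcal I_n[G_k]=\lim_{\varepsilon_1\to0^+}\int d^{n_{21}}\gamma^{(21)}\ \lim_{\varepsilon_2\to0^+}\int d^{n_{31}}\gamma^{(31)}d^{n_{32}}\gamma^{(32)}\cdots\lim_{\varepsilon_{k-1}\to0^+}\int d^{n_{k1}}\gamma^{(k1)}\cdots d^{n_{k\,k-1}}\gamma^{(k\,k-1)}\ \lim_{\varepsilon_k\to0^+}\big(\mathcal S\cdot\mathcal R[G_k]\cdot\mathcal F_{{\rm tot};\varepsilon}\big)(\gamma),$$ the integrals being over all real values. Suppose that $\mathcal I_n[G_k]$ is well-defined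 (the successive limits exist and the integrals converge) for every $n\in\mathcal N_r$. Then the truncated vacuum expectation value below is well-defined (the successive operator actions exist), and $$\Big(f_{\rm vac},\,O_1[g_1]\cdot O_2^{(r_1)}[g_2]\cdots O_k^{(r_{k-1})}[g_k]\cdot f_{\rm vac}\Big)=\sum_{n\in\mathcal N_r}\frac{\mathcal I_n[G_k]}{n!\,(2\pi)^{|n|}}\prod_{b>a}e^{-2i\pi n_{ba}\omega_{ba}},\qquad \omega_{ba}=\sum_{\ell=a+1}^b\omega_{O_\ell},$$ where $n!=\prod_{b>a}n_{ba}!$ and $|n|=\sum_{b>a}n_{ba}$. -/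

import Mathlib

open MeasureTheory Filter Topology
open scoped SchwartzMap

noncomputable section

namespace SinhGordon

/-! ### Parameters of the model, scattering matrix, kinematics -/

/-- The parameters of the quantum Sinh-Gordon model: the coupling `g` and the particle mass. -/
structure Model where
  coupling : ℝ
  mass : ℝ
  coupling_ne_zero : coupling ≠ 0
  mass_pos : 0 < mass

namespace Model

variable (Q : Model)

/-- `𝔟 = (1/2) g² / (8π + g²) ∈ (0, 1/2)`. -/
def b : ℝ := 1 / 2 * (Q.coupling ^ 2 / (8 * Real.pi + Q.coupling ^ 2))

/-- The dual parameter `1/2 - 𝔟`. -/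
def bHat : ℝ := 1 / 2 - Q.b

/-- `sin (2π𝔟)`. -/
def sinB : ℝ := Real.sin (2 * Real.pi * Q.b)

/-- The two-body scattering matrix
`S(β) = (sinh β - i sin 2π𝔟) / (sinh β + i sin 2π𝔟)`. -/
def S (β : ℂ) : ℂ :=
  (Complex.sinh β - Complex.I * (Q.sinB : ℂ)) / (Complex.sinh β + Complex.I * (Q.sinB : ℂ))

/-- Relativistic two-momentum `(m cosh β, m sinh β)` of a particle of rapidity `β`. -/
def momentum (β : ℝ) : ℝ × ℝ := (Q.mass * Real.cosh β, Q.mass * Real.sinh β)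

/-- Total momentum of a finite family of rapidities. -/
def totalMomentum {ι : Type*} [Fintype ι] (β : ι → ℝ) : ℝ × ℝ := ∑ a, Q.momentum (β a)

end Model

/-- The Minkowski form on `ℝ^{1,1}` of signature `(1,-1)`. -/
def minkowski (x y : ℝ × ℝ) : ℝ := x.1 * y.1 - x.2 * y.2

/-- The product of two-body `S`-factors `S(l ∣ l')` generated by reordering the vector of rapidities
`(v i)_{i ∈ l}` into `(v i)_{i ∈ l'}`, where `l` and `l'` are two orderings of the same set of labels:
each pair of labels whose order is exchanged contributes `S(v i - v j)`, with `i` preceding `j`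
in `l`. -/
def Model.scattering (Q : Model) {ι : Type*} [DecidableEq ι] (v : ι → ℝ) (l l' : List ι) : ℂ :=
  ∏ i ∈ l.toFinset, ∏ j ∈ l.toFinset,
    if l.idxOf i < l.idxOf j ∧ l'.idxOf j < l'.idxOf i then Q.S ((v i : ℂ) - (v j : ℂ)) else 1

/-! ### Form factors -/

/-- The Barnes `G`-function, through its canonical product
`G(1+z) = (2π)^{z/2} exp(-(z + (1+γ) z²)/2) ∏_{k ≥ 1} (1 + z/k)^k exp(z²/(2k) - z)`. -/
def barnesG (w : ℂ) : ℂ :=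
  let z := w - 1
  ((2 * Real.pi : ℝ) : ℂ) ^ (z / 2) *
    Complex.exp (-(z + (1 + (Real.eulerMascheroniConstant : ℂ)) * z ^ 2) / 2) *
    ∏' k : ℕ, (1 + z / ((k : ℂ) + 1)) ^ (k + 1) * Complex.exp (z ^ 2 / (2 * ((k : ℂ) + 1)) - z)

namespace Model

variable (Q : Model)

/-- The pole-free two-particle form factor `F(β)`, with `𝔷 = iβ/2π`. -/
def minimalFF (β : ℂ) : ℂ :=
  let z := Complex.I * β / (2 * Real.pi)
  let b : ℂ := Q.b
  let b' : ℂ := Q.bHat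
  1 / (Complex.Gamma (1 + z) * Complex.Gamma (-z)) *
    ((barnesG (1 - b - z) * barnesG (2 - b + z) * barnesG (1 - b' - z) * barnesG (2 - b' + z)) /
      (barnesG (b - z) * barnesG (1 + b + z) * barnesG (b' - z) * barnesG (1 + b' + z)))

/-- The `K`-transform of a function `p` of `n` complex and `n` two-valued variables. -/
def kTransform {n : ℕ} (p : (Fin n → ℂ) → (Fin n → Fin 2) → ℂ) (β : Fin n → ℂ) : ℂ :=
  ∑ l : Fin n → Fin 2, (-1) ^ (∑ a, (l a : ℕ)) *
    (∏ k, ∏ s, if k < s then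
      1 - Complex.I * ((((l k : ℕ) : ℂ) - ((l s : ℕ) : ℂ)) * (Q.sinB : ℂ)) /
        Complex.sinh (β k - β s)
      else 1) * p β l

end Model

/-- The data of a local operator `O`: a solution `(p_n)` of the constraints
(symmetry, periodicity, reduction, Lorentz covariance, growth) which generate its form factors,
with its spin `s_O`, growth index `w_O` and mutual locality index `ω_O`. -/
structure LocalOperator (Q : Model) where
  p : (n : ℕ) → (Fin n → ℂ) → (Fin n → Fin 2) → ℂ
  spin : ℂ
  growth : ℝ
  omega : ℝ
  holomorphic : ∀ n l, Differentiable ℂ (fun β => p n β l)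
  periodic : ∀ n β l (a : Fin n),
    p n (Function.update β a (β a + 2 * Real.pi * Complex.I)) l = p n β l
  symmetric : ∀ n (σ : Equiv.Perm (Fin n)) β l, p n (β ∘ σ) (l ∘ σ) = p n β l
  reduction : ∀ n, ∃ (g : Fin 2 → Fin 2 → ℂ) (h : Fin 2 → Fin 2 → (Fin (n + 1) → ℂ) → ℂ),
    g 0 1 = -1 / ((Q.sinB : ℂ) * Q.minimalFF (Complex.I * Real.pi)) ∧
    g 1 0 = -1 / ((Q.sinB : ℂ) * Q.minimalFF (Complex.I * Real.pi)) ∧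
    ∀ (β : Fin (n + 1) → ℂ) (l : Fin (n + 2) → Fin 2),
      p (n + 2) (Fin.cons (β 0 + Complex.I * Real.pi) β) l =
        g (l 0) (l 1) * p n (fun i => β i.succ) (fun i => l i.succ.succ) + h (l 0) (l 1) β
  boost : ∀ n (θ : ℝ) β l, p n (fun a => β a + (θ : ℂ)) l = Complex.exp (θ * spin) * p n β l
  bounded : ∀ n, ∃ C : ℝ, ∀ β l, ‖p n β l‖ ≤ C * ∏ a, Real.cosh (β a).re ^ growth

namespace LocalOperator

variable {Q : Model} (O : LocalOperator Q)

/-- The form factor `F_n^{(O)}(β) = ∏_{a<b} F(β_a - β_b) · K_n[p_n](β)`. -/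
def formFactorN {n : ℕ} (β : Fin n → ℂ) : ℂ :=
  (∏ a, ∏ c, if a < c then Q.minimalFF (β a - β c) else 1) * Q.kTransform (O.p n) β

/-- The form factor of a vector of rapidities of arbitrary length. -/
def formFactor (v : List ℂ) : ℂ := O.formFactorN v.get

/-- `F^{(O)}(x + iπ e_ε, y)`, where `e_ε = (1 - ε/π)(1,…,1)`. -/
def shiftedFormFactor (ε : ℝ) (x y : List ℝ) : ℂ :=
  O.formFactor (x.map (fun t => (t : ℂ) + Complex.I * Real.pi * (1 - (ε : ℂ) / Real.pi)) ++
    y.map (fun t => (t : ℂ)))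

end LocalOperator

/-! ### Action of the smeared operators on the Fock space -/

/-- The sector `ℝ^n_> = {β : β_1 > ⋯ > β_n}`. -/
def orderedSector (n : ℕ) : Set (Fin n → ℝ) := {β | ∀ i j, i < j → β j < β i}

/-- Sequences `f = (f^{(0)}, f^{(1)}, …)` of functions `f^{(n)}` on the sectors `ℝ^n_>`
(only the values on `ℝ^n_>` matter). -/
abbrev FockVector := (n : ℕ) → (Fin n → ℝ) → ℂ

/-- The vacuum `(1, 0, 0, …)`. -/
def vacuum : FockVector := fun n _ => if n = 0 then 1 else 0

/-- `R[g](A, B) = ∫ d²x exp(i [p(A) - p(B)] · x) g(x)`. -/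
def Model.smearing (Q : Model) (g : 𝓢(ℝ × ℝ, ℂ)) {n m : ℕ} (α : Fin n → ℝ) (β : Fin m → ℝ) : ℂ :=
  ∫ x : ℝ × ℝ, Complex.exp
    (Complex.I * ((minkowski (Q.totalMomentum α - Q.totalMomentum β) x : ℝ) : ℂ)) * g x

/-- The elements of `A` in increasing order. -/
def orderedList {n : ℕ} (A : Finset (Fin n)) : List (Fin n) := (List.finRange n).filter (· ∈ A)

section Kernel

variable {n m : ℕ}

/-- A choice of partitions `α = A₁ ∪ A₂` (both parts in the original order, `A₂` the complement of
`A₁`) and `β = B₁ ∪ B₂` with `|B₁| = |A₁|`, the elements `β_{i_1}, …, β_{i_p}` of `B₁` being taken in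
an arbitrary order, and those of `B₂` in the original order. -/
abbrev Contraction (n m : ℕ) := (A : Finset (Fin n)) × (Fin A.card ↪ Fin m)

namespace Contraction

variable (c : Contraction n m)

/-- The labels of `A₁`. -/
def A₁ : List (Fin n) := orderedList c.1

/-- The labels of `A₂`. -/
def A₂ : List (Fin n) := orderedList c.1ᶜ

/-- The labels of `B₁`. -/
def B₁ : List (Fin m) := (List.finRange c.1.card).map c.2

/-- The labels of `B₂`. -/
def B₂ : List (Fin m) := orderedList (Finset.univ.map c.2)ᶜ

open Classical in
/-- The measure `∏_a δ(α_{k_a} - β_{i_a}) d^mβ`: the variables of `B₁` carry the Dirac masses at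
their partners in `A₁`, those of `B₂` the Lebesgue measure. -/
def measure (α : Fin n → ℝ) : Measure (Fin m → ℝ) :=
  Measure.pi fun j =>
    if h : ∃ a, c.2 a = j then Measure.dirac (α (c.1.orderEmbOfFin rfl h.choose)) else volume

/-- The function integrated against the Dirac masses of the contraction `c`: the product
`S(←A ∣ ←A₂ ∪ ←A₁) S(B ∣ B₁ ∪ B₂) F(←A₂ + iπ e_ε, B₂) R[g](A, B) f(B)`. -/
def integrand {Q : Model} (O : LocalOperator Q) (g : 𝓢(ℝ × ℝ, ℂ)) (f : (Fin m → ℝ) → ℂ)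
    (ε : ℝ) (α : Fin n → ℝ) (β : Fin m → ℝ) : ℂ :=
  Q.scattering α (List.finRange n).reverse (c.A₂.reverse ++ c.A₁.reverse) *
    Q.scattering β (List.finRange m) (c.B₁ ++ c.B₂) *
    O.shiftedFormFactor ε (c.A₂.reverse.map α) (c.B₂.map β) *
    Q.smearing g α β * f β

end Contraction

/-- The regularised action on an `m`-particle wave function `f`, in the `n`-particle sector:
`∫_{ℝ^m_>} d^mβ/(2π)^m M_{n;m}(α; β)_ε R[g](α, β) f(β)`, the kernel `M_{n;m}` carrying the phase
`exp(-2iπ n ω_O)` and a factor `2πδ` for each contracted pair. -/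
def regularizedAction {Q : Model} (O : LocalOperator Q) (g : 𝓢(ℝ × ℝ, ℂ)) (f : (Fin m → ℝ) → ℂ)
    (ε : ℝ) (α : Fin n → ℝ) : ℂ :=
  Complex.exp (-2 * Complex.I * Real.pi * n * O.omega) *
    ∑ c : Contraction n m,
      (2 * Real.pi : ℂ) ^ c.1.card / (2 * Real.pi : ℂ) ^ m *
        ∫ β in orderedSector m, c.integrand O g f ε α β ∂(c.measure α)

/-- `φ = M_O^{(m)}[g, f]` in the `n`-particle sector: for almost every `α ∈ ℝ^n_>`, the regularised
action is given by convergent integrals and tends to `φ(α)` as the regulator `ε` tends to `0⁺`. -/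
def IsKernelAction {Q : Model} (O : LocalOperator Q) (g : 𝓢(ℝ × ℝ, ℂ)) (f : (Fin m → ℝ) → ℂ)
    (φ : (Fin n → ℝ) → ℂ) : Prop :=
  ∀ᵐ α ∂(volume.restrict (orderedSector n)),
    (∀ᶠ ε in 𝓝[>] (0 : ℝ), ∀ c : Contraction n m,
      IntegrableOn (c.integrand O g f ε α) (orderedSector m) (c.measure α)) ∧
    Tendsto (fun ε => regularizedAction O g f ε α) (𝓝[>] (0 : ℝ)) (𝓝 (φ α))

end Kernel

/-- `φ = O^{(n)}[g] · f = ∑_{m ≥ 0} M_O^{(m)}[g, f^{(m)}]` in the `n`-particle sector. -/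
def IsSectorAction {Q : Model} (O : LocalOperator Q) (g : 𝓢(ℝ × ℝ, ℂ)) (n : ℕ) (f : FockVector)
    (φ : (Fin n → ℝ) → ℂ) : Prop :=
  ∃ ψ : ℕ → (Fin n → ℝ) → ℂ, (∀ m, IsKernelAction O g (f m) (ψ m)) ∧
    ∀ᵐ α ∂(volume.restrict (orderedSector n)), HasSum (fun m => ψ m α) (φ α)

/-- `f' = (0, …, 0, O^{(n)}[g] · f, 0, …)`, with the non-zero entry in the `n`-particle sector. -/
def IsTruncatedAction {Q : Model} (O : LocalOperator Q) (g : 𝓢(ℝ × ℝ, ℂ)) (n : ℕ)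
    (f f' : FockVector) : Prop :=
  IsSectorAction O g n f (f' n) ∧ ∀ m, m ≠ n → f' m = 0

/-- The truncated vacuum expectation value
`(f_vac, O_1[g_1] · O_2^{(r_1)}[g_2] ⋯ O_k^{(r_{k-1})}[g_k] · f_vac)`, `k = K + 1`, is well-defined
and equal to `c`. The operators are applied successively to the vacuum, starting with the last one;
the scalar product with `f_vac = (1, 0, …)` selects the zero-particle component. -/
def IsTruncatedExpectation {Q : Model} {K : ℕ} (O : Fin (K + 1) → LocalOperator Q)
    (g : Fin (K + 1) → 𝓢(ℝ × ℝ, ℂ)) (r : Fin K → ℕ) (c : ℂ) : Prop :=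
  ∃ Φ : Fin (K + 2) → FockVector,
    Φ (Fin.last (K + 1)) = vacuum ∧
    (∀ p : Fin (K + 1), IsTruncatedAction (O p) (g p) ((Fin.cons 0 r : Fin (K + 1) → ℕ) p)
      (Φ p.succ) (Φ p.castSucc)) ∧
    c = Φ 0 0 ![]

/-! ### The multiple integrals

The operators are labelled by `Fin (K + 1)`, that is from `0` to `K = k - 1`. -/

/-- The pairs `(b, a)` with `b > a`. -/
abbrev OrdPair (K : ℕ) := {q : Fin (K + 1) × Fin (K + 1) // q.2 < q.1}

/-- The set `N_r` of the `n = (n_{ba})_{b > a}` with `∑_{u > p ≥ s} n_{us} = r_p` for all `p`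
(in the labels from `1` to `k`). -/
def truncationSet {K : ℕ} (r : Fin K → ℕ) : Set (OrdPair K → ℕ) :=
  {n | ∀ p : Fin K, ∑ q : OrdPair K,
    (if q.1.2 ≤ p.castSucc ∧ p.castSucc < q.1.1 then n q else 0) = r p}

theorem truncationSet_finite {K : ℕ} (r : Fin K → ℕ) : (truncationSet r).Finite := by
  refine (Set.finite_Iic (fun _ : OrdPair K => ∑ p, r p)).subset fun n hn q => ?_
  obtain ⟨⟨b, a⟩, hq⟩ := q
  have ha : (a : ℕ) < K := lt_of_lt_of_le hq (Nat.lt_succ_iff.mp b.2)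
  have h := hn ⟨a, ha⟩
  refine le_trans ?_ (Finset.single_le_sum (f := r) (fun _ _ => Nat.zero_le _)
    (Finset.mem_univ ⟨a, ha⟩))
  rw [← h]
  have h2 := Finset.single_le_sum (f := fun q : OrdPair K =>
    if q.1.2 ≤ (⟨a, ha⟩ : Fin K).castSucc ∧ (⟨a, ha⟩ : Fin K).castSucc < q.1.1 then n q else 0)
    (fun _ _ => Nat.zero_le _) (Finset.mem_univ ⟨(b, a), hq⟩)
  refine le_trans (le_of_eq ?_) h2
  have h3 : (⟨a, ha⟩ : Fin K).castSucc = a := Fin.ext rfl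
  simp only [h3]
  rw [if_pos ⟨le_refl _, hq⟩]

section Integrals

variable {K : ℕ}

/-- Labels of the integration variables: `⟨(b, a), j⟩` is the label of `γ^{(ba)}_j`. -/
abbrev Label (n : OrdPair K → ℕ) := (q : OrdPair K) × Fin (n q)

variable {n : OrdPair K → ℕ}

/-- The labels of the entries of the vector `γ^{(ba)}`, in order (empty unless `b > a`). -/
def block (n : OrdPair K → ℕ) (b a : Fin (K + 1)) : List (Label n) :=
  if h : a < b then (List.finRange (n ⟨(b, a), h⟩)).map (fun j => ⟨⟨(b, a), h⟩, j⟩) else []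

/-- The labels of `←γ^{(p p-1)} ∪ ⋯ ∪ ←γ^{(p 1)}`. -/
def incoming (n : OrdPair K → ℕ) (p : Fin (K + 1)) : List (Label n) :=
  (List.finRange (K + 1)).reverse.flatMap fun s => (block n p s).reverse

/-- The labels of `γ^{(k p)} ∪ ⋯ ∪ γ^{(p+1 p)}`. -/
def outgoing (n : OrdPair K → ℕ) (p : Fin (K + 1)) : List (Label n) :=
  (List.finRange (K + 1)).reverse.flatMap fun u => block n u p

/-- The factor
`S(γ) = ∏_{v > p > u > s} S(γ^{(vu)} ∪ γ^{(ps)} ∣ γ^{(ps)} ∪ γ^{(vu)})`. -/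
def totalScattering (Q : Model) (γ : Label n → ℝ) : ℂ :=
  ∏ v, ∏ p, ∏ u, ∏ s, if s < u ∧ u < p ∧ p < v then
    Q.scattering γ (block n v u ++ block n p s) (block n p s ++ block n v u) else 1

/-- The factor
`R[G](γ) = ∫ ∏_s dx_s G(x_1, …, x_k) ∏_{b > a} exp(i p(γ^{(ba)}) · (x_b - x_a))`. -/
def totalSmearing (Q : Model) (G : (Fin (K + 1) → ℝ × ℝ) → ℂ) (γ : Label n → ℝ) : ℂ :=
  ∫ x : Fin (K + 1) → ℝ × ℝ, G x * ∏ q : OrdPair K,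
    Complex.exp (Complex.I *
      ((minkowski (Q.totalMomentum fun j => γ ⟨q, j⟩) (x q.1.1 - x q.1.2) : ℝ) : ℂ))

/-- The factor `F_{tot;ε}(γ)`. -/
def totalFormFactor {Q : Model} (O : Fin (K + 1) → LocalOperator Q) (ε : Fin (K + 1) → ℝ)
    (γ : Label n → ℝ) : ℂ :=
  ∏ p, (O p).shiftedFormFactor (ε p) ((incoming n p).map γ) ((outgoing n p).map γ)

/-- The labels of all the variables `γ^{(b1)}, …, γ^{(b b-1)}`. -/
abbrev Block (n : OrdPair K → ℕ) (b : Fin (K + 1)) := {i : Label n // i.1.1.1 = b}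

/-- The label `K - j`. -/
def level (K j : ℕ) : Fin (K + 1) := ⟨K - j, by omega⟩

/-- Replace the variables `γ^{(b1)}, …, γ^{(b b-1)}` of `γ` by `y`. -/
def setBlock (γ : Label n → ℝ) (b : Fin (K + 1)) (y : Block n b → ℝ) :
    Label n → ℝ :=
  fun i => if h : i.1.1.1 = b then y ⟨i, h⟩ else γ i

/-- `IsIteratedLimit Ψ j ε γ v`: with `p = K - j` (labels from `0` to `K`), the iterated boundary value
`lim_{ε_p → 0⁺} ∫ dγ^{(p+1 ·)} lim_{ε_{p+1} → 0⁺} ∫ dγ^{(p+2 ·)} ⋯ ∫ dγ^{(K ·)} lim_{ε_K → 0⁺} Ψ(ε; γ)`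
is well-defined and equal to `v`, at fixed values `ε_0, …, ε_{p-1}` and `γ^{(ba)}`, `b ≤ p`. Here
`J t y` is the value of the inner iterated limit at `ε_p = t` and `γ^{(p+1 ·)} = y`. -/
def IsIteratedLimit (Ψ : (Fin (K + 1) → ℝ) → (Label n → ℝ) → ℂ) :
    ℕ → (Fin (K + 1) → ℝ) → (Label n → ℝ) → ℂ → Prop
  | 0, ε, γ, v =>
      Tendsto (fun t => Ψ (Function.update ε (Fin.last K) t) γ) (𝓝[>] (0 : ℝ)) (𝓝 v)
  | j + 1, ε, γ, v =>
      ∃ J : ℝ → (Block n (level K j) → ℝ) → ℂ,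
        (∀ᶠ t in 𝓝[>] (0 : ℝ),
          (∀ᵐ y : Block n (level K j) → ℝ,
            IsIteratedLimit Ψ j (Function.update ε (level K (j + 1)) t)
              (setBlock γ (level K j) y) (J t y)) ∧
          Integrable (J t)) ∧
        Tendsto (fun t => ∫ y, J t y) (𝓝[>] (0 : ℝ)) (𝓝 v)

/-- The iterated boundary-value integral `I_n[G]` of `S · R[G] · F_{tot;ε}` is well-defined and equal
to `v`. All regulators and all variables are bound, so that the base points `0` play no role. -/
def IsSummand {Q : Model} (O : Fin (K + 1) → LocalOperator Q) (G : (Fin (K + 1) → ℝ × ℝ) → ℂ)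
    (n : OrdPair K → ℕ) (v : ℂ) : Prop :=
  IsIteratedLimit
    (fun ε (γ : Label n → ℝ) =>
      totalScattering Q γ * totalSmearing Q G γ * totalFormFactor O ε γ) K 0 0 v

end Integrals

/-- `ω_{ba} = ∑_{ℓ = a+1}^{b} ω_{O_ℓ}`. -/
def omegaSum {Q : Model} {K : ℕ} (O : Fin (K + 1) → LocalOperator Q) (q : OrdPair K) : ℝ :=
  ∑ l ∈ Finset.Ioc q.1.2 q.1.1, (O l).omega

end SinhGordon

end

/-!
The operators are numbered by levels `1, …, K + 1`. A particle is described by its rapidity, by the level `hi` of the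
operator which absorbs it (whose form factor contains its rapidity shifted by `iπ`) and by the level `lo < hi` of the
operator which emits it. To a finite family of such particles belongs the amplitude `amp` of the operators
`p ≤ q < k`, a product of their form factors, of a scattering factor for each pair of world lines which cross, and of
the Fourier transforms of the smearing functions at the momenta which the operators absorb. The integrand of the
multiple integrals is such an amplitude (`totalScattering_mul_totalSmearing_mul_totalFormFactor`), and so, up to
factors which depend on the order of the particles only, is the kernel of a single operator (`extFactor_mul_amp_succ`,
`pairProd_mul_integrand`).

*Boundary values.* The only singularities of an amplitude at vanishing regulators are the simple poles of
`F(β_i - β_j + iπ - iε)` at coinciding rapidities of a particle `i` absorbed and a particle `j` emitted by the same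
operator. The quotient form of `F` in terms of Barnes functions shows that `F`, apart from this pole, has polynomial
growth in `cosh β` (`norm_twoBody_le`), whereas the smearing factors decrease rapidly in all rapidities, since energies
are positive (`exists_prod_inv_flow_le`). Shifting each integrated rapidity into the complex domain by an amount
proportional to `hi` moves all the poles away from the contour. The smearing factors are not analytic, but an almost
analytic extension of them along the direction of the shift, with Green's formula, suffices
(`integral_mul_eq_integral_stripKernel`, `integral_eq_stripIntegral`). This defines `boundaryValue` for regulators
`ε ≥ 0`; it is jointly continuous in them (`continuousOn_boundaryValue`), decreases rapidly in the other rapidities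
(`exists_norm_boundaryValue_le`) and is the integral of the amplitude at positive regulators
(`boundaryValue_eq_integral`). By continuity, Fubini's theorem extends to successive integrations with vanishing
regulators (`integral_amp_mul_boundaryValue`). In particular all the limits in question exist.

*Combinatorics.* By Watson's equation `F(β) = S(β) F(-β)` (`minimalFF_eq_S_mul`), the wave functions become symmetric
functions of the rapidities after multiplication with `∏_{i<j} F(β_i - β_j)`. In this form the sum over the
contractions is a sum over the sets of spectators, with unordered integrations over the emitted particles and a factor
`1/l!` (`pairProd_mul_regularizedAction`). The amplitudes have a normal form which does not refer to an order of the
particles (`extFactor_mul_ampA`); hence boundary values may be relabelled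
(`IsRelabelling.extFactor_mul_boundaryValue`). Induction over the operators, starting with the last one, shows that
the operators `p, p + 1, …` applied to the vacuum yield `expansion`: a sum over the levels at which the external
particles are absorbed and over the numbers `n` of particles exchanged by each pair of operators, with the coefficient
`1/(n! (2π)^{|n|})`. In the induction step the integral over the particles emitted by `p` is one of the successive
integrations of the boundary value (`integral_contractionKernel_mul_term`), and the sum over the levels of the `l`
emitted particles turns `1/l!` into the product of the factorials of their numbers at each level
(`sum_eq_sum_piAntidiag`). The truncation fixes the number of particles present between any two successive operators;
these conditions define the set of the `n` over which the sum extends (`mem_admissible_iff_mem_truncationSet`).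

Without external particles the terms of the expansion are the boundary values of the complete amplitudes, and so are
the iterated limits (`isSummand_term`). Since iterated limits are unique, the two sides agree.
-/

noncomputable section

namespace SinhGordon

/-! ### The Barnes function and its reflection quotient -/

/-- The `k`-th factor of the canonical product of `G(1+z)`. -/
def barnesFactor (k : ℕ) (z : ℂ) : ℂ :=
  (1 + z / ((k : ℂ) + 1)) ^ (k + 1) * Complex.exp (z ^ 2 / (2 * ((k : ℂ) + 1)) - z)

/-- The canonical product of `G(1+z)`, without its exponential prefactor. -/
def barnesProd (z : ℂ) : ℂ := ∏' k : ℕ, barnesFactor k z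

lemma natCast_add_one_ne_zero' (k : ℕ) : (k : ℂ) + 1 ≠ 0 := by
  exact_mod_cast Nat.succ_ne_zero k

lemma norm_barnesFactor_sub_one_le {k : ℕ} {z : ℂ} {ρ : ℝ} (hρ : 1 ≤ ρ) (hz : ‖z‖ ≤ ρ)
    (hk : 2 * ρ ^ 3 ≤ (k : ℝ) + 1) :
    ‖barnesFactor k z - 1‖ ≤ 2 * ρ ^ 3 * (1 / ((k : ℝ) + 1) ^ 2) := by
  set n : ℂ := (k : ℂ) + 1 with hn
  have hn0 : n ≠ 0 := natCast_add_one_ne_zero' k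
  have hnn : ‖n‖ = (k : ℝ) + 1 := by
    rw [hn]; exact_mod_cast Complex.norm_natCast (k + 1)
  have hk1 : (0 : ℝ) < (k : ℝ) + 1 := by positivity
  have hk2 : 1 ≤ (k : ℝ) + 1 := by linarith [(Nat.cast_nonneg k : (0 : ℝ) ≤ k)]
  set t : ℂ := z / n with ht
  have ht0 : ‖t‖ ≤ ρ / ((k : ℝ) + 1) := by
    rw [ht, norm_div, hnn]; gcongr
  have hρ3 : ρ ≤ ρ ^ 3 := by nlinarith [sq_nonneg ρ, mul_pos (lt_of_lt_of_le one_pos hρ) (lt_of_lt_of_le one_pos hρ)]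
  have ht1 : ‖t‖ ≤ 1 / 2 := by
    refine ht0.trans ?_
    rw [div_le_div_iff₀ hk1 (by norm_num)]
    linarith
  have hlt : ‖t‖ < 1 := by linarith
  have h1t : 1 + t ≠ 0 := by
    intro h
    have : t = -1 := by linear_combination h
    rw [this] at hlt; simp at hlt
  have hL := Complex.norm_log_sub_logTaylor_le 2 hlt
  have hT : Complex.logTaylor (2 + 1) t = t - t ^ 2 / 2 := by
    simp [Complex.logTaylor, Finset.sum_range_succ]; ring
  rw [hT] at hL
  set u : ℂ := n * (Complex.log (1 + t) - (t - t ^ 2 / 2)) with hu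
  have hexp : barnesFactor k z = Complex.exp u := by
    have e1 : (1 + t) ^ (k + 1) = Complex.exp (n * Complex.log (1 + t)) := by
      rw [hn, show ((k : ℂ) + 1) = ((k + 1 : ℕ) : ℂ) by push_cast; rfl, Complex.exp_nat_mul,
        Complex.exp_log h1t]
    rw [barnesFactor, ← hn, ← ht, e1, ← Complex.exp_add, hu]
    congr 1
    rw [ht]; field_simp; ring
  have hub : ‖u‖ ≤ ρ ^ 3 * (1 / ((k : ℝ) + 1) ^ 2) := by
    have h3 : ‖Complex.log (1 + t) - (t - t ^ 2 / 2)‖ ≤ ‖t‖ ^ 3 := by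
      refine hL.trans ?_
      have : (1 - ‖t‖)⁻¹ ≤ 2 := by
        rw [inv_le_comm₀ (by linarith) (by norm_num)]; linarith
      calc ‖t‖ ^ (2 + 1) * (1 - ‖t‖)⁻¹ / ((2 : ℕ) + 1) ≤ ‖t‖ ^ 3 * 2 / ((2 : ℕ) + 1) := by gcongr
        _ ≤ ‖t‖ ^ 3 := by
          push_cast
          nlinarith [pow_nonneg (norm_nonneg t) 3]
    calc ‖u‖ ≤ ((k : ℝ) + 1) * (ρ / ((k : ℝ) + 1)) ^ 3 := by
          rw [hu, norm_mul, hnn]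
          have := h3.trans (pow_le_pow_left₀ (norm_nonneg _) ht0 3)
          gcongr
      _ = ρ ^ 3 * (1 / ((k : ℝ) + 1) ^ 2) := by field_simp
  have hu1 : ‖u‖ ≤ 1 := by
    refine hub.trans ?_
    rw [mul_one_div, div_le_one (by positivity)]
    nlinarith
  rw [hexp]
  refine (Complex.norm_exp_sub_one_le hu1).trans ?_
  linarith

lemma summable_inv_sq (C : ℝ) : Summable fun k : ℕ => C * (1 / ((k : ℝ) + 1) ^ 2) := by
  refine Summable.mul_left C ?_
  have := (summable_nat_add_iff 1).2 (Real.summable_one_div_nat_pow.2 (one_lt_two))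
  simpa using this

lemma eventually_norm_barnesFactor_sub_one_le {ρ : ℝ} (hρ : 1 ≤ ρ) :
    ∀ᶠ k : ℕ in atTop, ∀ z ∈ Metric.ball (0 : ℂ) ρ,
      ‖barnesFactor k z - 1‖ ≤ 2 * ρ ^ 3 * (1 / ((k : ℝ) + 1) ^ 2) := by
  filter_upwards [eventually_ge_atTop (⌈2 * ρ ^ 3⌉₊)] with k hk z hz
  refine norm_barnesFactor_sub_one_le hρ (by simpa using (Metric.mem_ball.1 hz).le) ?_
  have : 2 * ρ ^ 3 ≤ k := (Nat.le_ceil _).trans (by exact_mod_cast hk)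
  linarith

lemma differentiable_barnesFactor (k : ℕ) : Differentiable ℂ (barnesFactor k) := by
  unfold barnesFactor
  fun_prop

lemma summable_norm_barnesFactor_sub_one (z : ℂ) :
    Summable fun k => ‖barnesFactor k z - 1‖ := by
  have hρ : 1 ≤ ‖z‖ + 1 := by linarith [norm_nonneg z]
  refine (summable_inv_sq (2 * (‖z‖ + 1) ^ 3)).of_norm_bounded_eventually_nat ?_
  filter_upwards [eventually_norm_barnesFactor_sub_one_le hρ] with k hk
  rw [norm_norm]
  exact hk z (by simp)

lemma tendsto_barnesProd (z : ℂ) :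
    Tendsto (fun N => ∏ k ∈ Finset.range N, barnesFactor k z) atTop (𝓝 (barnesProd z)) := by
  have h := multipliable_one_add_of_summable (summable_norm_barnesFactor_sub_one z)
  simp only [add_sub_cancel] at h
  exact h.hasProd.tendsto_prod_nat

lemma differentiable_barnesProd : Differentiable ℂ barnesProd := by
  intro z
  have hρ : 1 ≤ ‖z‖ + 1 := by linarith [norm_nonneg z]
  have h := Summable.hasProdLocallyUniformlyOn_nat_one_add
    (f := fun k z => barnesFactor k z - 1) (K := Metric.ball (0 : ℂ) (‖z‖ + 1)) Metric.isOpen_ball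
    (summable_inv_sq (2 * (‖z‖ + 1) ^ 3)) (eventually_norm_barnesFactor_sub_one_le hρ)
    (fun n => ((differentiable_barnesFactor n).sub_const 1).continuous.continuousOn)
  simp only [add_sub_cancel] at h
  have h2 := (hasProdLocallyUniformlyOn_iff_tendstoLocallyUniformlyOn.1 h).differentiableOn
    (Eventually.of_forall fun s => by
      exact (DifferentiableOn.fun_finsetProd fun i _ =>
        (differentiable_barnesFactor i).differentiableOn)) Metric.isOpen_ball
  exact (h2.differentiableAt (Metric.isOpen_ball.mem_nhds (by simp)))

lemma one_add_div_ne_zero {z : ℂ} (hz : |z.re| < 1) (k : ℕ) : 1 + z / ((k : ℂ) + 1) ≠ 0 := by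
  intro h
  have h2 : z = -((k : ℂ) + 1) := by
    have := natCast_add_one_ne_zero' k
    field_simp at h
    linear_combination h
  rw [h2] at hz
  simp only [Complex.neg_re, Complex.add_re, Complex.natCast_re, Complex.one_re, abs_neg] at hz
  have : |(k : ℝ) + 1| < 1 := hz
  rw [abs_of_nonneg (by positivity)] at this
  linarith [(Nat.cast_nonneg k : (0 : ℝ) ≤ k)]

lemma barnesFactor_ne_zero {z : ℂ} (hz : |z.re| < 1) (k : ℕ) : barnesFactor k z ≠ 0 :=
  mul_ne_zero (pow_ne_zero _ (one_add_div_ne_zero hz k)) (Complex.exp_ne_zero _)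

lemma barnesProd_ne_zero {z : ℂ} (hz : |z.re| < 1) : barnesProd z ≠ 0 := by
  have h := tprod_one_add_ne_zero_of_summable (f := fun k => barnesFactor k z - 1)
    (fun i => by simpa using barnesFactor_ne_zero hz i) (summable_norm_barnesFactor_sub_one z)
  simpa [barnesProd] using h

/-- `E(w) = G(1+w)/G(1-w)`, in which the Gaussian prefactors of the Barnes functions cancel. -/
def barnesQuot (w : ℂ) : ℂ :=
  ((2 * Real.pi : ℝ) : ℂ) ^ w * Complex.exp (-w) * (barnesProd w / barnesProd (-w))

lemma barnesG_div_barnesG (w : ℂ) : barnesG (1 + w) / barnesG (1 - w) = barnesQuot w := by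
  have h2 : ((2 * Real.pi : ℝ) : ℂ) ≠ 0 := by
    exact_mod_cast (by positivity : (2 * Real.pi : ℝ) ≠ 0)
  simp only [barnesG, barnesQuot, barnesProd, barnesFactor, add_sub_cancel_left,
    show (1 - w - 1 : ℂ) = -w by ring]
  have e1 : ((2 * Real.pi : ℝ) : ℂ) ^ w
      = ((2 * Real.pi : ℝ) : ℂ) ^ (w / 2) / ((2 * Real.pi : ℝ) : ℂ) ^ (-w / 2) := by
    rw [← Complex.cpow_sub _ _ h2]; congr 1; ring
  have e2 : Complex.exp (-w)
      = Complex.exp (-(w + (1 + (Real.eulerMascheroniConstant : ℂ)) * w ^ 2) / 2) /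
        Complex.exp (-(-w + (1 + (Real.eulerMascheroniConstant : ℂ)) * (-w) ^ 2) / 2) := by
    rw [← Complex.exp_sub]; congr 1; ring
  rw [e1, e2, mul_div_mul_comm, mul_div_mul_comm]

lemma barnesQuot_ne_zero {w : ℂ} (hw : |w.re| < 1) : barnesQuot w ≠ 0 := by
  have h2 : ((2 * Real.pi : ℝ) : ℂ) ≠ 0 := by
    exact_mod_cast (by positivity : (2 * Real.pi : ℝ) ≠ 0)
  refine mul_ne_zero (mul_ne_zero ?_ (Complex.exp_ne_zero _))
    (div_ne_zero (barnesProd_ne_zero hw) (barnesProd_ne_zero (by simpa using hw)))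
  rw [Complex.cpow_def_of_ne_zero h2]; exact Complex.exp_ne_zero _

lemma barnesQuot_neg {w : ℂ} : barnesQuot (-w) = (barnesQuot w)⁻¹ := by
  simp only [barnesQuot, Complex.cpow_neg, Complex.exp_neg, neg_neg, mul_inv, inv_div, inv_inv]

lemma differentiableAt_barnesQuot {w : ℂ} (hw : |w.re| < 1) : DifferentiableAt ℂ barnesQuot w := by
  have h2 : ((2 * Real.pi : ℝ) : ℂ) ≠ 0 := by
    exact_mod_cast (by positivity : (2 * Real.pi : ℝ) ≠ 0)
  unfold barnesQuot
  refine DifferentiableAt.mul (DifferentiableAt.mul ?_ (by fun_prop))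
    (DifferentiableAt.div (differentiable_barnesProd _)
      ((differentiable_barnesProd _).comp w (by fun_prop)) (barnesProd_ne_zero (by simpa using hw)))
  exact DifferentiableAt.const_cpow (by fun_prop) (Or.inl h2)

lemma measurable_barnesQuot : Measurable barnesQuot := by
  have h1 : Measurable barnesProd := differentiable_barnesProd.continuous.measurable
  unfold barnesQuot
  have h2 : Measurable fun w : ℂ => barnesProd (-w) := h1.comp measurable_neg
  fun_prop

lemma sum_range_sq_div_le {ρ : ℝ} (hρ : 0 ≤ ρ) (N : ℕ) :
    ∑ k ∈ Finset.range N, ρ ^ 2 / (((k : ℝ) + 1) ^ 2 + ρ ^ 2) ≤ 2 * ρ := by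
  rcases hρ.eq_or_lt with rfl | h
  · simp
  suffices ∑ k ∈ Finset.range N, ρ ^ 2 / (((k : ℝ) + 1) ^ 2 + ρ ^ 2) ≤
      2 * ρ - 2 * ρ ^ 2 / (N + ρ) by
    have h2 : 0 ≤ 2 * ρ ^ 2 / (N + ρ) := by positivity
    linarith
  induction N with
  | zero => simp; field_simp; simp
  | succ N ih =>
    rw [Finset.sum_range_succ]
    refine (add_le_add_left ih _).trans ?_
    have hN : (0 : ℝ) < N + ρ := by positivity
    have hN1 : (0 : ℝ) < (N + 1 : ℝ) + ρ := by positivity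
    push_cast
    have key : ρ ^ 2 / (((N : ℝ) + 1) ^ 2 + ρ ^ 2) ≤ 2 * ρ ^ 2 / (((N : ℝ) + ρ) * ((N : ℝ) + 1 + ρ)) := by
      rw [div_le_div_iff₀ (by positivity) (by positivity)]
      have hn : (0 : ℝ) ≤ N := Nat.cast_nonneg N
      have : ((N : ℝ) + ρ) * ((N : ℝ) + 1 + ρ) ≤ 2 * (((N : ℝ) + 1) ^ 2 + ρ ^ 2) := by
        nlinarith [sq_nonneg ((N : ℝ) + 1 - ρ)]
      nlinarith [sq_nonneg ρ]
    have e : 2 * ρ ^ 2 / ((N : ℝ) + ρ) - 2 * ρ ^ 2 / ((N : ℝ) + 1 + ρ)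
        = 2 * ρ ^ 2 / (((N : ℝ) + ρ) * ((N : ℝ) + 1 + ρ)) := by
      field_simp; ring
    linarith

lemma sum_range_inv_sq_le (N : ℕ) :
    ∑ k ∈ Finset.range N, 1 / ((k : ℝ) + 1) ^ 2 ≤ 4 := by
  refine (Finset.sum_le_sum fun k _ => ?_).trans ((Finset.mul_sum _ _ _).symm.le.trans
    ((mul_le_mul_of_nonneg_left (sum_range_sq_div_le zero_le_one N) (zero_le_two)).trans (by norm_num)))
  rw [one_pow, mul_one_div, div_le_div_iff₀ (by positivity) (by positivity)]
  nlinarith [(Nat.cast_nonneg k : (0 : ℝ) ≤ k)]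

lemma log_quot_le_of_nonneg {n x a D : ℝ} (hn : 1 ≤ n) (h0 : 0 ≤ x) (h1 : x ≤ 1) (ha : a ^ 2 < 1)
    (hxa : x ^ 2 ≤ a ^ 2) (hD : n ^ 2 + x ^ 2 ≤ D) :
    n * Real.log ((D + 2 * n * x) / (D - 2 * n * x)) / 2 - 2 * x ≤
      8 / (1 - a ^ 2) ^ 2 * (1 / n ^ 2) := by
  have ha' : 0 < 1 - a ^ 2 := by linarith
  have hn0 : 0 < n := by linarith
  set X := D + 2 * n * x with hX
  set Y := D - 2 * n * x with hY
  have h2 : n ^ 2 * (1 - a ^ 2) ≤ n ^ 2 - x ^ 2 := by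
    have : a ^ 2 ≤ n ^ 2 * a ^ 2 := le_mul_of_one_le_left (sq_nonneg a) (one_le_pow₀ hn)
    linarith
  have h3 : 0 < n ^ 2 * (1 - a ^ 2) := by positivity
  have hnx : x < n := by nlinarith
  have hY0 : 0 < Y := by
    have : 0 < (n - x) ^ 2 := by have : n - x ≠ 0 := by linarith
                                 positivity
    rw [hY]; linarith
  have hXY : Y ≤ X := by
    have : 0 ≤ n * x := by positivity
    rw [hX, hY]; linarith
  have hX0 : 0 < X := by linarith
  have hD0 : 0 < D := by linarith
  have ht : 1 ≤ X / Y := by rwa [one_le_div hY0]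
  have hlog : Real.log (X / Y) ≤ (X / Y - Y / X) / 2 := by
    have := Real.self_le_sinh_iff.2 (Real.log_nonneg ht)
    rwa [Real.sinh_log (by positivity), inv_div] at this
  have hXYp : X * Y = D ^ 2 - 4 * n ^ 2 * x ^ 2 := by rw [hX, hY]; ring
  have hden : n ^ 4 * (1 - a ^ 2) ^ 2 ≤ X * Y := by
    rw [hXYp]
    have h1 : (n ^ 2 + x ^ 2) ^ 2 ≤ D ^ 2 := by gcongr
    have h4 : (n ^ 2 * (1 - a ^ 2)) ^ 2 ≤ (n ^ 2 - x ^ 2) ^ 2 := by gcongr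
    have e1 : (n ^ 2 - x ^ 2) ^ 2 = (n ^ 2 + x ^ 2) ^ 2 - 4 * n ^ 2 * x ^ 2 := by ring
    have e2 : (n ^ 2 * (1 - a ^ 2)) ^ 2 = n ^ 4 * (1 - a ^ 2) ^ 2 := by ring
    linarith
  have hdpos : 0 < n ^ 4 * (1 - a ^ 2) ^ 2 := by positivity
  have s1 : n * Real.log (X / Y) / 2 - 2 * x ≤ n * ((X / Y - Y / X) / 2) / 2 - 2 * x := by gcongr
  have s2 : n * ((X / Y - Y / X) / 2) / 2 - 2 * x = 2 * x * (n ^ 2 * D / (X * Y) - 1) := by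
    have e1 : X / Y - Y / X = (X ^ 2 - Y ^ 2) / (X * Y) := by field_simp
    rw [e1, show X ^ 2 - Y ^ 2 = 8 * n * x * D by rw [hX, hY]; ring]
    ring
  have s3 : 2 * x * (n ^ 2 * D / (X * Y) - 1) ≤ 2 * x * (D ^ 2 / (X * Y) - 1) := by
    have : n ^ 2 * D ≤ D ^ 2 := by nlinarith [sq_nonneg x]
    gcongr
  have s4 : 2 * x * (D ^ 2 / (X * Y) - 1) = 8 * x ^ 3 * n ^ 2 / (X * Y) := by
    have hne : X * Y ≠ 0 := by positivity
    rw [show D ^ 2 = X * Y + 4 * n ^ 2 * x ^ 2 by rw [hXYp]; ring, add_div, div_self hne]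
    ring
  have s5 : 8 * x ^ 3 * n ^ 2 / (X * Y) ≤ 8 * 1 * n ^ 2 / (n ^ 4 * (1 - a ^ 2) ^ 2) := by
    have : x ^ 3 ≤ 1 := pow_le_one₀ h0 h1
    gcongr
  have s6 : 8 * 1 * n ^ 2 / (n ^ 4 * (1 - a ^ 2) ^ 2) = 8 / (1 - a ^ 2) ^ 2 * (1 / n ^ 2) := by
    field_simp
  linarith

lemma log_quot_le_of_nonpos {n x ρ D : ℝ} (hn : 1 ≤ n) (hx1 : -1 ≤ x) (h0 : x ≤ 0)
    (hD : D = n ^ 2 + ρ ^ 2) (hX0 : 0 < D + 2 * n * x) :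
    n * Real.log ((D + 2 * n * x) / (D - 2 * n * x)) / 2 - 2 * x ≤ 2 * (ρ ^ 2 / D) := by
  have hn0 : 0 < n := by linarith
  have hD0 : 0 < D := by nlinarith [sq_nonneg x]
  set X := D + 2 * n * x with hX
  set Y := D - 2 * n * x with hY
  have hXY : X ≤ Y := by
    have : n * x ≤ 0 := mul_nonpos_of_nonneg_of_nonpos hn0.le h0
    rw [hX, hY]; linarith
  have hY0 : 0 < Y := by linarith
  have hlog := Real.le_log_one_add_of_nonneg (x := (Y - X) / X)
    (div_nonneg (by linarith) hX0.le)
  have e1 : 1 + (Y - X) / X = Y / X := by field_simp; ring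
  have e2 : 2 * ((Y - X) / X) / ((Y - X) / X + 2) = -(4 * n * x) / D := by
    have e3 : (Y - X) / X + 2 = 2 * D / X := by
      rw [eq_div_iff hX0.ne', add_mul, div_mul_cancel₀ _ hX0.ne', hX, hY]; ring
    rw [e3, show Y - X = -(4 * n * x) by rw [hX, hY]; ring]
    field_simp
  rw [e1, e2] at hlog
  have e3 : Real.log (X / Y) = - Real.log (Y / X) := by rw [← Real.log_inv, inv_div]
  rw [e3]
  have h4 : -Real.log (Y / X) ≤ 4 * n * x / D := by
    rw [neg_div] at hlog; linarith
  have h5 : n * (-Real.log (Y / X)) / 2 ≤ n * (4 * n * x / D) / 2 := by gcongr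
  have e4 : n * (4 * n * x / D) / 2 - 2 * x = 2 * (-x) * (ρ ^ 2 / D) := by
    field_simp; rw [hD]; ring
  have h6 : 0 ≤ ρ ^ 2 / D := by positivity
  have h7 : 2 * (-x) * (ρ ^ 2 / D) ≤ 2 * (ρ ^ 2 / D) :=
    mul_le_mul_of_nonneg_right (by linarith) h6
  linarith

/-- Comparison of one factor at `w` and `-w`: the logarithm of the quotient of the norms is
elementary, and is bounded through `2(t-1)/(t+1) ≤ log t ≤ (t - t⁻¹)/2` for `t ≥ 1`. -/
lemma norm_barnesFactor_le {w : ℂ} {a : ℝ} (ha : a < 1) (hw : |w.re| ≤ a) (k : ℕ) :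
    ‖barnesFactor k w‖ ≤ ‖barnesFactor k (-w)‖ *
      Real.exp (8 / (1 - a ^ 2) ^ 2 * (1 / ((k : ℝ) + 1) ^ 2) +
        2 * (‖w‖ ^ 2 / (((k : ℝ) + 1) ^ 2 + ‖w‖ ^ 2))) := by
  have ha0 : 0 ≤ a := (abs_nonneg _).trans hw
  set n : ℝ := (k : ℝ) + 1 with hn
  have hn1 : 1 ≤ n := by rw [hn]; linarith [(Nat.cast_nonneg k : (0 : ℝ) ≤ k)]
  have hn0 : 0 < n := by linarith
  have hnC : ((k : ℂ) + 1) = (n : ℂ) := by rw [hn]; push_cast; rfl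
  set x := w.re with hx
  set D := n ^ 2 + ‖w‖ ^ 2 with hD
  have hD0 : 0 < D := by positivity
  have hxw : x ^ 2 ≤ ‖w‖ ^ 2 := by
    have := Complex.abs_re_le_norm w
    rw [← sq_abs x]; gcongr
  have hxa : x ^ 2 ≤ a ^ 2 := by rw [← sq_abs x]; gcongr
  have ha2 : a ^ 2 < 1 := by nlinarith
  have nsq : ∀ v : ℂ, ‖(n : ℂ) + v‖ ^ 2 = n ^ 2 + ‖v‖ ^ 2 + 2 * n * v.re := by
    intro v
    rw [← Complex.normSq_eq_norm_sq, ← Complex.normSq_eq_norm_sq]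
    simp [Complex.normSq_apply]; ring
  set X := ‖(n : ℂ) + w‖ ^ 2 with hX
  set Y := ‖(n : ℂ) + -w‖ ^ 2 with hY
  have hXe : X = D + 2 * n * x := by rw [hX, nsq w]
  have hYe : Y = D - 2 * n * x := by rw [hY, nsq (-w)]; simp [hD]; ring
  have hx1 : |x| < 1 := lt_of_le_of_lt hw ha
  obtain ⟨hxl, hxr⟩ := abs_lt.1 hx1
  have hDn : n ^ 2 + x ^ 2 ≤ D := by rw [hD]; linarith
  have hX0 : 0 < X := by rw [hXe]; nlinarith
  have hY0 : 0 < Y := by rw [hYe]; nlinarith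
  have hrt : ∀ v : ℂ, 0 < ‖(n : ℂ) + v‖ ^ 2 → ‖barnesFactor k v‖ =
      Real.exp (n * (Real.log (‖(n : ℂ) + v‖ ^ 2) / 2 - Real.log n) + ((v ^ 2).re / (2 * n) - v.re)) := by
    intro v hv
    have hv' : 0 < ‖(n : ℂ) + v‖ := by
      by_contra h
      have : ‖(n : ℂ) + v‖ = 0 := le_antisymm (not_lt.1 h) (norm_nonneg _)
      rw [this] at hv; simp at hv
    rw [barnesFactor, hnC, norm_mul, norm_pow, Complex.norm_exp, Real.exp_add]
    congr 1
    · have e : (1 : ℂ) + v / n = ((n : ℂ) + v) / n := by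
        have : (n : ℂ) ≠ 0 := by exact_mod_cast hn0.ne'
        field_simp
      rw [e, norm_div, Complex.norm_of_nonneg hn0.le, Real.log_pow]
      rw [show n * (((2 : ℕ) : ℝ) * Real.log ‖(n : ℂ) + v‖ / 2 - Real.log n)
        = ((k + 1 : ℕ) : ℝ) * (Real.log ‖(n : ℂ) + v‖ - Real.log n) by rw [hn]; push_cast; ring]
      rw [Real.exp_nat_mul, Real.exp_sub, Real.exp_log hv', Real.exp_log hn0]
    · congr 1
      rw [Complex.sub_re]
      congr 1
      rw [show (2 * (n : ℂ)) = ((2 * n : ℝ) : ℂ) by push_cast; rfl, Complex.div_ofReal_re]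
  rw [hrt w hX0, hrt (-w) hY0, ← Real.exp_add, Real.exp_le_exp, ← hX, ← hY]
  simp only [neg_sq, Complex.neg_re]
  rw [← hx]
  suffices h : n * (Real.log X - Real.log Y) / 2 - 2 * x ≤
      8 / (1 - a ^ 2) ^ 2 * (1 / n ^ 2) + 2 * (‖w‖ ^ 2 / D) by linarith
  have hp1 : 0 ≤ 8 / (1 - a ^ 2) ^ 2 * (1 / n ^ 2) := by positivity
  have hp2 : 0 ≤ 2 * (‖w‖ ^ 2 / D) := by positivity
  rw [← Real.log_div hX0.ne' hY0.ne', hXe, hYe]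
  rcases le_total 0 x with h0 | h0
  · exact (log_quot_le_of_nonneg hn1 h0 hxr.le ha2 hxa hDn).trans (le_add_of_nonneg_right hp2)
  · exact (log_quot_le_of_nonpos hn1 hxl.le h0 hD (hXe ▸ hX0)).trans
      (le_add_of_nonneg_left hp1)

lemma norm_barnesProd_le {w : ℂ} {a : ℝ} (ha : a < 1) (hw : |w.re| ≤ a) :
    ‖barnesProd w‖ ≤ ‖barnesProd (-w)‖ * Real.exp (32 / (1 - a ^ 2) ^ 2 + 4 * ‖w‖) := by
  refine le_of_tendsto_of_tendsto (tendsto_barnesProd w).norm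
    ((tendsto_barnesProd (-w)).norm.mul_const _) (Eventually.of_forall fun N => ?_)
  simp only [norm_prod]
  refine (Finset.prod_le_prod (fun _ _ => norm_nonneg _)
    (fun k _ => norm_barnesFactor_le ha hw k)).trans ?_
  rw [Finset.prod_mul_distrib, ← Real.exp_sum]
  gcongr
  rw [Finset.sum_add_distrib, ← Finset.mul_sum, ← Finset.mul_sum]
  have h1 := sum_range_inv_sq_le N
  have h2 := sum_range_sq_div_le (norm_nonneg w) N
  have h3 : 0 ≤ 8 / (1 - a ^ 2) ^ 2 := by positivity
  have := mul_le_mul_of_nonneg_left h1 h3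
  have e : 8 / (1 - a ^ 2) ^ 2 * 4 = 32 / (1 - a ^ 2) ^ 2 := by ring
  linarith

/-- In a vertical strip inside `|Re w| < 1`, the quotient grows at most exponentially in `|Im w|`, that is,
polynomially in the hyperbolic cosine of the rapidity. -/
lemma norm_barnesQuot_le {a : ℝ} (ha : a < 1) : ∃ C : ℝ, ∀ w : ℂ, |w.re| ≤ a →
    ‖barnesQuot w‖ ≤ Real.exp (C + 4 * |w.im|) := by
  refine ⟨2 * Real.pi + 1 + 32 / (1 - a ^ 2) ^ 2 + 4, fun w hw => ?_⟩
  have hw1 : |w.re| < 1 := lt_of_le_of_lt hw ha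
  have hm : barnesProd (-w) ≠ 0 := barnesProd_ne_zero (by simpa using hw1)
  have h1 : ‖barnesProd w / barnesProd (-w)‖ ≤ Real.exp (32 / (1 - a ^ 2) ^ 2 + 4 * ‖w‖) := by
    rw [norm_div, div_le_iff₀ (norm_pos_iff.2 hm), mul_comm]
    exact norm_barnesProd_le ha hw
  have h2 : ‖((2 * Real.pi : ℝ) : ℂ) ^ w‖ ≤ Real.exp (2 * Real.pi) := by
    rw [Complex.norm_cpow_eq_rpow_re_of_pos (by positivity)]
    refine (Real.rpow_le_rpow_of_exponent_le (y := w.re) (z := 1) ?_ (abs_lt.1 hw1).2.le).trans ?_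
    · linarith [Real.pi_gt_three]
    · rw [Real.rpow_one]; linarith [Real.add_one_le_exp (2 * Real.pi)]
  have h3 : ‖Complex.exp (-w)‖ ≤ Real.exp 1 := by
    rw [Complex.norm_exp, Real.exp_le_exp]
    simpa using (by linarith [(abs_lt.1 hw1).1] : -w.re ≤ 1)
  have h4 : ‖w‖ ≤ 1 + |w.im| := (Complex.norm_le_abs_re_add_abs_im w).trans (by linarith)
  rw [barnesQuot, norm_mul, norm_mul]
  calc _ ≤ Real.exp (2 * Real.pi) * Real.exp 1 * Real.exp (32 / (1 - a ^ 2) ^ 2 + 4 * ‖w‖) := by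
        gcongr
    _ ≤ _ := by
      rw [← Real.exp_add, ← Real.exp_add, Real.exp_le_exp]
      linarith

/-- Partial products of `E`, without prefactor. -/
def barnesPartial (N : ℕ) (w : ℂ) : ℂ :=
  ∏ k ∈ Finset.range N, (barnesFactor k w / barnesFactor k (-w))

lemma barnesFactor_div (k : ℕ) (w : ℂ) :
    barnesFactor k w / barnesFactor k (-w) =
      ((((k : ℂ) + 1) + w) / (((k : ℂ) + 1) - w)) ^ (k + 1) * Complex.exp (-2 * w) := by
  have hk := natCast_add_one_ne_zero' k
  have e1 : (1 : ℂ) + w / ((k : ℂ) + 1) = (((k : ℂ) + 1) + w) / ((k : ℂ) + 1) := by field_simp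
  have e2 : (1 : ℂ) + -w / ((k : ℂ) + 1) = (((k : ℂ) + 1) - w) / ((k : ℂ) + 1) := by field_simp; ring
  rw [barnesFactor, barnesFactor, mul_div_mul_comm, ← Complex.exp_sub, ← div_pow, e1, e2,
    div_div_div_cancel_right₀ hk]
  congr 2; ring

/-- The telescoping of the partial products. -/
lemma barnesPartial_mul {w : ℂ} (h0 : 0 < w.re) (h1 : w.re < 1) (N : ℕ) :
    barnesPartial N w * barnesPartial N (1 - w) *
      (Real.pi * w * ∏ j ∈ Finset.range N, ((1 : ℂ) - w ^ 2 / ((j : ℂ) + 1) ^ 2)) *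
      ((N.factorial : ℂ) ^ 2 * Complex.exp (2 * N)) =
      Real.pi * ((N + w) ^ (N + 1) * ((N + 1 : ℂ) - w) ^ N) := by
  have hne1 : ∀ k : ℕ, ((k : ℂ) + w) ≠ 0 := fun k h => by
    have := congrArg Complex.re h
    simp at this
    linarith [(Nat.cast_nonneg k : (0 : ℝ) ≤ k)]
  have hne2 : ∀ k : ℕ, ((k : ℂ) + 1 - w) ≠ 0 := fun k h => by
    have := congrArg Complex.re h
    simp at this
    linarith [(Nat.cast_nonneg k : (0 : ℝ) ≤ k)]
  induction N with
  | zero => simp [barnesPartial]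
  | succ N ih =>
    have hk := natCast_add_one_ne_zero' N
    have a1 := hne1 N
    have a2 := hne2 N
    have a3 : ((N : ℂ) + 1 + w) ≠ 0 := by have := hne1 (N + 1); push_cast at this; exact this
    have a4 : ((N : ℂ) + 1 + 1 - w) ≠ 0 := by have := hne2 (N + 1); push_cast at this; exact this
    have e : ∀ v, barnesPartial (N + 1) v = barnesPartial N v *
        (((((N : ℂ) + 1) + v) / (((N : ℂ) + 1) - v)) ^ (N + 1) * Complex.exp (-2 * v)) := by
      intro v
      rw [barnesPartial, Finset.prod_range_succ, barnesFactor_div]; rfl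
    rw [e, e, Finset.prod_range_succ, Nat.factorial_succ]
    have e5 : Complex.exp (2 * ((N + 1 : ℕ) : ℂ)) = Complex.exp (2 * N) * Complex.exp 2 := by
      rw [← Complex.exp_add]; congr 1; push_cast; ring
    have e6 : Complex.exp (-2 * w) * Complex.exp (-2 * (1 - w)) * Complex.exp 2 = 1 := by
      rw [← Complex.exp_add, ← Complex.exp_add,
        show -2 * w + -2 * (1 - w) + 2 = 0 by ring, Complex.exp_zero]
    have e7 : (1 : ℂ) - w ^ 2 / ((N : ℂ) + 1) ^ 2 =
        (((N : ℂ) + 1 + w) * ((N : ℂ) + 1 - w)) / ((N : ℂ) + 1) ^ 2 := by field_simp; ring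
    rw [e5, e7]
    push_cast
    have e8 : (((N : ℂ) + 1 + (1 - w)) / ((N : ℂ) + 1 - (1 - w))) = ((N : ℂ) + 1 + 1 - w) / ((N : ℂ) + w) := by
      congr 1 <;> ring
    rw [e8, div_pow, div_pow]
    calc _ = (barnesPartial N w * barnesPartial N (1 - w) *
      (Real.pi * w * ∏ j ∈ Finset.range N, ((1 : ℂ) - w ^ 2 / ((j : ℂ) + 1) ^ 2)) *
      ((N.factorial : ℂ) ^ 2 * Complex.exp (2 * N))) *
        (Complex.exp (-2 * w) * Complex.exp (-2 * (1 - w)) * Complex.exp 2) *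
        ((((N : ℂ) + 1 + w) ^ (N + 1) / ((N : ℂ) + 1 - w) ^ (N + 1)) *
        (((N : ℂ) + 1 + 1 - w) ^ (N + 1) / ((N : ℂ) + w) ^ (N + 1)) *
        (((N : ℂ) + 1 + w) * ((N : ℂ) + 1 - w))) := by
          field_simp
      _ = _ := by
        rw [ih, e6]
        field_simp
        ring

lemma tendsto_barnesPartial {w : ℂ} (hw : |w.re| < 1) :
    Tendsto (fun N => barnesPartial N w) atTop (𝓝 (barnesProd w / barnesProd (-w))) := by
  have := (tendsto_barnesProd w).div (tendsto_barnesProd (-w))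
    (barnesProd_ne_zero (by simpa using hw))
  refine this.congr fun N => ?_
  rw [barnesPartial, Finset.prod_div_distrib]; rfl

/-- The reflection formula, which follows from the telescoping of the partial products, Euler's product for the
sine, and `(1+t/n)^n → e^t`. -/
lemma barnesQuot_reflection {w v : ℂ} (hw0 : 0 < w.re) (hw1 : w.re < 1) (hv0 : 0 < v.re)
    (hv1 : v.re < 1) :
    barnesQuot w * barnesQuot (1 - w) * Complex.sin (Real.pi * w) =
      barnesQuot v * barnesQuot (1 - v) * Complex.sin (Real.pi * v) := by
  have habs : ∀ u : ℂ, 0 < u.re → u.re < 1 → |u.re| < 1 ∧ |(1 - u).re| < 1 := fun u h h' => by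
    simp only [Complex.sub_re, Complex.one_re, abs_lt]; exact ⟨⟨by linarith, h'⟩, by linarith, by linarith⟩
  -- the telescoped numerator, normalised so as to converge
  let r : ℕ → ℂ → ℂ := fun N u => (1 + u / N) ^ N * (1 + (1 - u) / N) ^ N * (1 + u / N)
  have hr : ∀ u : ℂ, Tendsto (fun N => r N u) atTop (𝓝 (Complex.exp 1)) := by
    intro u
    have h3 : Tendsto (fun N : ℕ => 1 + u / N) atTop (𝓝 (1 + 0)) :=
      (tendsto_const_div_atTop_nhds_zero_nat u).const_add 1
    have := ((Complex.tendsto_one_add_div_pow_exp u).mul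
      (Complex.tendsto_one_add_div_pow_exp (1 - u))).mul h3
    rw [← Complex.exp_add] at this
    simpa [r] using this
  let l : ℕ → ℂ → ℂ := fun N u => barnesPartial N u * barnesPartial N (1 - u) *
      (Real.pi * u * ∏ j ∈ Finset.range N, ((1 : ℂ) - u ^ 2 / ((j : ℂ) + 1) ^ 2))
  have hl : ∀ u : ℂ, 0 < u.re → u.re < 1 → Tendsto (fun N => l N u) atTop
      (𝓝 ((barnesProd u / barnesProd (-u)) * (barnesProd (1 - u) / barnesProd (-(1 - u))) *
        Complex.sin (Real.pi * u))) := fun u h h' =>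
    ((tendsto_barnesPartial (habs u h h').1).mul (tendsto_barnesPartial (habs u h h').2)).mul
      (Complex.tendsto_euler_sin_prod u)
  have hlr : ∀ᶠ N : ℕ in atTop, l N w * r N v = l N v * r N w := by
    filter_upwards [eventually_gt_atTop 0] with N hN
    have hN0 : (N : ℂ) ≠ 0 := by exact_mod_cast hN.ne'
    have hf : (N.factorial : ℂ) ^ 2 * Complex.exp (2 * N) ≠ 0 :=
      mul_ne_zero (pow_ne_zero _ (by exact_mod_cast Nat.factorial_ne_zero N)) (Complex.exp_ne_zero _)
    have hq : ∀ u : ℂ, r N u * (N : ℂ) ^ (2 * N + 1) = (N + u) ^ (N + 1) * ((N + 1 : ℂ) - u) ^ N := by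
      intro u
      have e1 : (1 : ℂ) + u / N = (N + u) / N := by field_simp
      have e2 : (1 : ℂ) + (1 - u) / N = (N + 1 - u) / N := by field_simp; ring
      simp only [r]
      rw [e1, e2, div_pow, div_pow]
      field_simp
      ring
    have hw' := barnesPartial_mul hw0 hw1 N
    have hv' := barnesPartial_mul hv0 hv1 N
    rw [← hq] at hw' hv'
    have hNp : (N : ℂ) ^ (2 * N + 1) ≠ 0 := pow_ne_zero _ hN0
    have hpi : (Real.pi : ℂ) ≠ 0 := by exact_mod_cast Real.pi_ne_zero
    have : (l N w * r N v) * (((N.factorial : ℂ) ^ 2 * Complex.exp (2 * N)) *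
        (Real.pi * (N : ℂ) ^ (2 * N + 1))) = (l N v * r N w) * (((N.factorial : ℂ) ^ 2 *
        Complex.exp (2 * N)) * (Real.pi * (N : ℂ) ^ (2 * N + 1))) := by
      simp only [l]
      linear_combination (r N v * (Real.pi * (N : ℂ) ^ (2 * N + 1))) * hw' -
        (r N w * (Real.pi * (N : ℂ) ^ (2 * N + 1))) * hv'
    exact mul_right_cancel₀ (mul_ne_zero hf (mul_ne_zero hpi hNp)) this
  have hlim := tendsto_nhds_unique (((hl w hw0 hw1).mul (hr v)).congr' hlr)
    ((hl v hv0 hv1).mul (hr w))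
  have hlim' := mul_right_cancel₀ (Complex.exp_ne_zero 1) hlim
  have h2 : ((2 * Real.pi : ℝ) : ℂ) ≠ 0 := by
    exact_mod_cast (by positivity : (2 * Real.pi : ℝ) ≠ 0)
  have hpre : ∀ u : ℂ, ((2 * Real.pi : ℝ) : ℂ) ^ u * Complex.exp (-u) *
      (((2 * Real.pi : ℝ) : ℂ) ^ (1 - u) * Complex.exp (-(1 - u))) =
      ((2 * Real.pi : ℝ) : ℂ) * Complex.exp (-1) := by
    intro u
    have e1 : ((2 * Real.pi : ℝ) : ℂ) ^ u * ((2 * Real.pi : ℝ) : ℂ) ^ (1 - u) = ((2 * Real.pi : ℝ) : ℂ) := by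
      rw [← Complex.cpow_add _ _ h2]; simp
    have e2 : Complex.exp (-u) * Complex.exp (-(1 - u)) = Complex.exp (-1) := by
      rw [← Complex.exp_add]; congr 1; ring
    linear_combination (Complex.exp (-u) * Complex.exp (-(1 - u))) * e1 +
      ((2 * Real.pi : ℝ) : ℂ) * e2
  simp only [barnesQuot]
  linear_combination (((2 * Real.pi : ℝ) : ℂ) * Complex.exp (-1)) * hlim' +
    ((barnesProd w / barnesProd (-w)) * (barnesProd (1 - w) / barnesProd (-(1 - w))) *
        Complex.sin (Real.pi * w)) * hpre w -
    ((barnesProd v / barnesProd (-v)) * (barnesProd (1 - v) / barnesProd (-(1 - v))) *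
        Complex.sin (Real.pi * v)) * hpre v

/-! ### The minimal form factor and the scattering matrix near the real axis -/

namespace Model

variable (Q : Model)

lemma b_pos : 0 < Q.b := by
  have h := Q.coupling_ne_zero
  have := Real.pi_pos
  unfold b; positivity

lemma b_lt : Q.b < 1 / 2 := by
  have h := Q.coupling_ne_zero
  have := Real.pi_pos
  have h2 : Q.coupling ^ 2 / (8 * Real.pi + Q.coupling ^ 2) < 1 := by
    rw [div_lt_one (by positivity)]; linarith
  unfold b; linarith

lemma bHat_pos : 0 < Q.bHat := by unfold bHat; linarith [Q.b_lt]

lemma bHat_lt : Q.bHat < 1 / 2 := by unfold bHat; linarith [Q.b_pos]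

lemma sinB_pos : 0 < Q.sinB := by
  have h1 := Q.b_pos
  have h2 := Q.b_lt
  have := Real.pi_pos
  exact Real.sin_pos_of_pos_of_lt_pi (by positivity) (by nlinarith)

lemma sinB_le_one : Q.sinB ≤ 1 := Real.sin_le_one _

/-- Half-width of a strip around the real axis in which the two-body functions are regular. -/
def reg : ℝ := min (min Q.b Q.bHat) (Q.sinB / 4)

lemma reg_pos : 0 < Q.reg := by
  have := Q.b_pos; have := Q.bHat_pos; have := Q.sinB_pos
  unfold reg; positivity

lemma reg_le_b : Q.reg ≤ Q.b := (min_le_left _ _).trans (min_le_left _ _)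

lemma reg_le_bHat : Q.reg ≤ Q.bHat := (min_le_left _ _).trans (min_le_right _ _)

lemma reg_le_sinB : Q.reg ≤ Q.sinB / 4 := min_le_right _ _

lemma reg_le : Q.reg ≤ 1 / 4 := Q.reg_le_sinB.trans (by linarith [Q.sinB_le_one])

/-- The variable `𝔷 = iβ/2π`. -/
def zvar (β : ℂ) : ℂ := Complex.I * β / (2 * Real.pi)

lemma zvar_re (β : ℂ) : (zvar β).re = -β.im / (2 * Real.pi) := by
  rw [zvar, show (2 * (Real.pi : ℂ)) = ((2 * Real.pi : ℝ) : ℂ) by push_cast; rfl,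
    Complex.div_ofReal_re]
  simp

lemma zvar_im (β : ℂ) : (zvar β).im = β.re / (2 * Real.pi) := by
  rw [zvar, show (2 * (Real.pi : ℂ)) = ((2 * Real.pi : ℝ) : ℂ) by push_cast; rfl,
    Complex.div_ofReal_im]
  simp

lemma pi_mul_zvar (β : ℂ) : (Real.pi : ℂ) * zvar β = β / 2 * Complex.I := by
  have : (Real.pi : ℂ) ≠ 0 := by exact_mod_cast Real.pi_ne_zero
  rw [zvar]; field_simp

/-- The factor of the minimal form factor built from Barnes functions. -/
def barnesPart (β : ℂ) : ℂ :=
  barnesQuot (1 - (Q.b : ℂ) + zvar β) / barnesQuot ((Q.b : ℂ) + zvar β) *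
    (barnesQuot (1 - (Q.bHat : ℂ) + zvar β) / barnesQuot ((Q.bHat : ℂ) + zvar β))

lemma minimalFF_eq (β : ℂ) :
    Q.minimalFF β = -(Complex.I / Real.pi) * Complex.sinh (β / 2) * Q.barnesPart β := by
  have h1 : 1 / (Complex.Gamma (1 + zvar β) * Complex.Gamma (-zvar β)) =
      -(Complex.I / Real.pi) * Complex.sinh (β / 2) := by
    have := Complex.Gamma_mul_Gamma_one_sub (-zvar β)
    rw [sub_neg_eq_add] at this
    rw [mul_comm, this, mul_neg, pi_mul_zvar, Complex.sin_neg, Complex.sin_mul_I, one_div_div]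
    ring
  have h2 : ∀ c : ℂ, barnesQuot (1 - c + zvar β) / barnesQuot (c + zvar β) =
      (barnesG (1 - c - zvar β) * barnesG (2 - c + zvar β)) /
        (barnesG (c - zvar β) * barnesG (1 + c + zvar β)) := by
    intro c
    rw [← barnesG_div_barnesG, ← barnesG_div_barnesG,
      show (1 + (1 - c + zvar β) : ℂ) = 2 - c + zvar β by ring,
      show (1 - (1 - c + zvar β) : ℂ) = c - zvar β by ring,
      show (1 + (c + zvar β) : ℂ) = 1 + c + zvar β by ring,
      show (1 - (c + zvar β) : ℂ) = 1 - c - zvar β by ring]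
    simp only [div_eq_mul_inv, mul_inv, inv_inv]
    ring
  rw [barnesPart, h2, h2, ← h1]
  simp only [minimalFF]
  rw [← zvar]
  simp only [div_eq_mul_inv, mul_inv]
  ring

/-- The regular quotient `F(β)/sinh β`. -/
def ffOverSinh (β : ℂ) : ℂ := -(Complex.I / (2 * Real.pi)) * Q.barnesPart β / Complex.cosh (β / 2)

lemma sinh_eq_half (β : ℂ) : Complex.sinh β = 2 * Complex.sinh (β / 2) * Complex.cosh (β / 2) := by
  rw [← Complex.sinh_two_mul]; congr 1; ring

lemma ffOverSinh_mul_sinh {β : ℂ} (h : Complex.cosh (β / 2) ≠ 0) :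
    Q.ffOverSinh β * Complex.sinh β = Q.minimalFF β := by
  have : (Real.pi : ℂ) ≠ 0 := by exact_mod_cast Real.pi_ne_zero
  rw [ffOverSinh, sinh_eq_half, minimalFF_eq]; field_simp

/-- The regularised two-body factor `F(β) - i (l - l') sin(2π𝔟) F(β)/sinh β`. -/
def twoBody (l l' : Fin 2) (β : ℂ) : ℂ :=
  Q.minimalFF β - Complex.I * ((((l : ℕ) : ℂ) - ((l' : ℕ) : ℂ)) * (Q.sinB : ℂ)) * Q.ffOverSinh β

lemma twoBody_eq {l l' : Fin 2} {β : ℂ} (h : Complex.sinh β ≠ 0) :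
    Q.twoBody l l' β = Q.minimalFF β *
      (1 - Complex.I * ((((l : ℕ) : ℂ) - ((l' : ℕ) : ℂ)) * (Q.sinB : ℂ)) / Complex.sinh β) := by
  have hc : Complex.cosh (β / 2) ≠ 0 := by
    intro h0; apply h; rw [sinh_eq_half, h0, mul_zero]
  rw [twoBody, ← Q.ffOverSinh_mul_sinh hc]
  field_simp

/-- The arguments of the Barnes quotients stay away from `±1`. -/
lemma abs_re_barnes_le {β : ℂ} (h1 : -(Real.pi * Q.reg) ≤ β.im) (h2 : β.im ≤ Real.pi) {c : ℝ}
    (hc : c = Q.b ∨ c = Q.bHat) :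
    |(1 - (c : ℂ) + zvar β).re| ≤ 1 - Q.reg / 2 ∧ |((c : ℂ) + zvar β).re| ≤ 1 - Q.reg / 2 := by
  have hc1 : Q.reg ≤ c ∧ c < 1 / 2 := by
    rcases hc with rfl | rfl
    · exact ⟨Q.reg_le_b, Q.b_lt⟩
    · exact ⟨Q.reg_le_bHat, Q.bHat_lt⟩
  have hp := Real.pi_pos
  have hr := Q.reg_pos
  have hr4 := Q.reg_le
  have h3 : -(1 / 2) ≤ (zvar β).re := by
    rw [zvar_re, le_div_iff₀ (by positivity)]; linarith
  have h4 : (zvar β).re ≤ Q.reg / 2 := by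
    rw [zvar_re, div_le_iff₀ (by positivity)]; linarith
  simp only [Complex.add_re, Complex.sub_re, Complex.one_re, Complex.ofReal_re, abs_le]
  refine ⟨⟨?_, ?_⟩, ?_, ?_⟩ <;> linarith [hc1.1, hc1.2]

lemma barnesPart_ne_zero {β : ℂ} (h1 : -(Real.pi * Q.reg) ≤ β.im) (h2 : β.im ≤ Real.pi) :
    Q.barnesPart β ≠ 0 := by
  have hr := Q.reg_pos
  obtain ⟨a1, a2⟩ := Q.abs_re_barnes_le h1 h2 (Or.inl rfl)
  obtain ⟨a3, a4⟩ := Q.abs_re_barnes_le h1 h2 (Or.inr rfl)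
  exact mul_ne_zero
    (div_ne_zero (barnesQuot_ne_zero (by linarith)) (barnesQuot_ne_zero (by linarith)))
    (div_ne_zero (barnesQuot_ne_zero (by linarith)) (barnesQuot_ne_zero (by linarith)))

lemma differentiableAt_barnesPart {β : ℂ} (h1 : -(Real.pi * Q.reg) ≤ β.im) (h2 : β.im ≤ Real.pi) :
    DifferentiableAt ℂ Q.barnesPart β := by
  have hr := Q.reg_pos
  obtain ⟨a1, a2⟩ := Q.abs_re_barnes_le h1 h2 (Or.inl rfl)
  obtain ⟨a3, a4⟩ := Q.abs_re_barnes_le h1 h2 (Or.inr rfl)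
  have hz : DifferentiableAt ℂ zvar β := by unfold zvar; fun_prop
  have key : ∀ c : ℂ, |(c + zvar β).re| ≤ 1 - Q.reg / 2 →
      DifferentiableAt ℂ (fun β => barnesQuot (c + zvar β)) β := fun c hc =>
    DifferentiableAt.comp (f := fun β => c + zvar β) β
      (differentiableAt_barnesQuot (by linarith)) (hz.const_add c)
  unfold barnesPart
  exact ((key _ a1).div (key _ a2) (barnesQuot_ne_zero (by linarith))).mul
    ((key _ a3).div (key _ a4) (barnesQuot_ne_zero (by linarith)))

lemma cosh_half_ne_zero {β : ℂ} (h1 : -Real.pi < β.im) (h2 : β.im < Real.pi) :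
    Complex.cosh (β / 2) ≠ 0 := by
  intro h
  have h3 := congrArg Complex.re h
  have e : β / 2 = ((β.re / 2 : ℝ) : ℂ) + ((β.im / 2 : ℝ) : ℂ) * Complex.I := by
    conv_lhs => rw [← Complex.re_add_im β]
    push_cast; ring
  rw [e, Complex.cosh_add, Complex.cosh_mul_I, Complex.sinh_mul_I] at h3
  simp only [← Complex.ofReal_cosh, ← Complex.ofReal_cos, ← Complex.ofReal_sinh,
    ← Complex.ofReal_sin, Complex.add_re, Complex.re_ofReal_mul, Complex.mul_I_re, Complex.ofReal_re,
    Complex.ofReal_im, Complex.zero_re] at h3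
  have : 0 < Real.cos (β.im / 2) := Real.cos_pos_of_mem_Ioo ⟨by linarith, by linarith⟩
  have h5 := Real.cosh_pos (β.re / 2)
  have : 0 < Real.cosh (β.re / 2) * Real.cos (β.im / 2) := by positivity
  simp at h3
  rcases h3 with h3 | h3 <;> simp [h3] at this

/-- Lower bound on `cosh (β/2)` at distance `τ` below `iπ`. -/
lemma norm_cosh_half_ge {β : ℂ} {τ : ℝ} (hτ : 0 < τ) (hτ1 : τ ≤ 1) (h1 : -1 ≤ β.im)
    (h2 : β.im ≤ Real.pi - τ) : τ / Real.pi ≤ ‖Complex.cosh (β / 2)‖ := by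
  have hp := Real.pi_gt_three
  have e : β / 2 = ((β.re / 2 : ℝ) : ℂ) + ((β.im / 2 : ℝ) : ℂ) * Complex.I := by
    conv_lhs => rw [← Complex.re_add_im β]
    push_cast; ring
  have hre : (Complex.cosh (β / 2)).re = Real.cosh (β.re / 2) * Real.cos (β.im / 2) := by
    have e2 : Complex.cosh (β / 2) = ((Real.cosh (β.re / 2) * Real.cos (β.im / 2) : ℝ) : ℂ) +
        ((Real.sinh (β.re / 2) * Real.sin (β.im / 2) : ℝ) : ℂ) * Complex.I := by
      rw [e, Complex.cosh_add, Complex.cosh_mul_I, Complex.sinh_mul_I]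
      push_cast; ring
    rw [e2]
    simp only [Complex.add_re, Complex.ofReal_re, Complex.mul_I_re, Complex.ofReal_im, neg_zero,
      add_zero]
  have hcos : τ / Real.pi ≤ Real.cos (β.im / 2) := by
    have h3 : |β.im / 2| ≤ (Real.pi - τ) / 2 := by
      rw [abs_le]; constructor <;> linarith
    rw [← Real.cos_abs]
    refine le_trans ?_ (Real.cos_le_cos_of_nonneg_of_le_pi (abs_nonneg _) (by linarith) h3)
    rw [show (Real.pi - τ) / 2 = Real.pi / 2 - τ / 2 by ring, Real.cos_pi_div_two_sub]
    have := Real.mul_le_sin (x := τ / 2) (by linarith) (by linarith)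
    calc τ / Real.pi = 2 / Real.pi * (τ / 2) := by ring
      _ ≤ _ := this
  have hch := Real.one_le_cosh (β.re / 2)
  have hpos : 0 < τ / Real.pi := by positivity
  calc τ / Real.pi ≤ Real.cosh (β.re / 2) * Real.cos (β.im / 2) := by nlinarith
    _ = (Complex.cosh (β / 2)).re := hre.symm
    _ ≤ _ := Complex.re_le_norm _

lemma exp_abs_le_two_mul_cosh (x : ℝ) : Real.exp |x| ≤ 2 * Real.cosh x := by
  rw [← Real.cosh_abs, Real.cosh_eq]
  have := Real.exp_pos (-|x|)
  linarith

lemma norm_barnesPart_le : ∃ C : ℝ, 0 ≤ C ∧ ∀ β : ℂ, -(Real.pi * Q.reg) ≤ β.im → β.im ≤ Real.pi →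
    ‖Q.barnesPart β‖ ≤ C * Real.cosh β.re ^ 3 := by
  have hr := Q.reg_pos
  obtain ⟨C, hC⟩ := norm_barnesQuot_le (a := 1 - Q.reg / 2) (by linarith)
  refine ⟨Real.exp (4 * C) * 8, by positivity, fun β h1 h2 => ?_⟩
  obtain ⟨a1, a2⟩ := Q.abs_re_barnes_le h1 h2 (Or.inl rfl)
  obtain ⟨a3, a4⟩ := Q.abs_re_barnes_le h1 h2 (Or.inr rfl)
  have key : ∀ c : ℝ, |((c : ℂ) + zvar β).re| ≤ 1 - Q.reg / 2 →
      ‖barnesQuot ((c : ℂ) + zvar β)‖ ≤ Real.exp (C + 4 * |(zvar β).im|) := by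
    intro c hc
    have := hC _ hc
    simpa using this
  have key' : ∀ c : ℝ, |((c : ℂ) + zvar β).re| ≤ 1 - Q.reg / 2 →
      ‖(barnesQuot ((c : ℂ) + zvar β))⁻¹‖ ≤ Real.exp (C + 4 * |(zvar β).im|) := by
    intro c hc
    have := hC (-((c : ℂ) + zvar β)) (by rwa [Complex.neg_re, abs_neg])
    rw [barnesQuot_neg] at this
    simpa only [Complex.neg_im, abs_neg, Complex.add_im, Complex.ofReal_im, zero_add] using this
  have k1 := key (1 - Q.b) (by push_cast; exact a1)
  have k2 := key' _ a2
  have k3 := key (1 - Q.bHat) (by push_cast; exact a3)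
  have k4 := key' _ a4
  push_cast at k1 k3
  rw [barnesPart, div_eq_mul_inv, div_eq_mul_inv, norm_mul, norm_mul, norm_mul]
  set e := Real.exp (C + 4 * |(zvar β).im|)
  calc _ ≤ e * e * (e * e) := by gcongr
    _ = Real.exp (4 * C) * Real.exp (16 * |(zvar β).im|) := by
      simp only [e]; rw [← Real.exp_add, ← Real.exp_add, ← Real.exp_add]; congr 1; ring
    _ ≤ Real.exp (4 * C) * Real.exp (3 * |β.re|) := by
      gcongr ?_ * Real.exp ?_
      rw [zvar_im, abs_div, abs_of_pos (by positivity : 0 < 2 * Real.pi), mul_div_assoc',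
        div_le_iff₀ (by positivity)]
      nlinarith [abs_nonneg β.re, Real.pi_gt_three]
    _ ≤ Real.exp (4 * C) * (2 * Real.cosh β.re) ^ 3 := by
      rw [show (3 : ℝ) * |β.re| = ((3 : ℕ) : ℝ) * |β.re| by norm_num, Real.exp_nat_mul]
      gcongr
      exact exp_abs_le_two_mul_cosh _
    _ = _ := by ring

lemma norm_sinh_le (β : ℂ) : ‖Complex.sinh β‖ ≤ Real.cosh β.re := by
  rw [Complex.sinh, norm_div, Real.cosh_eq]
  simp only [Complex.norm_ofNat]
  gcongr
  refine (norm_sub_le _ _).trans ?_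
  rw [Complex.norm_exp, Complex.norm_exp, Complex.neg_re]

/-- The two-body factor has polynomial growth in `cosh (Re β)`, and at most a simple pole
at `iπ`. -/
lemma norm_twoBody_le : ∃ C : ℝ, 1 ≤ C ∧ ∀ (l l' : Fin 2) (β : ℂ) (τ : ℝ), 0 < τ → τ ≤ 1 →
    -Q.reg ≤ β.im → β.im ≤ Real.pi - τ → ‖Q.twoBody l l' β‖ ≤ C / τ * Real.cosh β.re ^ 4 := by
  obtain ⟨C, hC0, hC⟩ := Q.norm_barnesPart_le
  refine ⟨2 * C + 1, by linarith, fun l l' β τ hτ hτ1 h1 h2 => ?_⟩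
  have hp := Real.pi_gt_three
  have hr := Q.reg_pos
  have hr4 := Q.reg_le
  have hc1 := Real.one_le_cosh β.re
  have hN := hC β (by nlinarith) (by linarith)
  set c := Real.cosh β.re with hc
  have hhalf : Real.cosh (β / 2).re ≤ c := by
    rw [hc, Real.cosh_le_cosh]
    have : (β / 2).re = β.re / 2 := by simp
    rw [this, abs_div, abs_two]; linarith [abs_nonneg β.re]
  have hF : ‖Q.minimalFF β‖ ≤ C * c ^ 4 := by
    rw [minimalFF_eq, norm_mul, norm_mul, norm_neg, norm_div, Complex.norm_I,
      Complex.norm_of_nonneg Real.pi_pos.le]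
    have h3 : 1 / Real.pi ≤ 1 := by rw [div_le_one (by linarith)]; linarith
    calc _ ≤ 1 * c * (C * c ^ 3) := by
          gcongr
          exact (norm_sinh_le _).trans hhalf
      _ = _ := by ring
  have hFs : ‖Q.ffOverSinh β‖ ≤ C / τ * c ^ 3 := by
    have h3 := norm_cosh_half_ge hτ hτ1 (by linarith) h2
    have hpos : 0 < τ / Real.pi := by positivity
    rw [ffOverSinh, norm_div, norm_mul, norm_neg, norm_div, Complex.norm_I, norm_mul,
      Complex.norm_of_nonneg Real.pi_pos.le, Complex.norm_ofNat]
    calc _ ≤ 1 / (2 * Real.pi) * (C * c ^ 3) / (τ / Real.pi) := by gcongr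
      _ = C / τ * c ^ 3 / 2 := by field_simp
      _ ≤ _ := half_le_self (by positivity)
  have hl : ‖Complex.I * ((((l : ℕ) : ℂ) - ((l' : ℕ) : ℂ)) * (Q.sinB : ℂ))‖ ≤ 1 := by
    rw [norm_mul, norm_mul, Complex.norm_I, Complex.norm_of_nonneg Q.sinB_pos.le, one_mul]
    have : ‖((l : ℕ) : ℂ) - ((l' : ℕ) : ℂ)‖ ≤ 1 := by
      fin_cases l <;> fin_cases l' <;> simp
    calc _ ≤ 1 * (1 : ℝ) := by
          have := Q.sinB_le_one; have := Q.sinB_pos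
          gcongr
      _ = 1 := one_mul 1
  have hτi : 1 ≤ 1 / τ := by rw [le_div_iff₀ hτ]; linarith
  calc ‖Q.twoBody l l' β‖ ≤ C * c ^ 4 + 1 * (C / τ * c ^ 3) := by
        refine (norm_sub_le _ _).trans (add_le_add hF ?_)
        rw [norm_mul]; gcongr
    _ ≤ C * (1 / τ) * c ^ 4 + C / τ * c ^ 4 := by
        rw [one_mul]
        gcongr
        · exact le_mul_of_one_le_right hC0 hτi
        · norm_num
    _ = 2 * C / τ * c ^ 4 := by ring
    _ ≤ (2 * C + 1) / τ * c ^ 4 := by gcongr; linarith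

lemma differentiableAt_twoBody (l l' : Fin 2) {β : ℂ} (h1 : -(2 * Q.reg) < β.im)
    (h2 : β.im < Real.pi) : DifferentiableAt ℂ (Q.twoBody l l') β := by
  have hr := Q.reg_pos
  have hr4 := Q.reg_le
  have hp := Real.pi_gt_three
  have hN := Q.differentiableAt_barnesPart (β := β) (by nlinarith) h2.le
  have hc := cosh_half_ne_zero (β := β) (by linarith) h2
  have e : Q.twoBody l l' = fun β => -(Complex.I / Real.pi) * Complex.sinh (β / 2) * Q.barnesPart β -
      Complex.I * ((((l : ℕ) : ℂ) - ((l' : ℕ) : ℂ)) * (Q.sinB : ℂ)) *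
        (-(Complex.I / (2 * Real.pi)) * Q.barnesPart β / Complex.cosh (β / 2)) := by
    ext β; rw [twoBody, minimalFF_eq, ffOverSinh]
  rw [e]
  have hsh : DifferentiableAt ℂ (fun β : ℂ => Complex.sinh (β / 2)) β := by fun_prop
  have hch : DifferentiableAt ℂ (fun β : ℂ => Complex.cosh (β / 2)) β := by fun_prop
  exact (((hsh.const_mul _).mul hN)).sub (((hN.const_mul _).div hch hc).const_mul _)

lemma measurable_barnesPart : Measurable Q.barnesPart := by
  have h := measurable_barnesQuot
  have hz : Measurable zvar := by unfold zvar; fun_prop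
  have key : ∀ c : ℂ, Measurable fun β => barnesQuot (c + zvar β) := fun c =>
    h.comp (hz.const_add c)
  unfold barnesPart
  exact ((key _).div (key _)).mul ((key _).div (key _))

lemma measurable_minimalFF : Measurable Q.minimalFF := by
  have e : Q.minimalFF = fun β => -(Complex.I / Real.pi) * Complex.sinh (β / 2) * Q.barnesPart β := by
    ext β; rw [minimalFF_eq]
  have h := Q.measurable_barnesPart
  have : Measurable Complex.sinh := Complex.continuous_sinh.measurable
  rw [e]; fun_prop

lemma measurable_twoBody (l l' : Fin 2) : Measurable (Q.twoBody l l') := by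
  have h := Q.measurable_barnesPart
  have h2 := Q.measurable_minimalFF
  have : Measurable Complex.cosh := Complex.continuous_cosh.measurable
  unfold twoBody ffOverSinh
  fun_prop

lemma measurable_S : Measurable Q.S := by
  have : Measurable Complex.sinh := Complex.continuous_sinh.measurable
  unfold S; fun_prop

lemma norm_sinh_add_ge {β : ℂ} (h : |β.im| ≤ 2 * Q.reg) :
    Q.sinB / 4 ≤ ‖Complex.sinh β + Complex.I * (Q.sinB : ℂ)‖ := by
  have hs := Q.sinB_pos
  have hs1 := Q.sinB_le_one
  have hy : |β.im| ≤ Q.sinB / 2 := h.trans (by linarith [Q.reg_le_sinB])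
  obtain ⟨hy1, hy2⟩ := abs_le.1 hy
  have e : Complex.sinh β + Complex.I * (Q.sinB : ℂ) =
      ((Real.sinh β.re * Real.cos β.im : ℝ) : ℂ) +
        ((Real.cosh β.re * Real.sin β.im + Q.sinB : ℝ) : ℂ) * Complex.I := by
    conv_lhs => rw [← Complex.re_add_im β]
    rw [Complex.sinh_add, Complex.cosh_mul_I, Complex.sinh_mul_I]
    push_cast; ring
  rw [e]
  rcases le_or_gt 1 |Real.sinh β.re| with h1 | h1
  · refine le_trans ?_ (Complex.abs_re_le_norm _)
    simp only [Complex.add_re, Complex.ofReal_re, Complex.mul_I_re, Complex.ofReal_im, neg_zero,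
      add_zero, abs_mul]
    have hcos : 1 / 4 ≤ Real.cos β.im := by
      have := Real.one_sub_sq_div_two_le_cos (x := β.im)
      nlinarith
    rw [abs_of_pos (by linarith : 0 < Real.cos β.im)]
    nlinarith
  · refine le_trans ?_ (Complex.abs_im_le_norm _)
    simp only [Complex.add_im, Complex.ofReal_im, Complex.mul_I_im, Complex.ofReal_re, zero_add]
    have hcosh : Real.cosh β.re ≤ 3 / 2 := by
      have h2 := Real.cosh_sq β.re
      have h3 : Real.sinh β.re ^ 2 ≤ 1 := by rw [← sq_abs]; nlinarith [abs_nonneg (Real.sinh β.re)]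
      nlinarith [Real.cosh_pos β.re]
    have hsin : |Real.sin β.im| ≤ Q.sinB / 2 := Real.abs_sin_le_abs.trans hy
    have : |Real.cosh β.re * Real.sin β.im| ≤ 3 / 2 * (Q.sinB / 2) := by
      rw [abs_mul, abs_of_pos (Real.cosh_pos _)]
      gcongr
    refine le_trans ?_ (le_abs_self _)
    linarith [neg_abs_le (Real.cosh β.re * Real.sin β.im)]

lemma norm_S_le {β : ℂ} (h : |β.im| ≤ 2 * Q.reg) : ‖Q.S β‖ ≤ 9 := by
  have hs := Q.sinB_pos
  have h1 := Q.norm_sinh_add_ge h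
  have hne : Complex.sinh β + Complex.I * (Q.sinB : ℂ) ≠ 0 := by
    intro h0; rw [h0, norm_zero] at h1; linarith
  have e : Q.S β = 1 - 2 * Complex.I * Q.sinB / (Complex.sinh β + Complex.I * (Q.sinB : ℂ)) := by
    rw [S]; field_simp; ring
  rw [e]
  refine (norm_sub_le _ _).trans ?_
  rw [norm_one, norm_div, norm_mul, norm_mul, Complex.norm_I, Complex.norm_ofNat,
    Complex.norm_of_nonneg hs.le]
  have : 2 * 1 * Q.sinB / ‖Complex.sinh β + Complex.I * (Q.sinB : ℂ)‖ ≤ 2 * 1 * Q.sinB / (Q.sinB / 4) := by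
    gcongr
  have e2 : 2 * 1 * Q.sinB / (Q.sinB / 4) = 8 := by field_simp; norm_num
  linarith

lemma differentiableAt_S {β : ℂ} (h : |β.im| ≤ 2 * Q.reg) : DifferentiableAt ℂ Q.S β := by
  have hs := Q.sinB_pos
  have h1 := Q.norm_sinh_add_ge h
  have hne : Complex.sinh β + Complex.I * (Q.sinB : ℂ) ≠ 0 := by
    intro h0; rw [h0, norm_zero] at h1; linarith
  unfold S
  exact DifferentiableAt.div (by fun_prop) (by fun_prop) hne

lemma minimalFF_ne_zero {x : ℝ} (hx : x ≠ 0) : Q.minimalFF x ≠ 0 := by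
  have hp : (Real.pi : ℂ) ≠ 0 := by exact_mod_cast Real.pi_ne_zero
  rw [minimalFF_eq]
  refine mul_ne_zero (mul_ne_zero (neg_ne_zero.2 (div_ne_zero Complex.I_ne_zero hp)) ?_)
    (Q.barnesPart_ne_zero ?_ ?_)
  · rw [show (x : ℂ) / 2 = ((x / 2 : ℝ) : ℂ) by push_cast; rfl, ← Complex.ofReal_sinh]
    exact_mod_cast Real.sinh_ne_zero.2 (by simpa using hx)
  · have := Real.pi_pos; have := Q.reg_pos
    simp only [Complex.ofReal_im, Left.neg_nonpos_iff]; positivity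
  · simpa using Real.pi_pos.le

/-- Watson's equation `F(x) = S(x) F(-x)`. -/
lemma minimalFF_eq_S_mul (x : ℝ) : Q.minimalFF x = Q.S x * Q.minimalFF (-x) := by
  have hb := Q.b_pos; have hb2 := Q.b_lt; have hb' := Q.bHat_pos; have hb2' := Q.bHat_lt
  have hz : zvar (-(x : ℂ)) = -zvar x := by rw [zvar, zvar]; ring
  have hzre : (zvar x).re = 0 := by rw [zvar_re]; simp
  have hp : (Real.pi : ℂ) ≠ 0 := by exact_mod_cast Real.pi_ne_zero
  have r : ∀ c : ℝ, 0 < c → c < 1 / 2 →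
      barnesQuot (1 - (c : ℂ) + zvar x) / barnesQuot ((c : ℂ) + zvar x) *
        Complex.sin (Real.pi * (c - zvar x)) =
      barnesQuot (1 - (c : ℂ) - zvar x) / barnesQuot ((c : ℂ) - zvar x) *
        Complex.sin (Real.pi * (c + zvar x)) := by
    intro c h1 h2
    have h := barnesQuot_reflection (w := c - zvar x) (v := c + zvar x)
      (by simp [hzre, h1]) (by simp [hzre]; linarith) (by simp [hzre, h1])
      (by simp [hzre]; linarith)
    have n1 : barnesQuot ((c : ℂ) + zvar x) ≠ 0 := barnesQuot_ne_zero (by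
      simp only [Complex.add_re, Complex.ofReal_re, hzre, add_zero, abs_lt]; constructor <;> linarith)
    have n2 : barnesQuot ((c : ℂ) - zvar x) ≠ 0 := barnesQuot_ne_zero (by
      simp only [Complex.sub_re, Complex.ofReal_re, hzre, sub_zero, abs_lt]; constructor <;> linarith)
    rw [show 1 - ((c : ℂ) - zvar x) = 1 - c + zvar x by ring,
      show 1 - ((c : ℂ) + zvar x) = 1 - c - zvar x by ring] at h
    rw [div_mul_eq_mul_div, div_mul_eq_mul_div, div_eq_div_iff n1 n2]
    linear_combination h
  have h1 := r _ hb hb2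
  have h2 := r _ hb' hb2'
  have hsin : ∀ z : ℂ, Complex.sin (Real.pi * (Q.b + z)) * Complex.sin (Real.pi * (Q.bHat + z)) =
      (Q.sinB + Complex.sin (2 * (Real.pi * z))) / 2 := by
    intro z
    have e1 : (Real.pi : ℂ) * (Q.bHat + z) = Real.pi / 2 - (Real.pi * Q.b - Real.pi * z) := by
      rw [bHat]; push_cast; ring
    have e2 : ((Q.sinB : ℝ) : ℂ) = Complex.sin ((Real.pi * Q.b + Real.pi * z) + (Real.pi * Q.b - Real.pi * z)) := by
      rw [sinB]; push_cast; congr 1; ring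
    have e3 : Complex.sin (2 * (Real.pi * z)) = Complex.sin ((Real.pi * Q.b + Real.pi * z) - (Real.pi * Q.b - Real.pi * z)) := by
      congr 1; ring
    rw [e1, Complex.sin_pi_div_two_sub, e2, e3, mul_add]
    generalize (Real.pi : ℂ) * Q.b + Real.pi * z = A
    generalize (Real.pi : ℂ) * Q.b - Real.pi * z = B
    rw [Complex.sin_add, Complex.sin_sub]
    ring
  have hs1 := hsin (zvar x)
  have hs2 : Complex.sin (Real.pi * (Q.b - zvar x)) * Complex.sin (Real.pi * (Q.bHat - zvar x)) =
      (Q.sinB - Complex.sinh x * Complex.I) / 2 := by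
    have := hsin (-zvar x)
    rw [show 2 * (Real.pi * -zvar x) = -(x * Complex.I) by
      linear_combination (-2 : ℂ) * pi_mul_zvar x, Complex.sin_neg, Complex.sin_mul_I] at this
    simpa only [sub_eq_add_neg] using this
  rw [pi_mul_zvar, show 2 * ((x : ℂ) / 2 * Complex.I) = x * Complex.I by ring,
    Complex.sin_mul_I] at hs1
  have hN : Q.barnesPart x * (Q.sinB - Complex.sinh x * Complex.I) =
      Q.barnesPart (-x) * (Q.sinB + Complex.sinh x * Complex.I) := by
    have e : Q.barnesPart (-x) =
      barnesQuot (1 - (Q.b : ℂ) - zvar x) / barnesQuot ((Q.b : ℂ) - zvar x) *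
      (barnesQuot (1 - (Q.bHat : ℂ) - zvar x) / barnesQuot ((Q.bHat : ℂ) - zvar x)) := by
      rw [barnesPart, hz]; simp only [sub_eq_add_neg]
    rw [e, barnesPart]
    have h12 := congr (congrArg HMul.hMul h1) h2
    linear_combination 2 * h12 -
      2 * (barnesQuot (1 - (Q.b : ℂ) + zvar x) / barnesQuot ((Q.b : ℂ) + zvar x) *
      (barnesQuot (1 - (Q.bHat : ℂ) + zvar x) / barnesQuot ((Q.bHat : ℂ) + zvar x))) * hs2 +
      2 * (barnesQuot (1 - (Q.b : ℂ) - zvar x) / barnesQuot ((Q.b : ℂ) - zvar x) *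
      (barnesQuot (1 - (Q.bHat : ℂ) - zvar x) / barnesQuot ((Q.bHat : ℂ) - zvar x))) * hs1
  have hs := Q.sinB_pos
  have hne : Complex.sinh x + Complex.I * (Q.sinB : ℂ) ≠ 0 := by
    have h1 := Q.norm_sinh_add_ge (β := x) (by simp [Q.reg_pos.le])
    intro h0; rw [h0, norm_zero] at h1; linarith
  rw [minimalFF_eq, minimalFF_eq, S, neg_div, Complex.sinh_neg, div_mul_eq_mul_div, eq_div_iff hne]
  linear_combination (Complex.I * -(Complex.I / Real.pi) * Complex.sinh (x / 2)) * hN +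
    (-(Complex.I / Real.pi) * Complex.sinh (x / 2) * (Complex.sinh x) * (Q.barnesPart x + Q.barnesPart (-x))) * Complex.I_sq

end Model

/-! ### Boundary values of holomorphic functions tested against smooth functions -/

/-- The kernel which represents a boundary value `∫ ψ(θ) a(θ) dθ` of a holomorphic function `a` as
an integral of `a` over the strip `0 < s < η`, in terms of `c k = ψ^{(k)}(θ)`. It vanishes to order
`M` at `s = 0`. -/
def stripKernel (M : ℕ) (η : ℝ) (c : ℕ → ℂ) (s : ℝ) : ℂ :=
  (s : ℂ) ^ M * (((M : ℂ) + 1) / (η : ℂ) ^ (M + 1) *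
      ∑ k ∈ Finset.range (M + 1), (Complex.I * s) ^ k / (k.factorial : ℂ) * c k +
    Complex.I ^ (M + 1) * (1 - ((s : ℂ) / η) ^ (M + 1)) / (M.factorial : ℂ) * c (M + 1))

lemma sum_taylor_telescope (τ τ' : ℂ) (s : ℝ) (c : ℕ → ℂ) (n : ℕ) :
    ∑ k ∈ Finset.range (n + 1), (Complex.I * (τ * ((Complex.I * s) ^ k / (k.factorial : ℂ))) * c (k + 1) -
      (τ' * ((Complex.I * s) ^ k / (k.factorial : ℂ)) +
        τ * (k * (Complex.I * s) ^ (k - 1) * Complex.I / (k.factorial : ℂ))) * c k) =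
    Complex.I * τ * ((Complex.I * s) ^ n / (n.factorial : ℂ)) * c (n + 1) -
      τ' * ∑ k ∈ Finset.range (n + 1), (Complex.I * s) ^ k / (k.factorial : ℂ) * c k := by
  induction n with
  | zero => simp
  | succ n ih =>
    rw [Finset.sum_range_succ, ih, Finset.sum_range_succ _ (n + 1)]
    have h1 : ((n + 1 : ℕ) : ℂ) * (Complex.I * s) ^ (n + 1 - 1) * Complex.I / ((n + 1).factorial : ℂ) =
        Complex.I * ((Complex.I * s) ^ n / (n.factorial : ℂ)) := by
      have h2 : ((n + 1 : ℕ) : ℂ) ≠ 0 := by exact_mod_cast Nat.succ_ne_zero n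
      have h3 : (n.factorial : ℂ) ≠ 0 := by exact_mod_cast Nat.factorial_ne_zero n
      rw [Nat.factorial_succ, Nat.add_sub_cancel]
      push_cast at h2 ⊢
      field_simp
    rw [h1]
    ring

/-- Green's formula for the almost analytic extension
`(1 - (s/η)^{M+1}) ∑_{k ≤ M} (is)^k ψ^{(k)}(θ)/k!` of `ψ`, which vanishes at `s = η`. -/
theorem integral_mul_eq_integral_stripKernel (M : ℕ) {η : ℝ} (hη : 0 < η) (ψ : ℕ → ℝ → ℂ)
    (hψ : ∀ k θ, HasDerivAt (ψ k) (ψ (k + 1) θ) θ) (h1 : ∀ k, ψ k 1 = 0) (h2 : ∀ k, ψ k (-1) = 0)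
    (a : ℂ → ℂ)
    (ha : ∀ z : ℂ, |z.re| ≤ 1 → 0 ≤ z.im → z.im ≤ η → DifferentiableAt ℂ a z) :
    ∫ θ in (-1 : ℝ)..1, ψ 0 θ * a θ =
      ∫ θ in (-1 : ℝ)..1, ∫ s in (0 : ℝ)..η,
        stripKernel M η (fun k => ψ k θ) s * a (θ + s * Complex.I) := by
  set τ : ℝ → ℂ := fun s => 1 - ((s : ℂ) / η) ^ (M + 1) with hτ
  set e : ℕ → ℝ → ℂ := fun k s => (Complex.I * s) ^ k / (k.factorial : ℂ) with he
  set τ' : ℝ → ℂ := fun s => -(((M : ℂ) + 1) * ((s : ℂ) / η) ^ M * (1 / η)) with hτ'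
  set e' : ℕ → ℝ → ℂ := fun k s => k * (Complex.I * s) ^ (k - 1) * Complex.I / (k.factorial : ℂ) with he'
  have hηC : (η : ℂ) ≠ 0 := by exact_mod_cast hη.ne'
  have hid : ∀ s : ℝ, HasDerivAt (fun s : ℝ => (s : ℂ)) 1 s := fun s => Complex.ofRealCLM.hasDerivAt
  have dτ : ∀ s, HasDerivAt τ (τ' s) s := by
    intro s
    have := (((hid s).div_const (η : ℂ)).pow (M + 1)).const_sub 1
    refine this.congr_deriv ?_
    simp [hτ']
  have de : ∀ k s, HasDerivAt (e k) (e' k s) s := by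
    intro k s
    have := ((((hid s).const_mul Complex.I)).pow k).div_const (k.factorial : ℂ)
    refine this.congr_deriv ?_
    simp [he']
  set f : ℂ → ℂ := fun z => ∑ k ∈ Finset.range (M + 1), (τ z.im * e k z.im) * ψ k z.re * a z with hf
  have hfd : ∀ z : ℂ, |z.re| ≤ 1 → 0 ≤ z.im → z.im ≤ η →
      ∃ F : ℂ →L[ℝ] ℂ, HasFDerivAt f F z ∧ Complex.I • F 1 - F Complex.I =
        stripKernel M η (fun k => ψ k z.re) z.im * a z := by
    intro z hz1 hz2 hz3
    have hre : ∀ k, HasFDerivAt (fun z : ℂ => ψ k z.re)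
        (Complex.reCLM.smulRight (ψ (k + 1) z.re)) z := fun k => by
      have := (hψ k z.re).hasFDerivAt.comp z Complex.reCLM.hasFDerivAt
      convert! this using 1
    have him : ∀ k, HasFDerivAt (fun z : ℂ => τ z.im * e k z.im)
        (Complex.imCLM.smulRight (τ' z.im * e k z.im + τ z.im * e' k z.im)) z := fun k => by
      have := ((dτ z.im).mul (de k z.im)).hasFDerivAt.comp z Complex.imCLM.hasFDerivAt
      convert! this using 1
    have hA := ((ha z hz1 hz2 hz3).hasDerivAt.hasFDerivAt).restrictScalars ℝ
    have hsum := HasFDerivAt.fun_sum (u := Finset.range (M + 1))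
      fun k _ => (((him k).mul (hre k)).mul hA)
    refine ⟨_, hsum, ?_⟩
    have tel := sum_taylor_telescope (τ z.im) (τ' z.im) z.im (fun k => ψ k z.re) M
    have hk : stripKernel M η (fun k => ψ k z.re) z.im =
        Complex.I * τ z.im * (e M z.im) * ψ (M + 1) z.re -
          τ' z.im * ∑ k ∈ Finset.range (M + 1), e k z.im * ψ k z.re := by
      simp only [stripKernel, hτ, hτ', he]
      generalize ∑ k ∈ Finset.range (M + 1), (Complex.I * (z.im : ℂ)) ^ k / (k.factorial : ℂ) *
        ψ k z.re = Sg
      simp only [div_pow, mul_pow]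
      field_simp
      ring
    rw [hk]
    rw [← tel, Finset.sum_mul]
    simp only [sum_apply, Finset.smul_sum]
    rw [← Finset.sum_sub_distrib]
    refine Finset.sum_congr rfl fun k _ => ?_
    simp [he, he']
    ring
  have hcont : ContinuousOn f (Set.uIcc (-1 : ℝ) 1 ×ℂ Set.uIcc (0 : ℝ) η) := by
    intro z hz
    rw [Complex.mem_reProdIm, Set.uIcc_of_le (by norm_num), Set.uIcc_of_le hη.le] at hz
    obtain ⟨F, hF, -⟩ := hfd z (abs_le.2 hz.1) hz.2.1 hz.2.2
    exact hF.continuousAt.continuousWithinAt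
  have key := Complex.integral_boundary_rect_of_hasFDerivAt_real_off_countable f (fderiv ℝ f)
    (-1 : ℂ) (1 + η * Complex.I) ∅ Set.countable_empty
    (by simpa using hcont)
    (by
      intro z hz
      simp only [Complex.neg_re, Complex.one_re, Complex.add_re, Complex.mul_re, Complex.ofReal_re,
        Complex.I_re, mul_zero, Complex.ofReal_im, Complex.I_im, mul_one, sub_self, add_zero,
        Complex.neg_im, Complex.one_im, neg_zero, Complex.add_im, Complex.mul_im, zero_add,
        Set.sdiff_empty, Complex.mem_reProdIm] at hz
      rw [min_eq_left (by norm_num), max_eq_right (by norm_num), min_eq_left hη.le,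
        max_eq_right hη.le] at hz
      obtain ⟨F, hF, -⟩ := hfd z (abs_le.2 ⟨hz.1.1.le, hz.1.2.le⟩) hz.2.1.le hz.2.2.le
      rwa [hF.fderiv])
    (by
      have hcompact : IsCompact (Set.uIcc (-1 : ℝ) 1 ×ℂ Set.uIcc (0 : ℝ) η) :=
        isCompact_uIcc.reProdIm isCompact_uIcc
      have hc : ContinuousOn (fun z : ℂ => stripKernel M η (fun k => ψ k z.re) z.im * a z)
          (Set.uIcc (-1 : ℝ) 1 ×ℂ Set.uIcc (0 : ℝ) η) := by
        have hψc : ∀ k, Continuous (ψ k) := fun k =>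
          continuous_iff_continuousAt.2 fun θ => (hψ k θ).continuousAt
        have hψc' : ∀ k, Continuous fun z : ℂ => ψ k z.re := fun k =>
          (hψc k).comp Complex.continuous_re
        refine ContinuousOn.mul (Continuous.continuousOn ?_) fun z hz => ?_
        · unfold stripKernel
          have := Complex.continuous_im
          fun_prop
        · rw [Complex.mem_reProdIm, Set.uIcc_of_le (by norm_num), Set.uIcc_of_le hη.le] at hz
          exact (ha z (abs_le.2 hz.1) hz.2.1 hz.2.2).continuousAt.continuousWithinAt
      have hi := hc.integrableOn_compact (μ := volume) hcompact
      have : IntegrableOn (fun z => Complex.I • fderiv ℝ f z 1 - fderiv ℝ f z Complex.I)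
          (Set.uIcc (-1 : ℝ) 1 ×ℂ Set.uIcc (0 : ℝ) η) := by
        refine hi.congr_fun (fun z hz => ?_) hcompact.measurableSet
        rw [Complex.mem_reProdIm, Set.uIcc_of_le (by norm_num), Set.uIcc_of_le hη.le] at hz
        obtain ⟨F, hF, hF2⟩ := hfd z (abs_le.2 hz.1) hz.2.1 hz.2.2
        simp only
        rw [hF.fderiv, hF2]
      simpa using this)
  have hz : ∀ k, (0 : ℂ) ^ k = if k = 0 then 1 else 0 := fun k => by
    split_ifs with h <;> simp [h]
  -- of the four sides of the rectangle only the lower one contributes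
  have f0 : ∀ x : ℝ, f x = ψ 0 x * a x := by
    intro x
    simp only [hf, hτ, he, Complex.ofReal_im, Complex.ofReal_re, Complex.ofReal_zero, mul_zero, hz]
    rw [Finset.sum_eq_single 0]
    · simp
    · intro k _ hk; simp [hk]
    · simp
  have fη : ∀ x : ℝ, f (x + η * Complex.I) = 0 := by
    intro x
    simp [hf, hτ, hηC]
  have fr : ∀ y : ℝ, f (1 + y * Complex.I) = 0 := by
    intro y; simp [hf, h1]
  have fl : ∀ y : ℝ, f (-1 + y * Complex.I) = 0 := by
    intro y; simp [hf, h2]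
  simp only [Complex.neg_re, Complex.one_re, Complex.add_re, Complex.mul_re, Complex.ofReal_re,
    Complex.I_re, mul_zero, Complex.ofReal_im, Complex.I_im, mul_one, sub_self, add_zero,
    Complex.neg_im, Complex.one_im, neg_zero, Complex.add_im, Complex.mul_im, zero_add,
    Complex.ofReal_zero, zero_mul, f0, fη, Complex.ofReal_one, Complex.ofReal_neg, fr, fl,
    intervalIntegral.integral_zero, sub_zero, smul_zero] at key
  rw [key]
  refine intervalIntegral.integral_congr fun x hx => ?_
  refine intervalIntegral.integral_congr fun y hy => ?_
  rw [Set.uIcc_of_le (by norm_num)] at hx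
  rw [Set.uIcc_of_le hη.le] at hy
  obtain ⟨F, hF, hF2⟩ := hfd (x + y * Complex.I) (by simpa [abs_le] using hx) (by simpa using hy.1)
    (by simpa using hy.2)
  rw [hF.fderiv, hF2]
  simp

lemma norm_stripKernel_le (M : ℕ) {η : ℝ} (hη : 0 < η) (hη1 : η ≤ 1) {c : ℕ → ℂ} {s B : ℝ}
    (hs : 0 ≤ s) (hsη : s ≤ η) (hB : ∀ k ≤ M + 1, ‖c k‖ ≤ B) :
    ‖stripKernel M η c s‖ ≤ s ^ M * ((((M : ℝ) + 1) ^ 2 / η ^ (M + 1) + 1) * B) := by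
  have hB0 : 0 ≤ B := (norm_nonneg _).trans (hB 0 (by omega))
  have hs1 : s ≤ 1 := hsη.trans hη1
  have fact1 : ∀ k : ℕ, (1 : ℝ) ≤ k.factorial := fun k => by exact_mod_cast Nat.succ_le_of_lt k.factorial_pos
  rw [stripKernel, norm_mul, norm_pow, Complex.norm_of_nonneg hs]
  gcongr
  refine (norm_add_le _ _).trans ?_
  rw [add_mul]
  refine add_le_add ?_ ?_
  · rw [norm_mul, norm_div, norm_pow, Complex.norm_of_nonneg hη.le]
    have e1 : ‖((M : ℂ) + 1)‖ = (M : ℝ) + 1 := by exact_mod_cast Complex.norm_natCast (M + 1)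
    rw [e1]
    have : ‖∑ k ∈ Finset.range (M + 1), (Complex.I * s) ^ k / (k.factorial : ℂ) * c k‖ ≤
        ((M : ℝ) + 1) * B := by
      refine (norm_sum_le_of_le _ (fun k hk => ?_)).trans
        (le_of_eq (b := ((M : ℝ) + 1) * B) (a := ∑ _k ∈ Finset.range (M + 1), B) (by simp))
      rw [norm_mul, norm_div, norm_pow, norm_mul, Complex.norm_I, one_mul,
        Complex.norm_of_nonneg hs, Complex.norm_natCast]
      have : s ^ k / (k.factorial : ℝ) ≤ 1 := by
        rw [div_le_one (by linarith [fact1 k])]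
        exact (pow_le_one₀ hs hs1).trans (fact1 k)
      calc _ ≤ 1 * B := by
            gcongr
            exact hB k (by simpa using (Finset.mem_range.1 hk).le)
        _ = B := one_mul B
    calc _ ≤ ((M : ℝ) + 1) / η ^ (M + 1) * (((M : ℝ) + 1) * B) := by gcongr
      _ = _ := by ring
  · rw [norm_mul, norm_div, norm_mul, norm_pow, Complex.norm_I, one_pow, one_mul, Complex.norm_natCast]
    have h1 : ‖(1 : ℂ) - ((s : ℂ) / η) ^ (M + 1)‖ ≤ 1 := by
      rw [show (1 : ℂ) - ((s : ℂ) / η) ^ (M + 1) = ((1 - (s / η) ^ (M + 1) : ℝ) : ℂ) by push_cast; rfl,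
        Complex.norm_real, Real.norm_eq_abs, abs_le]
      have h0 : 0 ≤ (s / η) ^ (M + 1) := by positivity
      have h1 : (s / η) ^ (M + 1) ≤ 1 := pow_le_one₀ (by positivity) ((div_le_one hη).2 hsη)
      constructor <;> linarith
    have : ‖(1 : ℂ) - ((s : ℂ) / η) ^ (M + 1)‖ / (M.factorial : ℝ) ≤ 1 := by
      rw [div_le_one (by linarith [fact1 M])]
      exact h1.trans (fact1 M)
    exact mul_le_mul this (hB _ le_rfl) (norm_nonneg _) zero_le_one

/-! ### Weights -/

/-- The weight `∏ cosh x_i`, which dominates the momenta. -/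
def weight {X : Type*} [Fintype X] (x : X → ℝ) : ℝ := ∏ i, Real.cosh (x i)

section weight
variable {X : Type*} [Fintype X]

lemma one_le_weight (x : X → ℝ) : 1 ≤ weight x :=
  Finset.one_le_prod (s := Finset.univ) (fun i _ => Real.one_le_cosh (x i))

lemma weight_pos (x : X → ℝ) : 0 < weight x := one_pos.trans_le (one_le_weight x)

lemma cosh_le_weight (x : X → ℝ) (i : X) : Real.cosh (x i) ≤ weight x := by
  classical
  rw [weight, ← Finset.mul_prod_erase _ _ (Finset.mem_univ i)]
  refine le_mul_of_one_le_right (Real.cosh_pos _).le ?_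
  exact Finset.one_le_prod (fun i _ => Real.one_le_cosh (x i))

lemma one_add_sq_div_two_le_cosh (x : ℝ) : 1 + x ^ 2 / 2 ≤ Real.cosh x := by
  have h : Real.cosh x = 1 + 2 * Real.sinh (x / 2) ^ 2 := by
    have h1 := Real.cosh_two_mul (x / 2)
    have h2 := Real.cosh_sq (x / 2)
    rw [mul_div_cancel₀ _ (two_ne_zero)] at h1
    linarith
  have h3 : (x / 2) ^ 2 ≤ Real.sinh (x / 2) ^ 2 := by
    rw [← sq_abs (x / 2), ← sq_abs (Real.sinh _), Real.abs_sinh]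
    have := Real.self_le_sinh_iff.2 (abs_nonneg (x / 2))
    gcongr
  rw [h]; nlinarith

lemma integrable_inv_cosh : Integrable fun x : ℝ => (Real.cosh x)⁻¹ := by
  refine (integrable_inv_one_add_sq.const_mul 2).mono'
    (Real.continuous_cosh.measurable.inv.aestronglyMeasurable) (Eventually.of_forall fun x => ?_)
  have h := one_add_sq_div_two_le_cosh x
  rw [norm_inv, Real.norm_of_nonneg (Real.cosh_pos x).le, inv_le_comm₀ (Real.cosh_pos x) (by positivity),
    mul_inv, inv_inv]
  nlinarith [sq_nonneg x]

lemma integrable_inv_weight : Integrable fun x : X → ℝ => (weight x)⁻¹ := by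
  have := Integrable.fintype_prod (ι := X) (f := fun _ x => (Real.cosh x)⁻¹)
    (μ := fun _ => (volume : Measure ℝ)) (fun _ => integrable_inv_cosh)
  simp only [weight, ← Finset.prod_inv_distrib]
  exact this

end weight

/-! ### Boundary values of integrals -/

/-- The measure on the strip `-1 < θ ≤ 1`, `0 < s ≤ η`. -/
def stripMeasure (η : ℝ) : Measure (ℝ × ℝ) :=
  (volume.restrict (Set.Ioc (-1 : ℝ) 1)).prod (volume.restrict (Set.Ioc (0 : ℝ) η))

instance (η : ℝ) : IsFiniteMeasure (stripMeasure η) := by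
  unfold stripMeasure; infer_instance

lemma ae_stripMeasure (η : ℝ) : ∀ᵐ p ∂(stripMeasure η), |p.1| ≤ 1 ∧ 0 < p.2 ∧ p.2 ≤ η := by
  have : stripMeasure η = volume.restrict (Set.Ioc (-1 : ℝ) 1 ×ˢ Set.Ioc (0 : ℝ) η) := by
    rw [stripMeasure, Measure.prod_restrict]; rfl
  rw [this]
  refine (ae_restrict_iff' (measurableSet_Ioc.prod measurableSet_Ioc)).2 (Eventually.of_forall ?_)
  rintro ⟨θ, s⟩ ⟨h1, h2⟩
  exact ⟨abs_le.2 ⟨h1.1.le, h1.2⟩, h2.1, h2.2⟩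

section boundary
variable {J : Type*} [Fintype J]

/-- The point `y + (θ + is) w`. -/
def shiftPoint (w : J → ℝ) (y : J → ℝ) (θ s : ℝ) : J → ℂ :=
  fun j => (y j : ℂ) + ((θ : ℂ) + s * Complex.I) * w j

lemma measurable_shiftPoint (w : J → ℝ) :
    Measurable fun p : (J → ℝ) × ℝ × ℝ => shiftPoint w p.1 p.2.1 p.2.2 := by
  refine Continuous.measurable ?_
  unfold shiftPoint
  fun_prop

/-- The integral of `A` over complex translates of `ℝ^J` in the direction `w`, with the kernel that
represents the integral over `ℝ^J` itself. -/
def stripIntegral (M : ℕ) (η : ℝ) (w : J → ℝ) (f : (J → ℝ) → ℝ → ℂ) (A : (J → ℂ) → ℂ) : ℂ :=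
  ∫ p : (J → ℝ) × ℝ × ℝ, stripKernel M η (fun k => iteratedDeriv k (f p.1) p.2.1) p.2.2 *
    A (shiftPoint w p.1 p.2.1 p.2.2) ∂((volume : Measure (J → ℝ)).prod (stripMeasure η))

variable {M : ℕ} {η C₁ C₂ : ℝ} {w : J → ℝ} {f : (J → ℝ) → ℝ → ℂ}

lemma norm_stripKernel_mul_le (hη : 0 < η) (hη1 : η ≤ 1)
    (hf : ∀ k ≤ M + 1, ∀ y θ, |θ| ≤ 1 → ‖iteratedDeriv k (f y) θ‖ ≤ C₁ / weight y ^ (M + 1))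
    {A : (J → ℂ) → ℂ}
    (hA : ∀ y θ s, |θ| ≤ 1 → 0 < s → s ≤ η →
      ‖A (shiftPoint w y θ s)‖ ≤ C₂ * (weight y / s) ^ M) (y : J → ℝ) (θ s : ℝ)
    (hθ : |θ| ≤ 1) (hs : 0 < s) (hs1 : s ≤ η) :
    ‖stripKernel M η (fun k => iteratedDeriv k (f y) θ) s * A (shiftPoint w y θ s)‖ ≤
      ((((M : ℝ) + 1) ^ 2 / η ^ (M + 1) + 1) * C₁ * C₂) * (weight y)⁻¹ := by
  have hW := weight_pos y
  rw [norm_mul]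
  have h1 := norm_stripKernel_le M hη hη1 (c := fun k => iteratedDeriv k (f y) θ) hs.le hs1
    (fun k hk => hf k hk y θ hθ)
  have h2 := hA y θ s hθ hs hs1
  calc _ ≤ s ^ M * ((((M : ℝ) + 1) ^ 2 / η ^ (M + 1) + 1) * (C₁ / weight y ^ (M + 1))) *
        (C₂ * (weight y / s) ^ M) := by
        exact mul_le_mul h1 h2 (norm_nonneg _) ((norm_nonneg _).trans h1)
    _ = _ := by
        rw [div_pow, pow_succ (weight y)]
        field_simp

lemma measurable_stripIntegrand
    (hfc : ∀ k, Continuous fun p : (J → ℝ) × ℝ => iteratedDeriv k (f p.1) p.2)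
    {A : (J → ℂ) → ℂ} (hA : Measurable A) :
    Measurable fun p : (J → ℝ) × ℝ × ℝ =>
      stripKernel M η (fun k => iteratedDeriv k (f p.1) p.2.1) p.2.2 *
        A (shiftPoint w p.1 p.2.1 p.2.2) := by
  refine Measurable.mul (Continuous.measurable ?_) (hA.comp (measurable_shiftPoint w))
  unfold stripKernel
  have : ∀ k, Continuous fun p : (J → ℝ) × ℝ × ℝ => iteratedDeriv k (f p.1) p.2.1 := fun k =>
    (hfc k).comp (by fun_prop : Continuous fun p : (J → ℝ) × ℝ × ℝ => (p.1, p.2.1))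
  fun_prop

lemma integrable_stripBound (C η : ℝ) :
    Integrable (fun p : (J → ℝ) × ℝ × ℝ => C * (weight p.1)⁻¹)
      ((volume : Measure (J → ℝ)).prod (stripMeasure η)) := by
  have := (integrable_inv_weight (X := J)).mul_prod (integrable_const (μ := stripMeasure η) (1 : ℝ))
  simpa using this.const_mul C

lemma ae_prod_stripMeasure (η : ℝ) :
    ∀ᵐ p ∂((volume : Measure (J → ℝ)).prod (stripMeasure η)),
      |p.2.1| ≤ 1 ∧ 0 < p.2.2 ∧ p.2.2 ≤ η :=
  Measure.quasiMeasurePreserving_snd.ae (ae_stripMeasure η)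

lemma integrable_stripIntegrand (hη : 0 < η) (hη1 : η ≤ 1)
    (hfc : ∀ k, Continuous fun p : (J → ℝ) × ℝ => iteratedDeriv k (f p.1) p.2)
    (hf : ∀ k ≤ M + 1, ∀ y θ, |θ| ≤ 1 → ‖iteratedDeriv k (f y) θ‖ ≤ C₁ / weight y ^ (M + 1))
    {A : (J → ℂ) → ℂ} (hAm : Measurable A)
    (hA : ∀ y θ s, |θ| ≤ 1 → 0 < s → s ≤ η →
      ‖A (shiftPoint w y θ s)‖ ≤ C₂ * (weight y / s) ^ M) :
    Integrable (fun p : (J → ℝ) × ℝ × ℝ =>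
      stripKernel M η (fun k => iteratedDeriv k (f p.1) p.2.1) p.2.2 *
        A (shiftPoint w p.1 p.2.1 p.2.2)) ((volume : Measure (J → ℝ)).prod (stripMeasure η)) := by
  refine (integrable_stripBound ((((M : ℝ) + 1) ^ 2 / η ^ (M + 1) + 1) * C₁ * C₂) η).mono'
    (measurable_stripIntegrand hfc hAm).aestronglyMeasurable ?_
  filter_upwards [ae_prod_stripMeasure η] with p hp
  exact norm_stripKernel_mul_le hη hη1 hf hA p.1 p.2.1 p.2.2 hp.1 hp.2.1 hp.2.2

lemma norm_stripIntegral_le (hη : 0 < η) (hη1 : η ≤ 1)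
    (hf : ∀ k ≤ M + 1, ∀ y θ, |θ| ≤ 1 → ‖iteratedDeriv k (f y) θ‖ ≤ C₁ / weight y ^ (M + 1))
    {A : (J → ℂ) → ℂ}
    (hA : ∀ y θ s, |θ| ≤ 1 → 0 < s → s ≤ η →
      ‖A (shiftPoint w y θ s)‖ ≤ C₂ * (weight y / s) ^ M) :
    ‖stripIntegral M η w f A‖ ≤ ((((M : ℝ) + 1) ^ 2 / η ^ (M + 1) + 1) * C₁ * C₂) *
      ∫ p : (J → ℝ) × ℝ × ℝ, (weight p.1)⁻¹
        ∂((volume : Measure (J → ℝ)).prod (stripMeasure η)) := by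
  rw [← integral_const_mul]
  refine norm_integral_le_of_norm_le (integrable_stripBound _ η) ?_
  filter_upwards [ae_prod_stripMeasure η] with p hp
  exact norm_stripKernel_mul_le hη hη1 hf hA p.1 p.2.1 p.2.2 hp.1 hp.2.1 hp.2.2

lemma continuousOn_stripIntegral {E : Type*} [TopologicalSpace E] [FirstCountableTopology E]
    {B : Set E} (hη : 0 < η) (hη1 : η ≤ 1)
    (hfc : ∀ k, Continuous fun p : (J → ℝ) × ℝ => iteratedDeriv k (f p.1) p.2)
    (hf : ∀ k ≤ M + 1, ∀ y θ, |θ| ≤ 1 → ‖iteratedDeriv k (f y) θ‖ ≤ C₁ / weight y ^ (M + 1))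
    {A : E → (J → ℂ) → ℂ} (hAm : ∀ ε, Measurable (A ε))
    (hA : ∀ ε ∈ B, ∀ y θ s, |θ| ≤ 1 → 0 < s → s ≤ η →
      ‖A ε (shiftPoint w y θ s)‖ ≤ C₂ * (weight y / s) ^ M)
    (hAc : ∀ y θ s, |θ| ≤ 1 → 0 < s → s ≤ η →
      ContinuousOn (fun ε => A ε (shiftPoint w y θ s)) B) :
    ContinuousOn (fun ε => stripIntegral M η w f (A ε)) B := by
  unfold stripIntegral
  refine continuousOn_of_dominated
    (bound := fun p => ((((M : ℝ) + 1) ^ 2 / η ^ (M + 1) + 1) * C₁ * C₂) * (weight p.1)⁻¹)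
    (fun ε _ => (measurable_stripIntegrand hfc (hAm ε)).aestronglyMeasurable)
    (fun ε hε => ?_)
    (integrable_stripBound ((((M : ℝ) + 1) ^ 2 / η ^ (M + 1) + 1) * C₁ * C₂) η) ?_
  · filter_upwards [ae_prod_stripMeasure η] with p hp
    exact norm_stripKernel_mul_le hη hη1 hf (hA ε hε) p.1 p.2.1 p.2.2 hp.1 hp.2.1 hp.2.2
  · filter_upwards [ae_prod_stripMeasure η] with p hp
    have h := hAc p.1 p.2.1 p.2.2 hp.1 hp.2.1 hp.2.2
    exact continuousOn_const.mul h

/-- Averaging over the real translates `y ↦ y + θ w` with the weight `χ(θ)`, and then moving the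
integration contour of `θ` into the complex domain. -/
theorem integral_eq_stripIntegral (hη : 0 < η) (hη1 : η ≤ 1)
    {R : (J → ℝ) → ℂ} {χ : ℝ → ℂ} (hχ : Continuous χ) (hχ1 : ∫ θ in Set.Ioc (-1 : ℝ) 1, χ θ = 1)
    (hfR : ∀ y θ, f y θ = χ θ * R (y + θ • w))
    (hf0 : ∀ y, ContDiff ℝ ((⊤ : ℕ∞) : WithTop ℕ∞) (f y))
    (hf1 : ∀ k y, iteratedDeriv k (f y) 1 = 0) (hf2 : ∀ k y, iteratedDeriv k (f y) (-1) = 0)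
    (hfc : ∀ k, Continuous fun p : (J → ℝ) × ℝ => iteratedDeriv k (f p.1) p.2)
    (hf : ∀ k ≤ M + 1, ∀ y θ, |θ| ≤ 1 → ‖iteratedDeriv k (f y) θ‖ ≤ C₁ / weight y ^ (M + 1))
    {A : (J → ℂ) → ℂ} (hAm : Measurable A)
    (hA : ∀ y θ s, |θ| ≤ 1 → 0 < s → s ≤ η →
      ‖A (shiftPoint w y θ s)‖ ≤ C₂ * (weight y / s) ^ M)
    (hAd : ∀ (y : J → ℝ) (z : ℂ), |z.re| ≤ 1 → 0 ≤ z.im → z.im ≤ η →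
      DifferentiableAt ℂ (fun z : ℂ => A (fun j => (y j : ℂ) + z * w j)) z)
    (hRm : Measurable R) (hi : Integrable fun y : J → ℝ => R y * A (fun j => (y j : ℂ))) :
    ∫ y : J → ℝ, R y * A (fun j => (y j : ℂ)) = stripIntegral M η w f A := by
  set ν := volume.restrict (Set.Ioc (-1 : ℝ) 1) with hν
  set G : (J → ℝ) → ℂ := fun y => R y * A (fun j => (y j : ℂ)) with hG
  have hGm : Measurable G := hRm.mul (hAm.comp (by fun_prop))
  obtain ⟨Cχ, hCχ⟩ : ∃ C, ∀ θ ∈ Set.Icc (-1 : ℝ) 1, ‖χ θ‖ ≤ C :=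
    isCompact_Icc.exists_bound_of_continuousOn hχ.continuousOn
  have hχb : ∀ᵐ θ ∂ν, ‖χ θ‖ ≤ Cχ :=
    (ae_restrict_iff' measurableSet_Ioc).2 (Eventually.of_forall fun θ hθ =>
      hCχ θ (Set.Ioc_subset_Icc_self hθ))
  have hprod : Integrable (fun p : (J → ℝ) × ℝ => χ p.2 * G (p.1 + p.2 • w))
      ((volume : Measure (J → ℝ)).prod ν) := by
    have hm : AEStronglyMeasurable (fun p : (J → ℝ) × ℝ => χ p.2 * G (p.1 + p.2 • w))
        ((volume : Measure (J → ℝ)).prod ν) := by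
      refine Measurable.aestronglyMeasurable ?_
      exact (hχ.measurable.comp measurable_snd).mul (hGm.comp (by fun_prop))
    refine (integrable_prod_iff' hm).2 ⟨?_, ?_⟩
    · refine Eventually.of_forall fun θ => ?_
      have hiG : Integrable G := hi
      exact (hiG.comp_add_right (θ • w)).const_mul (χ θ)
    · have e : (fun θ => ∫ y : J → ℝ, ‖χ θ * G (y + θ • w)‖) = fun θ => ‖χ θ‖ * ∫ y, ‖G y‖ := by
        funext θ
        simp only [norm_mul]
        rw [integral_const_mul, integral_add_right_eq_self (μ := volume) (fun y => ‖G y‖) (θ • w)]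
      rw [e]
      refine Integrable.mul_const (Integrable.mono' (integrable_const Cχ)
        hχ.norm.aestronglyMeasurable ?_) _
      simpa using hχb
  -- translation invariance of the Lebesgue measure
  have step1 : ∫ y, G y = ∫ y : J → ℝ, ∫ θ, χ θ * G (y + θ • w) ∂ν := by
    rw [integral_integral_swap hprod]
    have : ∀ θ, ∫ y : J → ℝ, χ θ * G (y + θ • w) = χ θ * ∫ y, G y := fun θ => by
      rw [integral_const_mul, integral_add_right_eq_self (μ := volume) G (θ • w)]
    simp only [this]
    rw [integral_mul_const, hχ1, one_mul]
  rw [step1, stripIntegral, integral_prod _ (integrable_stripIntegrand hη hη1 hfc hf hAm hA)]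
  refine integral_congr_ae ?_
  have hint := (integrable_stripIntegrand (w := w) hη hη1 hfc hf hAm hA).prod_right_ae
  filter_upwards [hint] with y hy
  rw [stripMeasure, integral_prod _ hy]
  have h1D := integral_mul_eq_integral_stripKernel M hη (fun k => iteratedDeriv k (f y))
    (fun k θ => by
      have := ((hf0 y).differentiable_iteratedDeriv k (by exact_mod_cast WithTop.coe_lt_top _)).differentiableAt (x := θ)
      rw [iteratedDeriv_succ]
      exact this.hasDerivAt)
    (fun k => hf1 k y) (fun k => hf2 k y) (fun z => A (fun j => (y j : ℂ) + z * w j))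
    (fun z h1 h2 h3 => hAd y z h1 h2 h3)
  rw [intervalIntegral.integral_of_le (by norm_num), intervalIntegral.integral_of_le (by norm_num)] at h1D
  calc _ = ∫ θ, iteratedDeriv 0 (f y) θ * A (fun j => (y j : ℂ) + θ * w j) ∂ν := by
        refine integral_congr_ae (Eventually.of_forall fun θ => ?_)
        simp only [hG, iteratedDeriv_zero, hfR, Pi.add_apply, Pi.smul_apply, smul_eq_mul]
        push_cast
        ring
    _ = _ := by
        rw [h1D]
        refine integral_congr_ae (Eventually.of_forall fun θ => ?_)
        simp only [intervalIntegral.integral_of_le hη.le]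
        rfl

end boundary

/-! ### Smearing factors -/

/-- The linear map `P ↦ (-P₀ / 2π, P₁ / 2π)`, which turns the Minkowski form into the Euclidean scalar
product in the normalisation of Mathlib's Fourier transform. -/
def momentumEquiv : (ℝ × ℝ) ≃L[ℝ] WithLp 2 (ℝ × ℝ) :=
  ((ContinuousLinearEquiv.smulLeft (Units.mk0 (-(2 * Real.pi)⁻¹) (by simp [Real.pi_ne_zero]))).prodCongr
    (ContinuousLinearEquiv.smulLeft (Units.mk0 ((2 * Real.pi)⁻¹) (by simp [Real.pi_ne_zero])))).trans
  (WithLp.prodContinuousLinearEquiv 2 ℝ ℝ ℝ).symm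

/-- The Fourier transform `P ↦ ∫ d²x exp(i P · x) g(x)` with respect to the Minkowski form, as a
Schwartz function. -/
def momentumTransform (g : 𝓢(ℝ × ℝ, ℂ)) : 𝓢(ℝ × ℝ, ℂ) :=
  SchwartzMap.compCLMOfContinuousLinearEquiv ℂ momentumEquiv
    (FourierTransform.fourier
      (SchwartzMap.compCLMOfContinuousLinearEquiv ℂ (WithLp.prodContinuousLinearEquiv 2 ℝ ℝ ℝ) g))

lemma momentumTransform_apply (g : 𝓢(ℝ × ℝ, ℂ)) (P : ℝ × ℝ) :
    momentumTransform g P =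
      ∫ x : ℝ × ℝ, Complex.exp (Complex.I * ((minkowski P x : ℝ) : ℂ)) * g x := by
  rw [momentumTransform, SchwartzMap.compCLMOfContinuousLinearEquiv_apply, Function.comp_apply,
    SchwartzMap.fourier_coe, Real.fourier_eq',
    ← (WithLp.volume_preserving_ofLp ℝ ℝ).integral_comp
      (WithLp.prodContinuousLinearEquiv 2 ℝ ℝ ℝ).toHomeomorph.measurableEmbedding]
  refine integral_congr_ae (Eventually.of_forall fun v => ?_)
  simp only [SchwartzMap.compCLMOfContinuousLinearEquiv_apply, Function.comp_apply, smul_eq_mul]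
  congr 2
  rw [mul_comm]
  congr 2
  rw [WithLp.prod_inner_apply]
  simp [momentumEquiv, minkowski, ContinuousLinearEquiv.smulLeft, Units.smul_def]
  have := Real.pi_ne_zero
  field_simp
  ring_nf

namespace Model
variable (Q : Model)

lemma hasDerivAt_momentum (t : ℝ) : HasDerivAt Q.momentum (Q.momentum t).swap t :=
  ((Real.hasDerivAt_cosh t).const_mul Q.mass).prodMk ((Real.hasDerivAt_sinh t).const_mul Q.mass)

lemma contDiff_momentum {n : WithTop ℕ∞} : ContDiff ℝ n Q.momentum :=
  (contDiff_const.mul Real.contDiff_cosh).prodMk (contDiff_const.mul Real.contDiff_sinh)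

lemma norm_momentum_le (t : ℝ) : ‖Q.momentum t‖ ≤ Q.mass * Real.cosh t := by
  have h : |Real.sinh t| ≤ Real.cosh t := by
    rw [Real.abs_sinh, ← Real.cosh_abs]; exact (Real.sinh_lt_cosh _).le
  rw [momentum, Prod.norm_def]
  simp only [norm_mul, Real.norm_eq_abs, abs_of_pos Q.mass_pos, abs_of_pos (Real.cosh_pos t)]
  exact max_le le_rfl (mul_le_mul_of_nonneg_left h Q.mass_pos.le)

lemma norm_iteratedDeriv_momentum_le (n : ℕ) (a w θ : ℝ) :
    ‖iteratedDeriv n (fun θ => Q.momentum (a + θ * w)) θ‖ ≤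
      |w| ^ n * (Q.mass * Real.cosh (a + θ * w)) := by
  have hd : ∀ t : ℝ, HasDerivAt (fun t => (Q.momentum t).swap) (Q.momentum t) t := fun t =>
    ((Real.hasDerivAt_sinh t).const_mul Q.mass).prodMk ((Real.hasDerivAt_cosh t).const_mul Q.mass)
  have hl : ∀ θ : ℝ, HasDerivAt (fun θ => a + θ * w) w θ := fun θ => by
    simpa using ((hasDerivAt_id θ).mul_const w).const_add a
  have h1 : ∀ θ : ℝ, HasDerivAt (fun θ => Q.momentum (a + θ * w)) (w • (Q.momentum (a + θ * w)).swap) θ :=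
    fun θ => HasDerivAt.scomp (g₁ := Q.momentum) θ (Q.hasDerivAt_momentum (a + θ * w)) (hl θ)
  have h2 : ∀ θ : ℝ, HasDerivAt (fun θ => (Q.momentum (a + θ * w)).swap) (w • Q.momentum (a + θ * w)) θ :=
    fun θ => HasDerivAt.scomp (g₁ := fun t => (Q.momentum t).swap) θ (hd (a + θ * w)) (hl θ)
  have key : (iteratedDeriv n (fun θ => Q.momentum (a + θ * w)) =
      fun θ => w ^ n • Q.momentum (a + θ * w)) ∨
      (iteratedDeriv n (fun θ => Q.momentum (a + θ * w)) =
      fun θ => w ^ n • (Q.momentum (a + θ * w)).swap) := by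
    induction n with
    | zero => left; simp
    | succ n ih =>
      rcases ih with ih | ih
      · right
        rw [iteratedDeriv_succ, ih]
        funext θ
        rw [((h1 θ).fun_const_smul (w ^ n)).deriv, smul_smul, pow_succ]
      · left
        rw [iteratedDeriv_succ, ih]
        funext θ
        rw [((h2 θ).fun_const_smul (w ^ n)).deriv, smul_smul, pow_succ]
  have hsw : ∀ v : ℝ × ℝ, ‖v.swap‖ = ‖v‖ := fun v => by
    rw [Prod.norm_def, Prod.norm_def, max_comm]; rfl
  rcases key with key | key <;> rw [key] <;>
    simp only [norm_smul, norm_pow, Real.norm_eq_abs, hsw] <;> gcongr <;> exact Q.norm_momentum_le _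

end Model

lemma cosh_add_le (a b : ℝ) : Real.cosh (a + b) ≤ Real.exp |b| * Real.cosh a := by
  rw [Real.cosh_add]
  have h1 : Real.sinh a * Real.sinh b ≤ Real.cosh a * Real.sinh |b| := by
    have : |Real.sinh a * Real.sinh b| ≤ Real.cosh a * Real.sinh |b| := by
      rw [abs_mul, Real.abs_sinh b, Real.abs_sinh a, ← Real.cosh_abs a]
      exact mul_le_mul_of_nonneg_right (Real.sinh_lt_cosh _).le
        (Real.sinh_nonneg_iff.2 (abs_nonneg b))
    exact (le_abs_self _).trans this
  have h2 := Real.cosh_add_sinh |b|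
  rw [Real.cosh_abs] at h2
  rw [← h2]; linarith

/-- Bound on the derivatives of a composition with a Schwartz function. -/
lemma exists_norm_iteratedDeriv_schwartz_comp_le (H : 𝓢(ℝ × ℝ, ℂ)) (n N : ℕ) :
    ∃ C, 0 ≤ C ∧ ∀ (P : ℝ → ℝ × ℝ) (θ D : ℝ), ContDiff ℝ ((⊤ : ℕ∞) : WithTop ℕ∞) P →
      (∀ i, 1 ≤ i → ‖iteratedDeriv i P θ‖ ≤ D ^ i) →
      ‖iteratedDeriv n (fun θ => H (P θ)) θ‖ ≤ C * D ^ n * ((1 + ‖P θ‖) ^ N)⁻¹ := by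
  obtain ⟨C, hC⟩ : ∃ C, ∀ i ≤ n, ∀ x, (1 + ‖x‖) ^ N * ‖iteratedFDeriv ℝ i H x‖ ≤ C :=
    ⟨_, fun i hi x => SchwartzMap.one_add_le_sup_seminorm_apply (𝕜 := ℝ) (m := (N, n))
      (k := N) (n := i) le_rfl hi H x⟩
  have hC0 : 0 ≤ C := le_trans (by positivity) (hC 0 (Nat.zero_le _) 0)
  refine ⟨n.factorial * C, by positivity, fun P θ D hP hD => ?_⟩
  have hpos : 0 < (1 + ‖P θ‖) ^ N := by positivity
  have := norm_iteratedFDeriv_comp_le (n := n) (N := ((⊤ : ℕ∞) : WithTop ℕ∞)) (H.smooth ⊤) hP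
    (by exact_mod_cast le_top) θ (C := C * ((1 + ‖P θ‖) ^ N)⁻¹) (D := D)
    (fun i hi => by
      rw [← div_eq_mul_inv, le_div_iff₀ hpos, mul_comm]
      exact hC i hi _)
    (fun i hi _ => by
      rw [norm_iteratedFDeriv_eq_norm_iteratedDeriv]
      exact hD i hi)
  rw [norm_iteratedFDeriv_eq_norm_iteratedDeriv] at this
  refine this.trans (le_of_eq ?_)
  ring

section flow
variable {Λ : Type*} [Fintype Λ] (Q : Model)

/-- The total momentum of the rapidities `γ`, counted with the coefficients `c`. -/
def Model.flow (c : Λ → ℝ) (γ : Λ → ℝ) : ℝ × ℝ := ∑ i, c i • Q.momentum (γ i)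

lemma contDiff_flow {n : WithTop ℕ∞} (c : Λ → ℝ) : ContDiff ℝ n (Q.flow c) := by
  unfold Model.flow
  refine ContDiff.sum fun i _ => ?_
  have h : ContDiff ℝ n fun x : Λ → ℝ => Q.momentum (x i) :=
    Q.contDiff_momentum.comp (contDiff_apply ℝ ℝ i)
  exact h.const_smul (c i)

lemma exists_norm_iteratedDeriv_flow_le (c w : Λ → ℝ) : ∃ D : ℝ, 0 ≤ D ∧
    ∀ (γ : Λ → ℝ) (θ : ℝ), |θ| ≤ 1 → ∀ i, 1 ≤ i →
      ‖iteratedDeriv i (fun θ : ℝ => Q.flow c (γ + θ • w)) θ‖ ≤ (D * weight γ) ^ i := by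
  have hm := Q.mass_pos
  set V : ℝ := 1 + ∑ j, |w j| with hV
  have hw : ∀ j, |w j| ≤ V := fun j =>
    (Finset.single_le_sum (f := fun j => |w j|) (fun _ _ => abs_nonneg _) (Finset.mem_univ j)).trans
      (by rw [hV]; linarith)
  have hV1 : 1 ≤ V := by
    have : 0 ≤ ∑ j, |w j| := Finset.sum_nonneg fun _ _ => abs_nonneg _
    rw [hV]; linarith
  set A : ℝ := 1 + ∑ j, |c j| * (Q.mass * Real.exp V) with hA
  have hA1 : 1 ≤ A := by
    have : 0 ≤ ∑ j, |c j| * (Q.mass * Real.exp V) := Finset.sum_nonneg fun _ _ => by positivity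
    rw [hA]; linarith
  refine ⟨A * V, by positivity, fun γ θ hθ i hi => ?_⟩
  have hcd : ∀ j, ContDiff ℝ ((i : ℕ) : WithTop ℕ∞) (fun θ : ℝ => c j • Q.momentum (γ j + θ * w j)) := fun j => by
    have h : ContDiff ℝ ((i : ℕ) : WithTop ℕ∞) fun θ : ℝ => Q.momentum (γ j + θ * w j) :=
      Q.contDiff_momentum.comp (by fun_prop)
    exact h.const_smul (c j)
  have e : (fun θ : ℝ => Q.flow c (γ + θ • w)) =
      fun θ : ℝ => ∑ j, c j • Q.momentum (γ j + θ * w j) := by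
    funext θ; simp [Model.flow]
  rw [e, iteratedDeriv_fun_sum fun j _ => (hcd j).contDiffAt]
  have hW := one_le_weight γ
  calc _ ≤ ∑ j, |c j| * (V ^ i * (Q.mass * (Real.exp V * weight γ))) := by
        refine norm_sum_le_of_le _ fun j _ => ?_
        rw [iteratedDeriv_fun_const_smul_field, norm_smul, Real.norm_eq_abs]
        refine mul_le_mul_of_nonneg_left ?_ (abs_nonneg _)
        refine (Q.norm_iteratedDeriv_momentum_le i (γ j) (w j) θ).trans ?_
        have h1 : Real.cosh (γ j + θ * w j) ≤ Real.exp V * weight γ := by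
          refine (cosh_add_le _ _).trans ?_
          have : |θ * w j| ≤ V := by
            rw [abs_mul]
            calc _ ≤ 1 * |w j| := by gcongr
              _ ≤ V := by rw [one_mul]; exact hw j
          have := cosh_le_weight γ j
          gcongr
        have := hw j
        gcongr
    _ = V ^ i * weight γ * ∑ j, |c j| * (Q.mass * Real.exp V) := by
        rw [Finset.mul_sum]
        exact Finset.sum_congr rfl fun j _ => by ring
    _ ≤ V ^ i * weight γ ^ i * A ^ i := by
        have h1 : weight γ ≤ weight γ ^ i := le_self_pow₀ hW (by omega)
        have h2 : A ≤ A ^ i := le_self_pow₀ hA1 (by omega)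
        have h3 : ∑ j, |c j| * (Q.mass * Real.exp V) ≤ A := by rw [hA]; linarith
        have h4 : 0 ≤ ∑ j, |c j| * (Q.mass * Real.exp V) := Finset.sum_nonneg fun _ _ => by positivity
        gcongr
        exact h3.trans h2
    _ = _ := by rw [mul_pow, mul_pow]; ring

/-- The smearing factor of a product of local operators: the operator `q` is smeared with `g q` and
absorbs the momentum `Q.flow (c q) γ`. -/
def Model.smearProd {ι : Type*} (s : Finset ι) (g : ι → 𝓢(ℝ × ℝ, ℂ)) (c : ι → Λ → ℝ) (γ : Λ → ℝ) : ℂ :=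
  ∏ q ∈ s, momentumTransform (g q) (Q.flow (c q) γ)

lemma contDiff_smearProd {ι : Type*} (s : Finset ι) (g : ι → 𝓢(ℝ × ℝ, ℂ)) (c : ι → Λ → ℝ) :
    ContDiff ℝ ((⊤ : ℕ∞) : WithTop ℕ∞) (Q.smearProd s g c) := by
  unfold Model.smearProd
  exact contDiff_prod fun q _ => ((momentumTransform (g q)).smooth ⊤).comp (contDiff_flow Q (c q))

/-- The class of functions whose `k`-th derivative is bounded by `C W^k b`, stable under products. -/
def DerivBound {T : Type*} (W : T → ℝ) (b : T → ℝ → ℝ) (f : T → ℝ → ℂ) : Prop :=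
  (∀ t, ContDiff ℝ ((⊤ : ℕ∞) : WithTop ℕ∞) (f t)) ∧
    ∀ k : ℕ, ∃ C, 0 ≤ C ∧ ∀ t θ, |θ| ≤ 1 → ‖iteratedDeriv k (f t) θ‖ ≤ C * W t ^ k * b t θ

lemma DerivBound.mul {T : Type*} {W : T → ℝ} {b b' : T → ℝ → ℝ} {f f' : T → ℝ → ℂ}
    (h : DerivBound W b f) (h' : DerivBound W b' f') (hW : ∀ t, 0 ≤ W t) (hb : ∀ t θ, 0 ≤ b t θ) :
    DerivBound W (fun t θ => b t θ * b' t θ) (fun t => f t * f' t) := by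
  refine ⟨fun t => (h.1 t).mul (h'.1 t), fun k => ?_⟩
  choose C hC0 hC using h.2
  choose C' hC0' hC' using h'.2
  refine ⟨∑ i ∈ Finset.range (k + 1), (k.choose i : ℝ) * C i * C' (k - i),
    Finset.sum_nonneg fun i _ => by have := hC0 i; have := hC0' (k - i); positivity, fun t θ hθ => ?_⟩
  rw [iteratedDeriv_mul ((h.1 t).contDiffAt.of_le (by exact_mod_cast le_top))
    ((h'.1 t).contDiffAt.of_le (by exact_mod_cast le_top)), Finset.sum_mul, Finset.sum_mul]
  refine norm_sum_le_of_le _ fun i hi => ?_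
  rw [norm_mul, norm_mul, Complex.norm_natCast]
  have hik : i + (k - i) = k := by have := Finset.mem_range.1 hi; omega
  have h0 := hC0 i
  have h1 := hW t
  have h2 := hb t θ
  calc _ ≤ (k.choose i : ℝ) * (C i * W t ^ i * b t θ) * (C' (k - i) * W t ^ (k - i) * b' t θ) :=
        mul_le_mul (mul_le_mul_of_nonneg_left (hC i t θ hθ) (by positivity)) (hC' _ t θ hθ)
          (norm_nonneg _) (by positivity)
    _ = (k.choose i : ℝ) * C i * C' (k - i) * W t ^ (i + (k - i)) * (b t θ * b' t θ) := by
        rw [pow_add]; ring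
    _ = _ := by rw [hik]

lemma derivBound_smearProd {ι : Type*} (s : Finset ι) (g : ι → 𝓢(ℝ × ℝ, ℂ)) (c : ι → Λ → ℝ)
    (w : Λ → ℝ) (N : ℕ) :
    DerivBound (fun γ : Λ → ℝ => weight γ)
      (fun γ θ => ∏ q ∈ s, ((1 + ‖Q.flow (c q) (γ + θ • w)‖) ^ N)⁻¹)
      (fun γ θ => Q.smearProd s g c (γ + θ • w)) := by
  classical
  induction s using Finset.induction_on with
  | empty =>
    refine ⟨fun t => ?_, fun k => ⟨1, zero_le_one, fun t θ _ => ?_⟩⟩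
    · simpa [Model.smearProd] using contDiff_const
    · have hW := one_le_weight t
      simp only [Model.smearProd, Finset.prod_empty, mul_one, one_mul]
      rw [iteratedDeriv_const]
      split_ifs with h
      · simp [h]
      · simp only [norm_zero]; positivity
  | insert q s hq ih =>
    have hl : ∀ γ : Λ → ℝ, ContDiff ℝ ((⊤ : ℕ∞) : WithTop ℕ∞) fun θ : ℝ => γ + θ • w := fun γ => by fun_prop
    have h1 : DerivBound (fun γ : Λ → ℝ => weight γ)
        (fun γ θ => ((1 + ‖Q.flow (c q) (γ + θ • w)‖) ^ N)⁻¹)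
        (fun γ θ => momentumTransform (g q) (Q.flow (c q) (γ + θ • w))) := by
      refine ⟨fun γ => ((momentumTransform (g q)).smooth ⊤).comp
        ((contDiff_flow Q (c q)).comp (hl γ)), fun k => ?_⟩
      obtain ⟨D, hD0, hD⟩ := exists_norm_iteratedDeriv_flow_le Q (c q) w
      obtain ⟨C, hC0, hC⟩ := exists_norm_iteratedDeriv_schwartz_comp_le (momentumTransform (g q)) k N
      refine ⟨C * D ^ k, by positivity, fun γ θ hθ => ?_⟩
      have := hC (fun θ => Q.flow (c q) (γ + θ • w)) θ (D * weight γ)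
        ((contDiff_flow Q (c q)).comp (hl γ)) (hD γ θ hθ)
      rwa [mul_pow, ← mul_assoc] at this
    have := h1.mul ih (fun γ => (weight_pos γ).le) (fun γ θ => by positivity)
    simp only [Finset.prod_insert hq]
    convert! this using 2
    · rename_i γ
      funext θ
      simp only [Model.smearProd, Finset.prod_insert hq, Pi.mul_apply]

lemma Continuous.iteratedDeriv_param {E : Type*} [NormedAddCommGroup E] [NormedSpace ℝ E]
    {F : E × ℝ → ℂ} (hF : ContDiff ℝ ((⊤ : ℕ∞) : WithTop ℕ∞) F) (k : ℕ) :
    Continuous fun p : E × ℝ => iteratedDeriv k (fun θ => F (p.1, θ)) p.2 := by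
  suffices h : ContDiff ℝ ((⊤ : ℕ∞) : WithTop ℕ∞)
      fun p : E × ℝ => iteratedDeriv k (fun θ => F (p.1, θ)) p.2 from h.continuous
  induction k with
  | zero => simpa using hF
  | succ k ih =>
    set G : E × ℝ → ℂ := fun p => iteratedDeriv k (fun θ => F (p.1, θ)) p.2 with hG
    have e : (fun p : E × ℝ => iteratedDeriv (k + 1) (fun θ => F (p.1, θ)) p.2) =
        fun p => fderiv ℝ G p (0, 1) := by
      funext p
      rw [iteratedDeriv_succ]
      have h1 : HasFDerivAt G (fderiv ℝ G (p.1, p.2)) (p.1, p.2) :=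
        (ih.differentiable (by simp) (p.1, p.2)).hasFDerivAt
      have h2 : HasDerivAt (fun θ : ℝ => (p.1, θ)) ((0 : E), (1 : ℝ)) p.2 :=
        (hasDerivAt_const _ _).prodMk (hasDerivAt_id _)
      exact (h1.comp_hasDerivAt p.2 h2).deriv
    rw [e]
    exact (ih.fderiv_right (m := ((⊤ : ℕ∞) : WithTop ℕ∞)) (by simp)).clm_apply contDiff_const

end flow

/-! ### Polynomially bounded functions -/

/-- `‖f t‖ ≤ C W(t)^M` on `D`, for some `C` and `M`. -/
def PolyBound {T : Type*} (D : Set T) (W : T → ℝ) (f : T → ℂ) : Prop :=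
  ∃ (C : ℝ) (M : ℕ), 0 ≤ C ∧ ∀ t ∈ D, ‖f t‖ ≤ C * W t ^ M

section PolyBound
variable {T : Type*} {D : Set T} {W : T → ℝ}

lemma polyBound_const (c : ℂ) : PolyBound D W fun _ => c :=
  ⟨‖c‖, 0, norm_nonneg _, fun t _ => by simp⟩

lemma PolyBound.mul {f g : T → ℂ} (hf : PolyBound D W f) (hg : PolyBound D W g) :
    PolyBound D W fun t => f t * g t := by
  obtain ⟨C, M, h0, h⟩ := hf
  obtain ⟨C', M', h0', h'⟩ := hg
  refine ⟨C * C', M + M', by positivity, fun t ht => ?_⟩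
  rw [norm_mul]
  calc _ ≤ (C * W t ^ M) * (C' * W t ^ M') :=
        mul_le_mul (h t ht) (h' t ht) (norm_nonneg _) ((norm_nonneg _).trans (h t ht))
    _ = _ := by rw [pow_add]; ring

lemma PolyBound.add (hW : ∀ t ∈ D, 1 ≤ W t) {f g : T → ℂ} (hf : PolyBound D W f)
    (hg : PolyBound D W g) : PolyBound D W fun t => f t + g t := by
  obtain ⟨C, M, h0, h⟩ := hf
  obtain ⟨C', M', h0', h'⟩ := hg
  refine ⟨C + C', M + M', by positivity, fun t ht => (norm_add_le _ _).trans ?_⟩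
  have h1 : W t ^ M ≤ W t ^ (M + M') := pow_le_pow_right₀ (hW t ht) (by omega)
  have h2 : W t ^ M' ≤ W t ^ (M + M') := pow_le_pow_right₀ (hW t ht) (by omega)
  calc _ ≤ C * W t ^ M + C' * W t ^ M' := add_le_add (h t ht) (h' t ht)
    _ ≤ C * W t ^ (M + M') + C' * W t ^ (M + M') := by gcongr
    _ = _ := by ring

lemma PolyBound.prod {ι : Type*} (s : Finset ι) {f : ι → T → ℂ} (hf : ∀ i ∈ s, PolyBound D W (f i)) :
    PolyBound D W fun t => ∏ i ∈ s, f i t := by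
  classical
  induction s using Finset.induction_on with
  | empty => simpa using polyBound_const 1
  | insert i s hi ih =>
    simp only [Finset.prod_insert hi]
    exact (hf i (by simp)).mul (ih fun j hj => hf j (by simp [hj]))

lemma PolyBound.sum (hW : ∀ t ∈ D, 1 ≤ W t) {ι : Type*} (s : Finset ι) {f : ι → T → ℂ}
    (hf : ∀ i ∈ s, PolyBound D W (f i)) : PolyBound D W fun t => ∑ i ∈ s, f i t := by
  classical
  induction s using Finset.induction_on with
  | empty => simpa using polyBound_const 0
  | insert i s hi ih =>
    simp only [Finset.sum_insert hi]
    exact (hf i (by simp)).add hW (ih fun j hj => hf j (by simp [hj]))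

end PolyBound

lemma cosh_sub_le (a b : ℝ) : Real.cosh (a - b) ≤ 2 * Real.cosh a * Real.cosh b := by
  have h := Real.cosh_add a b
  have h2 := Real.cosh_pos (a + b)
  rw [Real.cosh_sub]; linarith

lemma differentiableAt_finsetProd {E ι : Type*} [NormedAddCommGroup E] [NormedSpace ℂ E] {s : Finset ι}
    {f : ι → E → ℂ} {x : E} (h : ∀ i ∈ s, DifferentiableAt ℂ (f i) x) :
    DifferentiableAt ℂ (fun x => ∏ i ∈ s, f i x) x := by
  classical
  induction s using Finset.induction_on with
  | empty => simp
  | insert i s hi ih =>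
    simp only [Finset.prod_insert hi]
    exact (h i (by simp)).mul (ih fun j hj => h j (by simp [hj]))

/-! ### Regularised form factors and amplitudes -/

open scoped Classical in
/-- The form factor `∏_{x before y} F(β_x - β_y) · K[p](β)` of a family of rapidities indexed by a
finite type, in the order given by the relation `bef`, with each factor `F` multiplied into the
corresponding factor of the `K`-transform, whose pole on the diagonal it cancels. -/
def ffReg {Q : Model} (O : LocalOperator Q) {T : Type*} [Fintype T] (bef : T → T → Prop)
    (β : T → ℂ) : ℂ :=
  ∑ l : T → Fin 2, (-1) ^ (∑ x, (l x : ℕ)) *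
    (∏ x, ∏ y, if bef x y then Q.twoBody (l x) (l y) (β x - β y) else 1) *
    O.p (Fintype.card T) (β ∘ (Fintype.equivFin T).symm) (l ∘ (Fintype.equivFin T).symm)

section ffReg
variable {Q : Model} (O : LocalOperator Q) {T : Type*} [Fintype T] (bef : T → T → Prop)

lemma differentiableAt_ffReg {β : T → ℂ}
    (h : ∀ x y, bef x y → -(2 * Q.reg) < (β x - β y).im ∧ (β x - β y).im < Real.pi) :
    DifferentiableAt ℂ (ffReg O bef) β := by
  classical
  unfold ffReg
  refine DifferentiableAt.fun_sum fun l _ => ?_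
  refine DifferentiableAt.mul (DifferentiableAt.const_mul ?_ _) ?_
  · refine differentiableAt_finsetProd fun x _ => ?_
    refine differentiableAt_finsetProd fun y _ => ?_
    by_cases hxy : bef x y
    · simp only [if_pos hxy]
      exact DifferentiableAt.comp (g := Q.twoBody (l x) (l y)) (f := fun β : T → ℂ => β x - β y) β
        (Q.differentiableAt_twoBody (l x) (l y) (h x y hxy).1 (h x y hxy).2) (by fun_prop)
    · simp only [if_neg hxy]; fun_prop
  · have := O.holomorphic (Fintype.card T) (l ∘ (Fintype.equivFin T).symm)
    have h2 : Differentiable ℂ fun β : T → ℂ => β ∘ (Fintype.equivFin T).symm :=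
      differentiable_pi.2 fun i => by simp only [Function.comp_apply]; fun_prop
    exact (this.comp h2) β

lemma measurable_ffReg : Measurable (ffReg O bef) := by
  classical
  unfold ffReg
  refine Finset.measurable_fun_sum _ fun l _ => ?_
  refine Measurable.mul (Measurable.const_mul ?_ _) ?_
  · refine Finset.measurable_fun_prod _ fun x _ => Finset.measurable_fun_prod _ fun y _ => ?_
    have := Q.measurable_twoBody (l x) (l y)
    split_ifs <;> fun_prop
  · have := (O.holomorphic (Fintype.card T) (l ∘ (Fintype.equivFin T).symm)).continuous.measurable
    exact this.comp (measurable_pi_lambda _ fun i => measurable_pi_apply _)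

end ffReg

section amp
variable {Q : Model} {Λ : Type*} [Fintype Λ] (hi lo : Λ → ℕ)

/-- The labels of the particles absorbed or emitted by the operator `q`. -/
abbrev Leg (q : ℕ) := {i : Λ // hi i = q ∨ lo i = q}

open scoped Classical in
/-- The order of the particles at the operator `q`: first the absorbed ones, by decreasing `lo`, then
the emitted ones, by decreasing `hi`. The ties between particles with the same `hi` and `lo` are
resolved by an arbitrary numbering, in opposite directions at the two operators. -/
def before (q : ℕ) (i j : Λ) : Prop :=
  (hi i = q ∧ lo j = q) ∨
  (hi i = q ∧ hi j = q ∧ (lo j < lo i ∨ lo i = lo j ∧ Fintype.equivFin Λ j < Fintype.equivFin Λ i)) ∨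
  (lo i = q ∧ lo j = q ∧ (hi j < hi i ∨ hi i = hi j ∧ Fintype.equivFin Λ i < Fintype.equivFin Λ j))

open scoped Classical in
/-- The rapidities of the particles at the operator `q`, the absorbed ones being shifted by
`i(π - e)`. -/
def legRap (q : ℕ) (e : ℝ) (γ : Λ → ℂ) (i : Leg hi lo q) : ℂ :=
  γ i + if hi i = q then Complex.I * (Real.pi - e) else 0

/-- The form factor of the operator `q`. -/
def ffAt (O : LocalOperator Q) (q : ℕ) (e : ℝ) (γ : Λ → ℂ) : ℂ :=
  ffReg O (fun i j : Leg hi lo q => before hi lo q i j) (legRap hi lo q e γ)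

open scoped Classical in
/-- The scattering factors attributed to the operator `q`: the world lines which pass `q` and end
before those of the particles emitted by `q`. -/
def crossAt (Q : Model) (q : ℕ) (γ : Λ → ℂ) : ℂ :=
  ∏ i, ∏ j, if lo i = q ∧ lo j < q ∧ q < hi j ∧ hi j < hi i then Q.S (γ i - γ j) else 1

/-- The product of the form factors and scattering factors of the operators `q` with `p ≤ q < k`. -/
def ampA (O : ℕ → LocalOperator Q) (p k : ℕ) (ε : ℕ → ℝ) (γ : Λ → ℂ) : ℂ :=
  ∏ q ∈ Finset.Ico p k, ffAt hi lo (O q) q (ε q) γ * crossAt hi lo Q q γ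

/-- The parameters `(ε, γ, τ)` at which the amplitude is regular, with distance `τ` from its
kinematic poles. -/
def ampDomain (Q : Model) (p k : ℕ) : Set ((ℕ → ℝ) × (Λ → ℂ) × ℝ) :=
  {t | (∀ q, |t.1 q| ≤ 1) ∧ 0 < t.2.2 ∧ t.2.2 ≤ 1 ∧ (∀ i j, |(t.2.1 i).im - (t.2.1 j).im| ≤ Q.reg) ∧
    ∀ i j, lo j = hi i → p ≤ hi i → hi i < k → (t.2.1 i).im - (t.2.1 j).im - t.1 (hi i) ≤ -t.2.2}

variable {hi lo}

/-- At the parameters of the domain, the arguments of the two-body factors stay in the strip in which these are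
holomorphic, below the pole at `iπ`. -/
lemma im_legRap_sub (hlo : ∀ i, lo i < hi i) {p k : ℕ} {ε : ℕ → ℝ} {γ : Λ → ℂ} {τ : ℝ}
    (ht : (ε, γ, τ) ∈ ampDomain hi lo Q p k) {q : ℕ} (hpq : p ≤ q) (hqk : q < k)
    (i j : Leg hi lo q) (hij : before hi lo q i j) :
    -Q.reg ≤ (legRap hi lo q (ε q) γ i - legRap hi lo q (ε q) γ j).im ∧
      (legRap hi lo q (ε q) γ i - legRap hi lo q (ε q) γ j).im ≤ Real.pi - τ := by
  obtain ⟨h1, h2, h3, h4, h5⟩ := ht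
  simp only at h1 h2 h3 h4 h5
  have hp := Real.pi_gt_three
  have hr := Q.reg_le
  have hij' := abs_le.1 (h4 i j)
  have he := abs_le.1 (h1 q)
  obtain ⟨i, hi'⟩ := i
  obtain ⟨j, hj'⟩ := j
  simp only [legRap]
  simp only at hij hij'
  rcases hij with ⟨a, b⟩ | ⟨a, b, -⟩ | ⟨a, b, -⟩
  · have : hi j ≠ q := by have := hlo j; omega
    have h6 := h5 i j (by omega) (by omega) (by omega)
    rw [a] at h6
    simp [a, this]
    constructor <;> linarith
  · simp [a, b]
    constructor <;> linarith
  · have ha : hi i ≠ q := by have := hlo i; omega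
    have hb : hi j ≠ q := by have := hlo j; omega
    simp [ha, hb]
    constructor <;> linarith

lemma re_legRap {Λ : Type*} {hi lo : Λ → ℕ} (q : ℕ) (e : ℝ) (γ : Λ → ℂ) (i : Leg hi lo q) :
    (legRap hi lo q e γ i).re = (γ i).re := by
  unfold legRap
  split_ifs <;> simp

lemma one_le_weight_div {t : (ℕ → ℝ) × (Λ → ℂ) × ℝ} {p k : ℕ} (ht : t ∈ ampDomain hi lo Q p k) :
    1 ≤ weight (fun i => (t.2.1 i).re) / t.2.2 := by
  rw [le_div_iff₀ ht.2.1, one_mul]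
  exact ht.2.2.1.trans (one_le_weight _)

lemma polyBound_ffAt (hlo : ∀ i, lo i < hi i) (O : LocalOperator Q) {p k q : ℕ} (hpq : p ≤ q) (hqk : q < k) :
    PolyBound (ampDomain hi lo Q p k) (fun t => weight (fun i => (t.2.1 i).re) / t.2.2)
      (fun t => ffAt hi lo O q (t.1 q) t.2.1) := by
  classical
  have hW := fun (t : (ℕ → ℝ) × (Λ → ℂ) × ℝ) (ht : t ∈ ampDomain hi lo Q p k) => one_le_weight_div ht
  simp only [ffAt, ffReg]
  refine PolyBound.sum hW _ fun l _ => PolyBound.mul ((polyBound_const _).mul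
    (PolyBound.prod _ fun x _ => PolyBound.prod _ fun y _ => ?_)) ?_
  · by_cases hxy : before hi lo q x y
    · simp only [if_pos hxy]
      obtain ⟨C, hC1, hC⟩ := Q.norm_twoBody_le
      refine ⟨C * 2 ^ 4, 8, by positivity, fun t ht => ?_⟩
      obtain ⟨h1, h2⟩ := im_legRap_sub (ε := t.1) (γ := t.2.1) (τ := t.2.2) hlo ht hpq hqk x y hxy
      refine (hC (l x) (l y) _ t.2.2 ht.2.1 ht.2.2.1 h1 h2).trans ?_
      rw [Complex.sub_re, re_legRap, re_legRap]
      have hτ := ht.2.1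
      set W := weight (fun i => (t.2.1 i).re) with hWdef
      have hW0 : 0 < W := weight_pos _
      have hc : Real.cosh ((t.2.1 x).re - (t.2.1 y).re) ≤ 2 * W * W :=
        (cosh_sub_le _ _).trans (by
          have a := cosh_le_weight (fun i => (t.2.1 i).re) x
          have b := cosh_le_weight (fun i => (t.2.1 i).re) y
          have := Real.cosh_pos (t.2.1 x).re
          have := Real.cosh_pos (t.2.1 y).re
          rw [← hWdef] at a b
          gcongr)
      have hc0 := Real.cosh_pos ((t.2.1 x).re - (t.2.1 y).re)
      have hτ8 : t.2.2 ^ 8 ≤ t.2.2 := pow_le_of_le_one hτ.le ht.2.2.1 (by norm_num)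
      calc _ ≤ C / t.2.2 ^ 8 * (2 * W * W) ^ 4 := by gcongr
        _ = _ := by rw [div_pow]; ring
    · simp only [if_neg hxy]; exact polyBound_const 1
  · obtain ⟨C, hC⟩ := O.bounded (Fintype.card (Leg hi lo q))
    obtain ⟨n, hn⟩ := exists_nat_ge O.growth
    refine ⟨|C|, Fintype.card (Leg hi lo q) * n, abs_nonneg _, fun t ht => ?_⟩
    have hτ := ht.2.1
    have hτ1 := ht.2.2.1
    refine (hC _ _).trans ?_
    have h1 : ∏ a, Real.cosh ((legRap hi lo q (t.1 q) t.2.1 ∘ (Fintype.equivFin (Leg hi lo q)).symm) a).re ^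
        O.growth ≤ ∏ _a : Fin (Fintype.card (Leg hi lo q)),
          (weight (fun i => (t.2.1 i).re) / t.2.2) ^ n := by
      refine Finset.prod_le_prod (fun a _ => Real.rpow_nonneg (Real.cosh_pos _).le _) fun a _ => ?_
      have e : ((legRap hi lo q (t.1 q) t.2.1 ∘ (Fintype.equivFin (Leg hi lo q)).symm) a).re =
          (t.2.1 ((Fintype.equivFin (Leg hi lo q)).symm a)).re := re_legRap _ _ _ _
      rw [e]
      calc _ ≤ Real.cosh (t.2.1 ((Fintype.equivFin (Leg hi lo q)).symm a)).re ^ (n : ℝ) :=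
            Real.rpow_le_rpow_of_exponent_le (Real.one_le_cosh _) hn
        _ = Real.cosh (t.2.1 ((Fintype.equivFin (Leg hi lo q)).symm a)).re ^ n := Real.rpow_natCast _ _
        _ ≤ _ := by
          have a1 := cosh_le_weight (fun i => (t.2.1 i).re) ((Fintype.equivFin (Leg hi lo q)).symm a).1
          have a2 := weight_pos fun i => (t.2.1 i).re
          have a3 := Real.cosh_pos (t.2.1 ((Fintype.equivFin (Leg hi lo q)).symm a)).re
          refine pow_le_pow_left₀ a3.le (a1.trans ?_) _
          rw [le_div_iff₀ hτ]
          nlinarith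
    rw [Finset.prod_const, Finset.card_univ, Fintype.card_fin, ← pow_mul, mul_comm n] at h1
    refine (mul_le_mul_of_nonneg_right (le_abs_self C)
      (Finset.prod_nonneg fun a _ => Real.rpow_nonneg (Real.cosh_pos _).le _)).trans ?_
    exact mul_le_mul_of_nonneg_left h1 (abs_nonneg _)

lemma polyBound_crossAt {p k : ℕ} (q : ℕ) :
    PolyBound (ampDomain hi lo Q p k) (fun t => weight (fun i => (t.2.1 i).re) / t.2.2)
      (fun t => crossAt hi lo Q q t.2.1) := by
  classical
  simp only [crossAt]
  refine PolyBound.prod _ fun x _ => PolyBound.prod _ fun y _ => ?_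
  split_ifs
  · refine ⟨9, 0, by norm_num, fun t ht => ?_⟩
    rw [pow_zero, mul_one]
    refine Q.norm_S_le ?_
    rw [Complex.sub_im]
    have := ht.2.2.2.1 x y
    have := Q.reg_pos
    linarith
  · exact polyBound_const 1

/-- The amplitude is bounded by a power of the weight, divided by a power of the distance to the kinematic
poles. -/
lemma polyBound_ampA (hlo : ∀ i, lo i < hi i) (O : ℕ → LocalOperator Q) {p p' k k' : ℕ}
    (hp : p ≤ p') (hk : k' ≤ k) :
    PolyBound (ampDomain hi lo Q p k) (fun t => weight (fun i => (t.2.1 i).re) / t.2.2)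
      (fun t => ampA hi lo O p' k' t.1 t.2.1) := by
  refine PolyBound.prod _ fun q hq => ?_
  rw [Finset.mem_Ico] at hq
  exact (polyBound_ffAt hlo (O q) (by omega) (by omega)).mul (polyBound_crossAt q)

lemma measurable_ffAt (O : LocalOperator Q) (q : ℕ) (e : ℝ) : Measurable (ffAt hi lo O q e) := by
  refine (measurable_ffReg O _).comp (measurable_pi_lambda _ fun i => ?_)
  unfold legRap
  exact (measurable_pi_apply _).add_const _

lemma measurable_crossAt (q : ℕ) : Measurable (crossAt hi lo Q q) := by
  classical
  unfold crossAt
  refine Finset.measurable_fun_prod _ fun x _ => Finset.measurable_fun_prod _ fun y _ => ?_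
  have := Q.measurable_S
  split_ifs <;> fun_prop

lemma measurable_ampA (O : ℕ → LocalOperator Q) (p k : ℕ) (ε : ℕ → ℝ) :
    Measurable (ampA hi lo O p k ε) :=
  Finset.measurable_fun_prod _ fun q _ => (measurable_ffAt (O q) q (ε q)).mul (measurable_crossAt q)

lemma differentiableAt_crossAt {γ : Λ → ℂ} (h : ∀ i j, |(γ i).im - (γ j).im| ≤ Q.reg) (q : ℕ) :
    DifferentiableAt ℂ (crossAt hi lo Q q) γ := by
  classical
  unfold crossAt
  refine differentiableAt_finsetProd fun x _ => ?_
  refine differentiableAt_finsetProd fun y _ => ?_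
  split_ifs
  · have h1 : DifferentiableAt ℂ Q.S (γ x - γ y) := by
      refine Q.differentiableAt_S ?_
      rw [Complex.sub_im]
      have := h x y
      have := Q.reg_pos
      linarith
    exact DifferentiableAt.comp (g := Q.S) (f := fun γ : Λ → ℂ => γ x - γ y) γ h1 (by fun_prop)
  · fun_prop

/-- The amplitude is holomorphic in the rapidities as long as these avoid the kinematic poles. -/
lemma differentiableAt_ampA (hlo : ∀ i, lo i < hi i) (O : ℕ → LocalOperator Q) {p k : ℕ} {ε : ℕ → ℝ}
    {γ : Λ → ℂ} {τ : ℝ} (ht : (ε, γ, τ) ∈ ampDomain hi lo Q p k) :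
    DifferentiableAt ℂ (ampA hi lo O p k ε) γ := by
  unfold ampA
  refine differentiableAt_finsetProd fun q hq => ?_
  rw [Finset.mem_Ico] at hq
  refine DifferentiableAt.mul ?_ (differentiableAt_crossAt ht.2.2.2.1 q)
  have hr := Q.reg_pos
  have hτ : 0 < τ := ht.2.1
  refine DifferentiableAt.comp (g := ffReg (O q) _) (f := legRap hi lo q (ε q)) γ
    (differentiableAt_ffReg (O q) _ fun i j hij => ?_) ?_
  · have := im_legRap_sub hlo ht hq.1 (by omega) i j hij
    constructor <;> linarith
  · exact differentiableAt_pi.2 fun i => by unfold legRap; fun_prop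

lemma continuousAt_ampA (hlo : ∀ i, lo i < hi i) (O : ℕ → LocalOperator Q) {p k : ℕ} {ε : ℕ → ℝ}
    {γ : Λ → ℂ} {τ : ℝ} (ht : (ε, γ, τ) ∈ ampDomain hi lo Q p k) :
    ContinuousAt (fun ε => ampA hi lo O p k ε γ) ε := by
  unfold ampA
  refine tendsto_finsetProd _ fun q hq => ?_
  rw [Finset.mem_Ico] at hq
  refine Tendsto.mul ?_ tendsto_const_nhds
  have hr := Q.reg_pos
  have hτ : 0 < τ := ht.2.1
  refine ContinuousAt.comp (g := ffReg (O q) _) (f := fun ε : ℕ → ℝ => legRap hi lo q (ε q) γ)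
    (differentiableAt_ffReg (O q) _ fun i j hij => ?_).continuousAt ?_
  · have := im_legRap_sub hlo ht hq.1 (by omega) i j hij
    constructor <;> linarith
  · refine continuousAt_pi.2 fun i => ?_
    unfold legRap
    have h : Continuous fun ε : ℕ → ℝ => ((ε q : ℝ) : ℂ) :=
      Complex.continuous_ofReal.comp (continuous_apply q)
    split_ifs
    · exact (continuous_const.add (continuous_const.mul (continuous_const.sub h))).continuousAt
    · exact continuousAt_const

/-- The factors of the operators `q ≥ p` depend only on the particles absorbed by them. -/
lemma ampA_congr (hlo : ∀ i, lo i < hi i) (O : ℕ → LocalOperator Q) {p k : ℕ} {ε : ℕ → ℝ}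
    {γ γ' : Λ → ℂ} (h : ∀ i, p ≤ hi i → γ i = γ' i) :
    ampA hi lo O p k ε γ = ampA hi lo O p k ε γ' := by
  classical
  refine Finset.prod_congr rfl fun q hq => ?_
  rw [Finset.mem_Ico] at hq
  have h1 : legRap hi lo q (ε q) γ = legRap hi lo q (ε q) γ' := by
    funext ⟨i, hi'⟩
    unfold legRap
    simp only
    rw [h i (by have := hlo i; omega)]
  rw [ffAt, ffAt, h1]
  congr 1
  refine Finset.prod_congr rfl fun i _ => Finset.prod_congr rfl fun j _ => ?_
  split_ifs with hc
  · rw [h i (by omega), h j (by omega)]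
  · rfl

end amp

/-! ### Replacing a part of the variables -/

open scoped Classical in
/-- The family `γ`, with the entries whose labels satisfy `J` replaced by `y`. -/
def glue {Λ α : Type*} (J : Λ → Prop) (γ : Λ → α) (y : {i // J i} → α) : Λ → α :=
  fun i => if h : J i then y ⟨i, h⟩ else γ i

section glue
variable {Λ α : Type*} {J : Λ → Prop} {γ : Λ → α} {y : {i // J i} → α} {i : Λ}

lemma glue_of_pos (h : J i) : glue J γ y i = y ⟨i, h⟩ := by
  classical
  exact dif_pos h

lemma glue_of_neg (h : ¬ J i) : glue J γ y i = γ i := by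
  classical
  exact dif_neg h

lemma continuous_glue [TopologicalSpace α] :
    Continuous fun p : (Λ → α) × ({i // J i} → α) => glue J p.1 p.2 := by
  classical
  refine continuous_pi fun i => ?_
  unfold glue
  split_ifs <;> fun_prop

lemma continuous_glue_right [TopologicalSpace α] (γ : Λ → α) :
    Continuous fun y : {i // J i} → α => glue J γ y :=
  continuous_glue.comp (by fun_prop : Continuous fun y : {i // J i} → α => (γ, y))

end glue

/-! ### Amplitudes with their smearing factors -/

/-- A smooth function with integral `1` supported in `[-1/2, 1/2]`. -/
def cutoff (θ : ℝ) : ℂ :=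
  (((⟨1 / 4, 1 / 2, by norm_num, by norm_num⟩ : ContDiffBump (0 : ℝ)).normed volume θ : ℝ) : ℂ)

lemma contDiff_cutoff : ContDiff ℝ ((⊤ : ℕ∞) : WithTop ℕ∞) cutoff :=
  Complex.ofRealCLM.contDiff.comp (ContDiffBump.contDiff_normed _ (n := ⊤))

lemma cutoff_eq_zero {θ : ℝ} (h : 1 / 2 ≤ |θ|) : cutoff θ = 0 := by
  rw [cutoff, Complex.ofReal_eq_zero, ← Function.notMem_support, ContDiffBump.support_normed_eq,
    Metric.mem_ball, Real.dist_eq, sub_zero, not_lt]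
  exact h

lemma integral_cutoff : ∫ θ in Set.Ioc (-1 : ℝ) 1, cutoff θ = 1 := by
  rw [setIntegral_eq_integral_of_forall_compl_eq_zero]
  · unfold cutoff
    rw [integral_complex_ofReal, ContDiffBump.integral_normed, Complex.ofReal_one]
  · intro θ hθ
    refine cutoff_eq_zero ?_
    by_contra! h
    have := abs_lt.1 h
    exact hθ ⟨by linarith, by linarith⟩

lemma weight_add_le {Λ : Type*} [Fintype Λ] (γ v : Λ → ℝ) :
    weight (γ + v) ≤ (∏ i, Real.exp |v i|) * weight γ := by
  rw [weight, weight, ← Finset.prod_mul_distrib]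
  exact Finset.prod_le_prod (fun i _ => (Real.cosh_pos _).le) fun i _ => cosh_add_le _ _

lemma one_add_sum_le_prod {ι : Type*} (s : Finset ι) {f : ι → ℝ} (hf : ∀ i ∈ s, 0 ≤ f i) :
    1 + ∑ i ∈ s, f i ≤ ∏ i ∈ s, (1 + f i) := by
  classical
  induction s using Finset.induction_on with
  | empty => simp
  | insert i s hi ih =>
    rw [Finset.sum_insert hi, Finset.prod_insert hi]
    have h1 := hf i (by simp)
    have h2 := ih fun j hj => hf j (by simp [hj])
    have h3 : 0 ≤ ∑ i ∈ s, f i := Finset.sum_nonneg fun j hj => hf j (by simp [hj])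
    nlinarith

section amplitude
variable {Q : Model} {Λ : Type*} [Fintype Λ] (hi lo : Λ → ℕ)

open scoped Classical in
/-- The momentum absorbed by the operator `q` is the sum of those of the particles with `hi = q`
minus the sum of those of the particles with `lo = q`. -/
def flowCoeff (q : ℕ) (i : Λ) : ℝ := (if hi i = q then 1 else 0) - (if lo i = q then 1 else 0)

/-- The smearing factors of the operators `q` with `p ≤ q < k`. -/
def ampH (Q : Model) (g : ℕ → 𝓢(ℝ × ℝ, ℂ)) (p k : ℕ) (γ : Λ → ℝ) : ℂ :=
  Q.smearProd (Finset.Ico p k) g (flowCoeff hi lo) γ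

/-- The amplitude of the operators `q` with `p ≤ q < k`. -/
def amp (O : ℕ → LocalOperator Q) (g : ℕ → 𝓢(ℝ × ℝ, ℂ)) (p k : ℕ) (ε : ℕ → ℝ) (γ : Λ → ℝ) : ℂ :=
  ampH hi lo Q g p k γ * ampA hi lo O p k ε (fun i => (γ i : ℂ))

open scoped Classical in
/-- The family `γ`, with the rapidities of the particles absorbed below `p` replaced by `0`. -/
def activePart (p : ℕ) (γ : Λ → ℝ) : Λ → ℝ := fun i => if p ≤ hi i then γ i else 0

open scoped Classical in
/-- The direction of the contour deformation. A particle absorbed at the level `hi i` is shifted by an imaginary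
part proportional to `hi i`, so that at every operator the emitted particles, which are absorbed at a higher
level, are shifted further than the absorbed ones: this moves the kinematic poles away from the contour. -/
def shiftDir (J : Λ → Prop) (i : Λ) : ℝ := if J i then hi i else 0

/-- The smooth part of the integrand, averaged along the direction of the contour deformation. -/
def averaged (Q : Model) (g : ℕ → 𝓢(ℝ × ℝ, ℂ)) (p k : ℕ) (J : Λ → Prop) (γ : Λ → ℝ) (θ : ℝ) : ℂ :=
  cutoff θ * ampH hi lo Q g p k (γ + θ • shiftDir hi J)

variable {hi lo} {p k : ℕ} {J : Λ → Prop}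

lemma flow_activePart (hlo : ∀ i, lo i < hi i) {q : ℕ} (hq : p ≤ q) (γ : Λ → ℝ) :
    Q.flow (flowCoeff hi lo q) (activePart hi p γ) = Q.flow (flowCoeff hi lo q) γ := by
  classical
  refine Finset.sum_congr rfl fun i _ => ?_
  unfold activePart flowCoeff
  have := hlo i
  by_cases h : p ≤ hi i
  · simp [h]
  · have h1 : hi i ≠ q := by omega
    have h2 : lo i ≠ q := by omega
    simp [h1, h2]

lemma ampH_activePart (hlo : ∀ i, lo i < hi i) (g : ℕ → 𝓢(ℝ × ℝ, ℂ)) (γ : Λ → ℝ) :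
    ampH hi lo Q g p k (activePart hi p γ) = ampH hi lo Q g p k γ := by
  unfold ampH Model.smearProd
  refine Finset.prod_congr rfl fun q hq => ?_
  rw [flow_activePart hlo (Finset.mem_Ico.1 hq).1]

/-- The momentum absorbed by the operators to the right of a cut is that of the particles which cross it. -/
lemma sum_flow (hhi : ∀ i, hi i < k) (hlo : ∀ i, lo i < hi i) (b : ℕ) (γ : Λ → ℝ) :
    ∑ q ∈ Finset.Ico b k, Q.flow (flowCoeff hi lo q) γ =
      ∑ i, (if lo i < b ∧ b ≤ hi i then Q.momentum (γ i) else 0) := by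
  classical
  unfold Model.flow
  rw [Finset.sum_comm]
  refine Finset.sum_congr rfl fun i _ => ?_
  rw [← Finset.sum_smul]
  unfold flowCoeff
  rw [Finset.sum_sub_distrib, Finset.sum_ite_eq, Finset.sum_ite_eq]
  have := hhi i
  have := hlo i
  simp only [Finset.mem_Ico]
  by_cases h1 : b ≤ hi i <;> by_cases h2 : b ≤ lo i
  · rw [if_pos (by omega), if_pos (by omega), if_neg (by omega)]; simp
  · rw [if_pos (by omega), if_neg (by omega), if_pos (by omega)]; simp
  · omega
  · rw [if_neg (by omega), if_neg (by omega), if_neg (by omega)]; simp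

/-- The energies of the particles are bounded by the momenta absorbed by the operators. -/
lemma mass_mul_cosh_le (hhi : ∀ i, hi i < k) (hlo : ∀ i, lo i < hi i) (γ : Λ → ℝ) {i : Λ} (hi' : p ≤ hi i) :
    Q.mass * Real.cosh (γ i) ≤ ∑ q ∈ Finset.Ico p k, ‖Q.flow (flowCoeff hi lo q) γ‖ := by
  classical
  have hm := Q.mass_pos
  calc Q.mass * Real.cosh (γ i) ≤
        ∑ j, (if lo j < hi i ∧ hi i ≤ hi j then Q.mass * Real.cosh (γ j) else 0) := by
        have := Finset.single_le_sum
          (f := fun j => if lo j < hi i ∧ hi i ≤ hi j then Q.mass * Real.cosh (γ j) else 0)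
          (fun j _ => by
            have := Real.cosh_pos (γ j)
            split_ifs <;> positivity) (Finset.mem_univ i)
        simpa [hlo i] using this
    _ = (∑ q ∈ Finset.Ico (hi i) k, Q.flow (flowCoeff hi lo q) γ).1 := by
        rw [sum_flow hhi hlo, Prod.fst_sum]
        refine Finset.sum_congr rfl fun j _ => ?_
        split_ifs <;> simp [Model.momentum]
    _ ≤ ‖∑ q ∈ Finset.Ico (hi i) k, Q.flow (flowCoeff hi lo q) γ‖ :=
        (le_abs_self _).trans (norm_fst_le (∑ q ∈ Finset.Ico (hi i) k, Q.flow (flowCoeff hi lo q) γ))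
    _ ≤ ∑ q ∈ Finset.Ico (hi i) k, ‖Q.flow (flowCoeff hi lo q) γ‖ := norm_sum_le _ _
    _ ≤ _ := Finset.sum_le_sum_of_subset_of_nonneg (Finset.Ico_subset_Ico_left hi')
        fun _ _ _ => norm_nonneg _

/-- A product of inverse powers of the momenta absorbed by the operators decreases rapidly in the rapidities of all
particles absorbed at the levels `p, p + 1, …`. -/
lemma exists_prod_inv_flow_le (Q : Model) (hhi : ∀ i, hi i < k) (hlo : ∀ i, lo i < hi i) (p N : ℕ) :
    ∃ C, 0 ≤ C ∧ ∀ γ : Λ → ℝ, ∏ q ∈ Finset.Ico p k,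
      ((1 + ‖Q.flow (flowCoeff hi lo q) γ‖) ^ (N * Fintype.card Λ))⁻¹ ≤
        C / weight (activePart hi p γ) ^ N := by
  classical
  have hm := Q.mass_pos
  set c := 1 + (Q.mass)⁻¹ with hc
  have hc1 : 1 ≤ c := by have := inv_pos.2 hm; linarith
  refine ⟨(c ^ Fintype.card Λ) ^ N, by positivity, fun γ => ?_⟩
  set Pr := ∏ q ∈ Finset.Ico p k, (1 + ‖Q.flow (flowCoeff hi lo q) γ‖) with hPr
  have hPr1 : 1 ≤ Pr := Finset.one_le_prod (fun q _ => by have := norm_nonneg (Q.flow (flowCoeff hi lo q) γ); simp)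
  have hsum : ∑ q ∈ Finset.Ico p k, ‖Q.flow (flowCoeff hi lo q) γ‖ ≤ Pr := by
    have := one_add_sum_le_prod (Finset.Ico p k) (f := fun q => ‖Q.flow (flowCoeff hi lo q) γ‖)
      (fun _ _ => norm_nonneg _)
    linarith
  have hW : weight (activePart hi p γ) ≤ (c * Pr) ^ Fintype.card Λ := by
    rw [weight, ← Finset.card_univ, ← Finset.prod_const]
    refine Finset.prod_le_prod (fun _ _ => (Real.cosh_pos _).le) fun i _ => ?_
    unfold activePart
    split_ifs with h
    · have := (mass_mul_cosh_le (Q := Q) hhi hlo γ h).trans hsum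
      calc Real.cosh (γ i) = Q.mass⁻¹ * (Q.mass * Real.cosh (γ i)) := by field_simp
        _ ≤ Q.mass⁻¹ * Pr := by gcongr
        _ ≤ c * Pr := by gcongr; rw [hc]; linarith
    · rw [Real.cosh_zero]
      nlinarith
  rw [Finset.prod_inv_distrib, Finset.prod_pow, ← hPr]
  have hWpos := weight_pos (activePart hi p γ)
  rw [inv_eq_one_div, div_le_div_iff₀ (by positivity) (by positivity), one_mul]
  calc weight (activePart hi p γ) ^ N ≤ ((c * Pr) ^ Fintype.card Λ) ^ N := by gcongr
    _ = _ := by rw [mul_pow, mul_pow, mul_comm N, pow_mul Pr]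

lemma contDiff_ampH (g : ℕ → 𝓢(ℝ × ℝ, ℂ)) : ContDiff ℝ ((⊤ : ℕ∞) : WithTop ℕ∞) (ampH hi lo Q g p k) :=
  contDiff_smearProd Q _ g _

lemma norm_ampH_le (Q : Model) (hhi : ∀ i, hi i < k) (hlo : ∀ i, lo i < hi i) (g : ℕ → 𝓢(ℝ × ℝ, ℂ)) (p N : ℕ) :
    ∃ C, 0 ≤ C ∧ ∀ γ : Λ → ℝ, ‖ampH hi lo Q g p k γ‖ ≤ C / weight (activePart hi p γ) ^ N := by
  obtain ⟨C, hC0, hC⟩ := exists_prod_inv_flow_le Q hhi hlo p N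
  obtain ⟨C', hC0', hC'⟩ := (derivBound_smearProd Q (Finset.Ico p k) g (flowCoeff hi lo) (0 : Λ → ℝ)
    (N * Fintype.card Λ)).2 0
  refine ⟨C' * C, by positivity, fun γ => ?_⟩
  have := hC' γ 0 (by simp)
  simp only [iteratedDeriv_zero, smul_zero, add_zero, pow_zero, mul_one] at this
  refine this.trans ?_
  rw [mul_div_assoc]
  exact mul_le_mul_of_nonneg_left (hC γ) hC0'

lemma activePart_add {Λ : Type*} {hi : Λ → ℕ} {J : Λ → Prop} (hJ : ∀ i, J i → p ≤ hi i) (γ : Λ → ℝ) (θ : ℝ) :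
    activePart hi p (γ + θ • shiftDir hi J) = activePart hi p γ + θ • shiftDir hi J := by
  classical
  funext i
  simp only [activePart, shiftDir, Pi.add_apply, Pi.smul_apply, smul_eq_mul]
  by_cases h : J i
  · simp [h, hJ i h]
  · simp [h]

/-- The smooth part of the integrand decreases rapidly in the rapidities, together with its derivatives along the
direction of the contour deformation. -/
lemma exists_norm_averaged_le (Q : Model) (hhi : ∀ i, hi i < k) (hlo : ∀ i, lo i < hi i)
    (hJ : ∀ i, J i → p ≤ hi i) (g : ℕ → 𝓢(ℝ × ℝ, ℂ)) (n N : ℕ) :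
    ∃ C, 0 ≤ C ∧ ∀ (γ : Λ → ℝ) (θ : ℝ), |θ| ≤ 1 →
      ‖iteratedDeriv n (averaged hi lo Q g p k J γ) θ‖ ≤ C / weight (activePart hi p γ) ^ N := by
  classical
  set w := shiftDir hi J with hw
  obtain ⟨C, hC0, hC⟩ := exists_prod_inv_flow_le Q hhi hlo p (N + n)
  have hcut : DerivBound (T := Λ → ℝ) (fun γ : Λ → ℝ => weight γ) (fun _ _ => 1) (fun _ => cutoff) := by
    refine ⟨fun _ => contDiff_cutoff, fun m => ?_⟩
    have hc : Continuous (iteratedDeriv m cutoff) :=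
      contDiff_cutoff.continuous_iteratedDeriv m (by exact_mod_cast le_top)
    obtain ⟨C, hC⟩ := (isCompact_Icc (a := (-1 : ℝ)) (b := 1)).exists_bound_of_continuousOn hc.continuousOn
    refine ⟨|C|, abs_nonneg _, fun γ θ hθ => ?_⟩
    have h1 := (hC θ (by rwa [Set.mem_Icc, ← abs_le])).trans (le_abs_self C)
    have h2 : 1 ≤ weight γ ^ m := one_le_pow₀ (one_le_weight γ)
    rw [mul_one]
    nlinarith [abs_nonneg C]
  obtain ⟨C', hC0', hC'⟩ := (hcut.mul (derivBound_smearProd Q (Finset.Ico p k) g (flowCoeff hi lo) w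
    ((N + n) * Fintype.card Λ)) (fun γ => (weight_pos γ).le) (fun _ _ => zero_le_one)).2 n
  set E := ∏ i, Real.exp |w i| with hE
  have hE1 : 1 ≤ E := Finset.one_le_prod (fun i _ => Real.one_le_exp (abs_nonneg _))
  refine ⟨C' * C * E ^ (N + n), by positivity, fun γ θ hθ => ?_⟩
  set γ' := activePart hi p γ with hγ'
  have e1 : averaged hi lo Q g p k J γ = averaged hi lo Q g p k J γ' := by
    funext θ
    unfold averaged
    rw [← ampH_activePart hlo, activePart_add hJ, ← hγ', ← ampH_activePart hlo g (γ' + _),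
      activePart_add hJ]
  have e2 : activePart hi p (γ' + θ • w) = γ' + θ • w := by
    rw [hw, activePart_add hJ]
    congr 1
    funext i; simp only [hγ', activePart]; split_ifs <;> rfl
  rw [e1]
  have h1 := hC' γ' θ hθ
  have h2 := hC (γ' + θ • w)
  rw [e2] at h2
  have h3 : weight γ' ≤ E * weight (γ' + θ • w) := by
    have := weight_add_le (γ' + θ • w) (-(θ • w))
    rw [add_neg_cancel_right] at this
    refine this.trans (mul_le_mul_of_nonneg_right ?_ (weight_pos _).le)
    refine Finset.prod_le_prod (fun _ _ => (Real.exp_pos _).le) fun i _ => ?_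
    refine Real.exp_le_exp.2 ?_
    simp only [Pi.neg_apply, Pi.smul_apply, smul_eq_mul, abs_neg, abs_mul]
    nlinarith [abs_nonneg (w i)]
  have hW := weight_pos γ'
  have hW' := weight_pos (γ' + θ • w)
  refine (show ‖iteratedDeriv n (averaged hi lo Q g p k J γ') θ‖ ≤ _ from h1).trans ?_
  simp only [one_mul]
  calc _ ≤ C' * weight γ' ^ n * (C / weight (γ' + θ • w) ^ (N + n)) := by gcongr
    _ ≤ C' * weight γ' ^ n * (C / (weight γ' / E) ^ (N + n)) := by
        have : weight γ' / E ≤ weight (γ' + θ • w) := by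
          rw [div_le_iff₀ (by positivity)]; linarith
        gcongr
    _ = _ := by
        rw [div_pow, pow_add (weight γ')]
        field_simp

end amplitude

/-! ### Boundary values of the amplitudes -/

section boundaryValue
variable {Q : Model} {Λ : Type*} [Fintype Λ] (hi lo : Λ → ℕ)

/-- A degree of the polynomial bound of the amplitude in terms of the distance to the kinematic
poles. The set is not empty by `polyBound_ampA`, so that its infimum is attained. -/
def ampDegree (O : ℕ → LocalOperator Q) (p k : ℕ) : ℕ :=
  sInf {M | ∃ C : ℝ, 0 ≤ C ∧ ∀ t ∈ ampDomain hi lo Q p k,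
    ‖ampA hi lo O p k t.1 t.2.1‖ ≤ C * (weight (fun i => (t.2.1 i).re) / t.2.2) ^ M}

/-- Height of the strip used for the contour deformation. Since the components of the direction of the deformation
are at most `k`, all imaginary parts stay below `Q.reg`. -/
def stripWidth (Q : Model) (k : ℕ) : ℝ := Q.reg / (k + 1)

open scoped Classical in
/-- The integral of the amplitude of the operators `q` with `p ≤ q < k` over the rapidities with
labels in `J`, extended to the regulators `ε ≥ 0` by a contour deformation. -/
def boundaryValue (O : ℕ → LocalOperator Q) (g : ℕ → 𝓢(ℝ × ℝ, ℂ)) (p k : ℕ) (J : Λ → Prop)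
    (ε : ℕ → ℝ) (γ : Λ → ℝ) : ℂ :=
  stripIntegral (ampDegree hi lo O p k) (stripWidth Q k) (fun j : {i // J i} => shiftDir hi J j)
    (fun y => averaged hi lo Q g p k J (glue J γ y))
    (fun z => ampA hi lo O p k ε (glue J (fun i => (γ i : ℂ)) z))

/-- The regulators `ε` with `0 ≤ ε ≤ 1`, those in `D` being at least `e`. -/
def regBox (e : ℝ) (D : Set ℕ) : Set (ℕ → ℝ) := {ε | ∀ q, 0 ≤ ε q ∧ ε q ≤ 1 ∧ (q ∈ D → e ≤ ε q)}

open scoped Classical in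
/-- The weight of the rapidities which are not integrated. -/
def outerWeight (p : ℕ) (J : Λ → Prop) (γ : Λ → ℝ) : ℝ :=
  ∏ i, if p ≤ hi i ∧ ¬ J i then Real.cosh (γ i) else 1

/-- The set of labels `J` is such that the deformation of the contour avoids the kinematic poles of
the operators which are not in `D`: at each such operator the emitted particles are integrated, and hence shifted
further than the absorbed ones. At the operators in `D` the regulator itself keeps the poles away. -/
structure Deformable (p k : ℕ) (J : Λ → Prop) (D : Set ℕ) : Prop where
  lt : ∀ i, lo i < hi i
  hi_lt : ∀ i, hi i < k
  le : ∀ i, J i → p ≤ hi i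
  pinch : ∀ i j, lo j = hi i → p ≤ hi i → J j ∨ (¬ J i ∧ hi i ∈ D)

variable {hi lo} {O : ℕ → LocalOperator Q} {g : ℕ → 𝓢(ℝ × ℝ, ℂ)} {p k : ℕ} {J : Λ → Prop} {D : Set ℕ}
  {e : ℝ}

lemma stripWidth_pos : 0 < stripWidth Q k := by
  have := Q.reg_pos
  unfold stripWidth; positivity

lemma stripWidth_le : stripWidth Q k ≤ 1 := by
  have := Q.reg_pos
  have := Q.reg_le
  unfold stripWidth
  rw [div_le_one (by positivity)]
  have : (0 : ℝ) ≤ k := by positivity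
  linarith

lemma exists_norm_ampA_le (hlo : ∀ i, lo i < hi i) (O : ℕ → LocalOperator Q) (p k : ℕ) :
    ∃ C : ℝ, 0 ≤ C ∧ ∀ t ∈ ampDomain hi lo Q p k, ‖ampA hi lo O p k t.1 t.2.1‖ ≤
      C * (weight (fun i => (t.2.1 i).re) / t.2.2) ^ ampDegree hi lo O p k := by
  have h : {M | ∃ C : ℝ, 0 ≤ C ∧ ∀ t ∈ ampDomain hi lo Q p k,
    ‖ampA hi lo O p k t.1 t.2.1‖ ≤ C * (weight (fun i => (t.2.1 i).re) / t.2.2) ^ M}.Nonempty := by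
    obtain ⟨C, M, h⟩ := polyBound_ampA hlo O (le_refl p) (le_refl k)
    exact ⟨M, C, h⟩
  exact Nat.sInf_mem h

lemma outerWeight_pos (γ : Λ → ℝ) : 0 < outerWeight hi p J γ := by
  classical
  refine Finset.prod_pos fun i _ => ?_
  have := Real.cosh_pos (γ i)
  split_ifs <;> linarith

lemma weight_activePart_glue (hJ : ∀ i, J i → p ≤ hi i) [Fintype {i // J i}] (γ : Λ → ℝ)
    (y : {i // J i} → ℝ) :
    weight (activePart hi p (glue J γ y)) = outerWeight hi p J γ * weight y := by
  classical
  have h1 : weight y = ∏ i : Λ, if h : J i then Real.cosh (y ⟨i, h⟩) else 1 := by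
    rw [weight, Finset.prod_dite]
    simp only [Finset.prod_const_one, mul_one]
    refine (Finset.prod_bij (fun x _ => ⟨x.1, (Finset.mem_filter.1 x.2).2⟩) ?_ ?_ ?_ ?_).symm
    · intros; simp
    · rintro ⟨a, ha⟩ _ ⟨b, hb⟩ _ h; simpa using h
    · rintro ⟨b, hb⟩ _; exact ⟨⟨b, by simpa using hb⟩, by simp, rfl⟩
    · intros; rfl
  rw [h1, outerWeight, weight, ← Finset.prod_mul_distrib]
  refine Finset.prod_congr rfl fun i _ => ?_
  unfold activePart
  by_cases h : J i
  · simp [h, hJ i h, glue_of_pos h]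
  · by_cases h2 : p ≤ hi i <;> simp [h, h2, glue_of_neg h]

lemma activePart_glue_ofReal (hlo : ∀ i, lo i < hi i) (O : ℕ → LocalOperator Q) (ε : ℕ → ℝ)
    (γ : Λ → ℝ) (v : Λ → ℂ) :
    ampA hi lo O p k ε (fun i => (γ i : ℂ) + v i) =
      ampA hi lo O p k ε (fun i => (activePart hi p γ i : ℂ) + v i) := by
  classical
  refine ampA_congr hlo O fun i h => ?_
  simp [activePart, h]

lemma shiftDir_nonneg {Λ : Type*} {hi : Λ → ℕ} {J : Λ → Prop} (i : Λ) : 0 ≤ shiftDir hi J i := by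
  classical
  unfold shiftDir; split_ifs <;> positivity

lemma shiftDir_le {Λ : Type*} {hi lo : Λ → ℕ} {J : Λ → Prop} (hJ : Deformable hi lo p k J D) (i : Λ) : shiftDir hi J i ≤ k := by
  classical
  unfold shiftDir
  have := hJ.hi_lt i
  split_ifs
  · exact_mod_cast this.le
  · positivity

/-- The deformed contour stays in the domain of regularity, at the distance `τ` from the kinematic poles: either
because all regulators are at least `τ`, or because the shift is. -/
lemma mem_ampDomain {Λ : Type*} {hi lo : Λ → ℕ} {J : Λ → Prop} (hJ : Deformable hi lo p k J D) {ε : ℕ → ℝ} (hε : ε ∈ regBox e D) (γ : Λ → ℝ)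
    {θ s τ : ℝ} (hs : 0 ≤ s) (hs1 : s ≤ stripWidth Q k) (hτ : 0 < τ) (hτ1 : τ ≤ 1)
    (h : (∀ q < k, τ ≤ ε q) ∨ (τ ≤ s ∧ τ ≤ e)) :
    (ε, (fun i => (γ i : ℂ) + ((θ : ℂ) + s * Complex.I) * shiftDir hi J i), τ) ∈
      ampDomain hi lo Q p k := by
  classical
  have him : ∀ i, ((γ i : ℂ) + ((θ : ℂ) + s * Complex.I) * shiftDir hi J i).im = s * shiftDir hi J i := by
    intro i; simp
  refine ⟨fun q => abs_le.2 ⟨by linarith [(hε q).1], (hε q).2.1⟩, hτ, hτ1, fun i j => ?_,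
    fun i j hij hp hk => ?_⟩
  · simp only [him]
    have a1 := shiftDir_nonneg (hi := hi) (J := J) i
    have a2 := shiftDir_nonneg (hi := hi) (J := J) j
    have b1 := shiftDir_le hJ i
    have b2 := shiftDir_le hJ j
    rw [← mul_sub, abs_mul, abs_of_nonneg hs]
    have h1 : |shiftDir hi J i - shiftDir hi J j| ≤ k := abs_le.2 ⟨by linarith, by linarith⟩
    have hr := Q.reg_pos
    calc _ ≤ stripWidth Q k * k := by gcongr; exact stripWidth_pos.le
      _ ≤ Q.reg := by
        unfold stripWidth
        rw [div_mul_eq_mul_div, div_le_iff₀ (by positivity)]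
        nlinarith
  · simp only [him]
    have hε0 := hε (hi i)
    rcases hJ.pinch i j hij hp with hj | ⟨hi', hD⟩
    · have h1 : shiftDir hi J i + 1 ≤ shiftDir hi J j := by
        have h2 : shiftDir hi J j = hi j := if_pos hj
        have h3 : shiftDir hi J i ≤ hi i := by
          unfold shiftDir; split_ifs
          · exact le_rfl
          · positivity
        have h4 : ((hi i : ℕ) : ℝ) + 1 ≤ hi j := by have := hJ.lt j; exact_mod_cast (by omega : hi i + 1 ≤ hi j)
        linarith
      rcases h with h | ⟨h, -⟩
      · have := h (hi i) hk
        nlinarith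
      · nlinarith
    · have h1 : shiftDir hi J i = 0 := if_neg hi'
      have h2 := shiftDir_nonneg (hi := hi) (J := J) j
      rw [h1]
      have h3 := hε0.2.2 hD
      rcases h with h | ⟨h, h'⟩
      · have := h (hi i) hk
        nlinarith
      · nlinarith

/-- The polynomial bound of the analytic part of the amplitude, on the deformed contour. -/
lemma exists_norm_ampA_shift_le (hJ : Deformable hi lo p k J D) (O : ℕ → LocalOperator Q) :
    ∃ C, 0 ≤ C ∧ ∀ e, ∀ ε ∈ regBox e D, ∀ (γ : Λ → ℝ) (θ s τ : ℝ), |θ| ≤ 1 → 0 ≤ s →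
      s ≤ stripWidth Q k → 0 < τ → τ ≤ 1 → ((∀ q < k, τ ≤ ε q) ∨ (τ ≤ s ∧ τ ≤ e)) →
      ‖ampA hi lo O p k ε (fun i => (γ i : ℂ) + ((θ : ℂ) + s * Complex.I) * shiftDir hi J i)‖ ≤
        C * (weight (activePart hi p γ) / τ) ^ ampDegree hi lo O p k := by
  classical
  obtain ⟨C, hC0, hC⟩ := exists_norm_ampA_le hJ.lt O p k
  set E := ∏ i, Real.exp |shiftDir hi J i| with hE
  refine ⟨C * E ^ ampDegree hi lo O p k, by positivity, fun e ε hε γ θ s τ hθ hs hs1 hτ hτ1 h => ?_⟩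
  rw [activePart_glue_ofReal hJ.lt O ε γ _]
  refine (hC _ (mem_ampDomain hJ hε (activePart hi p γ) (θ := θ) hs hs1 hτ hτ1 h)).trans ?_
  simp only
  have h1 : weight (fun i => ((activePart hi p γ i : ℂ) + ((θ : ℂ) + s * Complex.I) * shiftDir hi J i).re) ≤
      E * weight (activePart hi p γ) := by
    have e1 : (fun i => ((activePart hi p γ i : ℂ) + ((θ : ℂ) + s * Complex.I) * shiftDir hi J i).re) =
        activePart hi p γ + θ • shiftDir hi J := by
      funext i; simp
    rw [e1]
    refine (weight_add_le _ _).trans (mul_le_mul_of_nonneg_right ?_ (weight_pos _).le)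
    refine Finset.prod_le_prod (fun _ _ => (Real.exp_pos _).le) fun i _ => Real.exp_le_exp.2 ?_
    simp only [Pi.smul_apply, smul_eq_mul, abs_mul]
    nlinarith [abs_nonneg (shiftDir hi J i)]
  rw [mul_assoc, ← mul_pow, ← mul_div_assoc]
  have := weight_pos (fun i => ((activePart hi p γ i : ℂ) + ((θ : ℂ) + s * Complex.I) * shiftDir hi J i).re)
  gcongr

lemma glue_shiftPoint {Λ : Type*} {hi : Λ → ℕ} {J : Λ → Prop} (γ : Λ → ℝ) (y : {i // J i} → ℝ) (θ s : ℝ) :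
    glue J (fun i => (γ i : ℂ)) (shiftPoint (fun j : {i // J i} => shiftDir hi J j) y θ s) =
      fun i => ((glue J γ y i : ℝ) : ℂ) + ((θ : ℂ) + s * Complex.I) * shiftDir hi J i := by
  classical
  funext i
  by_cases h : J i
  · simp only [glue_of_pos h]; rfl
  · simp [glue_of_neg h, shiftDir, h]

variable (g)

lemma continuous_iteratedDeriv_averaged (n : ℕ) : Continuous fun q : (Λ → ℝ) × ℝ =>
    iteratedDeriv n (averaged hi lo Q g p k J q.1) q.2 := by
  have h : ContDiff ℝ ((⊤ : ℕ∞) : WithTop ℕ∞) fun q : (Λ → ℝ) × ℝ => averaged hi lo Q g p k J q.1 q.2 := by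
    unfold averaged
    exact (contDiff_cutoff.comp contDiff_snd).mul
      ((contDiff_ampH g).comp (contDiff_fst.add (contDiff_snd.smul contDiff_const)))
  exact Continuous.iteratedDeriv_param h n

open scoped Classical in
lemma exists_averaged_glue_bound (Q : Model) (hJ : Deformable hi lo p k J D) (M N : ℕ) :
    ∃ C, 0 ≤ C ∧ ∀ (γ : Λ → ℝ), ∀ n ≤ M + 1, ∀ (y : {i // J i} → ℝ) (θ : ℝ), |θ| ≤ 1 →
      ‖iteratedDeriv n (averaged hi lo Q g p k J (glue J γ y)) θ‖ ≤
        (C / outerWeight hi p J γ ^ (N + M + 1)) / weight y ^ (M + 1) := by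
  choose C hC0 hC using fun n => exists_norm_averaged_le Q hJ.hi_lt hJ.lt hJ.le g n (N + M + 1)
  refine ⟨∑ n ∈ Finset.range (M + 2), C n, Finset.sum_nonneg fun n _ => hC0 n,
    fun γ n hn y θ hθ => (hC n _ θ hθ).trans ?_⟩
  have h1 : C n ≤ ∑ n ∈ Finset.range (M + 2), C n :=
    Finset.single_le_sum (fun n _ => hC0 n) (Finset.mem_range.2 (by omega))
  have h2 := outerWeight_pos (hi := hi) (p := p) (J := J) γ
  have h3 := weight_pos y
  have hS : 0 ≤ ∑ n ∈ Finset.range (M + 2), C n := (hC0 n).trans h1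
  have h5 : weight y ^ (M + 1) ≤ weight y ^ (N + M + 1) :=
    pow_le_pow_right₀ (one_le_weight y) (by omega)
  rw [weight_activePart_glue hJ.le, mul_pow, div_div]
  gcongr

open scoped Classical in
lemma exists_ampA_glue_bound (hJ : Deformable hi lo p k J D) (O : ℕ → LocalOperator Q) (he : 0 < e)
    (he1 : e ≤ 1) :
    ∃ C, 0 ≤ C ∧ ∀ ε ∈ regBox e D, ∀ (γ : Λ → ℝ) (y : {i // J i} → ℝ) (θ s : ℝ), |θ| ≤ 1 →
      0 < s → s ≤ stripWidth Q k →
      ‖ampA hi lo O p k ε (glue J (fun i => (γ i : ℂ))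
          (shiftPoint (fun j : {i // J i} => shiftDir hi J j) y θ s))‖ ≤
        (C * outerWeight hi p J γ ^ ampDegree hi lo O p k) * (weight y / s) ^ ampDegree hi lo O p k := by
  obtain ⟨C, hC0, hC⟩ := exists_norm_ampA_shift_le hJ O
  refine ⟨C * (1 / e) ^ ampDegree hi lo O p k, by positivity, fun ε hε γ y θ s hθ hs hs1 => ?_⟩
  have hs2 : s ≤ 1 := hs1.trans stripWidth_le
  rw [glue_shiftPoint]
  refine (hC e ε hε (glue J γ y) θ s (s * e) hθ hs.le hs1 (by positivity) (by nlinarith)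
    (Or.inr ⟨by nlinarith, by nlinarith⟩)).trans (le_of_eq ?_)
  rw [weight_activePart_glue hJ.le, mul_assoc, mul_assoc, ← mul_pow, ← mul_pow]
  congr 2
  field_simp

lemma measurable_glue_right {α : Type*} [MeasurableSpace α] {Λ : Type*} {J : Λ → Prop} (γ : Λ → α) :
    Measurable fun y : {i // J i} → α => glue J γ y := by
  classical
  refine measurable_pi_lambda _ fun i => ?_
  unfold glue
  split_ifs <;> fun_prop

lemma continuous_iteratedDeriv_comp {X E : Type*} [TopologicalSpace X] [TopologicalSpace E] {A : E → ℝ → ℂ}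
    {n : ℕ} (h : Continuous fun q : E × ℝ => iteratedDeriv n (A q.1) q.2) {a : X → E} {b : X → ℝ}
    (ha : Continuous a) (hb : Continuous b) : Continuous fun x => iteratedDeriv n (A (a x)) (b x) :=
  h.comp (ha.prodMk hb)

lemma continuous_iteratedDeriv_averaged_glue_right (γ : Λ → ℝ) (n : ℕ) :
    Continuous fun q : ({i // J i} → ℝ) × ℝ =>
      iteratedDeriv n (averaged hi lo Q g p k J (glue J γ q.1)) q.2 :=
  continuous_iteratedDeriv_comp (continuous_iteratedDeriv_averaged g n)
    ((continuous_glue_right γ).comp continuous_fst) continuous_snd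

lemma measurable_ampA_glue (O : ℕ → LocalOperator Q) (ε : ℕ → ℝ) (γ : Λ → ℝ) :
    Measurable fun z : {i // J i} → ℂ => ampA hi lo O p k ε (glue J (fun i => (γ i : ℂ)) z) :=
  (measurable_ampA O p k ε).comp (measurable_glue_right _)

/-- The boundary values are continuous in the regulators. -/
theorem continuousOn_boundaryValue (hJ : Deformable hi lo p k J D) (O : ℕ → LocalOperator Q)
    (he : 0 < e) (he1 : e ≤ 1) (γ : Λ → ℝ) :
    ContinuousOn (fun ε => boundaryValue hi lo O g p k J ε γ) (regBox e D) := by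
  classical
  obtain ⟨C₁, hC₁0, hC₁⟩ := exists_averaged_glue_bound g Q hJ (ampDegree hi lo O p k) 0
  obtain ⟨C₂, hC₂0, hC₂⟩ := exists_ampA_glue_bound hJ O he he1
  unfold boundaryValue
  refine continuousOn_stripIntegral (E := ℕ → ℝ) (M := ampDegree hi lo O p k)
    (η := stripWidth Q k) (w := fun j : {i // J i} => shiftDir hi J j)
    (f := fun y => averaged hi lo Q g p k J (glue J γ y))
    (A := fun ε z => ampA hi lo O p k ε (glue J (fun i => (γ i : ℂ)) z))
    stripWidth_pos stripWidth_le ?_ (hC₁ γ)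
    (fun ε => measurable_ampA_glue O ε γ) (fun ε hε => hC₂ ε hε γ) ?_
  · exact continuous_iteratedDeriv_averaged_glue_right g γ
  · intro y θ s hθ hs hs1 ε hε
    rw [glue_shiftPoint]
    have hs2 : s ≤ 1 := hs1.trans stripWidth_le
    exact (continuousAt_ampA hJ.lt O (mem_ampDomain hJ hε (glue J γ y) hs.le hs1
      (mul_pos hs he) (by nlinarith) (Or.inr ⟨by nlinarith, by nlinarith⟩))).continuousWithinAt

/-- The boundary values decrease rapidly in the rapidities which are not integrated. -/
theorem exists_norm_boundaryValue_le (hJ : Deformable hi lo p k J D) (O : ℕ → LocalOperator Q)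
    (he : 0 < e) (he1 : e ≤ 1) (N : ℕ) :
    ∃ C, 0 ≤ C ∧ ∀ ε ∈ regBox e D, ∀ γ : Λ → ℝ,
      ‖boundaryValue hi lo O g p k J ε γ‖ ≤ C / outerWeight hi p J γ ^ N := by
  classical
  set M := ampDegree hi lo O p k with hM
  obtain ⟨C₁, hC₁0, hC₁⟩ := exists_averaged_glue_bound g Q hJ M N
  obtain ⟨C₂, hC₂0, hC₂⟩ := exists_ampA_glue_bound hJ O he he1
  set η := stripWidth Q k with hη
  set V := ∫ q : ({i // J i} → ℝ) × ℝ × ℝ, (weight q.1)⁻¹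
    ∂((volume : Measure ({i // J i} → ℝ)).prod (stripMeasure η)) with hV
  have hV0 : 0 ≤ V := integral_nonneg fun q => (inv_nonneg.2 (weight_pos q.1).le)
  have hη0 : 0 < η := stripWidth_pos
  refine ⟨(((M : ℝ) + 1) ^ 2 / η ^ (M + 1) + 1) * C₁ * C₂ * V, by positivity, fun ε hε γ => ?_⟩
  refine (norm_stripIntegral_le stripWidth_pos stripWidth_le (hC₁ γ) (hC₂ ε hε γ)).trans ?_
  have hX := outerWeight_pos (hi := hi) (p := p) (J := J) γ
  have hX1 : 1 ≤ outerWeight hi p J γ := Finset.one_le_prod fun i _ => by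
    have := Real.one_le_cosh (γ i)
    split_ifs <;> simp [this]
  rw [← hV, ← hη, ← hM]
  set X := outerWeight hi p J γ
  calc _ = ((((M : ℝ) + 1) ^ 2 / η ^ (M + 1) + 1) * C₁ * C₂ * V) * (X ^ M / X ^ (N + M + 1)) := by ring
    _ ≤ ((((M : ℝ) + 1) ^ 2 / η ^ (M + 1) + 1) * C₁ * C₂ * V) * (1 / X ^ N) := by
        have : X ^ M / X ^ (N + M + 1) ≤ 1 / X ^ N := by
          rw [div_le_div_iff₀ (by positivity) (by positivity), one_mul, ← pow_add]
          exact pow_le_pow_right₀ hX1 (by omega)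
        gcongr
    _ = _ := by ring

lemma measurable_glue {α : Type*} [MeasurableSpace α] {Λ : Type*} {J : Λ → Prop} :
    Measurable fun q : (Λ → α) × ({i // J i} → α) => glue J q.1 q.2 := by
  classical
  refine measurable_pi_lambda _ fun i => ?_
  unfold glue
  split_ifs <;> fun_prop

lemma measurable_boundaryValue (O : ℕ → LocalOperator Q) (ε : ℕ → ℝ) :
    Measurable (boundaryValue hi lo O g p k J ε) := by
  classical
  unfold boundaryValue stripIntegral
  refine StronglyMeasurable.measurable (StronglyMeasurable.integral_prod_right ?_)
  refine Measurable.stronglyMeasurable ?_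
  refine Measurable.mul (Continuous.measurable ?_) ((measurable_ampA O p k ε).comp ?_)
  · unfold stripKernel
    have : ∀ n, Continuous fun q : (Λ → ℝ) × ({i // J i} → ℝ) × ℝ × ℝ =>
        iteratedDeriv n (averaged hi lo Q g p k J (glue J q.1 q.2.1)) q.2.2.1 := fun n =>
      continuous_iteratedDeriv_comp (continuous_iteratedDeriv_averaged g n)
        (continuous_glue.comp (continuous_fst.prodMk continuous_snd.fst)) continuous_snd.snd.fst
    simp only
    fun_prop
  · have h1 : Measurable fun q : (Λ → ℝ) × ({i // J i} → ℝ) × ℝ × ℝ =>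
        ((fun i => (q.1 i : ℂ) : Λ → ℂ),
          shiftPoint (fun j : {i // J i} => shiftDir hi J j) q.2.1 q.2.2.1 q.2.2.2) :=
      Measurable.prodMk (by fun_prop) ((measurable_shiftPoint _).comp measurable_snd)
    exact measurable_glue.comp h1

open scoped Classical in
/-- At strictly positive regulators the boundary value is a convergent integral. -/
theorem boundaryValue_eq_integral (hJ : Deformable hi lo p k J D) (O : ℕ → LocalOperator Q)
    (he : 0 < e) (he1 : e ≤ 1) {ε : ℕ → ℝ} (hε : ε ∈ regBox e D) (hε0 : ∀ q, 0 < ε q) (γ : Λ → ℝ) :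
    Integrable (fun y : {i // J i} → ℝ => amp hi lo O g p k ε (glue J γ y)) ∧
      boundaryValue hi lo O g p k J ε γ = ∫ y : {i // J i} → ℝ, amp hi lo O g p k ε (glue J γ y) := by
  obtain ⟨C₁, hC₁0, hC₁⟩ := exists_averaged_glue_bound g Q hJ (ampDegree hi lo O p k) 0
  obtain ⟨C₂, hC₂0, hC₂⟩ := exists_ampA_glue_bound hJ O he he1
  obtain ⟨τ, hτ, hτ1, hτε⟩ : ∃ τ, 0 < τ ∧ τ ≤ 1 ∧ ∀ q < k, τ ≤ ε q := by
    rcases (Finset.range k).eq_empty_or_nonempty with h | h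
    · exact ⟨1, one_pos, le_rfl, fun q hq => absurd (Finset.mem_range.2 hq) (by simp [h])⟩
    · obtain ⟨q₀, -, hq₀⟩ := Finset.exists_min_image _ ε h
      exact ⟨ε q₀, hε0 q₀, (hε q₀).2.1, fun q hq => hq₀ q (Finset.mem_range.2 hq)⟩
  have hmH : Measurable fun y : {i // J i} → ℝ => ampH hi lo Q g p k (glue J γ y) :=
    (contDiff_ampH g).continuous.measurable.comp (measurable_glue_right _)
  have hmA : Measurable fun z : {i // J i} → ℂ => ampA hi lo O p k ε (glue J (fun i => (γ i : ℂ)) z) :=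
    (measurable_ampA O p k ε).comp (measurable_glue_right _)
  have hre : ∀ y : {i // J i} → ℝ, glue J (fun i => (γ i : ℂ)) (fun j => (y j : ℂ)) =
      fun i => ((glue J γ y i : ℝ) : ℂ) := by
    intro y; funext i; unfold glue; split_ifs <;> rfl
  have hint : Integrable fun y : {i // J i} → ℝ => ampH hi lo Q g p k (glue J γ y) *
      ampA hi lo O p k ε (glue J (fun i => (γ i : ℂ)) (fun j => (y j : ℂ))) := by
    obtain ⟨C', hC0', hC'⟩ := exists_norm_ampA_shift_le hJ O
    set M := ampDegree hi lo O p k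
    obtain ⟨C, hC0, hC⟩ := norm_ampH_le Q hJ.hi_lt hJ.lt g p (M + 1)
    refine Integrable.mono' (integrable_inv_weight.const_mul
      (C * C' / τ ^ M / outerWeight hi p J γ)) ?_ (Eventually.of_forall fun y => ?_)
    · exact (hmH.mul (hmA.comp (by fun_prop))).aestronglyMeasurable
    · rw [norm_mul, hre]
      have h1 := hC (glue J γ y)
      have h2 := hC' e ε hε (glue J γ y) 0 0 τ (by simp) le_rfl stripWidth_pos.le hτ hτ1 (Or.inl hτε)
      simp only [Complex.ofReal_zero, zero_mul, add_zero] at h2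
      rw [weight_activePart_glue hJ.le] at h1 h2
      have hX := outerWeight_pos (hi := hi) (p := p) (J := J) γ
      have hY := weight_pos y
      refine (mul_le_mul h1 h2 (norm_nonneg _) (by positivity)).trans (le_of_eq ?_)
      rw [div_pow, pow_succ]
      field_simp
  refine ⟨?_, ?_⟩
  · simpa only [amp, hre] using hint
  · have key := integral_eq_stripIntegral (M := ampDegree hi lo O p k) (η := stripWidth Q k)
      (w := fun j : {i // J i} => shiftDir hi J j)
      (f := fun y => averaged hi lo Q g p k J (glue J γ y))
      (R := fun y => ampH hi lo Q g p k (glue J γ y)) (χ := cutoff)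
      (A := fun z => ampA hi lo O p k ε (glue J (fun i => (γ i : ℂ)) z))
      stripWidth_pos stripWidth_le contDiff_cutoff.continuous integral_cutoff
      (fun y θ => by
        unfold averaged
        congr 2
        funext i
        by_cases h : J i
        · simp [glue_of_pos h]
        · simp [glue_of_neg h, shiftDir, h])
      (fun y => by
        unfold averaged
        exact contDiff_cutoff.mul ((contDiff_ampH g).comp (by fun_prop)))
      (fun n y => by
        have : averaged hi lo Q g p k J (glue J γ y) =ᶠ[𝓝 1] fun _ => 0 := by
          filter_upwards [lt_mem_nhds (show (1 / 2 : ℝ) < 1 by norm_num)] with θ hθ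
          rw [averaged, cutoff_eq_zero (hθ.le.trans (le_abs_self θ)), zero_mul]
        rw [this.iteratedDeriv_eq, iteratedDeriv_const]; simp)
      (fun n y => by
        have : averaged hi lo Q g p k J (glue J γ y) =ᶠ[𝓝 (-1)] fun _ => 0 := by
          filter_upwards [gt_mem_nhds (show (-1 : ℝ) < -(1 / 2) by norm_num)] with θ hθ
          rw [averaged, cutoff_eq_zero (by have := neg_le_abs θ; linarith), zero_mul]
        rw [this.iteratedDeriv_eq, iteratedDeriv_const]; simp)
      (continuous_iteratedDeriv_averaged_glue_right g γ)
      (hC₁ γ) hmA (hC₂ ε hε γ)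
      (fun y z h1 h2 h3 => by
        have hz : ∀ z : ℂ, glue J (fun i => (γ i : ℂ)) (fun j => (y j : ℂ) + z * (shiftDir hi J j : ℝ)) =
            fun i => ((glue J γ y i : ℝ) : ℂ) + z * shiftDir hi J i := by
          intro z
          funext i
          by_cases h : J i
          · simp [glue_of_pos h]
          · simp [glue_of_neg h, shiftDir, h]
        simp only [hz]
        have hm := mem_ampDomain hJ hε (glue J γ y) (θ := z.re) h2 h3 hτ hτ1 (Or.inl hτε)
        simp only [Complex.re_add_im] at hm
        have hlin : DifferentiableAt ℂ
            (fun (z : ℂ) (i : Λ) => ((glue J γ y i : ℝ) : ℂ) + z * shiftDir hi J i) z :=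
          differentiableAt_pi.2 fun i => by fun_prop
        exact DifferentiableAt.comp (g := ampA hi lo O p k ε) z (differentiableAt_ampA hJ.lt O hm)
          hlin)
      hmH hint
    rw [boundaryValue, ← key]
    refine integral_congr_ae (Eventually.of_forall fun y => ?_)
    simp only [amp, hre]

end boundaryValue

/-! ### Successive integrations -/

section reindex
variable {ι ι' κ : Type*} [Fintype ι] [Fintype ι'] [Fintype κ]

/-- Relabelling of real variables. -/
def reindex (e : ι ≃ κ) : (κ → ℝ) ≃ᵐ (ι → ℝ) := (MeasurableEquiv.piCongrLeft (fun _ => ℝ) e).symm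

lemma measurePreserving_reindex (e : ι ≃ κ) : MeasurePreserving (reindex e) :=
  (volume_measurePreserving_piCongrLeft (fun _ : κ => ℝ) e).symm _

lemma integral_reindex (e : ι ≃ κ) (f : (ι → ℝ) → ℂ) : ∫ y : κ → ℝ, f (y ∘ e) = ∫ y, f y :=
  (measurePreserving_reindex e).integral_comp' f

lemma integrable_reindex (e : ι ≃ κ) (f : (ι → ℝ) → ℂ) :
    Integrable (fun y : κ → ℝ => f (y ∘ e)) ↔ Integrable f :=
  (measurePreserving_reindex e).integrable_comp_emb (reindex e).measurableEmbedding

/-- Splitting of a family of real variables into two families. -/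
def splitVars (e : ι ⊕ ι' ≃ κ) : (ι → ℝ) × (ι' → ℝ) ≃ᵐ (κ → ℝ) :=
  (MeasurableEquiv.sumPiEquivProdPi fun _ : ι ⊕ ι' => ℝ).symm.trans (reindex e.symm)

lemma measurePreserving_splitVars (e : ι ⊕ ι' ≃ κ) : MeasurePreserving (splitVars e) :=
  (measurePreserving_reindex e.symm).comp
    (volume_measurePreserving_sumPiEquivProdPi_symm (fun _ : ι ⊕ ι' => ℝ))

/-- Fubini's theorem for a splitting of the labels into two groups. -/
lemma integral_split (e : ι ⊕ ι' ≃ κ) {f : (κ → ℝ) → ℂ} (hf : Integrable f) :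
    Integrable (fun a : ι → ℝ => ∫ b : ι' → ℝ, f (fun j => Sum.elim a b (e.symm j))) ∧
      ∫ y, f y = ∫ a : ι → ℝ, ∫ b : ι' → ℝ, f (fun j => Sum.elim a b (e.symm j)) := by
  have hs := measurePreserving_splitVars e
  have hi : Integrable (fun q : (ι → ℝ) × (ι' → ℝ) => f (splitVars e q)) :=
    (hs.integrable_comp_emb (splitVars e).measurableEmbedding).2 hf
  have h2 := integral_prod _ hi
  exact ⟨hi.integral_prod_left, (hs.integral_comp' f).symm.trans h2⟩

end reindex

section boundaryValue
variable {Q : Model} {Λ : Type*} [Fintype Λ] {hi lo : Λ → ℕ} {O : ℕ → LocalOperator Q}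
  {p p' k : ℕ} {J J₁ J₂ : Λ → Prop} {D D₂ : Set ℕ} {e : ℝ}

open scoped Classical in
/-- The labels of `J` are those of `J₁` and of `J₂`. -/
def sumSubtypeEquiv (h : ∀ i, J i ↔ J₁ i ∨ J₂ i) (hd : ∀ i, J₁ i → ¬ J₂ i) :
    {i // J₁ i} ⊕ {i // J₂ i} ≃ {i // J i} where
  toFun := Sum.elim (fun i => ⟨i, (h i).2 (Or.inl i.2)⟩) (fun i => ⟨i, (h i).2 (Or.inr i.2)⟩)
  invFun i := if h1 : J₁ i then Sum.inl ⟨i, h1⟩ else Sum.inr ⟨i, ((h i).1 i.2).resolve_left h1⟩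
  left_inv x := by
    rcases x with x | x
    · simp [x.2]
    · have : ¬ J₁ x := fun h1 => hd x h1 x.2
      simp [this]
  right_inv i := by
    dsimp only
    split_ifs <;> rfl

lemma glue_glue {Λ : Type*} {J J₁ J₂ : Λ → Prop} (h : ∀ i, J i ↔ J₁ i ∨ J₂ i) (hd : ∀ i, J₁ i → ¬ J₂ i) (γ : Λ → ℝ)
    (a : {i // J₁ i} → ℝ) (b : {i // J₂ i} → ℝ) :
    glue J γ (fun j => Sum.elim a b ((sumSubtypeEquiv h hd).symm j)) = glue J₂ (glue J₁ γ a) b := by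
  classical
  funext i
  by_cases h1 : J₁ i
  · rw [glue_of_pos ((h i).2 (Or.inl h1)), glue_of_neg (hd i h1), glue_of_pos h1]
    simp [sumSubtypeEquiv, h1]
  · by_cases h2 : J₂ i
    · rw [glue_of_pos ((h i).2 (Or.inr h2)), glue_of_pos h2]
      simp [sumSubtypeEquiv, h1]
    · have : ¬ J i := by rw [h i]; tauto
      rw [glue_of_neg this, glue_of_neg h2, glue_of_neg h1]

lemma amp_mul_amp (g : ℕ → 𝓢(ℝ × ℝ, ℂ)) (h1 : p ≤ p') (h2 : p' ≤ k) (ε : ℕ → ℝ) (γ : Λ → ℝ) :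
    amp hi lo O g p p' ε γ * amp hi lo O g p' k ε γ = amp hi lo O g p k ε γ := by
  unfold amp ampH Model.smearProd ampA
  rw [← Finset.prod_Ico_consecutive _ h1 h2, ← Finset.prod_Ico_consecutive _ h1 h2]
  ring

lemma amp_congr_reg (g : ℕ → 𝓢(ℝ × ℝ, ℂ)) {ε ε' : ℕ → ℝ} (h : ∀ q, p ≤ q → q < k → ε q = ε' q)
    (γ : Λ → ℝ) : amp hi lo O g p k ε γ = amp hi lo O g p k ε' γ := by
  unfold amp ampA
  refine congrArg₂ _ rfl ?_
  refine Finset.prod_congr rfl fun q hq => ?_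
  rw [Finset.mem_Ico] at hq
  rw [h q hq.1 hq.2]

/-- The factors of the operators `q < k` depend only on the particles emitted below `k`. -/
lemma amp_congr (hlo : ∀ i, lo i < hi i) (g : ℕ → 𝓢(ℝ × ℝ, ℂ)) {ε : ℕ → ℝ} {γ γ' : Λ → ℝ}
    (h : ∀ i, p < k ∧ lo i < k → γ i = γ' i) :
    amp hi lo O g p k ε γ = amp hi lo O g p k ε γ' := by
  classical
  unfold amp
  refine congrArg₂ _ ?_ ?_
  · unfold ampH Model.smearProd Model.flow
    refine Finset.prod_congr rfl fun q hq => ?_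
    rw [Finset.mem_Ico] at hq
    congr 1
    refine Finset.sum_congr rfl fun i _ => ?_
    by_cases hi' : lo i < k
    · rw [h i ⟨by omega, hi'⟩]
    · have := hlo i
      have h1 : hi i ≠ q := by omega
      have h2 : lo i ≠ q := by omega
      simp [flowCoeff, h1, h2]
  · unfold ampA
    refine Finset.prod_congr rfl fun q hq => ?_
    rw [Finset.mem_Ico] at hq
    have h1 : legRap hi lo q (ε q) (fun i => (γ i : ℂ)) = legRap hi lo q (ε q) fun i => (γ' i : ℂ) := by
      funext ⟨i, hi'⟩
      unfold legRap
      simp only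
      rw [h i ⟨by omega, by have := hlo i; omega⟩]
    rw [ffAt, ffAt, h1]
    congr 1
    unfold crossAt
    refine Finset.prod_congr rfl fun i _ => Finset.prod_congr rfl fun j _ => ?_
    split_ifs with hc
    · simp only
      rw [h i ⟨by omega, by omega⟩, h j ⟨by omega, by omega⟩]
    · rfl

lemma measurable_amp (g : ℕ → 𝓢(ℝ × ℝ, ℂ)) (ε : ℕ → ℝ) : Measurable (amp hi lo O g p k ε) :=
  (contDiff_ampH g).continuous.measurable.mul
    (Measurable.comp (g := ampA hi lo O p k ε) (measurable_ampA O p k ε)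
      (measurable_pi_lambda _ fun i => Complex.measurable_ofReal.comp (measurable_pi_apply i)))

lemma exists_norm_amp_le (hlo : ∀ i, lo i < hi i) (g : ℕ → 𝓢(ℝ × ℝ, ℂ)) (p k : ℕ)
    {ε : ℕ → ℝ} (he : 0 < e) (he1 : e ≤ 1) (h0 : ∀ q, 0 ≤ ε q ∧ ε q ≤ 1) (h : ∀ q, p ≤ q → q < k → e ≤ ε q) :
    ∃ (C : ℝ) (M : ℕ), 0 ≤ C ∧ ∀ γ : Λ → ℝ, ‖amp hi lo O g p k ε γ‖ ≤ C * weight γ ^ M := by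
  obtain ⟨C, hC0, hC⟩ := (derivBound_smearProd Q (Finset.Ico p k) g (flowCoeff hi lo) (0 : Λ → ℝ) 0).2 0
  obtain ⟨C', M, hC0', hC'⟩ := polyBound_ampA hlo O (le_refl p) (le_refl k)
  refine ⟨C * (C' * (1 / e) ^ M), M, by positivity, fun γ => ?_⟩
  have h1 := hC γ 0 (by simp)
  simp only [iteratedDeriv_zero, smul_zero, add_zero, pow_zero, mul_one, inv_one,
    Finset.prod_const_one] at h1
  have hr := Q.reg_pos
  have h2 := hC' (ε, (fun i => (γ i : ℂ)), e)
    ⟨fun q => abs_le.2 ⟨by linarith [(h0 q).1], (h0 q).2⟩, he, he1, fun i j => by simp [hr.le],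
      fun i j hij hp hk => by simpa using h _ hp hk⟩
  simp only [Complex.ofReal_re] at h2
  rw [amp, norm_mul]
  calc _ ≤ C * (C' * (weight γ / e) ^ M) := mul_le_mul h1 h2 (norm_nonneg _) hC0
    _ = _ := by rw [div_pow, div_pow, one_pow]; ring

lemma weight_glue_le [Fintype {i // J i}] (γ : Λ → ℝ) (y : {i // J i} → ℝ) :
    weight (glue J γ y) ≤ weight γ * weight y := by
  classical
  have h1 : activePart (fun _ => 0) 0 (glue J γ y) = glue J γ y := by
    funext i; simp [activePart]
  have := weight_activePart_glue (hi := fun _ : Λ => 0) (p := 0) (J := J) (fun _ _ => le_rfl) γ y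
  rw [h1] at this
  rw [this]
  refine mul_le_mul_of_nonneg_right ?_ (weight_pos y).le
  refine Finset.prod_le_prod (fun i _ => ?_) fun i _ => ?_
  · have := Real.cosh_pos (γ i); split_ifs <;> linarith
  · have := Real.one_le_cosh (γ i); split_ifs <;> linarith

lemma weight_le_outerWeight [Fintype {i // J₁ i}] (h1 : ∀ i, J₁ i → p ≤ hi i)
    (hd : ∀ i, J₁ i → ¬ J₂ i) (γ : Λ → ℝ) (y : {i // J₁ i} → ℝ) :
    weight y ≤ outerWeight hi p J₂ (glue J₁ γ y) := by
  classical
  have h := weight_activePart_glue h1 γ y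
  have h2 : weight y ≤ outerWeight hi p J₁ γ * weight y := by
    refine le_mul_of_one_le_left (weight_pos y).le ?_
    refine Finset.one_le_prod fun i _ => ?_
    have := Real.one_le_cosh (γ i)
    split_ifs <;> simp [this]
  have h3 : weight y = ∏ i : Λ, if h : J₁ i then Real.cosh (y ⟨i, h⟩) else 1 := by
    have := weight_activePart_glue h1 (fun _ => (0 : ℝ)) y
    have h4 : outerWeight hi p J₁ (fun _ => (0 : ℝ)) = 1 := by simp [outerWeight]
    rw [h4, one_mul] at this
    rw [← this, weight]
    refine Finset.prod_congr rfl fun i _ => ?_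
    unfold activePart
    by_cases h : J₁ i
    · simp [h, h1 i h, glue_of_pos h]
    · simp [h, glue_of_neg h]
  rw [h3]
  refine Finset.prod_le_prod (fun i _ => ?_) fun i _ => ?_
  · split_ifs with h
    · exact (Real.cosh_pos _).le
    · exact zero_le_one
  · by_cases h : J₁ i
    · simp [h, h1 i h, hd i h, glue_of_pos h]
    · have := Real.one_le_cosh (glue J₁ γ y i)
      simp only [h, dif_neg, not_false_eq_true]
      split_ifs <;> simp [this]

open scoped Classical in
/-- The boundary values can be calculated by successive integrations, provided that the regulators
of the operators whose factors have been separated, and of those which could produce kinematic poles in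
the remaining variables, are strictly positive. -/
theorem integral_amp_mul_boundaryValue (g : ℕ → 𝓢(ℝ × ℝ, ℂ)) (hJ : Deformable hi lo p k J D)
    (hJ₂ : Deformable hi lo p' k J₂ D₂) (hpp : p ≤ p') (hpk : p' ≤ k)
    (h : ∀ i, J i ↔ J₁ i ∨ J₂ i) (hd : ∀ i, J₁ i → ¬ J₂ i) (h1 : ∀ i, J₁ i → p' ≤ hi i)
    (h2 : p' ≤ p ∨ ∀ i, J₂ i → p' ≤ lo i) (he : 0 < e) (he1 : e ≤ 1) {ε : ℕ → ℝ} (hε : ε ∈ regBox e (D ∪ D₂ ∪ Set.Ico p p')) (γ : Λ → ℝ) :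
    Integrable (fun b : {i // J₁ i} → ℝ => amp hi lo O g p p' ε (glue J₁ γ b) *
      boundaryValue hi lo O g p' k J₂ ε (glue J₁ γ b)) ∧
    ∫ b : {i // J₁ i} → ℝ, amp hi lo O g p p' ε (glue J₁ γ b) *
      boundaryValue hi lo O g p' k J₂ ε (glue J₁ γ b) = boundaryValue hi lo O g p k J ε γ := by
  set D' := D ∪ D₂ ∪ Set.Ico p p' with hD'
  have hsub : ∀ {e : ℝ} {ε : ℕ → ℝ}, ε ∈ regBox e D' → ε ∈ regBox e D ∧ ε ∈ regBox e D₂ := fun hε =>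
    ⟨fun q => ⟨(hε q).1, (hε q).2.1, fun hq => (hε q).2.2 (Or.inl (Or.inl hq))⟩,
      fun q => ⟨(hε q).1, (hε q).2.1, fun hq => (hε q).2.2 (Or.inl (Or.inr hq))⟩⟩
  obtain ⟨C, M, hC0, hC⟩ := exists_norm_amp_le (O := O) (ε := ε) hJ.lt g p p' he he1
    (fun q => ⟨(hε q).1, (hε q).2.1⟩) (fun q h1 h2 => (hε q).2.2 (Or.inr ⟨h1, h2⟩))
  obtain ⟨C', hC0', hC'⟩ := exists_norm_boundaryValue_le (p := p') g hJ₂ O he he1 (M + 1)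
  -- The regulators in `D'` are kept fixed, the other ones tend to their values from above.
  set εn : ℕ → ℕ → ℝ := fun n q => if q ∈ D' then ε q else max (ε q) (1 / ((n : ℝ) + 1)) with hεn
  have hεnmem : ∀ n, εn n ∈ regBox e D' := by
    intro n q
    have h0 := hε q
    have hn : 0 < 1 / ((n : ℝ) + 1) := by positivity
    have hn1 : 1 / ((n : ℝ) + 1) ≤ 1 := by rw [div_le_one (by positivity)]; linarith [(n.cast_nonneg : (0 : ℝ) ≤ n)]
    simp only [hεn]
    split_ifs with hq
    · exact ⟨h0.1, h0.2.1, h0.2.2⟩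
    · exact ⟨le_max_of_le_left h0.1, max_le h0.2.1 hn1, fun hq' => absurd hq' hq⟩
  have hεnpos : ∀ n q, 0 < εn n q := by
    intro n q
    simp only [hεn]
    split_ifs with hq
    · exact he.trans_le ((hε q).2.2 hq)
    · exact lt_max_of_lt_right (by positivity)
  have hεnlim : Tendsto εn atTop (𝓝 ε) := by
    refine tendsto_pi_nhds.2 fun q => ?_
    simp only [hεn]
    split_ifs with hq
    · exact tendsto_const_nhds
    · have := (tendsto_const_nhds (x := ε q)).max (tendsto_one_div_add_atTop_nhds_zero_nat (𝕜 := ℝ))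
      rwa [max_eq_left (hε q).1] at this
  have hamp : ∀ n γ, amp hi lo O g p p' (εn n) γ = amp hi lo O g p p' ε γ := fun n γ =>
    amp_congr_reg g (fun q h1 h2 => by simp only [hεn]; rw [if_pos (show q ∈ D' from Or.inr ⟨h1, h2⟩)]) γ
  have hbound : ∀ ε' ∈ regBox e D', ∀ b : {i // J₁ i} → ℝ, ‖amp hi lo O g p p' ε (glue J₁ γ b) *
      boundaryValue hi lo O g p' k J₂ ε' (glue J₁ γ b)‖ ≤ (C * weight γ ^ M * C') * (weight b)⁻¹ := by
    intro ε' hε' b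
    have hb := weight_pos b
    have hγ := weight_pos γ
    have h2 := weight_le_outerWeight (p := p') h1 hd γ b
    have h3 := weight_glue_le (J := J₁) γ b
    have h4 := weight_pos (glue J₁ γ b)
    rw [norm_mul]
    calc _ ≤ (C * weight (glue J₁ γ b) ^ M) * (C' / outerWeight hi p' J₂ (glue J₁ γ b) ^ (M + 1)) :=
          mul_le_mul (hC _) (hC' ε' (hsub hε').2 _) (norm_nonneg _) (by positivity)
      _ ≤ (C * (weight γ * weight b) ^ M) * (C' / outerWeight hi p' J₂ (glue J₁ γ b) ^ (M + 1)) := by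
          have := outerWeight_pos (hi := hi) (p := p') (J := J₂) (glue J₁ γ b)
          gcongr
      _ ≤ (C * (weight γ * weight b) ^ M) * (C' / weight b ^ (M + 1)) := by gcongr
      _ = _ := by rw [mul_pow, pow_succ]; field_simp
  have hmeas : ∀ ε', AEStronglyMeasurable (fun b : {i // J₁ i} → ℝ => amp hi lo O g p p' ε (glue J₁ γ b) *
      boundaryValue hi lo O g p' k J₂ ε' (glue J₁ γ b)) := fun ε' =>
    (((measurable_amp g ε).comp (measurable_glue_right γ)).mul
      ((measurable_boundaryValue g O ε').comp (measurable_glue_right γ))).aestronglyMeasurable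
  have hdom : Integrable fun b : {i // J₁ i} → ℝ => (C * weight γ ^ M * C') * (weight b)⁻¹ :=
    integrable_inv_weight.const_mul _
  refine ⟨hdom.mono' (hmeas ε) (Eventually.of_forall (hbound ε hε)), ?_⟩
  -- at positive regulators this is Fubini's theorem
  have hpos : ∀ n, ∫ b : {i // J₁ i} → ℝ, amp hi lo O g p p' ε (glue J₁ γ b) *
      boundaryValue hi lo O g p' k J₂ (εn n) (glue J₁ γ b) = boundaryValue hi lo O g p k J (εn n) γ := by
    intro n
    obtain ⟨hi1, hi2⟩ := boundaryValue_eq_integral g hJ O he he1 (hsub (hεnmem n)).1 (hεnpos n) γ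
    rw [hi2, (integral_split (sumSubtypeEquiv h hd) hi1).2]
    refine integral_congr_ae (Eventually.of_forall fun b => ?_)
    simp only [glue_glue]
    rw [(boundaryValue_eq_integral g hJ₂ O he he1 (hsub (hεnmem n)).2 (hεnpos n) _).2,
      ← integral_const_mul]
    refine integral_congr_ae (Eventually.of_forall fun y => ?_)
    simp only
    rw [← amp_mul_amp g hpp hpk, hamp]
    congr 1
    refine amp_congr hJ.lt g (fun i hi' => (glue_of_neg fun hi2 => ?_).symm)
    rcases h2 with h2 | h2
    · omega
    · have := h2 i hi2; omega
  have hl1 : Tendsto (fun n => boundaryValue hi lo O g p k J (εn n) γ) atTop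
      (𝓝 (boundaryValue hi lo O g p k J ε γ)) :=
    ((continuousOn_boundaryValue g hJ O he he1 γ) ε (hsub hε).1).tendsto.comp
      (tendsto_nhdsWithin_iff.2 ⟨hεnlim, Eventually.of_forall fun n => (hsub (hεnmem n)).1⟩)
  have hl2 : Tendsto (fun n => ∫ b : {i // J₁ i} → ℝ, amp hi lo O g p p' ε (glue J₁ γ b) *
      boundaryValue hi lo O g p' k J₂ (εn n) (glue J₁ γ b)) atTop
      (𝓝 (∫ b : {i // J₁ i} → ℝ, amp hi lo O g p p' ε (glue J₁ γ b) *
      boundaryValue hi lo O g p' k J₂ ε (glue J₁ γ b))) := by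
    refine tendsto_integral_of_dominated_convergence _ (fun n => hmeas (εn n)) hdom
      (fun n => Eventually.of_forall (hbound _ (hεnmem n))) (Eventually.of_forall fun b => ?_)
    exact (((continuousOn_boundaryValue g hJ₂ O he he1 _) ε (hsub hε).2).tendsto.comp
      (tendsto_nhdsWithin_iff.2 ⟨hεnlim, Eventually.of_forall fun n => (hsub (hεnmem n)).2⟩)).const_mul _
  simp only [hpos] at hl2
  exact tendsto_nhds_unique hl2 hl1

end boundaryValue

/-! ### Products over pairs and the symmetry of the form factors -/

/-- A product over all pairs depends only on the products over the two orderings of each pair. -/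
lemma prod_prod_eq_of_pairs {ι M : Type*} [CommMonoid M] (s : Finset ι) {f g : ι → ι → M}
    (h : ∀ x y, x ≠ y → f x y * f y x = g x y * g y x) (h0 : ∀ x, f x x = g x x) :
    ∏ x ∈ s, ∏ y ∈ s, f x y = ∏ x ∈ s, ∏ y ∈ s, g x y := by
  classical
  induction s using Finset.induction_on with
  | empty => simp
  | insert a s ha ih =>
    have key : ∀ f : ι → ι → M, ∏ x ∈ insert a s, ∏ y ∈ insert a s, f x y =
        f a a * (∏ y ∈ s, f a y * f y a) * ∏ x ∈ s, ∏ y ∈ s, f x y := by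
      intro f
      simp only [Finset.prod_insert ha, Finset.prod_mul_distrib]
      simp only [mul_assoc]
    rw [key, key, ih, h0]
    congr 2
    refine Finset.prod_congr rfl fun y hy => h a y ?_
    rintro rfl; exact ha hy

/-- If exactly one of two conditions holds, the product of the conditional factors is their common
value. -/
lemma ite_mul_ite_of_iff_not {M : Type*} [MulOneClass M] {a b : Prop} [Decidable a] [Decidable b]
    {u v : M} (hb : b ↔ ¬ a) (huv : u = v) : (if a then u else 1) * (if b then v else 1) = u := by
  by_cases h : a <;> simp [h, hb, huv]

section KT
variable {Q : Model}

/-- The factor of the `K`-transform attached to a pair of rapidities. -/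
def kFactor (Q : Model) (l l' : Fin 2) (x : ℂ) : ℂ :=
  1 - Complex.I * ((((l : ℕ) : ℂ) - ((l' : ℕ) : ℂ)) * (Q.sinB : ℂ)) / Complex.sinh x

lemma kFactor_neg (l l' : Fin 2) (x : ℂ) : kFactor Q l l' (-x) = kFactor Q l' l x := by
  rw [kFactor, kFactor, Complex.sinh_neg, div_neg]
  ring

/-- The `K`-transform of a local operator at a family of rapidities indexed by a finite type. -/
def kTr (O : LocalOperator Q) {T : Type*} [Fintype T] (β : T → ℂ) : ℂ :=
  Q.kTransform (O.p (Fintype.card T)) (β ∘ (Fintype.equivFin T).symm)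

lemma kTransform_comp_perm (O : LocalOperator Q) {n : ℕ} (β : Fin n → ℂ) (σ : Equiv.Perm (Fin n)) :
    Q.kTransform (O.p n) (β ∘ σ) = Q.kTransform (O.p n) β := by
  unfold Model.kTransform
  rw [← (Equiv.arrowCongr σ.symm (Equiv.refl (Fin 2))).sum_comp]
  refine Finset.sum_congr rfl fun l _ => ?_
  have e : (Equiv.arrowCongr σ.symm (Equiv.refl (Fin 2))) l = l ∘ σ := rfl
  rw [e, O.symmetric]
  congr 1
  congr 1
  · congr 1
    exact Equiv.sum_comp σ fun a => (l a : ℕ)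
  · rw [← Equiv.prod_comp σ (fun k => ∏ s, if k < s then
      1 - Complex.I * ((((l k : ℕ) : ℂ) - ((l s : ℕ) : ℂ)) * (Q.sinB : ℂ)) /
        Complex.sinh (β k - β s) else 1)]
    simp only [← Equiv.prod_comp σ (fun s => if σ _ < s then _ else _)]
    refine prod_prod_eq_of_pairs _ (fun x y hxy => ?_) (fun x => by simp)
    have hs : σ x ≠ σ y := fun h => hxy (σ.injective h)
    have hk := kFactor_neg (Q := Q) (l (σ y)) (l (σ x)) (β (σ x) - β (σ y))
    rw [neg_sub] at hk
    have t1 : y < x ↔ ¬ x < y := ⟨fun h => h.not_gt, fun h => lt_of_le_of_ne (not_lt.1 h) hxy.symm⟩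
    have t2 : σ y < σ x ↔ ¬ σ x < σ y :=
      ⟨fun h => h.not_gt, fun h => lt_of_le_of_ne (not_lt.1 h) hs.symm⟩
    exact (ite_mul_ite_of_iff_not t1 hk.symm).trans (ite_mul_ite_of_iff_not t2 hk.symm).symm

lemma kTransform_comp_equiv (O : LocalOperator Q) {T : Type*} [Fintype T] (β : T → ℂ) {n : ℕ}
    (e : Fin n ≃ T) : Q.kTransform (O.p n) (β ∘ e) = kTr O β := by
  have hn : n = Fintype.card T := by simpa using Fintype.card_congr e
  subst hn
  have := kTransform_comp_perm O (β ∘ (Fintype.equivFin T).symm) (e.trans (Fintype.equivFin T))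
  rw [kTr, ← this]
  congr 1
  funext i
  simp

lemma kTr_comp_equiv (O : LocalOperator Q) {T T' : Type*} [Fintype T] [Fintype T'] (β : T → ℂ)
    (e : T' ≃ T) : kTr O (β ∘ e) = kTr O β := by
  rw [← kTransform_comp_equiv O β ((Fintype.equivFin T').symm.trans e)]
  rfl

open scoped Classical in
/-- At rapidities which differ from each other, the regularised form factor is the product of the
factors `F` and the symmetric `K`-transform. -/
lemma ffReg_eq (O : LocalOperator Q) {T : Type*} [Fintype T] {bef : T → T → Prop} {β : T → ℂ}
    (h0 : ∀ x, ¬ bef x x) (h1 : ∀ x y, x ≠ y → bef x y ∨ bef y x) (h2 : ∀ x y, bef x y → ¬ bef y x)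
    (hβ : ∀ x y, x ≠ y → Complex.sinh (β x - β y) ≠ 0) :
    ffReg O bef β = (∏ x, ∏ y, if bef x y then Q.minimalFF (β x - β y) else 1) * kTr O β := by
  unfold ffReg kTr Model.kTransform
  set e := Fintype.equivFin T with he
  rw [Finset.mul_sum, ← (Equiv.arrowCongr e.symm (Equiv.refl (Fin 2))).sum_comp]
  refine Finset.sum_congr rfl fun l _ => ?_
  have e1 : (Equiv.arrowCongr e.symm (Equiv.refl (Fin 2))) l = l ∘ e := rfl
  rw [e1, Function.comp_assoc, Equiv.self_comp_symm, Function.comp_id]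
  have e2 : ∑ x, ((l ∘ e) x : ℕ) = ∑ a, (l a : ℕ) := Equiv.sum_comp e fun a => (l a : ℕ)
  have e3 : (∏ x, ∏ y, if bef x y then Q.twoBody ((l ∘ e) x) ((l ∘ e) y) (β x - β y) else 1) =
      (∏ x, ∏ y, if bef x y then Q.minimalFF (β x - β y) else 1) *
        ∏ x, ∏ y, if bef x y then kFactor Q ((l ∘ e) x) ((l ∘ e) y) (β x - β y) else 1 := by
    simp only [← Finset.prod_mul_distrib]
    refine Finset.prod_congr rfl fun x _ => Finset.prod_congr rfl fun y _ => ?_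
    split_ifs with hb
    · have hxy : x ≠ y := by rintro rfl; exact h0 x hb
      rw [Q.twoBody_eq (hβ x y hxy)]
      rfl
    · simp
  have e4 : (∏ x, ∏ y, if bef x y then kFactor Q ((l ∘ e) x) ((l ∘ e) y) (β x - β y) else 1) =
      ∏ k, ∏ s, if k < s then
        1 - Complex.I * ((((l k : ℕ) : ℂ) - ((l s : ℕ) : ℂ)) * (Q.sinB : ℂ)) /
          Complex.sinh ((β ∘ e.symm) k - (β ∘ e.symm) s) else 1 := by
    rw [← Equiv.prod_comp e]
    simp only [← Equiv.prod_comp e (fun s => if e _ < s then _ else _)]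
    refine prod_prod_eq_of_pairs _ (fun x y hxy => ?_) (fun x => by simp [h0])
    have hs : e x ≠ e y := fun h => hxy (e.injective h)
    have hk := kFactor_neg (Q := Q) (l (e y)) (l (e x)) (β x - β y)
    rw [neg_sub] at hk
    simp only [Function.comp_apply, Equiv.symm_apply_apply]
    have t1 : bef y x ↔ ¬ bef x y := ⟨h2 _ _, fun h => (h1 x y hxy).resolve_left h⟩
    have t2 : e y < e x ↔ ¬ e x < e y :=
      ⟨fun h => h.not_gt, fun h => lt_of_le_of_ne (not_lt.1 h) hs.symm⟩
    exact (ite_mul_ite_of_iff_not t1 hk.symm).trans (ite_mul_ite_of_iff_not t2 hk.symm).symm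
  rw [e2, e3, e4]
  ring

end KT

/-! ### The normal form of the amplitudes -/

section PairFactors
variable {M : Type*} [CommMonoid M]

/-- The factors of the amplitude of the operators `p, p + 1, …` attached to an ordered pair of particles,
absorbed at `h`, `h'` and emitted at `l`, `l'`, the numbers `r`, `r'` deciding the order of
particles with the same end points: `f` stands for `F(x)`, `u` for `F(x + iπ - iε_h)` and `s` for `S(x)`,
`x` being the difference of the rapidities. -/
def pairAmp (p h l r h' l' r' : ℕ) (f u s : M) : M :=
  (if p ≤ h ∧ p ≤ h' ∧ l < p ∧ l' < p ∧ (h' < h ∨ h = h' ∧ (l < l' ∨ l = l' ∧ r < r')) then f else 1) *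
    (if p ≤ h ∧ h = l' then u else 1) *
    (if p ≤ h ∧ h = h' ∧ (l' < l ∨ l = l' ∧ r' < r) then f else 1) *
    (if p ≤ l ∧ l = l' ∧ (h' < h ∨ h = h' ∧ r < r') then f else 1) *
    (if p ≤ l ∧ l' < l ∧ l < h' ∧ h' < h then s else 1)

/-- The normal form of `pairAmp`, which does not refer to an order of the particles with the same end
points. The levels `l`, `l'` are to be replaced by `0` where they are smaller than `p`. -/
def pairNormal (p h l h' l' : ℕ) (f u s : M) : M :=
  (if p ≤ h ∧ p ≤ h' ∧ ((h = h' ∧ l' ≤ l) ∨ (l = l' ∧ h' < h)) then f else 1) *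
    (if p ≤ h ∧ h = l' then u else 1) *
    (if p ≤ l ∧ l' < l ∧ l < h' ∧ h' < h then s else 1)

/-- Replace the levels smaller than `p` by `0`. -/
def truncLevel (p l : ℕ) : ℕ := if l < p then 0 else l

lemma pairAmp_mul_pairAmp_aux {p h l r h' l' r' : ℕ} (hp : 1 ≤ p) (hl : l < h) (hl' : l' < h')
    (hr : r ≠ r') (f u s f' u' s' : M) (hh : h' ≤ h) :
    pairAmp p h l r h' l' r' f u s * pairAmp p h' l' r' h l r f' u' s' =
      pairNormal p h (truncLevel p l) h' (truncLevel p l') f u s *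
        pairNormal p h' (truncLevel p l') h (truncLevel p l) f' u' s' := by
  obtain ⟨t, ht, htl⟩ : ∃ t, truncLevel p l = t ∧ (l < p ∧ t = 0 ∨ p ≤ l ∧ t = l) := by
    unfold truncLevel; split_ifs <;> exact ⟨_, rfl, by omega⟩
  obtain ⟨t', ht', htl'⟩ : ∃ t, truncLevel p l' = t ∧ (l' < p ∧ t = 0 ∨ p ≤ l' ∧ t = l') := by
    unfold truncLevel; split_ifs <;> exact ⟨_, rfl, by omega⟩
  rw [ht, ht']
  unfold pairAmp pairNormal
  rcases lt_or_ge h' p with h1 | h1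
  · simp (discharger := omega) only [if_neg, mul_one]
  rcases hh.eq_or_lt with h2 | h2
  · rcases htl with ⟨a, a'⟩ | ⟨a, a'⟩ <;> rcases htl' with ⟨b, b'⟩ | ⟨b, b'⟩
    · rcases lt_trichotomy l l' with c | c | c <;> rcases lt_or_gt_of_ne hr with d | d <;>
      simp (discharger := omega) only [if_neg, if_pos, one_mul, mul_one]
    · simp (discharger := omega) only [if_neg, if_pos, one_mul, mul_one]
    · simp (discharger := omega) only [if_neg, if_pos, one_mul, mul_one]
    · rcases lt_trichotomy t t' with c | c | c <;> rcases lt_or_gt_of_ne hr with d | d <;>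
      simp (discharger := omega) only [if_neg, if_pos, one_mul, mul_one]
  · rcases htl with ⟨a, a'⟩ | ⟨a, a'⟩ <;> rcases htl' with ⟨b, b'⟩ | ⟨b, b'⟩
    · simp (discharger := omega) only [if_neg, if_pos, mul_one]
    · simp (discharger := omega) only [if_neg, mul_one]
    · rcases lt_trichotomy h' t with c | c | c <;>
      simp (discharger := omega) only [if_neg, if_pos, one_mul, mul_one]
    · rcases lt_trichotomy h' t with c | c | c <;> rcases lt_trichotomy t t' with d | d | d <;>
      simp (discharger := omega) only [if_neg, if_pos, one_mul, mul_one]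

lemma pairAmp_mul_pairAmp {p h l r h' l' r' : ℕ} (hp : 1 ≤ p) (hl : l < h) (hl' : l' < h')
    (hr : r ≠ r') (f u s f' u' s' : M) :
    pairAmp p h l r h' l' r' f u s * pairAmp p h' l' r' h l r f' u' s' =
      pairNormal p h (truncLevel p l) h' (truncLevel p l') f u s *
        pairNormal p h' (truncLevel p l') h (truncLevel p l) f' u' s' := by
  rcases le_total h' h with h1 | h1
  · exact pairAmp_mul_pairAmp_aux hp hl hl' hr f u s f' u' s' h1
  · rw [mul_comm, mul_comm (pairNormal _ _ _ _ _ _ _ _)]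
    exact pairAmp_mul_pairAmp_aux hp hl' hl hr.symm f' u' s' f u s h1

lemma pairAmp_self {p h l r : ℕ} (hl : l < h) (f u s : M) : pairAmp p h l r h l r f u s = 1 := by
  unfold pairAmp
  simp (discharger := omega) only [if_neg, one_mul]

end PairFactors

lemma sinh_ofReal_add_ne_zero {x t : ℝ} (hx : x ≠ 0) :
    Complex.sinh ((x : ℂ) + Complex.I * t) ≠ 0 := by
  intro h
  have h1 := congrArg Complex.re h
  have h2 := congrArg Complex.im h
  rw [mul_comm, Complex.sinh_add, Complex.sinh_mul_I, Complex.cosh_mul_I] at h1 h2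
  simp only [← Complex.ofReal_sinh, ← Complex.ofReal_cosh, ← Complex.ofReal_sin,
    ← Complex.ofReal_cos, Complex.add_re, Complex.add_im, Complex.mul_re, Complex.mul_im,
    Complex.ofReal_re, Complex.ofReal_im, Complex.I_re, Complex.I_im, Complex.zero_re,
    Complex.zero_im] at h1 h2
  have h3 : Real.sinh x ≠ 0 := Real.sinh_ne_zero.2 hx
  have h4 : Real.cosh x ≠ 0 := (Real.cosh_pos x).ne'
  have h5 : Real.cos t = 0 := by
    have : Real.sinh x * Real.cos t = 0 := by linarith
    exact (mul_eq_zero.1 this).resolve_left h3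
  have h6 : Real.sin t = 0 := by
    have : Real.cosh x * Real.sin t = 0 := by linarith
    exact (mul_eq_zero.1 this).resolve_left h4
  have := Real.sin_sq_add_cos_sq t
  rw [h5, h6] at this
  norm_num at this

section Normal
variable {Q : Model} {Λ : Type*} [Fintype Λ] {hi lo : Λ → ℕ}

/-- The numbering of the particles which decides the order of particles with the same end points. -/
def rank (i : Λ) : ℕ := Fintype.equivFin Λ i

lemma rank_ne {i j : Λ} (h : i ≠ j) : rank i ≠ rank j := fun h1 =>
  h ((Fintype.equivFin Λ).injective (Fin.ext h1))

open scoped Classical in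
lemma ffAt_eq (hlo : ∀ i, lo i < hi i) (O : LocalOperator Q) (q : ℕ) (e : ℝ) {γ : Λ → ℝ}
    (hγ : Function.Injective γ) :
    ffAt hi lo O q e (fun i => (γ i : ℂ)) = (∏ i, ∏ j,
      (if hi i = q ∧ lo j = q then Q.minimalFF ((γ i : ℂ) - γ j + Complex.I * (Real.pi - e)) else 1) *
      (if hi i = q ∧ hi j = q ∧ (lo j < lo i ∨ lo i = lo j ∧ rank j < rank i) then
        Q.minimalFF ((γ i : ℂ) - γ j) else 1) *
      (if lo i = q ∧ lo j = q ∧ (hi j < hi i ∨ hi i = hi j ∧ rank i < rank j) then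
        Q.minimalFF ((γ i : ℂ) - γ j) else 1)) *
      kTr O (legRap hi lo q e fun i => (γ i : ℂ)) := by
  have hrk : ∀ i j : Λ, Fintype.equivFin Λ i < Fintype.equivFin Λ j ↔ rank i < rank j := fun i j =>
    Iff.rfl
  have hb : ∀ i j : Λ, before hi lo q i j ↔ (hi i = q ∧ lo j = q) ∨
      (hi i = q ∧ hi j = q ∧ (lo j < lo i ∨ lo i = lo j ∧ rank j < rank i)) ∨
      (lo i = q ∧ lo j = q ∧ (hi j < hi i ∨ hi i = hi j ∧ rank i < rank j)) := fun i j => by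
    unfold before; simp only [hrk]
  rw [ffAt, ffReg_eq]
  · congr 1
    have step : ∀ i j : Λ, (if before hi lo q i j then Q.minimalFF
        (((γ i : ℂ) + if hi i = q then Complex.I * (Real.pi - e) else 0) -
          ((γ j : ℂ) + if hi j = q then Complex.I * (Real.pi - e) else 0)) else 1) =
      (if hi i = q ∧ lo j = q then Q.minimalFF ((γ i : ℂ) - γ j + Complex.I * (Real.pi - e)) else 1) *
      (if hi i = q ∧ hi j = q ∧ (lo j < lo i ∨ lo i = lo j ∧ rank j < rank i) then
        Q.minimalFF ((γ i : ℂ) - γ j) else 1) *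
      (if lo i = q ∧ lo j = q ∧ (hi j < hi i ∨ hi i = hi j ∧ rank i < rank j) then
        Q.minimalFF ((γ i : ℂ) - γ j) else 1) := by
      intro i j
      have a := hlo i
      have b := hlo j
      have hb' := hb i j
      by_cases c1 : hi i = q ∧ lo j = q
      · rw [if_pos (hb'.2 (Or.inl c1)), if_pos c1, if_pos c1.1, if_neg (show ¬ hi j = q by omega),
          if_neg (by omega), if_neg (by omega), mul_one, mul_one]
        congr 1; ring
      by_cases c2 : hi i = q ∧ hi j = q ∧ (lo j < lo i ∨ lo i = lo j ∧ rank j < rank i)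
      · rw [if_pos (hb'.2 (Or.inr (Or.inl c2))), if_neg c1, if_pos c2, if_pos c2.1, if_pos c2.2.1,
          if_neg (by omega), mul_one, one_mul]
        congr 1; ring
      by_cases c3 : lo i = q ∧ lo j = q ∧ (hi j < hi i ∨ hi i = hi j ∧ rank i < rank j)
      · rw [if_pos (hb'.2 (Or.inr (Or.inr c3))), if_neg c1, if_neg c2, if_pos c3,
          if_neg (show ¬ hi i = q by omega), if_neg (show ¬ hi j = q by omega), one_mul, one_mul]
        congr 1; ring
      · rw [if_neg (by rw [hb']; tauto), if_neg c1, if_neg c2, if_neg c3, one_mul, one_mul]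
    refine Fintype.prod_of_injective Subtype.val Subtype.val_injective _ _ (fun i hi' => ?_)
      fun x => Fintype.prod_of_injective Subtype.val Subtype.val_injective _ _ (fun j hj => ?_)
        fun y => ?_
    · refine Finset.prod_eq_one fun j _ => ?_
      rw [← step, if_neg]
      rw [hb]
      intro h
      exact hi' ⟨⟨i, by omega⟩, rfl⟩
    · rw [← step, if_neg]
      rw [hb]
      intro h
      exact hj ⟨⟨j, by omega⟩, rfl⟩
    · rw [← step]
      rfl
  · intro x
    rw [hb]
    have := hlo x
    omega
  · intro x y hxy
    have h0 := rank_ne (fun h => hxy (Subtype.ext h) : (x : Λ) ≠ y)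
    rw [hb, hb]
    rcases x.2 with hx | hx <;> rcases y.2 with hy | hy
    · rcases lt_trichotomy (lo x) (lo y) with h | h | h
      · exact Or.inr (Or.inr (Or.inl ⟨hy, hx, Or.inl h⟩))
      · rcases lt_or_gt_of_ne h0 with h1 | h1
        · exact Or.inr (Or.inr (Or.inl ⟨hy, hx, Or.inr ⟨h.symm, h1⟩⟩))
        · exact Or.inl (Or.inr (Or.inl ⟨hx, hy, Or.inr ⟨h, h1⟩⟩))
      · exact Or.inl (Or.inr (Or.inl ⟨hx, hy, Or.inl h⟩))
    · exact Or.inl (Or.inl ⟨hx, hy⟩)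
    · exact Or.inr (Or.inl ⟨hy, hx⟩)
    · rcases lt_trichotomy (hi x) (hi y) with h | h | h
      · exact Or.inr (Or.inr (Or.inr ⟨hy, hx, Or.inl h⟩))
      · rcases lt_or_gt_of_ne h0 with h1 | h1
        · exact Or.inl (Or.inr (Or.inr ⟨hx, hy, Or.inr ⟨h, h1⟩⟩))
        · exact Or.inr (Or.inr (Or.inr ⟨hy, hx, Or.inr ⟨h.symm, h1⟩⟩))
      · exact Or.inl (Or.inr (Or.inr ⟨hx, hy, Or.inl h⟩))
  · intro x y
    have := hlo x; have := hlo y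
    rw [hb, hb]
    rintro (h | h | h) (h' | h' | h') <;> omega
  · intro x y hxy
    have hne : γ x - γ y ≠ 0 := sub_ne_zero.2 (hγ.ne fun h => hxy (Subtype.ext h))
    have key := sinh_ofReal_add_ne_zero (t := (if hi (x : Λ) = q then Real.pi - e else 0) -
      (if hi (y : Λ) = q then Real.pi - e else 0)) hne
    convert key using 2
    unfold legRap
    push_cast
    split_ifs <;> push_cast <;> ring

lemma prod_Ico_ite_eq_and {M : Type*} [CommMonoid M] (p k a : ℕ) (P : ℕ → Prop) [DecidablePred P]
    (f : ℕ → M) (ha : a < k) :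
    (∏ q ∈ Finset.Ico p k, if a = q ∧ P q then f q else 1) = if p ≤ a ∧ P a then f a else 1 := by
  have : ∀ q, (if a = q ∧ P q then f q else 1) = if a = q then (if P q then f q else 1) else 1 :=
    fun q => by by_cases h : a = q <;> simp [h]
  simp only [this, Finset.prod_ite_eq, Finset.mem_Ico, ha, and_true]
  by_cases h : p ≤ a <;> simp [h]

open scoped Classical in
/-- The product of the factors `F` of the particles which are emitted below `p`, ordered as the
absorbed particles of an operator to the left of `p`. -/
def extFactor (hi lo : Λ → ℕ) (Q : Model) (p : ℕ) (γ : Λ → ℝ) : ℂ :=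
  ∏ i, ∏ j, if p ≤ hi i ∧ p ≤ hi j ∧ lo i < p ∧ lo j < p ∧
      (hi j < hi i ∨ hi i = hi j ∧ (lo i < lo j ∨ lo i = lo j ∧ rank i < rank j)) then
    Q.minimalFF ((γ i : ℂ) - γ j) else 1

open scoped Classical in
/-- At rapidities which differ from each other, the amplitude depends on the levels below `p` and on the
numbering of the particles only through the factor `extFactor`. -/
lemma extFactor_mul_ampA (hlo : ∀ i, lo i < hi i) (O : ℕ → LocalOperator Q) {p k : ℕ} (hp : 1 ≤ p)
    (hhi : ∀ i, hi i < k) (ε : ℕ → ℝ) {γ : Λ → ℝ} (hγ : Function.Injective γ) :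
    extFactor hi lo Q p γ * ampA hi lo O p k ε (fun i => (γ i : ℂ)) =
      (∏ i, ∏ j, if i = j then 1 else pairNormal p (hi i) (truncLevel p (lo i)) (hi j)
        (truncLevel p (lo j)) (Q.minimalFF ((γ i : ℂ) - γ j))
        (Q.minimalFF ((γ i : ℂ) - γ j + Complex.I * (Real.pi - ε (hi i)))) (Q.S ((γ i : ℂ) - γ j))) *
      ∏ q ∈ Finset.Ico p k, kTr (O q) (legRap hi lo q (ε q) fun i => (γ i : ℂ)) := by
  unfold ampA crossAt
  simp only [ffAt_eq hlo _ _ _ hγ]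
  have e1 : ∀ a b c : ℂ, a * b * c = (a * c) * b := fun a b c => by ring
  simp only [e1 _ (kTr _ _) _]
  rw [Finset.prod_mul_distrib, ← mul_assoc]
  congr 1
  simp only [← Finset.prod_mul_distrib]
  rw [Finset.prod_comm]
  simp only [Finset.prod_comm (s := Finset.Ico p k)]
  unfold extFactor
  simp only [← Finset.prod_mul_distrib]
  have e2 : ∀ i j : Λ, (if p ≤ hi i ∧ p ≤ hi j ∧ lo i < p ∧ lo j < p ∧
      (hi j < hi i ∨ hi i = hi j ∧ (lo i < lo j ∨ lo i = lo j ∧ rank i < rank j)) then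
        Q.minimalFF ((γ i : ℂ) - γ j) else 1) * ∏ q ∈ Finset.Ico p k,
      ((if hi i = q ∧ lo j = q then Q.minimalFF ((γ i : ℂ) - γ j + Complex.I * (Real.pi - ε q)) else 1) *
      (if hi i = q ∧ hi j = q ∧ (lo j < lo i ∨ lo i = lo j ∧ rank j < rank i) then
        Q.minimalFF ((γ i : ℂ) - γ j) else 1) *
      (if lo i = q ∧ lo j = q ∧ (hi j < hi i ∨ hi i = hi j ∧ rank i < rank j) then
        Q.minimalFF ((γ i : ℂ) - γ j) else 1) *
      (if lo i = q ∧ lo j < q ∧ q < hi j ∧ hi j < hi i then Q.S ((γ i : ℂ) - γ j) else 1)) =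
      pairAmp p (hi i) (lo i) (rank i) (hi j) (lo j) (rank j) (Q.minimalFF ((γ i : ℂ) - γ j))
        (Q.minimalFF ((γ i : ℂ) - γ j + Complex.I * (Real.pi - ε (hi i)))) (Q.S ((γ i : ℂ) - γ j)) := by
    intro i j
    have hi1 := hhi i
    have hi2 : lo i < k := (hlo i).trans hi1
    simp only [Finset.prod_mul_distrib]
    rw [prod_Ico_ite_eq_and p k (hi i) (fun q => lo j = q) _ hi1,
      prod_Ico_ite_eq_and p k (hi i) (fun q => hi j = q ∧ (lo j < lo i ∨ lo i = lo j ∧ rank j < rank i))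
        _ hi1,
      prod_Ico_ite_eq_and p k (lo i) (fun q => lo j = q ∧ (hi j < hi i ∨ hi i = hi j ∧ rank i < rank j))
        _ hi2,
      prod_Ico_ite_eq_and p k (lo i) (fun q => lo j < q ∧ q < hi j ∧ hi j < hi i) _ hi2]
    unfold pairAmp
    simp only [eq_comm (a := lo j), eq_comm (a := hi j), ← mul_assoc]
  simp only [e2]
  refine prod_prod_eq_of_pairs _ (fun x y hxy => ?_) fun x => ?_
  · rw [if_neg hxy, if_neg hxy.symm]
    exact pairAmp_mul_pairAmp hp (hlo x) (hlo y) (rank_ne hxy) _ _ _ _ _ _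
  · rw [if_pos rfl]
    exact pairAmp_self (hlo x) _ _ _

end Normal

/-! ### The kernel of a single operator -/

section StagePair

/-- The factors of the operator `p` attached to an ordered pair of particles, including those of `extFactor`. -/
def stageAmp (p h l r h' l' r' : ℕ) (f u s : ℂ) : ℂ :=
  (if p ≤ h ∧ p ≤ h' ∧ l < p ∧ l' < p ∧ (h' < h ∨ h = h' ∧ (l < l' ∨ l = l' ∧ r < r')) then f else 1) *
    (if h = p ∧ l' = p then u else 1) *
    (if h = p ∧ h' = p ∧ (l' < l ∨ l = l' ∧ r' < r) then f else 1) *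
    (if l = p ∧ l' = p ∧ (h' < h ∨ h = h' ∧ r < r') then f else 1) *
    (if l = p ∧ l' < p ∧ p < h' ∧ h' < h then s else 1)

/-- The normal form of `stageAmp`, up to the factors in `extFactor` of the next operator. -/
def stageNormal (p h l r h' l' r' : ℕ) (f u : ℂ) : ℂ :=
  (if h = p ∧ h' = p then f else 1) * (if (p < h ∧ l < p) ∧ h' = p then f else 1) *
    (if h = p ∧ l' = p then u else 1) * (if (p < h ∧ l < p) ∧ l' = p then f⁻¹ else 1) *
    (if p + 1 ≤ h ∧ p + 1 ≤ h' ∧ l < p + 1 ∧ l' < p + 1 ∧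
      (h' < h ∨ h = h' ∧ (l < l' ∨ l = l' ∧ r < r')) then f else 1)

lemma stageAmp_mul_stageAmp {p h l r h' l' r' : ℕ} (hl : l < h) (hl' : l' < h')
    (hr : r ≠ r') {f u s f' u' s' : ℂ} (h1 : f ≠ 0) (h2 : f' ≠ 0) (h3 : f = s * f') (h4 : f' = s' * f) :
    stageAmp p h l r h' l' r' f u s * stageAmp p h' l' r' h l r f' u' s' =
      stageNormal p h l r h' l' r' f u * stageNormal p h' l' r' h l r f' u' := by
  unfold stageAmp stageNormal
  have t : ∀ h l : ℕ, l < h → h < p ∨ p < l ∨ h = p ∧ l < p ∨ (p < h ∧ l < p) ∨ l = p ∧ p < h := by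
    intro h l; omega
  rcases t h l hl with a | a | a | a | a
  · simp (discharger := omega) only [if_neg]
  · simp (discharger := omega) only [if_neg]
  · rcases t h' l' hl' with b | b | b | b | b
    · simp (discharger := omega) only [if_neg, mul_one]
    · simp (discharger := omega) only [if_neg, mul_one]
    · rcases lt_trichotomy l l' with c | c | c <;> rcases lt_or_gt_of_ne hr with d | d <;>
      simp (discharger := omega) only [if_neg, if_pos, one_mul, mul_one]
    · simp (discharger := omega) only [if_neg, if_pos, one_mul, mul_one]
    · simp (discharger := omega) only [if_neg, if_pos, one_mul, mul_one]
  · rcases t h' l' hl' with b | b | b | b | b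
    · simp (discharger := omega) only [if_neg, mul_one]
    · simp (discharger := omega) only [if_neg, mul_one]
    · simp (discharger := omega) only [if_neg, if_pos, one_mul, mul_one]
    · rcases lt_trichotomy h h' with e | e | e <;>
      rcases lt_trichotomy l l' with c | c | c <;> rcases lt_or_gt_of_ne hr with d | d <;>
      simp (discharger := omega) only [if_neg, if_pos, one_mul, mul_one]
    · rcases lt_trichotomy h h' with e | e | e <;>
      simp (discharger := omega) only [if_neg, if_pos, one_mul, mul_one]
      · field_simp
        exact h4.symm
      · field_simp
      · field_simp
  · rcases t h' l' hl' with b | b | b | b | b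
    · simp (discharger := omega) only [if_neg, mul_one]
    · simp (discharger := omega) only [if_neg, mul_one]
    · simp (discharger := omega) only [if_neg, if_pos, one_mul, mul_one]
    · rcases lt_trichotomy h h' with e | e | e <;>
      simp (discharger := omega) only [if_neg, if_pos, one_mul, mul_one]
      · field_simp
      · field_simp
      · field_simp
        exact h3.symm
    · rcases lt_trichotomy h h' with e | e | e <;> rcases lt_or_gt_of_ne hr with d | d <;>
      simp (discharger := omega) only [if_neg, if_pos, one_mul, mul_one]

lemma stageAmp_self {p h l r : ℕ} (hl : l < h) (f u s : ℂ) : stageAmp p h l r h l r f u s = 1 := by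
  unfold stageAmp
  simp (discharger := omega) only [if_neg, one_mul]

end StagePair

section StageKernel
variable {Q : Model} {Λ : Type*} [Fintype Λ]

open scoped Classical in
/-- The kernel of the operator `O`, smeared with `g`, with absorbed particles `X`, emitted particles
`Z` and spectators `Y`. -/
def stageKernel (O : LocalOperator Q) (g : 𝓢(ℝ × ℝ, ℂ)) (X Y Z : Λ → Prop) (e : ℝ) (γ : Λ → ℝ) : ℂ :=
  (∏ i, ∏ j, if i = j then 1 else
    (if X i ∧ X j then Q.minimalFF ((γ i : ℂ) - γ j) else 1) *
    (if Y i ∧ X j then Q.minimalFF ((γ i : ℂ) - γ j) else 1) *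
    (if X i ∧ Z j then Q.minimalFF ((γ i : ℂ) - γ j + Complex.I * (Real.pi - e)) else 1) *
    (if Y i ∧ Z j then (Q.minimalFF ((γ i : ℂ) - γ j))⁻¹ else 1)) *
  kTr O (fun i : {i // X i ∨ Z i} => (γ i : ℂ) + if X i then Complex.I * (Real.pi - e) else 0) *
  momentumTransform g (∑ i, ((if X i then 1 else 0) - (if Z i then 1 else 0) : ℝ) • Q.momentum (γ i))

/-- The amplitude of a single operator in terms of its kernel. -/
lemma extFactor_mul_amp_succ {hi lo : Λ → ℕ} (hlo : ∀ i, lo i < hi i) (O : ℕ → LocalOperator Q)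
    (g : ℕ → 𝓢(ℝ × ℝ, ℂ)) (p : ℕ) (ε : ℕ → ℝ) {γ : Λ → ℝ} (hγ : Function.Injective γ) :
    extFactor hi lo Q p γ * amp hi lo O g p (p + 1) ε γ =
      stageKernel (O p) (g p) (fun i => hi i = p) (fun i => p < hi i ∧ lo i < p) (fun i => lo i = p)
        (ε p) γ * extFactor hi lo Q (p + 1) γ := by
  classical
  unfold amp ampA ampH Model.smearProd stageKernel crossAt
  rw [Nat.Ico_succ_singleton]
  simp only [Finset.prod_singleton]
  rw [ffAt_eq hlo _ _ _ hγ]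
  have e1 : ∀ E m P K C : ℂ, E * (m * (P * K * C)) = (E * P * C) * K * m := fun _ _ _ _ _ => by ring
  have e2 : ∀ P K m E : ℂ, P * K * m * E = (P * E) * K * m := fun _ _ _ _ => by ring
  rw [e1 (extFactor hi lo Q p γ), e2 _ _ _ (extFactor hi lo Q (p + 1) γ)]
  refine congrArg₂ _ (congrArg₂ _ ?_ ?_) ?_
  · unfold extFactor
    simp only [← Finset.prod_mul_distrib]
    refine prod_prod_eq_of_pairs _ (fun x y hxy => ?_) fun x => ?_
    · have hne : γ x - γ y ≠ 0 := sub_ne_zero.2 (hγ.ne hxy)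
      have h1 := Q.minimalFF_ne_zero hne
      have h2 := Q.minimalFF_ne_zero (neg_ne_zero.2 hne)
      have h3 := Q.minimalFF_eq_S_mul (γ x - γ y)
      have h4 := Q.minimalFF_eq_S_mul (-(γ x - γ y))
      push_cast at h1 h2 h3 h4
      rw [neg_sub] at h2 h3 h4
      rw [neg_sub] at h4
      rw [if_neg hxy, if_neg hxy.symm]
      have key := stageAmp_mul_stageAmp (p := p) (u := Q.minimalFF ((γ x : ℂ) - γ y + Complex.I * (Real.pi - ε p)))
        (u' := Q.minimalFF ((γ y : ℂ) - γ x + Complex.I * (Real.pi - ε p))) (hlo x) (hlo y) (rank_ne hxy) h1 h2 h3 h4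
      unfold stageAmp stageNormal at key
      simp only [← mul_assoc] at key ⊢
      convert key using 12
    · rw [if_pos rfl, if_neg (show ¬ (p + 1 ≤ hi x ∧ p + 1 ≤ hi x ∧ lo x < p + 1 ∧ lo x < p + 1 ∧
        (hi x < hi x ∨ hi x = hi x ∧ (lo x < lo x ∨ lo x = lo x ∧ rank x < rank x))) by omega), one_mul]
      have key := stageAmp_self (p := p) (r := rank x) (hlo x) (Q.minimalFF ((γ x : ℂ) - γ x))
        (Q.minimalFF ((γ x : ℂ) - γ x + Complex.I * (Real.pi - ε p))) (Q.S ((γ x : ℂ) - γ x))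
      unfold stageAmp at key
      simp only [← mul_assoc] at key ⊢
      convert key
  · unfold legRap
    congr!
  · congr 1
    unfold Model.flow flowCoeff
    congr!

/-- The kernel depends only on the particles which take part in the process. -/
lemma stageKernel_comp (O : LocalOperator Q) (g : 𝓢(ℝ × ℝ, ℂ)) {X Y Z : Λ → Prop} (e : ℝ) (γ : Λ → ℝ)
    {Λ' : Type*} [Fintype Λ'] {f : Λ' → Λ} (hf : Function.Injective f)
    (h : ∀ i, X i ∨ Y i ∨ Z i → i ∈ Set.range f) :
    stageKernel O g (X ∘ f) (Y ∘ f) (Z ∘ f) e (γ ∘ f) = stageKernel O g X Y Z e γ := by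
  classical
  unfold stageKernel
  refine congrArg₂ _ (congrArg₂ _ ?_ ?_) ?_
  · refine Fintype.prod_of_injective f hf _ _ (fun i hi => Finset.prod_eq_one fun j _ => ?_)
      fun x => Fintype.prod_of_injective f hf _ _ (fun j hj => ?_) fun y => ?_
    · have h1 : ¬ (X i ∨ Y i ∨ Z i) := fun a => hi (h i a)
      simp only [not_or] at h1
      simp [h1]
    · have h1 : ¬ (X j ∨ Y j ∨ Z j) := fun a => hj (h j a)
      simp only [not_or] at h1
      simp [h1]
    · simp only [Function.comp_apply, hf.eq_iff]
  · set E : {i // (X ∘ f) i ∨ (Z ∘ f) i} ≃ {i // X i ∨ Z i} :=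
      Equiv.ofBijective (fun i => ⟨f i, i.2⟩) ⟨fun i j hij => Subtype.ext (hf (Subtype.mk.inj hij)),
        fun ⟨i, hi⟩ => by
          obtain ⟨j, rfl⟩ := h i (by tauto)
          exact ⟨⟨j, hi⟩, rfl⟩⟩ with hE
    exact kTr_comp_equiv O (fun i : {i // X i ∨ Z i} =>
      (γ i : ℂ) + if X i then Complex.I * (Real.pi - e) else 0) E
  · congr 1
    refine Fintype.sum_of_injective f hf _ _ (fun i hi => ?_) fun x => rfl
    have h1 : ¬ (X i ∨ Y i ∨ Z i) := fun a => hi (h i a)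
    simp only [not_or] at h1
    simp [h1]

end StageKernel

section Transport
variable {Q : Model} {Λ Λ' : Type*} {hi lo : Λ → ℕ} {hi' lo' : Λ' → ℕ} {f : Λ' → Λ} {p k : ℕ}

/-- An injection of the labels which respects what matters of their levels for the operators
`p, p + 1, …`. -/
structure IsRelabelling (hi lo : Λ → ℕ) (hi' lo' : Λ' → ℕ) (p : ℕ) (f : Λ' → Λ) : Prop where
  injective : Function.Injective f
  hi_eq : ∀ i, hi (f i) = hi' i
  lo_eq : ∀ i, truncLevel p (lo (f i)) = truncLevel p (lo' i)
  mem_range : ∀ i, p ≤ hi i → i ∈ Set.range f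

lemma IsRelabelling.lo_eq_iff (hf : IsRelabelling hi lo hi' lo' p f) (hp : 1 ≤ p) {q : ℕ} (hq : p ≤ q) (i : Λ') :
    lo (f i) = q ↔ lo' i = q := by
  have := hf.lo_eq i
  unfold truncLevel at this
  split_ifs at this <;> omega

variable [Fintype Λ] [Fintype Λ']

lemma IsRelabelling.extFactor_mul_amp (hf : IsRelabelling hi lo hi' lo' p f) (hlo : ∀ i, lo i < hi i)
    (hlo' : ∀ i, lo' i < hi' i) (hhi : ∀ i, hi i < k) (O : ℕ → LocalOperator Q)
    (g : ℕ → 𝓢(ℝ × ℝ, ℂ)) (hp : 1 ≤ p) (ε : ℕ → ℝ) {γ : Λ → ℝ} (hγ : Function.Injective γ) :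
    extFactor hi' lo' Q p (γ ∘ f) * amp hi' lo' O g p k ε (γ ∘ f) =
      extFactor hi lo Q p γ * amp hi lo O g p k ε γ := by
  classical
  have hhi' : ∀ i, hi' i < k := fun i => hf.hi_eq i ▸ hhi _
  have e1 : ∀ E h A : ℂ, E * (h * A) = h * (E * A) := fun _ _ _ => by ring
  unfold amp
  rw [e1 (extFactor hi' lo' Q p (γ ∘ f)), e1 (extFactor hi lo Q p γ)]
  refine congrArg₂ _ ?_ ?_
  · unfold ampH Model.smearProd Model.flow
    refine Finset.prod_congr rfl fun q hq => ?_
    rw [Finset.mem_Ico] at hq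
    congr 1
    refine Fintype.sum_of_injective f hf.injective _ _ (fun i hi' => ?_) fun x => ?_
    · have h1 : hi i < p := by
        by_contra h; exact hi' (hf.mem_range i (by omega))
      have := hlo i
      have h2 : hi i ≠ q := by omega
      have h3 : lo i ≠ q := by omega
      simp [flowCoeff, h2, h3]
    · simp only [flowCoeff, hf.hi_eq, hf.lo_eq_iff hp hq.1, Function.comp_apply]
  · rw [show (fun i => ((γ ∘ f) i : ℂ)) = fun i => (((γ ∘ f) i : ℝ) : ℂ) from rfl,
      extFactor_mul_ampA hlo' O hp hhi' ε (hγ.comp hf.injective), extFactor_mul_ampA hlo O hp hhi ε hγ]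
    refine congrArg₂ _ ?_ ?_
    · refine Fintype.prod_of_injective f hf.injective _ _ (fun i hi' => Finset.prod_eq_one fun j _ => ?_)
        fun x => Fintype.prod_of_injective f hf.injective _ _ (fun j hj => ?_) fun y => ?_
      · have h1 : hi i < p := by
          by_contra h; exact hi' (hf.mem_range i (by omega))
        have h2 : truncLevel p (lo i) = 0 := if_pos ((hlo i).trans h1)
        have h3 : pairNormal p (hi i) (truncLevel p (lo i)) (hi j) (truncLevel p (lo j))
          (Q.minimalFF ((γ i : ℂ) - γ j))
          (Q.minimalFF ((γ i : ℂ) - γ j + Complex.I * (Real.pi - ε (hi i)))) (Q.S ((γ i : ℂ) - γ j)) = 1 := by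
          unfold pairNormal
          simp (discharger := omega) only [if_neg, one_mul]
        rw [h3, ite_self]
      · have h1 : hi j < p := by
          by_contra h; exact hj (hf.mem_range j (by omega))
        have h2 : truncLevel p (lo j) = 0 := if_pos ((hlo j).trans h1)
        have h3 : pairNormal p (hi (f x)) (truncLevel p (lo (f x))) (hi j) (truncLevel p (lo j))
          (Q.minimalFF ((γ (f x) : ℂ) - γ j))
          (Q.minimalFF ((γ (f x) : ℂ) - γ j + Complex.I * (Real.pi - ε (hi (f x)))))
          (Q.S ((γ (f x) : ℂ) - γ j)) = 1 := by
          unfold pairNormal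
          rw [if_neg (by omega), if_neg (by omega), if_neg (by omega), one_mul, one_mul]
        rw [h3, ite_self]
      · simp only [Function.comp_apply, hf.injective.eq_iff, hf.hi_eq, hf.lo_eq]
    · refine Finset.prod_congr rfl fun q hq => ?_
      rw [Finset.mem_Ico] at hq
      have hleg : ∀ i, (hi' i = q ∨ lo' i = q) ↔ (hi (f i) = q ∨ lo (f i) = q) := fun i => by
        rw [hf.hi_eq, hf.lo_eq_iff hp hq.1]
      set E : Leg hi' lo' q ≃ Leg hi lo q :=
        Equiv.ofBijective (fun i => ⟨f i, (hleg i).1 i.2⟩)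
          ⟨fun i j hij => Subtype.ext (hf.injective (Subtype.mk.inj hij)), fun ⟨i, hi'⟩ => by
            obtain ⟨j, rfl⟩ := hf.mem_range i (by have := hlo i; omega)
            exact ⟨⟨j, (hleg j).2 hi'⟩, rfl⟩⟩ with hE
      rw [← kTr_comp_equiv (O q) (legRap hi lo q (ε q) fun i => (γ i : ℂ)) E]
      congr 1
      funext i
      have hEi : ((E i : Leg hi lo q) : Λ) = f i := rfl
      simp only [legRap, Function.comp_apply, hEi, hf.hi_eq]

end Transport

/-! ### Relabelling of the boundary values -/

lemma ae_ne_of_ne {ι : Type*} [Fintype ι] {i j : ι} (h : i ≠ j) : ∀ᵐ y : ι → ℝ, y i ≠ y j := by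
  classical
  have h1 : volume ((LinearMap.ker (LinearMap.proj (R := ℝ) (φ := fun _ : ι => ℝ) i -
      LinearMap.proj j) : Submodule ℝ (ι → ℝ)) : Set (ι → ℝ)) = 0 := by
    refine Measure.addHaar_submodule _ _ fun h2 => ?_
    have h3 : (Pi.single i 1 : ι → ℝ) ∈ LinearMap.ker (LinearMap.proj (R := ℝ) (φ := fun _ : ι => ℝ) i -
      LinearMap.proj j) := h2 ▸ Submodule.mem_top
    simp [LinearMap.mem_ker, h.symm] at h3
  refine measure_mono_null (fun y hy => ?_) h1
  simp only [Set.mem_compl_iff, Set.mem_ofPred_eq, not_not] at hy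
  simp only [SetLike.mem_coe, LinearMap.mem_ker, LinearMap.sub_apply, LinearMap.proj_apply]
  exact sub_eq_zero.2 hy

lemma ae_ne_const {ι : Type*} [Fintype ι] (i : ι) (c : ℝ) : ∀ᵐ y : ι → ℝ, y i ≠ c := by
  have := Measure.pi_hyperplane (fun _ : ι => (volume : Measure ℝ)) i c
  rw [← volume_pi] at this
  exact measure_mono_null (fun y hy => by simpa using hy) this

open scoped Classical in
/-- Almost all values of the integrated rapidities differ from each other and from the other rapidities. -/
lemma ae_injOn_glue {Λ : Type*} [Fintype Λ] {J : Λ → Prop} {γ : Λ → ℝ} {s : Set Λ}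
    (hγ : Set.InjOn γ {i | i ∈ s ∧ ¬ J i}) : ∀ᵐ y : {i // J i} → ℝ, Set.InjOn (glue J γ y) s := by
  have h1 : ∀ᵐ y : {i // J i} → ℝ, ∀ i j : {i // J i}, i ≠ j → y i ≠ y j :=
    ae_all_iff.2 fun i => ae_all_iff.2 fun j => by
      by_cases h : i = j
      · simp [h]
      · filter_upwards [ae_ne_of_ne h] with y hy _ using hy
  have h2 : ∀ᵐ y : {i // J i} → ℝ, ∀ (i : {i // J i}) (j : Λ), y i ≠ γ j :=
    ae_all_iff.2 fun i => ae_all_iff.2 fun j => ae_ne_const i _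
  filter_upwards [h1, h2] with y hy1 hy2 i hi j hj hij
  by_cases a : J i <;> by_cases b : J j
  · rw [glue_of_pos a, glue_of_pos b] at hij
    by_contra h
    exact hy1 ⟨i, a⟩ ⟨j, b⟩ (fun h' => h (Subtype.mk.inj h')) hij
  · rw [glue_of_pos a, glue_of_neg b] at hij
    exact absurd hij (hy2 _ _)
  · rw [glue_of_neg a, glue_of_pos b] at hij
    exact absurd hij.symm (hy2 _ _)
  · rw [glue_of_neg a, glue_of_neg b] at hij
    exact hγ ⟨hi, a⟩ ⟨hj, b⟩ hij

/-- Each family of regulators is a limit of families of positive ones. -/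
lemma exists_tendsto_regBox {e : ℝ} {D : Set ℕ} {ε : ℕ → ℝ} (hε : ε ∈ regBox e D) :
    ∃ εn : ℕ → ℕ → ℝ, (∀ n, εn n ∈ regBox e D) ∧ (∀ n q, 0 < εn n q) ∧
      Tendsto εn atTop (𝓝 ε) := by
  refine ⟨fun n q => max (ε q) (1 / ((n : ℝ) + 1)), fun n q => ?_, fun n q => ?_, ?_⟩
  · have h0 := hε q
    have hn1 : 1 / ((n : ℝ) + 1) ≤ 1 := by
      rw [div_le_one (by positivity)]; linarith [(n.cast_nonneg : (0 : ℝ) ≤ n)]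
    exact ⟨le_max_of_le_left h0.1, max_le h0.2.1 hn1, fun hq => le_max_of_le_left (h0.2.2 hq)⟩
  · exact lt_max_of_lt_right (by positivity)
  · refine tendsto_pi_nhds.2 fun q => ?_
    have := (tendsto_const_nhds (x := ε q)).max (tendsto_one_div_add_atTop_nhds_zero_nat (𝕜 := ℝ))
    rwa [max_eq_left (hε q).1] at this

section Transport
variable {Q : Model} {Λ Λ' : Type*} [Fintype Λ] [Fintype Λ'] {hi lo : Λ → ℕ} {hi' lo' : Λ' → ℕ}
  {f : Λ' → Λ} {p k : ℕ} {J : Λ → Prop} {D : Set ℕ}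

lemma extFactor_congr {Λ : Type*} [Fintype Λ] {hi lo : Λ → ℕ} {γ γ' : Λ → ℝ} (h : ∀ i, lo i < p → γ i = γ' i) :
    extFactor hi lo Q p γ = extFactor hi lo Q p γ' := by
  unfold extFactor
  refine Finset.prod_congr rfl fun i _ => Finset.prod_congr rfl fun j _ => ?_
  split_ifs with hc
  · rw [h i hc.2.2.1, h j hc.2.2.2.1]
  · rfl

lemma tendsto_boundaryValue {Λ : Type*} [Fintype Λ] {hi lo : Λ → ℕ} {J : Λ → Prop}
    (hJ : Deformable hi lo p k J D) (O : ℕ → LocalOperator Q) (g : ℕ → 𝓢(ℝ × ℝ, ℂ)) {e : ℝ}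
    (he : 0 < e) (he1 : e ≤ 1) {ε : ℕ → ℝ} (hε : ε ∈ regBox e D) {εn : ℕ → ℕ → ℝ}
    (h1 : ∀ n, εn n ∈ regBox e D) (h : Tendsto εn atTop (𝓝 ε)) (γ : Λ → ℝ) :
    Tendsto (fun n => boundaryValue hi lo O g p k J (εn n) γ) atTop
      (𝓝 (boundaryValue hi lo O g p k J ε γ)) :=
  ((continuousOn_boundaryValue g hJ O he he1 γ) ε hε).tendsto.comp
    (tendsto_nhdsWithin_iff.2 ⟨h, Eventually.of_forall h1⟩)

/-- The boundary values of two families of labels agree, up to the factors which depend on the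
numbering of the particles. -/
theorem IsRelabelling.extFactor_mul_boundaryValue (hf : IsRelabelling hi lo hi' lo' p f)
    (hJ : Deformable hi lo p k J D) (hJ' : Deformable hi' lo' p k (J ∘ f) D)
    (hJlo : ∀ i, J i → p ≤ lo i) (O : ℕ → LocalOperator Q)
    (g : ℕ → 𝓢(ℝ × ℝ, ℂ)) (hp : 1 ≤ p) {e : ℝ} (he : 0 < e) (he1 : e ≤ 1) {ε : ℕ → ℝ}
    (hε : ε ∈ regBox e D) {γ : Λ → ℝ} (hγ : Set.InjOn γ {i | ¬ J i}) :
    extFactor hi' lo' Q p (γ ∘ f) * boundaryValue hi' lo' O g p k (J ∘ f) ε (γ ∘ f) =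
      extFactor hi lo Q p γ * boundaryValue hi lo O g p k J ε γ := by
  classical
  obtain ⟨εn, h1, h2, h3⟩ := exists_tendsto_regBox hε
  -- at positive regulators both sides are integrals of amplitudes with the same normal form
  have hpos : ∀ n, extFactor hi' lo' Q p (γ ∘ f) * boundaryValue hi' lo' O g p k (J ∘ f) (εn n) (γ ∘ f) =
      extFactor hi lo Q p γ * boundaryValue hi lo O g p k J (εn n) γ := by
    intro n
    rw [(boundaryValue_eq_integral g hJ O he he1 (h1 n) (h2 n) γ).2,
      (boundaryValue_eq_integral g hJ' O he he1 (h1 n) (h2 n) (γ ∘ f)).2]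
    set E : {i // (J ∘ f) i} ≃ {i // J i} := Equiv.ofBijective (fun i => ⟨f i, i.2⟩)
      ⟨fun i j hij => Subtype.ext (hf.injective (Subtype.mk.inj hij)), fun ⟨i, hi'⟩ => by
        obtain ⟨j, rfl⟩ := hf.mem_range i (hJ.le i hi')
        exact ⟨⟨j, hi'⟩, rfl⟩⟩ with hE
    rw [← integral_reindex E, ← integral_const_mul, ← integral_const_mul]
    have hae := ae_injOn_glue (J := J) (γ := γ) (s := Set.univ) (by simpa using hγ)
    refine integral_congr_ae ?_
    filter_upwards [hae] with y hy
    rw [Set.injOn_univ] at hy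
    have hg : glue (J ∘ f) (γ ∘ f) (y ∘ E) = glue J γ y ∘ f := by
      funext i
      by_cases h : J (f i)
      · exact (glue_of_pos (show (J ∘ f) i from h)).trans (glue_of_pos h).symm
      · exact (glue_of_neg (show ¬ (J ∘ f) i from h)).trans (glue_of_neg h).symm
    have key := hf.extFactor_mul_amp hJ.lt hJ'.lt hJ.hi_lt O g hp (εn n) hy
    rw [extFactor_congr (γ' := γ) fun i hi' => glue_of_neg fun h => by have := hJlo i h; omega] at key
    rw [hg, ← key]
    congr 1
    refine extFactor_congr fun i hi' => ?_
    have hi2 : lo (f i) < p := by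
      have := hf.lo_eq i
      unfold truncLevel at this
      split_ifs at this <;> omega
    exact (glue_of_neg fun h => by have := hJlo (f i) h; omega).symm
  have ha := (tendsto_boundaryValue hJ' O g he he1 hε h1 h3 (γ ∘ f)).const_mul
    (extFactor hi' lo' Q p (γ ∘ f))
  simp only [hpos] at ha
  exact tendsto_nhds_unique ha ((tendsto_boundaryValue hJ O g he he1 hε h1 h3 γ).const_mul _)

end Transport

/-! ### Products over the pairs of a list -/

section PairProd
variable {ι κ M : Type*} [CommMonoid M]

/-- The product of `f a b` over the pairs of entries of a list, `a` preceding `b`. -/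
def pairProd (f : ι → ι → M) : List ι → M
  | [] => 1
  | a :: l => (l.map (f a)).prod * pairProd f l

/-- The product of `f a b` over the entries `a` of the first and `b` of the second list. -/
def crossProd (f : ι → ι → M) (l l' : List ι) : M := (l.map fun a => (l'.map (f a)).prod).prod

lemma pairProd_append (f : ι → ι → M) (l l' : List ι) :
    pairProd f (l ++ l') = pairProd f l * pairProd f l' * crossProd f l l' := by
  induction l with
  | nil => simp [pairProd, crossProd]
  | cons a l ih =>
    simp only [List.cons_append, pairProd, List.map_append, List.prod_append, ih, crossProd,
      List.map_cons, List.prod_cons]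
    simp only [mul_comm, mul_left_comm, mul_assoc]

lemma pairProd_map (f : κ → κ → M) (v : ι → κ) (l : List ι) :
    pairProd f (l.map v) = pairProd (fun a b => f (v a) (v b)) l := by
  induction l with
  | nil => rfl
  | cons a l ih => simp only [List.map_cons, pairProd, ih, List.map_map]; rfl

lemma pairProd_reverse (f : ι → ι → M) (l : List ι) :
    pairProd f l.reverse = pairProd (fun a b => f b a) l := by
  induction l with
  | nil => rfl
  | cons a l ih =>
    simp only [List.reverse_cons, pairProd_append, pairProd, ih, crossProd, List.map_nil, List.prod_nil,
      List.map_cons, List.prod_cons, mul_one, List.map_reverse, List.prod_reverse]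
    rw [mul_comm]

lemma pairProd_congr {f f' : ι → ι → M} {l : List ι} (h : ∀ a ∈ l, ∀ b ∈ l, f a b = f' a b) :
    pairProd f l = pairProd f' l := by
  induction l with
  | nil => rfl
  | cons a l ih =>
    rw [pairProd, pairProd, ih fun a ha b hb => h a (by simp [ha]) b (by simp [hb])]
    congr 2
    exact List.map_congr_left fun b hb => h a (by simp) b (by simp [hb])

lemma crossProd_eq [DecidableEq ι] (f : ι → ι → M) {l l' : List ι} (h : l.Nodup) (h' : l'.Nodup) :
    crossProd f l l' = ∏ a ∈ l.toFinset, ∏ b ∈ l'.toFinset, f a b := by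
  unfold crossProd
  rw [List.prod_toFinset _ h]
  simp only [List.prod_toFinset _ h']

lemma pairProd_eq [DecidableEq ι] (f : ι → ι → M) {l : List ι} (h : l.Nodup) :
    pairProd f l = ∏ a ∈ l.toFinset, ∏ b ∈ l.toFinset, if l.idxOf a < l.idxOf b then f a b else 1 := by
  induction l with
  | nil => rfl
  | cons x l ih =>
    rw [List.nodup_cons] at h
    have hx : x ∉ l.toFinset := by simpa using h.1
    have h1 : ∀ a ∈ l.toFinset, List.idxOf a (x :: l) = List.idxOf a l + 1 := fun a ha => by
      rw [List.idxOf_cons_ne]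
      rintro rfl; exact hx ha
    rw [pairProd, ih h.2, List.toFinset_cons, Finset.prod_insert hx, Finset.prod_insert hx]
    congr 1
    · rw [← List.prod_toFinset _ h.2]
      simp only [List.idxOf_cons_self, lt_irrefl, if_false, one_mul]
      refine Finset.prod_congr rfl fun b hb => ?_
      rw [h1 b hb, if_pos (by omega)]
    · refine Finset.prod_congr rfl fun a ha => ?_
      rw [Finset.prod_insert hx, List.idxOf_cons_self, if_neg (by omega), one_mul]
      refine Finset.prod_congr rfl fun b hb => ?_
      rw [h1 a ha, h1 b hb]
      simp only [add_lt_add_iff_right]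

lemma prod_get_eq_pairProd (f : ι → ι → M) (l : List ι) :
    (∏ a : Fin l.length, ∏ c : Fin l.length, if a < c then f (l.get a) (l.get c) else 1) =
      pairProd f l := by
  induction l with
  | nil => rfl
  | cons x l ih =>
    simp only [List.length_cons]
    rw [Fin.prod_univ_succ, pairProd, ← ih]
    congr 1
    · rw [Fin.prod_univ_succ, if_neg (lt_irrefl _), one_mul]
      simp only [Fin.succ_pos, if_true]
      rw [← List.prod_ofFn]
      congr 1
      refine List.ext_getElem (by simp) fun i h1 h2 => by simp
    · refine Finset.prod_congr rfl fun a _ => ?_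
      rw [Fin.prod_univ_succ, if_neg (Fin.not_lt_zero _), one_mul]
      simp only [Fin.succ_lt_succ_iff, List.get_eq_getElem, Fin.val_succ, List.getElem_cons_succ]

lemma prod_prod_eq_of_pairs_mem {s : Finset ι} {f g : ι → ι → M}
    (h : ∀ x ∈ s, ∀ y ∈ s, x ≠ y → f x y * f y x = g x y * g y x) (h0 : ∀ x ∈ s, f x x = g x x) :
    ∏ x ∈ s, ∏ y ∈ s, f x y = ∏ x ∈ s, ∏ y ∈ s, g x y := by
  have e : ∀ f : ι → ι → M, ∏ x ∈ s, ∏ y ∈ s, f x y = ∏ x : s, ∏ y : s, f x y := fun f => by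
    rw [← Finset.prod_coe_sort]
    exact Finset.prod_congr rfl fun x _ => (Finset.prod_coe_sort _ _).symm
  rw [e, e]
  exact prod_prod_eq_of_pairs _ (fun x y hxy => h x x.2 y y.2 fun h => hxy (Subtype.ext h))
    fun x => h0 x x.2

lemma pairProd_mul_pairProd_reverse [DecidableEq ι] (f : ι → ι → M) {l : List ι} (h : l.Nodup) :
    pairProd f l * pairProd f l.reverse =
      ∏ a ∈ l.toFinset, ∏ b ∈ l.toFinset, if a = b then 1 else f a b := by
  rw [pairProd_reverse, pairProd_eq _ h, pairProd_eq _ h]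
  simp only [← Finset.prod_mul_distrib]
  have hi : ∀ x ∈ l.toFinset, ∀ y ∈ l.toFinset, x ≠ y → l.idxOf x ≠ l.idxOf y := fun x hx y hy hxy h =>
    hxy ((List.idxOf_inj (by simpa using hx)).1 h)
  refine prod_prod_eq_of_pairs_mem (fun x hx y hy hxy => ?_) fun x _ => by simp
  have := hi x hx y hy hxy
  rw [if_neg hxy, if_neg hxy.symm]
  rcases lt_or_gt_of_ne this with h1 | h1
  · simp [h1, h1.not_gt]
  · simp [h1, h1.not_gt, mul_comm]

end PairProd

section Scattering
variable {Q : Model} {ι : Type*}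

/-- The factor `F` of two particles with real rapidities. -/
def pairF (Q : Model) (v : ι → ℝ) (i j : ι) : ℂ := Q.minimalFF ((v i : ℂ) - v j)

lemma pairF_eq (v : ι → ℝ) (i j : ι) : pairF Q v i j = Q.S ((v i : ℂ) - v j) * pairF Q v j i := by
  have := Q.minimalFF_eq_S_mul (v i - v j)
  push_cast at this
  rwa [neg_sub] at this

lemma pairF_ne_zero {v : ι → ℝ} {i j : ι} (h : v i ≠ v j) : pairF Q v i j ≠ 0 := by
  have := Q.minimalFF_ne_zero (sub_ne_zero.2 h)
  push_cast at this
  exact this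

lemma pairProd_pairF_ne_zero {v : ι → ℝ} (hv : Function.Injective v) {l : List ι} (hl : l.Nodup) :
    pairProd (pairF Q v) l ≠ 0 := by
  induction l with
  | nil => exact one_ne_zero
  | cons a l ih =>
    rw [List.nodup_cons] at hl
    rw [pairProd]
    refine mul_ne_zero (List.prod_ne_zero fun h => ?_) (ih hl.2)
    obtain ⟨b, hb, hb0⟩ := List.mem_map.1 h
    exact pairF_ne_zero (hv.ne (by rintro rfl; exact hl.1 hb)) hb0

/-- The scattering factors relate the products of the factors `F` in different orders. -/
lemma scattering_mul_pairProd [DecidableEq ι] (v : ι → ℝ) {l l' : List ι} (hl : l.Nodup) (h : l.Perm l') :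
    Q.scattering v l l' * pairProd (pairF Q v) l' = pairProd (pairF Q v) l := by
  have hl' : l'.Nodup := h.nodup_iff.1 hl
  have hs : l'.toFinset = l.toFinset := (List.toFinset_eq_of_perm _ _ h).symm
  rw [pairProd_eq _ hl, pairProd_eq _ hl', hs, Model.scattering]
  simp only [← Finset.prod_mul_distrib]
  refine prod_prod_eq_of_pairs_mem (fun x hx y hy hxy => ?_) fun x _ => by simp
  rw [List.mem_toFinset] at hx hy
  have h1 : l.idxOf x ≠ l.idxOf y := fun h => hxy ((List.idxOf_inj hx).1 h)
  have h2 : l'.idxOf x ≠ l'.idxOf y := fun h' => hxy ((List.idxOf_inj (h.mem_iff.1 hx)).1 h')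
  have e1 := pairF_eq (Q := Q) v x y
  have e2 := pairF_eq (Q := Q) v y x
  rcases lt_or_gt_of_ne h1 with h1 | h1 <;> rcases lt_or_gt_of_ne h2 with h2 | h2 <;>
    simp [h1, h2, h1.not_gt, h2.not_gt, ← e1]
  rw [mul_comm, ← e2]

end Scattering

section FormFactor
variable {Q : Model} (O : LocalOperator Q)

lemma formFactor_eq (L : List ℂ) :
    O.formFactor L = pairProd (fun x y => Q.minimalFF (x - y)) L * Q.kTransform (O.p L.length) L.get := by
  rw [LocalOperator.formFactor, LocalOperator.formFactorN, ← prod_get_eq_pairProd]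

open scoped Classical in
lemma kTransform_get_map {Λ : Type*} [Fintype Λ] {P : Λ → Prop} {L : List Λ} (hL : L.Nodup)
    (h : ∀ x, x ∈ L ↔ P x) (rap : Λ → ℂ) :
    Q.kTransform (O.p (L.map rap).length) (L.map rap).get = kTr O fun x : {x // P x} => rap x := by
  rw [← kTransform_comp_equiv O (fun x : {x // P x} => rap x)
    ((finCongr (List.length_map (as := L) rap)).trans
      ((List.Nodup.getEquiv L hL).trans (Equiv.subtypeEquivRight h)))]
  congr 1
  funext i
  simp

/-- The form factor of two lists of labels. -/
lemma shiftedFormFactor_eq {Λ : Type*} (e : ℝ) (γ : Λ → ℝ) (a b : List Λ) :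
    O.shiftedFormFactor e (a.map γ) (b.map γ) =
      pairProd (pairF Q γ) a * pairProd (pairF Q γ) b *
        crossProd (fun i j => Q.minimalFF ((γ i : ℂ) - γ j + Complex.I * (Real.pi - e))) a b *
        Q.kTransform (O.p _) (a.map (fun i => (γ i : ℂ) + Complex.I * (Real.pi - e)) ++
          b.map (fun i => (γ i : ℂ))).get := by
  have hs : ∀ t : ℝ, (t : ℂ) + Complex.I * Real.pi * (1 - (e : ℂ) / Real.pi) =
      t + Complex.I * (Real.pi - e) := fun t => by
    have : (Real.pi : ℂ) ≠ 0 := by exact_mod_cast Real.pi_ne_zero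
    field_simp
  have hb : ∀ l : List ℝ, (do let a ← l; pure (a : ℂ)) =
      List.map (fun t : ℝ => (t : ℂ)) l := fun l => by
    rw [List.map_eq_flatMap]; rfl
  rw [LocalOperator.shiftedFormFactor]
  simp only [hb, List.map_map]
  simp only [Function.comp_def, hs]
  rw [formFactor_eq, pairProd_append, pairProd_map, pairProd_map]
  have h1 : pairProd (fun i j : Λ => Q.minimalFF ((γ i : ℂ) + Complex.I * (Real.pi - e) -
      (γ j + Complex.I * (Real.pi - e)))) a = pairProd (pairF Q γ) a :=
    pairProd_congr fun i _ j _ => by rw [pairF]; congr 1; ring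
  have h2 : crossProd (fun x y => Q.minimalFF (x - y))
      (a.map fun i => (γ i : ℂ) + Complex.I * (Real.pi - e)) (b.map fun i => (γ i : ℂ)) =
      crossProd (fun i j => Q.minimalFF ((γ i : ℂ) - γ j + Complex.I * (Real.pi - e))) a b := by
    unfold crossProd
    simp only [List.map_map, Function.comp_def]
    refine congrArg List.prod (List.map_congr_left fun i _ => ?_)
    refine congrArg List.prod (List.map_congr_left fun j _ => ?_)
    congr 1; ring
  exact congrArg₂ _ (congrArg₂ _ (congrArg₂ _ h1 rfl) h2) rfl

end FormFactor

/-! ### The integrand of a contraction -/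

lemma prod_prod_ite_mem {Λ M : Type*} [Fintype Λ] [DecidableEq Λ] [CommMonoid M] (s t : Finset Λ)
    (f : Λ → Λ → M) :
    (∏ i, ∏ j, if i ∈ s ∧ j ∈ t then f i j else 1) = ∏ i ∈ s, ∏ j ∈ t, f i j := by
  simp only [ite_and]
  rw [← Finset.prod_subset (Finset.subset_univ s)]
  · refine Finset.prod_congr rfl fun i hi => ?_
    simp only [if_pos hi]
    rw [Finset.prod_ite_mem, Finset.univ_inter]
  · intro i _ hi
    simp [hi]

section Lists
variable {Q : Model} {Λ : Type*} [Fintype Λ]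

/-- The kernel as a ratio of products of factors `F`, ordered as in lists which begin with the spectators: the
remaining factors are the form factor and the smearing factor of the operator. -/
lemma stageKernel_mul_pairProd (O : LocalOperator Q) (g : 𝓢(ℝ × ℝ, ℂ)) {X Y Z : Λ → Prop} (e : ℝ)
    {γ : Λ → ℝ} (hγ : Function.Injective γ) {a₁ a₂ b₂ : List Λ} (hY : ∀ x, x ∈ a₁ ↔ Y x)
    (hX : ∀ x, x ∈ a₂ ↔ X x) (hZ : ∀ x, x ∈ b₂ ↔ Z x) (h₁ : (a₁ ++ a₂).Nodup) (h₂ : (a₁ ++ b₂).Nodup)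
    (h₃ : (a₂ ++ b₂).Nodup) :
    stageKernel O g X Y Z e γ * pairProd (pairF Q γ) (a₁ ++ b₂) =
      pairProd (pairF Q γ) (a₁ ++ a₂) * O.shiftedFormFactor e (a₂.reverse.map γ) (b₂.map γ) *
        momentumTransform g
          ((a₂.map fun x => Q.momentum (γ x)).sum - (b₂.map fun x => Q.momentum (γ x)).sum) := by
  classical
  obtain ⟨n1, n2, d12⟩ := List.nodup_append'.1 h₁
  obtain ⟨-, n3, d13⟩ := List.nodup_append'.1 h₂
  obtain ⟨-, -, d23⟩ := List.nodup_append'.1 h₃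
  have k := kTransform_get_map O (P := fun x => X x ∨ Z x) (L := a₂.reverse ++ b₂)
    (List.nodup_append'.2 ⟨List.nodup_reverse.2 n2, n3, fun x hx hy => d23 (List.mem_reverse.1 hx) hy⟩)
    (fun x => by rw [List.mem_append, List.mem_reverse, hX, hZ])
    fun i => (γ i : ℂ) + if X i then Complex.I * (Real.pi - e) else 0
  have k2 : (a₂.reverse ++ b₂).map (fun i => (γ i : ℂ) + if X i then Complex.I * (Real.pi - e) else 0) =
      a₂.reverse.map (fun i => (γ i : ℂ) + Complex.I * (Real.pi - e)) ++ b₂.map (fun i => (γ i : ℂ)) := by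
    rw [List.map_append]
    congr 1
    · refine List.map_congr_left fun i hi => ?_
      rw [if_pos ((hX i).1 (List.mem_reverse.1 hi))]
    · refine List.map_congr_left fun i hi => ?_
      rw [if_neg fun h => d23 ((hX i).2 h) hi, add_zero]
  rw [k2] at k
  obtain ⟨K, hK⟩ : ∃ K, ∀ inst : Fintype {x // X x ∨ Z x}, @kTr Q O _ inst
      (fun i => (γ i : ℂ) + if X i then Complex.I * (Real.pi - e) else 0) = K :=
    ⟨@kTr Q O _ (Fintype.ofFinite _) _, fun inst => by rw [Subsingleton.elim inst]⟩
  rw [hK] at k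
  rw [shiftedFormFactor_eq, k, pairProd_append, pairProd_append]
  have hc : crossProd (pairF Q γ) a₁ b₂ ≠ 0 := by
    rw [crossProd_eq _ n1 n3]
    refine Finset.prod_ne_zero_iff.2 fun i hi => Finset.prod_ne_zero_iff.2 fun j hj => ?_
    refine pairF_ne_zero (hγ.ne ?_)
    rintro rfl
    exact d13 (List.mem_toFinset.1 hi) (List.mem_toFinset.1 hj)
  have hm : (∑ i, ((if X i then 1 else 0) - (if Z i then 1 else 0) : ℝ) • Q.momentum (γ i)) =
      (a₂.map fun x => Q.momentum (γ x)).sum - (b₂.map fun x => Q.momentum (γ x)).sum := by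
    rw [← List.sum_toFinset _ n2, ← List.sum_toFinset _ n3]
    simp only [sub_smul, Finset.sum_sub_distrib, ite_smul, one_smul, zero_smul, ← hX, ← hZ,
      ← List.mem_toFinset, Finset.sum_ite_mem, Finset.univ_inter]
  have hp : (∏ i, ∏ j, if i = j then 1 else
      (if X i ∧ X j then Q.minimalFF ((γ i : ℂ) - γ j) else 1) *
      (if Y i ∧ X j then Q.minimalFF ((γ i : ℂ) - γ j) else 1) *
      (if X i ∧ Z j then Q.minimalFF ((γ i : ℂ) - γ j + Complex.I * (Real.pi - e)) else 1) *
      (if Y i ∧ Z j then (Q.minimalFF ((γ i : ℂ) - γ j))⁻¹ else 1)) =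
      (pairProd (pairF Q γ) a₂ * pairProd (pairF Q γ) a₂.reverse) * crossProd (pairF Q γ) a₁ a₂ *
      crossProd (fun i j => Q.minimalFF ((γ i : ℂ) - γ j + Complex.I * (Real.pi - e))) a₂.reverse b₂ *
      (crossProd (pairF Q γ) a₁ b₂)⁻¹ := by
    rw [pairProd_mul_pairProd_reverse _ n2, crossProd_eq _ n1 n2, crossProd_eq _ (List.nodup_reverse.2 n2) n3,
      crossProd_eq _ n1 n3, List.toFinset_reverse]
    simp only [← Finset.prod_inv_distrib]
    rw [← prod_prod_ite_mem a₂.toFinset a₂.toFinset, ← prod_prod_ite_mem a₁.toFinset,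
      ← prod_prod_ite_mem a₂.toFinset b₂.toFinset, ← prod_prod_ite_mem a₁.toFinset]
    simp only [← Finset.prod_mul_distrib, List.mem_toFinset, hX, hY, hZ]
    refine Finset.prod_congr rfl fun i _ => Finset.prod_congr rfl fun j _ => ?_
    by_cases hij : i = j
    · subst hij
      have t1 : ¬ (Y i ∧ X i) := fun h => d12 ((hY i).2 h.1) ((hX i).2 h.2)
      have t2 : ¬ (X i ∧ Z i) := fun h => d23 ((hX i).2 h.1) ((hZ i).2 h.2)
      have t3 : ¬ (Y i ∧ Z i) := fun h => d13 ((hY i).2 h.1) ((hZ i).2 h.2)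
      simp [t1, t2, t3]
    · simp only [if_neg hij]
      rfl
  unfold stageKernel
  rw [hp, hm]
  generalize crossProd (fun i j => Q.minimalFF ((γ i : ℂ) - γ j + Complex.I * (Real.pi - e))) a₂.reverse b₂ = C
  rw [hK]
  field_simp

end Lists

section OrderedList
variable {n : ℕ}

lemma mem_orderedList {A : Finset (Fin n)} {i : Fin n} : i ∈ orderedList A ↔ i ∈ A := by
  simp [orderedList]

lemma nodup_orderedList (A : Finset (Fin n)) : (orderedList A).Nodup :=
  (List.nodup_finRange n).filter _

lemma orderedList_eq_map (A : Finset (Fin n)) :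
    orderedList A = (List.finRange A.card).map (A.orderEmbOfFin rfl) := by
  have h1 : (orderedList A).Pairwise (· < ·) := (List.pairwise_lt_finRange n).filter _
  have h2 : ((List.finRange A.card).map (A.orderEmbOfFin rfl)).Pairwise (· < ·) :=
    (List.pairwise_lt_finRange _).map _ fun a b h => (A.orderEmbOfFin rfl).strictMono h
  refine List.Perm.eq_of_pairwise (fun a b _ _ h h' => absurd h (lt_asymm h')) h1 h2 ?_
  refine (List.perm_ext_iff_of_nodup (nodup_orderedList A) (h2.imp fun h => h.ne)).2 fun i => ?_
  rw [mem_orderedList]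
  simp only [List.mem_map, List.mem_finRange, true_and]
  have := Finset.range_orderEmbOfFin A rfl
  rw [← Finset.mem_coe, ← this]
  rfl

end OrderedList

section Contract
variable {Q : Model} {n m l : ℕ}

/-- The kernel of an operator whose spectators are the particles `A` of `α`, the particles `y` being
emitted. -/
def contractionKernel (O : LocalOperator Q) (g : 𝓢(ℝ × ℝ, ℂ)) (e : ℝ) (α : Fin n → ℝ) (A : Finset (Fin n))
    (y : Fin l → ℝ) : ℂ :=
  stageKernel O g (Sum.elim (fun i => i ∉ A) fun _ => False) (Sum.elim (fun i => i ∈ A) fun _ => False)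
    (Sum.elim (fun _ => False) fun _ => True) e (Sum.elim α y)

/-- The rapidities of the right hand state, with the spectators `A` and the emitted particles `y`. -/
def rightRap (α : Fin n → ℝ) (A : Finset (Fin n)) (y : Fin l → ℝ) : Fin A.card ⊕ Fin l → ℝ :=
  Sum.elim (α ∘ A.orderEmbOfFin rfl) y

/-- After multiplication with the products of the factors `F`, the scattering factors of a contraction disappear, by
Watson's equation, and the order of the particles does not matter any more. -/
lemma pairProd_mul_integrand (O : LocalOperator Q) (g : 𝓢(ℝ × ℝ, ℂ)) (f : (Fin m → ℝ) → ℂ) (e : ℝ)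
    {α : Fin n → ℝ} (c : Contraction n m) {w : Fin c.1.card ⊕ Fin l ≃ Fin m} (hw : ∀ a, w (Sum.inl a) = c.2 a)
    {y : Fin l → ℝ} (hy : Function.Injective (Sum.elim α y)) :
    pairProd (pairF Q α) (List.finRange n) * c.integrand O g f e α (rightRap α c.1 y ∘ w.symm) =
      contractionKernel O g e α c.1 y *
        (pairProd (pairF Q (rightRap α c.1 y ∘ w.symm)) (List.finRange m) * f (rightRap α c.1 y ∘ w.symm)) := by
  classical
  obtain ⟨A, emb⟩ := c
  simp only at w hw ⊢
  set c : Contraction n m := ⟨A, emb⟩ with hc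
  set β : Fin m → ℝ := rightRap α A y ∘ w.symm with hβ
  set γ : Fin n ⊕ Fin l → ℝ := Sum.elim α y with hγ
  set v : Fin m → Fin n ⊕ Fin l := Sum.map (A.orderEmbOfFin rfl) id ∘ w.symm with hv
  have hw' : ∀ a, c.2 a = w (Sum.inl a) := fun a => (hw a).symm
  have hα : Function.Injective α := hy.comp Sum.inl_injective
  have hvinj : Function.Injective v :=
    (Sum.map_injective.2 ⟨(A.orderEmbOfFin rfl).injective, Function.injective_id⟩).comp w.symm.injective
  have hβv : β = γ ∘ v := by
    funext j
    simp only [hβ, hγ, hv, rightRap, Function.comp_apply]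
    rcases w.symm j with a | z <;> rfl
  have hβinj : Function.Injective β := hβv ▸ hy.comp hvinj
  -- the four lists
  have hA1 : c.A₁ = (List.finRange A.card).map (A.orderEmbOfFin rfl) := orderedList_eq_map A
  have hB1v : c.B₁.map v = c.A₁.map Sum.inl := by
    rw [hA1, Contraction.B₁, List.map_map, List.map_map]
    refine List.map_congr_left fun a _ => ?_
    simp [hv, hw']
  have memA1 : ∀ i, i ∈ c.A₁ ↔ i ∈ A := fun i => mem_orderedList
  have memA2 : ∀ i, i ∈ c.A₂ ↔ i ∉ A := fun i => by
    rw [Contraction.A₂, mem_orderedList, Finset.mem_compl]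
  have memB2 : ∀ j, j ∈ c.B₂ ↔ ∃ z, j = w (Sum.inr z) := fun j => by
    rw [Contraction.B₂, mem_orderedList, Finset.mem_compl]
    simp only [Finset.mem_map, Finset.mem_univ, true_and, not_exists, hw']
    constructor
    · intro h
      rcases hx : w.symm j with a | z
      · exact absurd (by rw [← hx, w.apply_symm_apply]) (h a)
      · exact ⟨z, by rw [← hx, w.apply_symm_apply]⟩
    · rintro ⟨z, rfl⟩ a h
      exact absurd (w.injective h) (by simp)
  have ndA1 : c.A₁.Nodup := nodup_orderedList _
  have ndA2 : c.A₂.Nodup := nodup_orderedList _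
  have ndB2 : c.B₂.Nodup := nodup_orderedList _
  have ndB1 : c.B₁.Nodup := (List.nodup_finRange _).map emb.injective
  have memB1 : ∀ j, j ∈ c.B₁ ↔ ∃ a, j = w (Sum.inl a) := fun j => by
    simp only [Contraction.B₁, List.mem_map, List.mem_finRange, true_and, hw', eq_comm]
    exact Iff.rfl
  have ndA : (c.A₁ ++ c.A₂).Nodup := List.nodup_append'.2 ⟨ndA1, ndA2, fun i h1 h2 =>
    (memA2 i).1 h2 ((memA1 i).1 h1)⟩
  have ndB : (c.B₁ ++ c.B₂).Nodup := List.nodup_append'.2 ⟨ndB1, ndB2, fun i h1 h2 => by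
    obtain ⟨a, ha⟩ := (memB1 i).1 h1
    obtain ⟨z, hz⟩ := (memB2 i).1 h2
    exact absurd (w.injective (ha.symm.trans hz)) (by simp)⟩
  have pA : (c.A₁ ++ c.A₂).Perm (List.finRange n) :=
    (List.perm_ext_iff_of_nodup ndA (List.nodup_finRange n)).2 fun i => by
      simp only [List.mem_append, memA1, memA2, List.mem_finRange, iff_true]; tauto
  have pB : (List.finRange m).Perm (c.B₁ ++ c.B₂) :=
    (List.perm_ext_iff_of_nodup (List.nodup_finRange m) ndB).2 fun j => by
      simp only [List.mem_append, memB1, memB2, List.mem_finRange, true_iff]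
      rcases hx : w.symm j with a | z
      · exact Or.inl ⟨a, by rw [← hx, w.apply_symm_apply]⟩
      · exact Or.inr ⟨z, by rw [← hx, w.apply_symm_apply]⟩
  -- the scattering factors
  have s1 : pairProd (pairF Q α) (List.finRange n) *
      Q.scattering α (List.finRange n).reverse (c.A₂.reverse ++ c.A₁.reverse) =
      pairProd (pairF Q α) (c.A₁ ++ c.A₂) := by
    have e1 := scattering_mul_pairProd (Q := Q) α (l := (List.finRange n).reverse)
      (l' := c.A₂.reverse ++ c.A₁.reverse) (List.nodup_reverse.2 (List.nodup_finRange n))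
      (by rw [← List.reverse_append]
          exact (List.reverse_perm _).trans (pA.symm.trans (List.reverse_perm _).symm))
    have e2 := pairProd_mul_pairProd_reverse (pairF Q α) (List.nodup_finRange n)
    have e3 := pairProd_mul_pairProd_reverse (pairF Q α) ndA
    rw [List.toFinset_eq_of_perm _ _ pA, ← e2, List.reverse_append] at e3
    have hne : pairProd (pairF Q α) (c.A₂.reverse ++ c.A₁.reverse) ≠ 0 := by
      rw [← List.reverse_append]
      exact pairProd_pairF_ne_zero hα (List.nodup_reverse.2 ndA)
    refine mul_right_cancel₀ hne ?_
    rw [mul_assoc, e1, e3]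
  have s2 := scattering_mul_pairProd (Q := Q) β (List.nodup_finRange m) pB
  have s3 : pairProd (pairF Q β) (c.B₁ ++ c.B₂) =
      pairProd (pairF Q γ) (c.A₁.map Sum.inl ++ c.B₂.map v) := by
    rw [← hB1v, ← List.map_append, pairProd_map, hβv]; rfl
  have s4 : pairProd (pairF Q α) (c.A₁ ++ c.A₂) =
      pairProd (pairF Q γ) (c.A₁.map Sum.inl ++ c.A₂.map Sum.inl) := by
    rw [← List.map_append, pairProd_map]; rfl
  have memb2 : ∀ x, x ∈ c.B₂.map v ↔ ∃ z, x = Sum.inr z := fun x => by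
    simp only [List.mem_map, memB2]
    constructor
    · rintro ⟨_, ⟨z, rfl⟩, rfl⟩; exact ⟨z, by simp [hv]⟩
    · rintro ⟨z, rfl⟩; exact ⟨_, ⟨z, rfl⟩, by simp [hv]⟩
  have key := stageKernel_mul_pairProd O g (X := Sum.elim (fun i => i ∉ A) fun _ => False)
    (Y := Sum.elim (fun i => i ∈ A) fun _ => False) (Z := Sum.elim (fun _ => False) fun _ => True) e hy
    (a₁ := c.A₁.map Sum.inl) (a₂ := c.A₂.map Sum.inl) (b₂ := c.B₂.map v)
    (fun x => by rcases x with i | z <;> simp [memA1])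
    (fun x => by rcases x with i | z <;> simp [memA2])
    (fun x => by rw [memb2]; rcases x with i | z <;> simp)
    (by rw [← List.map_append]; exact ndA.map Sum.inl_injective)
    (by rw [← hB1v, ← List.map_append]; exact ndB.map hvinj)
    (List.nodup_append'.2 ⟨ndA2.map Sum.inl_injective, ndB2.map hvinj, fun x h1 h2 => by
      obtain ⟨z, rfl⟩ := (memb2 x).1 h2
      simp at h1⟩)
  have hne : pairProd (pairF Q γ) (c.A₁.map Sum.inl ++ c.B₂.map v) ≠ 0 := by
    rw [← hB1v, ← List.map_append]
    exact pairProd_pairF_ne_zero hy (ndB.map hvinj)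
  have hmom : ((c.A₂.map (Sum.inl : Fin n → Fin n ⊕ Fin l)).map fun x => Q.momentum (γ x)).sum -
      ((c.B₂.map v).map fun x => Q.momentum (γ x)).sum = Q.totalMomentum α - Q.totalMomentum β := by
    have m1 : Q.totalMomentum α = ∑ i ∈ A, Q.momentum (α i) + ∑ i ∈ Aᶜ, Q.momentum (α i) :=
      (Finset.sum_add_sum_compl A _).symm
    have m2 : Q.totalMomentum β = ∑ i ∈ A, Q.momentum (α i) + ∑ z, Q.momentum (y z) := by
      unfold Model.totalMomentum
      rw [← Equiv.sum_comp w, Fintype.sum_sum_type]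
      simp only [hβ, rightRap, Function.comp_apply, Equiv.symm_apply_apply, Sum.elim_inl, Sum.elim_inr]
      congr 1
      have : A = Finset.univ.map (A.orderEmbOfFin rfl).toEmbedding := by
        ext i
        have h := Finset.range_orderEmbOfFin A rfl
        rw [← Finset.mem_coe, ← h]
        simp
      conv_rhs => rw [this, Finset.sum_map]
      rfl
    have m3 : (c.A₂.map (Sum.inl : Fin n → Fin n ⊕ Fin l)).toFinset = Aᶜ.map ⟨Sum.inl, Sum.inl_injective⟩ := by
      ext x; rcases x with i | z <;> simp [memA2]
    have m4 : (c.B₂.map v).toFinset = Finset.univ.map ⟨Sum.inr, Sum.inr_injective⟩ := by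
      ext x
      rw [List.mem_toFinset, memb2]
      simp [eq_comm]
    rw [← List.sum_toFinset _ (ndA2.map Sum.inl_injective), ← List.sum_toFinset _ (ndB2.map hvinj),
      m1, m2, m3, m4, Finset.sum_map, Finset.sum_map]
    simp only [Function.Embedding.coeFn_mk, hγ, Sum.elim_inl, Sum.elim_inr]
    abel
  rw [hmom] at key
  have hff : O.shiftedFormFactor e (c.A₂.reverse.map α) (c.B₂.map β) =
      O.shiftedFormFactor e ((c.A₂.map (Sum.inl : Fin n → Fin n ⊕ Fin l)).reverse.map γ)
        ((c.B₂.map v).map γ) := by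
    rw [← List.map_reverse, List.map_map, List.map_map, hβv]; rfl
  have hsm : Q.smearing g α β = momentumTransform g (Q.totalMomentum α - Q.totalMomentum β) := by
    rw [momentumTransform_apply]; rfl
  refine mul_right_cancel₀ hne ?_
  unfold Contraction.integrand contractionKernel
  rw [hff, hsm]
  rw [s3] at s2
  rw [s4] at s1
  calc _ = (pairProd (pairF Q α) (List.finRange n) *
      Q.scattering α (List.finRange n).reverse (c.A₂.reverse ++ c.A₁.reverse)) *
      (Q.scattering β (List.finRange m) (c.B₁ ++ c.B₂) *
        pairProd (pairF Q γ) (c.A₁.map Sum.inl ++ c.B₂.map v)) *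
      (O.shiftedFormFactor e ((c.A₂.map (Sum.inl : Fin n → Fin n ⊕ Fin l)).reverse.map γ)
        ((c.B₂.map v).map γ) * momentumTransform g (Q.totalMomentum α - Q.totalMomentum β)) * f β := by ring
    _ = (pairProd (pairF Q γ) (c.A₁.map Sum.inl ++ c.A₂.map Sum.inl) *
      O.shiftedFormFactor e ((c.A₂.map (Sum.inl : Fin n → Fin n ⊕ Fin l)).reverse.map γ)
        ((c.B₂.map v).map γ) * momentumTransform g (Q.totalMomentum α - Q.totalMomentum β)) *
      (pairProd (pairF Q β) (List.finRange m) * f β) := by rw [s1, s2]; ring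
    _ = _ := by rw [← key]; ring

end Contract

/-! ### Summation over the contractions -/

section Embeddings
variable {a l m : ℕ}

/-- The injection of the first summand given by a bijection. -/
def leftEmbedding (w : Fin a ⊕ Fin l ≃ Fin m) : Fin a ↪ Fin m :=
  ⟨fun i => w (Sum.inl i), w.injective.comp Sum.inl_injective⟩

lemma exists_leftEmbedding_eq (h : a + l = m) (f : Fin a ↪ Fin m) :
    ∃ w : Fin a ⊕ Fin l ≃ Fin m, leftEmbedding w = f := by
  classical
  have hc : Fintype.card (Fin l) = Fintype.card {j // j ∉ Set.range f} := by
    rw [Fintype.card_subtype_compl]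
    have : Fintype.card {j // j ∈ Set.range f} = a := by
      have := Fintype.card_congr (Equiv.ofInjective f f.injective)
      rw [Fintype.card_fin] at this
      exact this.symm
    rw [this]
    simp; omega
  obtain ⟨e⟩ := Fintype.card_eq.1 hc
  refine ⟨Equiv.ofBijective (Sum.elim f fun i => (e i : Fin m)) ⟨?_, fun j => ?_⟩, by ext; rfl⟩
  · refine f.injective.sumElim (Subtype.val_injective.comp e.injective) fun i j hij => ?_
    exact (e j).2 ⟨i, hij⟩
  · by_cases hj : j ∈ Set.range f
    · obtain ⟨i, rfl⟩ := hj
      exact ⟨Sum.inl i, rfl⟩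
    · exact ⟨Sum.inr (e.symm ⟨j, hj⟩), by simp⟩

/-- Each injection extends to `l!` bijections. -/
lemma sum_leftEmbedding (h : a + l = m) (X : (Fin a ↪ Fin m) → ℂ) :
    ∑ w : Fin a ⊕ Fin l ≃ Fin m, X (leftEmbedding w) = (l.factorial : ℂ) * ∑ f, X f := by
  classical
  choose W hW using exists_leftEmbedding_eq (a := a) (l := l) h
  have hWi : ∀ f i, W f (Sum.inl i) = f i := fun f i => DFunLike.congr_fun (hW f) i
  set Φ : (Fin a ↪ Fin m) × Equiv.Perm (Fin l) → (Fin a ⊕ Fin l ≃ Fin m) := fun q =>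
    (Equiv.sumCongr (Equiv.refl _) q.2).trans (W q.1) with hΦ
  have hΦl : ∀ q, leftEmbedding (Φ q) = q.1 := by
    rintro ⟨f, σ⟩
    ext i
    simp [leftEmbedding, hΦ, hWi]
  have hbij : Function.Bijective Φ := by
    constructor
    · rintro ⟨f, σ⟩ ⟨f', σ'⟩ hq
      have h1 : f = f' := (hΦl (f, σ)).symm.trans ((congrArg leftEmbedding hq).trans (hΦl (f', σ')))
      subst h1
      have h2 : σ = σ' := by
        ext i
        have := congrArg (fun w => w (Sum.inr i)) hq
        simp only [hΦ, Equiv.trans_apply, Equiv.sumCongr_apply, Sum.map_inr, EmbeddingLike.apply_eq_iff_eq,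
          Sum.inr.injEq] at this
        rw [this]
      rw [h2]
    · intro w
      set τ : Equiv.Perm (Fin a ⊕ Fin l) := w.trans (W (leftEmbedding w)).symm with hτ
      have hτl : ∀ i, τ (Sum.inl i) = Sum.inl i := fun i => by
        rw [hτ, Equiv.trans_apply, Equiv.symm_apply_eq, hWi]; rfl
      obtain ⟨⟨σ₁, σ₂⟩, hσ⟩ := Equiv.Perm.mem_sumCongrHom_range_of_perm_mapsTo_inl (σ := τ) (by
        rintro _ ⟨i, rfl⟩; exact ⟨i, (hτl i).symm⟩)
      have h1 : σ₁ = 1 := by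
        ext i
        have := congrArg (fun w => w (Sum.inl i)) hσ
        simp only [Equiv.Perm.sumCongrHom_apply, Equiv.Perm.sumCongr_apply, Sum.map_inl, hτl, Sum.inl.injEq] at this
        rw [this]; rfl
      refine ⟨(leftEmbedding w, σ₂), ?_⟩
      have h2 : (Equiv.sumCongr (Equiv.refl _) σ₂ : Equiv.Perm (Fin a ⊕ Fin l)) = τ := by
        rw [← hσ, h1]; rfl
      simp only [hΦ]
      rw [h2, hτ, Equiv.trans_assoc, Equiv.symm_trans_self, Equiv.trans_refl]
  rw [← hbij.sum_comp, Fintype.sum_prod_type]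
  simp only [hΦl, Finset.sum_const, Finset.card_univ, Fintype.card_perm, Fintype.card_fin, nsmul_eq_mul,
    Finset.mul_sum]

/-- Exactly one arrangement of a family of distinct numbers is decreasing. -/
lemma existsUnique_mem_orderedSector {T : Type*} [Fintype T] (hT : Fintype.card T = m) {v : T → ℝ}
    (hv : Function.Injective v) : ∃! w : T ≃ Fin m, v ∘ w.symm ∈ orderedSector m := by
  classical
  set s := Finset.univ.image v with hs
  have hcard : s.card = m := by rw [hs, Finset.card_image_of_injective _ hv, Finset.card_univ, hT]
  have hmem : ∀ t, v t ∈ s := fun t => Finset.mem_image_of_mem v (Finset.mem_univ t)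
  set E : T ≃ s := Equiv.ofBijective (fun t => ⟨v t, hmem t⟩)
    ⟨fun x y hxy => hv (Subtype.mk.inj hxy), fun ⟨x, hx⟩ => by
      obtain ⟨t, -, rfl⟩ := Finset.mem_image.1 hx
      exact ⟨t, rfl⟩⟩ with hE
  have hEv : ∀ x, v (E.symm x) = x := fun x => by
    have := congrArg Subtype.val (E.apply_symm_apply x)
    exact this
  refine ⟨E.trans ((s.orderIsoOfFin hcard).toEquiv.symm.trans Fin.revPerm), fun i j hij => ?_, fun w hw => ?_⟩
  · simp only [Function.comp_apply, Equiv.symm_trans_apply, Equiv.symm_symm, hEv]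
    have := (s.orderIsoOfFin hcard).strictMono (Fin.rev_lt_rev.2 hij)
    exact_mod_cast this
  · set w₀ := E.trans ((s.orderIsoOfFin hcard).toEquiv.symm.trans Fin.revPerm) with hw₀
    have h0 : v ∘ w₀.symm ∈ orderedSector m := fun i j hij => by
      simp only [hw₀, Function.comp_apply, Equiv.symm_trans_apply, Equiv.symm_symm, hEv]
      have := (s.orderIsoOfFin hcard).strictMono (Fin.rev_lt_rev.2 hij)
      exact_mod_cast this
    have hmono : ∀ w w' : T ≃ Fin m, v ∘ w.symm ∈ orderedSector m → v ∘ w'.symm ∈ orderedSector m →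
        StrictMono (w' ∘ w.symm) := by
      intro w w' hw hw' i j hij
      by_contra hc
      have h1 := hw i j hij
      rcases (not_lt.1 hc).lt_or_eq with h2 | h2
      · have h3 := hw' _ _ h2
        simp only [Function.comp_apply, Equiv.symm_apply_apply] at h1 h3
        exact lt_asymm h1 h3
      · simp only [Function.comp_apply, EmbeddingLike.apply_eq_iff_eq] at h2
        exact hij.ne' h2
    have key : ∀ i, w₀ (w.symm i) = i := by
      have h1 : StrictMono (w₀ ∘ w.symm) := hmono w w₀ hw h0
      have := Subsingleton.elim (h1.orderIsoOfSurjective _ (w₀.surjective.comp w.symm.surjective)) (OrderIso.refl _)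
      intro i
      exact DFunLike.congr_fun this i
    ext t
    have := key (w t)
    rw [Equiv.symm_apply_apply] at this
    rw [this]

end Embeddings

section Measure
variable {n m l : ℕ}

lemma measurableSet_orderedSector : MeasurableSet (orderedSector m) := by
  have : orderedSector m = ⋂ i, ⋂ j, ⋂ _ : i < j, {β : Fin m → ℝ | β j < β i} := by
    ext β; simp [orderedSector]
  rw [this]
  exact MeasurableSet.iInter fun i => MeasurableSet.iInter fun j => MeasurableSet.iInter fun _ =>
    measurableSet_lt (measurable_pi_apply j) (measurable_pi_apply i)

lemma measurableEmbedding_rightRap (α : Fin n → ℝ) (A : Finset (Fin n)) (w : Fin A.card ⊕ Fin l ≃ Fin m) :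
    MeasurableEmbedding fun y : Fin l → ℝ => rightRap α A y ∘ w.symm := by
  refine Continuous.measurableEmbedding (continuous_pi fun j => ?_) fun y y' h => ?_
  · simp only [Function.comp_apply]
    rcases w.symm j with i | z
    · exact continuous_const
    · exact continuous_apply z
  · funext z
    have := congrFun h (w (Sum.inr z))
    simpa [rightRap] using this

/-- The measure of a contraction is the image of the Lebesgue measure of the emitted particles. -/
lemma measure_eq_map (α : Fin n → ℝ) (c : Contraction n m) {w : Fin c.1.card ⊕ Fin l ≃ Fin m}
    (hw : ∀ a, w (Sum.inl a) = c.2 a) :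
    c.measure α = volume.map fun y : Fin l → ℝ => rightRap α c.1 y ∘ w.symm := by
  classical
  set μ : Fin m → Measure ℝ := fun j =>
    if h : ∃ a, c.2 a = j then Measure.dirac (α (c.1.orderEmbOfFin rfl h.choose)) else volume with hμ
  have hμl : ∀ a, μ (w (Sum.inl a)) = Measure.dirac (α (c.1.orderEmbOfFin rfl a)) := fun a => by
    have h : ∃ a', c.2 a' = w (Sum.inl a) := ⟨a, (hw a).symm⟩
    have h2 : h.choose = a := c.2.injective (h.choose_spec.trans (hw a))
    simp only [hμ]
    rw [dif_pos h, h2]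
  have hμr : ∀ z, μ (w (Sum.inr z)) = volume := fun z => by
    simp only [hμ]
    rw [dif_neg]
    rintro ⟨a, ha⟩
    rw [← hw] at ha
    exact absurd (w.injective ha) (by simp)
  have hsf : ∀ j, SigmaFinite (μ j) := fun j => by
    simp only [hμ]; split_ifs <;> infer_instance
  change Measure.pi μ = _
  refine Measure.pi_eq fun s hs => ?_
  rw [(measurableEmbedding_rightRap α c.1 w).map_apply, ← Equiv.prod_comp w, Fintype.prod_sum_type]
  simp only [hμl, hμr, Measure.dirac_apply' _ (hs _)]
  by_cases h : ∀ a, α (c.1.orderEmbOfFin rfl a) ∈ s (w (Sum.inl a))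
  · have h1 : (fun y : Fin l → ℝ => rightRap α c.1 y ∘ w.symm) ⁻¹' Set.univ.pi s =
        Set.univ.pi fun z => s (w (Sum.inr z)) := by
      ext y
      simp only [Set.mem_preimage, Set.mem_pi, Set.mem_univ, true_imp_iff]
      constructor
      · intro hy z
        have := hy (w (Sum.inr z))
        simpa [rightRap] using this
      · intro hy j
        obtain ⟨x, rfl⟩ := w.surjective j
        rcases x with a | z
        · simpa [rightRap] using h a
        · simpa [rightRap] using hy z
    rw [h1, volume_pi_pi]
    simp [Set.indicator_of_mem (h _)]
  · have h1 : (fun y : Fin l → ℝ => rightRap α c.1 y ∘ w.symm) ⁻¹' Set.univ.pi s = ∅ := by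
      rw [Set.eq_empty_iff_forall_notMem]
      intro y hy
      refine h fun a => ?_
      have := hy (w (Sum.inl a)) (Set.mem_univ _)
      simpa [rightRap] using this
    push Not at h
    obtain ⟨a, ha⟩ := h
    rw [h1, measure_empty]
    symm
    refine mul_eq_zero_of_left (Finset.prod_eq_zero (Finset.mem_univ a) ?_) _
    rw [Set.indicator_of_notMem ha]

end Measure

section Action
variable {Q : Model} {n m : ℕ}

lemma injective_of_mem_orderedSector {α : Fin n → ℝ} (h : α ∈ orderedSector n) : Function.Injective α := by
  intro i j hij
  rcases lt_trichotomy i j with h1 | h1 | h1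
  · exact absurd hij (h i j h1).ne'
  · exact h1
  · exact absurd hij (h j i h1).ne

lemma ae_injective_sumElim {ι T : Type*} [Countable ι] [Fintype T] {α : ι → ℝ} (hα : Function.Injective α) :
    ∀ᵐ y : T → ℝ, Function.Injective (Sum.elim α y) := by
  have h1 : ∀ᵐ y : T → ℝ, ∀ i j : T, i ≠ j → y i ≠ y j :=
    ae_all_iff.2 fun i => ae_all_iff.2 fun j => by
      by_cases h : i = j
      · simp [h]
      · filter_upwards [ae_ne_of_ne h] with y hy _ using hy
  have h2 : ∀ᵐ y : T → ℝ, ∀ (i : T) (j : ι), y i ≠ α j :=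
    ae_all_iff.2 fun i => ae_all_iff.2 fun j => ae_ne_const i _
  filter_upwards [h1, h2] with y hy1 hy2
  refine hα.sumElim (fun i j hij => ?_) fun i j hij => hy2 j i hij.symm
  by_contra h
  exact hy1 i j h hij

/-- The action of an operator on a wave function. On the ordered sector, the wave function is the quotient of a
symmetric function, with values `Fs`, and of the product of the factors `F`; the action has the same
form. -/
theorem pairProd_mul_regularizedAction (O : LocalOperator Q) (g : 𝓢(ℝ × ℝ, ℂ)) (f : (Fin m → ℝ) → ℂ) (e : ℝ)
    {α : Fin n → ℝ} (hα : α ∈ orderedSector n) (Fs : (A : Finset (Fin n)) → (Fin (m - A.card) → ℝ) → ℂ)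
    (hf : ∀ A, A.card ≤ m → ∀ (w : Fin A.card ⊕ Fin (m - A.card) ≃ Fin m) (y : Fin (m - A.card) → ℝ),
      Function.Injective (Sum.elim α y) →
      pairProd (pairF Q (rightRap α A y ∘ w.symm)) (List.finRange m) * f (rightRap α A y ∘ w.symm) = Fs A y)
    (hint : ∀ A, A.card ≤ m → Integrable fun y => contractionKernel O g e α A y * Fs A y) :
    (∀ c : Contraction n m, IntegrableOn (c.integrand O g f e α) (orderedSector m) (c.measure α)) ∧
    pairProd (pairF Q α) (List.finRange n) * regularizedAction O g f e α =
      Complex.exp (-2 * Complex.I * Real.pi * n * O.omega) * ∑ A : Finset (Fin n),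
        if A.card ≤ m then (2 * Real.pi : ℂ) ^ A.card / (2 * Real.pi : ℂ) ^ m *
          (((m - A.card).factorial : ℂ)⁻¹ * ∫ y, contractionKernel O g e α A y * Fs A y) else 0 := by
  classical
  have hαi := injective_of_mem_orderedSector hα
  set P := pairProd (pairF Q α) (List.finRange n) with hP
  have hP0 : P ≠ 0 := pairProd_pairF_ne_zero hαi (List.nodup_finRange n)
  -- a single contraction
  have hc : ∀ (c : Contraction n m) (w : Fin c.1.card ⊕ Fin (m - c.1.card) ≃ Fin m), c.1.card ≤ m →
      leftEmbedding w = c.2 →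
      IntegrableOn (c.integrand O g f e α) (orderedSector m) (c.measure α) ∧
      P * ∫ β in orderedSector m, c.integrand O g f e α β ∂(c.measure α) =
        ∫ y, (if rightRap α c.1 y ∘ w.symm ∈ orderedSector m then 1 else 0) *
          (contractionKernel O g e α c.1 y * Fs c.1 y) := by
    intro c w hcm hw
    have hw' : ∀ a, w (Sum.inl a) = c.2 a := fun a => DFunLike.congr_fun hw a
    have hemb := measurableEmbedding_rightRap α c.1 w
    have hms : MeasurableSet ((fun y : Fin (m - c.1.card) → ℝ => rightRap α c.1 y ∘ w.symm) ⁻¹' orderedSector m) :=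
      hemb.measurable measurableSet_orderedSector
    have hae : ∀ᵐ y : Fin (m - c.1.card) → ℝ, c.integrand O g f e α (rightRap α c.1 y ∘ w.symm) =
        P⁻¹ * (contractionKernel O g e α c.1 y * Fs c.1 y) := by
      filter_upwards [ae_injective_sumElim hαi] with y hy
      rw [← hf c.1 hcm w y hy, ← pairProd_mul_integrand O g f e c hw' hy, ← hP, inv_mul_cancel_left₀ hP0]
    rw [IntegrableOn, measure_eq_map α c hw', hemb.restrict_map, hemb.integrable_map_iff, hemb.integral_map]
    refine ⟨?_, ?_⟩
    · refine Integrable.congr ((hint c.1 hcm).const_mul P⁻¹).integrableOn ?_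
      exact ae_restrict_of_ae (hae.mono fun y hy => hy.symm)
    · rw [integral_congr_ae (ae_restrict_of_ae hae), integral_const_mul, mul_inv_cancel_left₀ hP0,
        ← integral_indicator hms]
      refine integral_congr_ae (Eventually.of_forall fun y => ?_)
      simp only [Set.indicator, Set.mem_preimage, ite_mul, one_mul, zero_mul]
  have hle : ∀ c : Contraction n m, c.1.card ≤ m := fun c => by
    simpa using Fintype.card_le_of_embedding c.2
  refine ⟨fun c => ?_, ?_⟩
  · obtain ⟨w, hw⟩ := exists_leftEmbedding_eq (Nat.add_sub_cancel' (hle c)) c.2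
    exact (hc c w (hle c) hw).1
  · unfold regularizedAction
    rw [mul_left_comm, Fintype.sum_sigma, Finset.mul_sum]
    congr 1
    refine Finset.sum_congr rfl fun A _ => ?_
    split_ifs with hA
    · simp only
      rw [← Finset.mul_sum, mul_left_comm]
      congr 1
      have hl : (((m - A.card).factorial : ℕ) : ℂ) ≠ 0 := by exact_mod_cast Nat.factorial_ne_zero _
      rw [eq_inv_mul_iff_mul_eq₀ hl, mul_left_comm, ← sum_leftEmbedding (Nat.add_sub_cancel' hA), Finset.mul_sum]
      have h1 : ∀ w : Fin A.card ⊕ Fin (m - A.card) ≃ Fin m, _ := fun w =>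
        (hc ⟨A, leftEmbedding w⟩ w hA rfl).2
      simp only at h1
      rw [Finset.sum_congr rfl fun w _ => h1 w]
      have hI : ∀ w : Fin A.card ⊕ Fin (m - A.card) ≃ Fin m, Integrable fun y =>
          (if rightRap α A y ∘ w.symm ∈ orderedSector m then (1 : ℂ) else 0) *
            (contractionKernel O g e α A y * Fs A y) := by
        intro w
        have hms : MeasurableSet ((fun y : Fin (m - A.card) → ℝ => rightRap α A y ∘ w.symm) ⁻¹' orderedSector m) :=
          (measurableEmbedding_rightRap α A w).measurable measurableSet_orderedSector
        refine ((hint A hA).indicator hms).congr (Eventually.of_forall fun y => ?_)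
        simp only [Set.indicator, Set.mem_preimage, ite_mul, one_mul, zero_mul]
      have hS := integral_finsetSum (μ := volume) Finset.univ fun w _ => hI w
      refine hS.symm.trans ?_
      refine integral_congr_ae ?_
      filter_upwards [ae_injective_sumElim hαi] with y hy
      rw [← Finset.sum_mul]
      have hy' : Function.Injective (rightRap α A y) := by
        have : rightRap α A y = Sum.elim α y ∘ Sum.map (A.orderEmbOfFin rfl) id := by
          funext x; rcases x with a | z <;> rfl
        rw [this]
        exact hy.comp (Sum.map_injective.2 ⟨(A.orderEmbOfFin rfl).injective, Function.injective_id⟩)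
      -- the ordered sector contains exactly one arrangement of the rapidities
      obtain ⟨w₀, h0, h1⟩ := existsUnique_mem_orderedSector (m := m) (by simp; omega) hy'
      rw [Finset.sum_eq_single w₀ (fun w _ hw => if_neg fun h => hw (h1 w h)) (by simp), if_pos h0, one_mul]
    · have : IsEmpty (Fin A.card ↪ Fin m) := ⟨fun f => hA (hle ⟨A, f⟩)⟩
      rw [Finset.univ_eq_empty, Finset.sum_empty, mul_zero]

end Action

/-! ### Sums over the levels of indistinguishable particles -/

/-- A function of families of labels which depends only on the number of times each label is taken can be
summed over these numbers. -/
lemma sum_eq_sum_piAntidiag {B : Type*} [Fintype B] [DecidableEq B] {l : ℕ} (z : (Fin l → B) → ℂ)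
    (zn : (B → ℕ) → ℂ) (h : ∀ (ν : B → ℕ) (e : Fin l ≃ (b : B) × Fin (ν b)), z (fun i => (e i).1) = zn ν) :
    ((l.factorial : ℕ) : ℂ)⁻¹ * ∑ κ, z κ =
      ∑ ν ∈ Finset.piAntidiag Finset.univ l, ((∏ b, (ν b).factorial : ℕ) : ℂ)⁻¹ * zn ν := by
  -- apply a linear form to the two expansions of a power of the sum of the variables
  set L : MvPolynomial B ℂ →ₗ[ℂ] ℂ := (MvPolynomial.basisMonomials B ℂ).constr ℂ fun s => zn s with hL
  have hLm : ∀ s : B →₀ ℕ, L (MvPolynomial.monomial s 1) = zn s := fun s => by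
    have := (MvPolynomial.basisMonomials B ℂ).constr_basis ℂ (fun s => zn s) s
    rwa [MvPolynomial.coe_basisMonomials] at this
  have h1 := Fintype.sum_pow (fun b : B => (MvPolynomial.X b : MvPolynomial B ℂ)) l
  rw [Finset.sum_pow_eq_sum_piAntidiag] at h1
  have h2 := congrArg L h1
  rw [map_sum, map_sum] at h2
  have h3 : ∀ κ : Fin l → B, L (∏ i, MvPolynomial.X (κ i)) = z κ := by
    intro κ
    have e1 : (∏ i, (MvPolynomial.X (κ i) : MvPolynomial B ℂ)) =
        MvPolynomial.monomial (∑ i, Finsupp.single (κ i) 1) 1 := by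
      rw [MvPolynomial.monomial_sum_one]; rfl
    rw [e1, hLm]
    have e2 : ∀ b, (∑ i, Finsupp.single (κ i) 1 : B →₀ ℕ) b = Fintype.card {i // κ i = b} := fun b => by
      rw [Finsupp.finsetSum_apply, Fintype.card_subtype, Finset.card_filter]
      refine Finset.sum_congr rfl fun i _ => ?_
      rw [Finsupp.single_apply]
    set ν : B →₀ ℕ := ∑ i, Finsupp.single (κ i) 1
    rw [← h ν ((Equiv.sigmaFiberEquiv κ).symm.trans (Equiv.sigmaCongrRight fun b =>
      (Fintype.equivFin _).trans (finCongr (e2 b).symm)))]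
    rfl
  have h4 : ∀ ν ∈ Finset.piAntidiag (Finset.univ : Finset B) l,
      L ((Nat.multinomial Finset.univ ν : MvPolynomial B ℂ) * ∏ b, MvPolynomial.X b ^ ν b) =
        (Nat.multinomial Finset.univ ν : ℂ) * zn ν := by
    intro ν _
    have e1 : (∏ b, (MvPolynomial.X b : MvPolynomial B ℂ) ^ ν b) =
        MvPolynomial.monomial (Finsupp.equivFunOnFinite.symm ν) 1 := by
      rw [MvPolynomial.monomial_eq, Finsupp.prod_fintype _ _ fun _ => pow_zero _]
      simp
    rw [e1, ← map_natCast (MvPolynomial.C (σ := B) (R := ℂ)), MvPolynomial.C_mul', map_smul, hLm, smul_eq_mul]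
    rfl
  rw [Finset.sum_congr rfl h4] at h2
  simp only [h3] at h2
  rw [← h2, Finset.mul_sum]
  refine Finset.sum_congr rfl fun ν hν => ?_
  have hs : ∑ b, ν b = l := (Finset.mem_piAntidiag.1 hν).1
  have hm := Nat.multinomial_spec Finset.univ ν
  rw [hs] at hm
  have hl : ((l.factorial : ℕ) : ℂ) ≠ 0 := by exact_mod_cast Nat.factorial_ne_zero l
  have hp : ((∏ b, (ν b).factorial : ℕ) : ℂ) ≠ 0 := by
    exact_mod_cast Finset.prod_ne_zero_iff.2 fun b _ => Nat.factorial_ne_zero _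
  have hm' : ((∏ b, (ν b).factorial : ℕ) : ℂ) * (Nat.multinomial Finset.univ ν : ℂ) = (l.factorial : ℕ) := by
    exact_mod_cast hm
  rw [← mul_assoc]
  congr 1
  rw [inv_mul_eq_iff_eq_mul₀ hl, ← hm']
  field_simp

/-! ### The terms of the expansion -/

section Terms
variable {Q : Model} {Λ : Type*} [Fintype Λ] {hi lo : Λ → ℕ} {O : ℕ → LocalOperator Q}
  {g : ℕ → 𝓢(ℝ × ℝ, ℂ)} {p k : ℕ} {J : Λ → Prop}

lemma glue_congr {Λ α : Type*} {J : Λ → Prop} {γ γ' : Λ → α} (h : ∀ i, ¬ J i → γ i = γ' i) (y : {i // J i} → α) :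
    glue J γ y = glue J γ' y := by
  funext i
  by_cases hi : J i
  · rw [glue_of_pos hi, glue_of_pos hi]
  · rw [glue_of_neg hi, glue_of_neg hi, h i hi]

lemma boundaryValue_congr {ε : ℕ → ℝ} {γ γ' : Λ → ℝ} (h : ∀ i, ¬ J i → γ i = γ' i) :
    boundaryValue hi lo O g p k J ε γ = boundaryValue hi lo O g p k J ε γ' := by
  have h' : ∀ i, ¬ J i → ((γ i : ℝ) : ℂ) = γ' i := fun i hi => by rw [h i hi]
  unfold boundaryValue
  simp only [glue_congr h, glue_congr h']

lemma boundaryValue_congr_reg {ε ε' : ℕ → ℝ} (h : ∀ q, p ≤ q → q < k → ε q = ε' q) (γ : Λ → ℝ) :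
    boundaryValue hi lo O g p k J ε γ = boundaryValue hi lo O g p k J ε' γ := by
  have : ∀ z : Λ → ℂ, ampA hi lo O p k ε z = ampA hi lo O p k ε' z := fun z => by
    unfold ampA
    refine Finset.prod_congr rfl fun q hq => ?_
    rw [h q (Finset.mem_Ico.1 hq).1 (Finset.mem_Ico.1 hq).2]
  unfold boundaryValue
  simp only [this]

/-- Without integrations, the boundary value is the amplitude itself. -/
lemma boundaryValue_of_forall_not {D : Set ℕ} {e : ℝ} (hJ : Deformable hi lo p k J D) (he : 0 < e) (he1 : e ≤ 1)
    {ε : ℕ → ℝ} (hε : ε ∈ regBox e D) (hε0 : ∀ q, 0 < ε q) (h : ∀ i, ¬ J i) (γ : Λ → ℝ) :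
    boundaryValue hi lo O g p k J ε γ = amp hi lo O g p k ε γ := by
  classical
  have hglue : ∀ y, glue J γ y = γ := fun y => funext fun i => glue_of_neg (h i)
  have : IsEmpty {i // J i} := ⟨fun i => h i.1 i.2⟩
  rw [(boundaryValue_eq_integral g hJ O he he1 hε hε0 γ).2]
  simp only [hglue]
  rw [integral_const, volume_pi, Measure.pi_of_empty]
  simp

end Terms

section Levels
variable {K : ℕ} {ι : Type*}

/-- The level at which a particle exchanged by two operators is absorbed. -/
def upper (q : OrdPair K) : ℕ := q.1.1 + 1

/-- The level at which a particle exchanged by two operators is emitted. -/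
def lower (q : OrdPair K) : ℕ := q.1.2 + 1

lemma lower_lt_upper (q : OrdPair K) : lower q < upper q := Nat.add_lt_add_right q.2 1

lemma upper_lt (q : OrdPair K) : upper q < K + 2 := Nat.add_lt_add_right q.1.1.2 1

lemma one_le_lower (q : OrdPair K) : 1 ≤ lower q := Nat.le_add_left _ _

/-- The levels at which the external particles, and those exchanged by two operators, are absorbed. -/
def hiOf (h : ι → ℕ) (n : OrdPair K → ℕ) : ι ⊕ Label n → ℕ := Sum.elim h fun i => upper i.1

/-- The levels at which particles are emitted, with the level `0` for the external particles. -/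
def loOf (n : OrdPair K → ℕ) : ι ⊕ Label n → ℕ := Sum.elim (fun _ => 0) fun i => lower i.1

/-- The labels of the particles exchanged by two operators. -/
def exchanged (n : OrdPair K → ℕ) : ι ⊕ Label n → Prop := Sum.elim (fun _ => False) fun _ => True

/-- All exchanged particles are integrated, and no external particle is emitted by an operator. Hence the contour can
be deformed without any assumption on the regulators. -/
lemma deformable_exchanged {p : ℕ} (hp : 1 ≤ p) {h : ι → ℕ} (hh : ∀ i, p ≤ h i ∧ h i < K + 2)
    {n : OrdPair K → ℕ} (hn : ∀ q, lower q < p → n q = 0) :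
    Deformable (hiOf h n) (loOf n) p (K + 2) (exchanged n) ∅ where
  lt i := by
    rcases i with i | i
    · have := hh i; simp only [hiOf, loOf, Sum.elim_inl]; omega
    · exact lower_lt_upper i.1
  hi_lt i := by
    rcases i with i | i
    · exact (hh i).2
    · exact upper_lt i.1
  le i hi := by
    rcases i with i | i
    · exact hi.elim
    · by_contra hc
      have h1 : lower i.1 < p := by
        have := lower_lt_upper i.1
        simp only [hiOf, Sum.elim_inr] at hc
        omega
      have := i.2.2
      have h2 := hn i.1 h1
      omega
  pinch i j hij hi := by
    rcases j with j | j
    · simp only [loOf, Sum.elim_inl] at hij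
      omega
    · exact Or.inl trivial

end Levels

section Key
variable {Q : Model} {K : ℕ} {ι : Type*} [Fintype ι]

/-- The term of the expansion of the action of the operators `p, p + 1, …` on the vacuum in which the external
particles are absorbed at the levels `h`, and `n` counts the exchanged particles. -/
def term (O : ℕ → LocalOperator Q) (g : ℕ → 𝓢(ℝ × ℝ, ℂ)) (p : ℕ) (ε : ℕ → ℝ) (h : ι → ℕ) (n : OrdPair K → ℕ)
    (α : ι → ℝ) : ℂ :=
  extFactor (hiOf h n) (loOf n) Q p (Sum.elim α 0) *
    boundaryValue (hiOf h n) (loOf n) O g p (K + 2) (exchanged n) ε (Sum.elim α 0)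

variable {O : ℕ → LocalOperator Q} {g : ℕ → 𝓢(ℝ × ℝ, ℂ)} {p : ℕ} {ε : ℕ → ℝ}

lemma le_lower_of_label {n : OrdPair K → ℕ} (hn : ∀ q, lower q < p → n q = 0) (i : Label n) : p ≤ lower i.1 := by
  by_contra hc
  have := i.2.2
  have h2 := hn i.1 (by omega)
  omega

/-- The value of a term does not depend on the rapidities assigned to the exchanged particles. -/
lemma term_eq (h : ι → ℕ) {n : OrdPair K → ℕ} (hn : ∀ q, lower q < p → n q = 0) (α : ι → ℝ) {γ : ι ⊕ Label n → ℝ}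
    (hγ : ∀ i, γ (Sum.inl i) = α i) :
    term O g p ε h n α = extFactor (hiOf h n) (loOf n) Q p γ *
      boundaryValue (hiOf h n) (loOf n) O g p (K + 2) (exchanged n) ε γ := by
  unfold term
  refine congrArg₂ _ (extFactor_congr fun i hi => ?_) (boundaryValue_congr fun i hi => ?_)
  · rcases i with i | i
    · exact (hγ i).symm
    · have := le_lower_of_label hn i
      simp only [loOf, Sum.elim_inr] at hi
      omega
  · rcases i with i | i
    · exact (hγ i).symm
    · exact absurd trivial hi

/-- The terms are invariant under a renumbering of the external particles. -/
lemma term_comp_equiv {ι' : Type*} [Fintype ι'] (e : ι' ≃ ι) (hp : 1 ≤ p) {h : ι → ℕ} (hh : ∀ i, p ≤ h i ∧ h i < K + 2)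
    {n : OrdPair K → ℕ} (hn : ∀ q, lower q < p → n q = 0) (hε : ε ∈ regBox 1 ∅) {α : ι → ℝ}
    (hα : Function.Injective α) : term O g p ε (h ∘ e) n (α ∘ e) = term O g p ε h n α := by
  set f : ι' ⊕ Label n → ι ⊕ Label n := Sum.map e id with hf
  have hrel : IsRelabelling (hiOf h n) (loOf n) (hiOf (h ∘ e) n) (loOf n) p f :=
    { injective := Sum.map_injective.2 ⟨e.injective, Function.injective_id⟩
      hi_eq := fun i => by rcases i with i | i <;> rfl
      lo_eq := fun i => by rcases i with i | i <;> rfl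
      mem_range := fun i _ => by
        rcases i with i | i
        · exact ⟨Sum.inl (e.symm i), by simp [hf]⟩
        · exact ⟨Sum.inr i, rfl⟩ }
  have hJ : (exchanged n : ι ⊕ Label n → Prop) ∘ f = exchanged n := by
    funext i; rcases i with i | i <;> rfl
  have key := hrel.extFactor_mul_boundaryValue (Q := Q) (J := exchanged n) (D := ∅) (deformable_exchanged hp hh hn)
    (by rw [hJ]; exact deformable_exchanged hp (fun i => hh (e i)) hn)
    (fun i hi => by
      rcases i with i | i
      · exact hi.elim
      · exact le_lower_of_label hn i) O g hp one_pos le_rfl hε (γ := Sum.elim α 0)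
    (fun i hi j hj hij => by
      rcases i with i | i
      · rcases j with j | j
        · exact congrArg _ (hα hij)
        · exact absurd trivial hj
      · exact absurd trivial hi)
  rw [hJ] at key
  have hγ : (Sum.elim α 0 : ι ⊕ Label n → ℝ) ∘ f = Sum.elim (α ∘ e) 0 := by
    funext i; rcases i with i | i <;> rfl
  rw [hγ] at key
  exact key

end Key

/-! ### The action of an operator on a term of the expansion -/

section Key
variable {Q : Model} {K N l : ℕ} {O : ℕ → LocalOperator Q} {g : ℕ → 𝓢(ℝ × ℝ, ℂ)} {p : ℕ}

/-- The numbers of particles exchanged by the operators which follow the operator `p`. -/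
def dropLevel (p : ℕ) (n : OrdPair K → ℕ) : OrdPair K → ℕ := fun q => if lower q = p then 0 else n q

lemma dropLevel_le (p : ℕ) (n : OrdPair K → ℕ) (q : OrdPair K) : dropLevel p n q ≤ n q := by
  unfold dropLevel
  split_ifs <;> simp

/-- The particles exchanged by the operators which follow `p`, among all those exchanged. -/
def dropEmbedding (p : ℕ) (n : OrdPair K → ℕ) (i : Label (dropLevel p n)) : Label n :=
  ⟨i.1, Fin.castLE (dropLevel_le p n i.1) i.2⟩

lemma injective_dropEmbedding (p : ℕ) (n : OrdPair K → ℕ) : Function.Injective (dropEmbedding p n) := by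
  rintro ⟨q, j⟩ ⟨q', j'⟩ h
  obtain rfl : q = q' := congrArg Sigma.fst h
  have h2 : Fin.castLE (dropLevel_le p n q) j = Fin.castLE (dropLevel_le p n q) j' := by
    simpa [dropEmbedding] using h
  rw [Fin.castLE_injective _ h2]

lemma lower_dropEmbedding (n : OrdPair K → ℕ) (i : Label (dropLevel p n)) : lower i.1 ≠ p := by
  intro h
  have h1 : dropLevel p n i.1 = 0 := if_pos h
  have := i.2.2
  omega

lemma exists_dropEmbedding {n : OrdPair K → ℕ} (i : Label n) (h : lower i.1 ≠ p) : ∃ j, dropEmbedding p n j = i :=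
  ⟨⟨i.1, Fin.cast (if_neg h).symm i.2⟩, rfl⟩

variable {n : OrdPair K → ℕ} {h : Fin N → ℕ} {A : Finset (Fin N)}

/-- The particles which take part in the processes of the operators `p + 1, …`: the spectators of the operator
`p`, those which it emits, and those exchanged later on. -/
def stageMap (A : Finset (Fin N)) (E : Fin l ≃ {i : Label n // lower i.1 = p}) :
    (Fin A.card ⊕ Fin l) ⊕ Label (dropLevel p n) → Fin N ⊕ Label n :=
  Sum.elim (Sum.elim (fun x => Sum.inl (A.orderEmbOfFin rfl x)) fun z => Sum.inr (E z).1) fun i =>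
    Sum.inr (dropEmbedding p n i)

lemma isRelabelling_stageMap (hA : ∀ i, i ∈ A ↔ p < h i) (E : Fin l ≃ {i : Label n // lower i.1 = p}) :
    IsRelabelling (hiOf h n) (loOf n) (hiOf (Sum.elim (h ∘ A.orderEmbOfFin rfl) fun z => upper (E z).1.1)
      (dropLevel p n)) (loOf (dropLevel p n)) (p + 1) (stageMap A E) where
  injective := by
    refine Function.Injective.sumElim (Function.Injective.sumElim (fun x y hxy => ?_) (fun x y hxy => ?_)
      fun x y => by simp) (fun x y hxy => ?_) fun x y => ?_
    · exact (A.orderEmbOfFin rfl).injective (Sum.inl_injective hxy)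
    · exact E.injective (Subtype.ext (Sum.inr_injective hxy))
    · exact injective_dropEmbedding p n (Sum.inr_injective hxy)
    · rcases x with x | x
      · simp
      · intro hxy
        have h1 := (E x).2
        rw [Sum.inr_injective hxy] at h1
        exact lower_dropEmbedding n y h1
  hi_eq i := by rcases i with (i | i) | i <;> rfl
  lo_eq i := by
    rcases i with (i | i) | i
    · rfl
    · have h1 := (E i).2
      have h2 : loOf (ι := Fin N) n (stageMap A E (Sum.inl (Sum.inr i))) = p := h1
      have h3 : loOf (ι := Fin A.card ⊕ Fin l) (dropLevel p n) (Sum.inl (Sum.inr i)) = 0 := rfl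
      rw [h2, h3]
      unfold truncLevel
      simp
    · rfl
  mem_range i hi := by
    rcases i with i | i
    · have h1 : i ∈ Set.range (A.orderEmbOfFin rfl) := by
        rw [Finset.range_orderEmbOfFin]
        exact (hA i).2 hi
      obtain ⟨x, rfl⟩ := h1
      exact ⟨Sum.inl (Sum.inl x), rfl⟩
    · by_cases h1 : lower i.1 = p
      · refine ⟨Sum.inl (Sum.inr (E.symm ⟨i, h1⟩)), ?_⟩
        simp [stageMap]
      · obtain ⟨j, rfl⟩ := exists_dropEmbedding i h1
        exact ⟨Sum.inr j, rfl⟩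

/-- The action of the operator `p` on a term of the expansion of the action of the following operators. -/
theorem integral_contractionKernel_mul_term (hp : 1 ≤ p) (hpK : p + 1 ≤ K + 2) (hh : ∀ i, p ≤ h i ∧ h i < K + 2)
    (hn : ∀ q, lower q < p → n q = 0) (hA : ∀ i, i ∈ A ↔ p < h i)
    (E : Fin l ≃ {i : Label n // lower i.1 = p}) {e : ℝ} (he : 0 < e) (he1 : e ≤ 1) {α : Fin N → ℝ}
    (hα : Function.Injective α) :
    Integrable (fun y => contractionKernel (O p) (g p) e α A y *
      term O g (p + 1) 0 (Sum.elim (h ∘ A.orderEmbOfFin rfl) fun z => upper (E z).1.1) (dropLevel p n)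
        (rightRap α A y)) ∧
    ∫ y, contractionKernel (O p) (g p) e α A y *
      term O g (p + 1) 0 (Sum.elim (h ∘ A.orderEmbOfFin rfl) fun z => upper (E z).1.1) (dropLevel p n)
        (rightRap α A y) = term O g p (Function.update 0 p e) h n α := by
  classical
  set ε : ℕ → ℝ := Function.update 0 p e with hε
  -- dummy values of the exchanged rapidities, which differ from each other and from those in `α`
  obtain ⟨η, hη⟩ := (ae_injective_sumElim (T := Label n) hα).exists
  set γ : Fin N ⊕ Label n → ℝ := Sum.elim α η with hγ
  set hi := hiOf h n with hhi
  set lo : Fin N ⊕ Label n → ℕ := loOf n with hlo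
  set n' := dropLevel p n with hn'
  set h' : Fin A.card ⊕ Fin l → ℕ := Sum.elim (h ∘ A.orderEmbOfFin rfl) fun z => upper (E z).1.1 with hh'
  have hJ : Deformable hi lo p (K + 2) (exchanged n) ∅ := deformable_exchanged hp hh hn
  set J₁ : Fin N ⊕ Label n → Prop := Sum.elim (fun _ => False) fun i => lower i.1 = p with hJ₁
  set J₂ : Fin N ⊕ Label n → Prop := Sum.elim (fun _ => False) fun i => p + 1 ≤ lower i.1 with hJ₂'
  have hJ₂ : Deformable hi lo (p + 1) (K + 2) J₂ ∅ :=
    { lt := hJ.lt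
      hi_lt := hJ.hi_lt
      le := fun i hi => by
        rcases i with i | i
        · exact hi.elim
        · exact le_trans hi (lower_lt_upper i.1).le
      pinch := fun i j hij hi => by
        rcases j with j | j
        · simp only [hlo, loOf, Sum.elim_inl] at hij
          omega
        · exact Or.inl (le_of_le_of_eq hi hij.symm) }
  have hεr : ∀ D : Set ℕ, D ⊆ {p} → ε ∈ regBox e D := fun D hD q => by
    by_cases hq : q = p
    · subst hq
      simp [hε, he.le, he1]
    · simp only [hε, Function.update_of_ne hq, Pi.zero_apply, le_refl, zero_le_one, true_and]
      exact fun h => absurd (hD h) hq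
  obtain ⟨hint, hrec⟩ := integral_amp_mul_boundaryValue (O := O) (J₁ := J₁) g hJ hJ₂ (Nat.le_succ p) hpK
    (fun i => by
      rcases i with i | i
      · exact ⟨fun a => a.elim, fun a => a.elim id id⟩
      · have := le_lower_of_label hn i
        simp only [exchanged, hJ₁, hJ₂', Sum.elim_inr, true_iff]
        omega)
    (fun i a b => by
      rcases i with i | i
      · exact a
      · simp only [hJ₁, hJ₂', Sum.elim_inr] at a b
        omega)
    (fun i a => by
      rcases i with i | i
      · exact a.elim
      · have := lower_lt_upper i.1
        simp only [hJ₁, hhi, hiOf, Sum.elim_inr] at a ⊢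
        omega)
    (Or.inr fun i a => by
      rcases i with i | i
      · exact a.elim
      · exact a) he he1 (hεr _ (by
      rw [Set.empty_union, Set.empty_union]
      exact fun q hq => Nat.le_antisymm (Nat.lt_succ_iff.1 hq.2) hq.1)) γ
  set E₁ : Fin l ≃ {i // J₁ i} := E.trans
    { toFun := fun i => ⟨Sum.inr i.1, i.2⟩
      invFun := fun i => match i with
        | ⟨Sum.inr i, hi⟩ => ⟨i, hi⟩
      left_inv := fun i => rfl
      right_inv := fun i => match i with
        | ⟨Sum.inr i, hi⟩ => rfl } with hE₁
  have hE₁v : ∀ z, (E₁ z : Fin N ⊕ Label n) = Sum.inr (E z).1 := fun z => rfl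
  set F : (Fin l → ℝ) → ℂ := fun y => contractionKernel (O p) (g p) e α A y *
      term O g (p + 1) 0 h' n' (rightRap α A y) with hF
  have hn'0 : ∀ q, lower q < p + 1 → n' q = 0 := fun q hq => by
    by_cases h1 : lower q = p
    · exact if_pos h1
    · exact (if_neg h1).trans (hn q (by omega))
  have hh'b : ∀ i, p + 1 ≤ h' i ∧ h' i < K + 2 := fun i => by
    rcases i with i | i
    · have h1 : A.orderEmbOfFin rfl i ∈ A := Finset.orderEmbOfFin_mem A rfl i
      exact ⟨(hA _).1 h1, (hh _).2⟩
    · have h1 := (E i).2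
      have h2 := lower_lt_upper (E i).1.1
      refine ⟨?_, upper_lt _⟩
      simp only [hh', Sum.elim_inr]
      omega
  -- the integrand of the recursion factorises into the kernel of the operator `p` and the following term
  have key : ∀ᵐ b : {i // J₁ i} → ℝ, extFactor hi lo Q p γ * (amp hi lo O g p (p + 1) ε (glue J₁ γ b) *
      boundaryValue hi lo O g (p + 1) (K + 2) J₂ ε (glue J₁ γ b)) = F (b ∘ E₁) := by
    filter_upwards [ae_injOn_glue (J := J₁) (γ := γ) (s := Set.univ) (hη.injOn)] with b hb
    rw [Set.injOn_univ] at hb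
    set δ := glue J₁ γ b with hδ
    have hδl : ∀ i, δ (Sum.inl i) = α i := fun i => glue_of_neg fun a => a
    have hδE : ∀ z, δ (Sum.inr (E z).1) = b (E₁ z) := fun z => glue_of_pos (E₁ z).2
    have s1 : extFactor hi lo Q p γ = extFactor hi lo Q p δ := extFactor_congr fun i hi => by
      rcases i with i | i
      · exact (hδl i).symm
      · have := le_lower_of_label hn i
        simp only [hlo, loOf, Sum.elim_inr] at hi
        omega
    rw [s1, ← mul_assoc, extFactor_mul_amp_succ hJ.lt O g p ε hb, mul_assoc]
    refine congrArg₂ _ ?_ ?_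
    · have s2 : ε p = e := by simp [hε]
      rw [s2]
      set f₂ : Fin N ⊕ Fin l → Fin N ⊕ Label n := Sum.elim Sum.inl fun z => Sum.inr (E z).1 with hf₂
      have hf₂i : Function.Injective f₂ :=
        Sum.inl_injective.sumElim (fun x y hxy => E.injective (Subtype.ext (Sum.inr_injective hxy)))
          fun x y => by simp
      rw [← stageKernel_comp (O p) (g p) e δ hf₂i fun i hi' => by
        rcases i with i | i
        · exact ⟨Sum.inl i, rfl⟩
        · have h1 := le_lower_of_label hn i
          have h2 := lower_lt_upper i.1
          simp only [hhi, hlo, hiOf, loOf, Sum.elim_inr] at hi'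
          have h3 : lower i.1 = p := by omega
          exact ⟨Sum.inr (E.symm ⟨i, h3⟩), by simp [hf₂]⟩]
      unfold contractionKernel
      congr 1
      · funext i
        rcases i with i | i
        · have := hh i
          have h1 := hA i
          refine propext ?_
          change h i = p ↔ i ∉ A
          rw [h1]
          omega
        · have h1 := (E i).2
          have h2 := lower_lt_upper (E i).1.1
          refine propext ?_
          change upper (E i).1.1 = p ↔ False
          rw [iff_false]
          omega
      · funext i
        rcases i with i | i
        · refine propext ?_
          change (p < h i ∧ 0 < p) ↔ i ∈ A
          rw [hA i]
          omega
        · have h1 := (E i).2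
          refine propext ?_
          change (_ ∧ lower (E i).1.1 < p) ↔ False
          rw [iff_false]
          omega
      · funext i
        rcases i with i | i
        · refine propext ?_
          change 0 = p ↔ False
          rw [iff_false]
          omega
        · exact propext (iff_of_true (E i).2 trivial)
      · funext i
        rcases i with i | i
        · exact hδl i
        · exact hδE i
    · have hJf : J₂ ∘ stageMap A E = exchanged n' := by
        funext i
        rcases i with (i | i) | i
        · rfl
        · have h1 := (E i).2
          refine propext ?_
          change p + 1 ≤ lower (E i).1.1 ↔ False
          rw [iff_false]
          omega
        · refine propext (iff_of_true ?_ trivial)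
          change p + 1 ≤ lower i.1
          have h1 := lower_dropEmbedding n i
          have h2 := le_lower_of_label hn (dropEmbedding p n i)
          change p ≤ lower i.1 at h2
          omega
      rw [← (isRelabelling_stageMap hA E).extFactor_mul_boundaryValue hJ₂
        (by rw [hJf]; exact deformable_exchanged (Nat.le_add_left 1 p) hh'b hn'0)
        (fun i hi => by
          rcases i with i | i
          · exact hi.elim
          · exact hi) O g (Nat.le_add_left 1 p) he he1 (hεr ∅ (Set.empty_subset _)) hb.injOn, hJf,
        term_eq h' hn'0 (rightRap α A (b ∘ E₁)) (γ := δ ∘ stageMap A E) fun i => by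
          rcases i with i | i
          · exact hδl _
          · exact hδE i]
      have hreg : ∀ q, p + 1 ≤ q → q < K + 2 → ε q = (0 : ℕ → ℝ) q := fun q hq _ => by
        simp only [hε]
        rw [Function.update_of_ne (by omega)]
      rw [boundaryValue_congr_reg hreg]
  have hint' : Integrable fun b : {i // J₁ i} → ℝ => F (b ∘ E₁) := (hint.const_mul _).congr key
  refine ⟨(integrable_reindex E₁ F).1 hint', ?_⟩
  change ∫ y, F y = _
  rw [← integral_reindex E₁ F, ← integral_congr_ae key, integral_const_mul, hrec]
  exact (term_eq h hn α fun i => rfl).symm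

end Key

/-! ### The numbers of exchanged particles -/

section Admissible
variable {K : ℕ} {ι : Type*} [Fintype ι]

/-- The number of particles present between the operators `t - 1` and `t`. -/
def flux (h : ι → ℕ) (n : OrdPair K → ℕ) (t : ℕ) : ℕ :=
  (∑ i, if t ≤ h i then 1 else 0) + ∑ q : OrdPair K, if lower q < t ∧ t ≤ upper q then n q else 0

/-- The families `n` of numbers of particles exchanged by the operators `p, p + 1, …`, for external particles
absorbed at the levels `h`, such that `R t` particles are present between the operators `t - 1` and `t`. -/
def admissible (K : ℕ) (R : ℕ → ℕ) (p : ℕ) (h : ι → ℕ) : Finset (OrdPair K → ℕ) :=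
  open scoped Classical in
  (Fintype.piFinset fun _ => Finset.range (∑ t ∈ Finset.range (K + 2), R t + 1)).filter fun n =>
    (∀ q, lower q < p → n q = 0) ∧ ∀ t, p < t → t < K + 2 → flux h n t = R t

lemma mem_admissible {R : ℕ → ℕ} {p : ℕ} {h : ι → ℕ} {n : OrdPair K → ℕ} :
    n ∈ admissible K R p h ↔ (∀ q, lower q < p → n q = 0) ∧ ∀ t, p < t → t < K + 2 → flux h n t = R t := by
  classical
  unfold admissible
  rw [Finset.mem_filter, Fintype.mem_piFinset]
  refine ⟨fun a => a.2, fun a => ⟨fun q => ?_, a⟩⟩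
  rw [Finset.mem_range, Nat.lt_succ_iff]
  by_cases hq : lower q < p
  · rw [a.1 q hq]
    exact Nat.zero_le _
  · have h1 := lower_lt_upper q
    have h2 := upper_lt q
    have h3 := a.2 (lower q + 1) (by omega) (by omega)
    have h4 : n q ≤ flux h n (lower q + 1) := by
      unfold flux
      refine le_trans ?_ (Nat.le_add_left _ _)
      refine le_trans (le_of_eq (if_pos ⟨Nat.lt_succ_self _, h1⟩).symm) (Finset.single_le_sum
        (f := fun q' : OrdPair K => if lower q' < lower q + 1 ∧ lower q + 1 ≤ upper q' then n q' else 0)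
        (fun _ _ => Nat.zero_le _) (Finset.mem_univ q))
    rw [h3] at h4
    exact h4.trans (Finset.single_le_sum (f := R) (fun _ _ => Nat.zero_le _) (Finset.mem_range.2 (by omega)))

lemma flux_comp_equiv {ι' : Type*} [Fintype ι'] (e : ι' ≃ ι) (h : ι → ℕ) (n : OrdPair K → ℕ) (t : ℕ) :
    flux (h ∘ e) n t = flux h n t := by
  unfold flux
  rw [← Equiv.sum_comp e]
  rfl

lemma admissible_comp_equiv {ι' : Type*} [Fintype ι'] (e : ι' ≃ ι) (R : ℕ → ℕ) (p : ℕ) (h : ι → ℕ) :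
    admissible K R p (h ∘ e) = admissible K R p h := by
  ext n
  simp only [mem_admissible, flux_comp_equiv]

end Admissible

@[to_additive]
lemma prod_subtype_eq_prod_ite {ι M : Type*} [Fintype ι] [CommMonoid M] {P : ι → Prop} [DecidablePred P]
    {inst : Fintype {x // P x}} (f : ι → M) : ∏ x : {x // P x}, f x = ∏ x, if P x then f x else 1 := by
  rw [← Finset.prod_subtype (Finset.univ.filter P) (by simp) f, Finset.prod_filter]

section Stage
variable {K N l : ℕ} {p : ℕ} {n : OrdPair K → ℕ} {h : Fin N → ℕ} {A : Finset (Fin N)} {R : ℕ → ℕ}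

lemma sum_emitted (E : Fin l ≃ {i : Label n // lower i.1 = p}) (f : OrdPair K → ℕ) :
    ∑ z, f (E z).1.1 = ∑ q, if lower q = p then n q * f q else 0 := by
  rw [Equiv.sum_comp E fun i => f i.1.1, sum_subtype_eq_sum_ite (fun i : Label n => f i.1),
    Fintype.sum_sigma]
  refine Finset.sum_congr rfl fun q _ => ?_
  simp

lemma flux_dropLevel (hA : ∀ i, i ∈ A ↔ p < h i)
    (E : Fin l ≃ {i : Label n // lower i.1 = p}) {t : ℕ} (ht : p < t) :
    flux (Sum.elim (h ∘ A.orderEmbOfFin rfl) fun z => upper (E z).1.1) (dropLevel p n) t = flux h n t := by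
  unfold flux
  have e1 : (∑ x : Fin A.card, if t ≤ h (A.orderEmbOfFin rfl x) then 1 else 0) = ∑ i, if t ≤ h i then 1 else 0 := by
    refine Fintype.sum_of_injective _ (A.orderEmbOfFin rfl).injective _ _ (fun i hi => if_neg fun hc => hi ?_)
      fun x => rfl
    rw [Finset.range_orderEmbOfFin]
    exact (hA i).2 (by omega)
  have e2 := sum_emitted E fun q => if t ≤ upper q then 1 else 0
  have e0 : (∑ i, if t ≤ (Sum.elim (h ∘ A.orderEmbOfFin rfl) fun z => upper (E z).1.1 : _ → ℕ) i then 1 else 0) =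
      (∑ x : Fin A.card, if t ≤ h (A.orderEmbOfFin rfl x) then 1 else 0) +
        ∑ z, if t ≤ upper (E z).1.1 then 1 else 0 := by
    rw [Fintype.sum_sum_type]
    rfl
  rw [e0, e1, e2, add_assoc, ← Finset.sum_add_distrib]
  congr 1
  refine Finset.sum_congr rfl fun q _ => ?_
  unfold dropLevel
  by_cases h1 : lower q = p
  · by_cases h2 : t ≤ upper q <;> simp [h1, h2, ht]
  · simp [h1]

lemma flux_succ (hA : ∀ i, i ∈ A ↔ p < h i) (hn : ∀ q, lower q < p → n q = 0) :
    flux h n (p + 1) = A.card + ∑ b : {q : OrdPair K // lower q = p}, n b := by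
  unfold flux
  congr 1
  · rw [Finset.sum_boole, Nat.cast_id]
    congr 1
    ext i
    simp [hA]
  · rw [sum_subtype_eq_sum_ite]
    refine Finset.sum_congr rfl fun q _ => ?_
    have h1 := lower_lt_upper q
    by_cases h2 : lower q = p
    · rw [if_pos (by omega), if_pos h2]
    · rw [if_neg h2]
      split_ifs with h3
      · exact hn q (by omega)
      · rfl

lemma dropLevel_mem_admissible (hA : ∀ i, i ∈ A ↔ p < h i) (hn : ∀ q, lower q < p → n q = 0)
    (hR : p + 1 < K + 2 → A.card + ∑ b : {q : OrdPair K // lower q = p}, n b = R (p + 1))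
    (E : Fin l ≃ {i : Label n // lower i.1 = p}) :
    dropLevel p n ∈ admissible K R (p + 1) (Sum.elim (h ∘ A.orderEmbOfFin rfl) fun z => upper (E z).1.1) ↔
      n ∈ admissible K R p h := by
  rw [mem_admissible, mem_admissible]
  constructor
  · rintro ⟨-, h2⟩
    refine ⟨hn, fun t ht htK => ?_⟩
    rcases Nat.lt_or_ge (p + 1) t with ht' | ht'
    · rw [← h2 t ht' htK, flux_dropLevel hA E ht]
    · obtain rfl : t = p + 1 := by omega
      rw [flux_succ hA hn, hR htK]
  · rintro ⟨h1, h2⟩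
    refine ⟨fun q hq => ?_, fun t ht htK => ?_⟩
    · unfold dropLevel
      split_ifs with h3
      · rfl
      · exact h1 q (by omega)
    · rw [flux_dropLevel hA E (by omega), h2 t (by omega) htK]

/-- The numbers of exchanged particles, given those of the particles emitted at the level `p`. -/
def addLevel (p : ℕ) (ν : {q : OrdPair K // lower q = p} → ℕ) (n : OrdPair K → ℕ) : OrdPair K → ℕ :=
  fun q => if h : lower q = p then ν ⟨q, h⟩ else n q

lemma addLevel_apply (ν : {q : OrdPair K // lower q = p} → ℕ) (n : OrdPair K → ℕ) (b) :
    addLevel p ν n b.1 = ν b := dif_pos b.2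

lemma dropLevel_addLevel (ν : {q : OrdPair K // lower q = p} → ℕ) (hn : ∀ q, lower q = p → n q = 0) :
    dropLevel p (addLevel p ν n) = n := by
  funext q
  unfold dropLevel addLevel
  split_ifs with h1
  · exact (hn q h1).symm
  · rfl

lemma addLevel_dropLevel : addLevel p (fun b => n b) (dropLevel p n) = n := by
  funext q
  unfold dropLevel addLevel
  split_ifs with h1
  · rfl
  · exact if_neg h1

/-- The particles emitted at the level `p`. -/
def emittedEquiv (p : ℕ) (n : OrdPair K → ℕ) :
    ((b : {q : OrdPair K // lower q = p}) × Fin (n b)) ≃ {i : Label n // lower i.1 = p} where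
  toFun x := ⟨⟨x.1, x.2⟩, x.1.2⟩
  invFun i := ⟨⟨i.1.1, i.2⟩, i.1.2⟩
  left_inv _ := rfl
  right_inv _ := rfl

lemma exists_equiv_sigma {B : Type*} [DecidableEq B] (κ : Fin l → B) :
    ∃ (ν : B → ℕ) (e : Fin l ≃ (b : B) × Fin (ν b)), ∀ z, (e z).1 = κ z :=
  ⟨fun b => Fintype.card {i // κ i = b}, (Equiv.sigmaFiberEquiv κ).symm.trans
    (Equiv.sigmaCongrRight fun _ => Fintype.equivFin _), fun _ => rfl⟩

/-- The sum over the levels of all particles after the operator `p`, in terms of those of the particles before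
it and of the emitted particles. -/
lemma sum_piFinset_eq (hp : 1 ≤ p) (hpK : p + 1 ≤ K + 2) (A : Finset (Fin N)) (F : (Fin A.card ⊕ Fin l → ℕ) → ℂ) :
    ∑ h' ∈ Fintype.piFinset fun _ => Finset.Ico (p + 1) (K + 2), F h' =
      ∑ h ∈ (Fintype.piFinset fun _ : Fin N => Finset.Ico p (K + 2)).filter (fun h => Finset.univ.filter (p < h ·) = A),
        ∑ κ : Fin l → {q : OrdPair K // lower q = p},
          F (Sum.elim (h ∘ A.orderEmbOfFin rfl) fun z => upper (κ z).1) := by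
  rw [← Finset.sum_product' _ _ fun (h : Fin N → ℕ) (κ : Fin l → {q : OrdPair K // lower q = p}) =>
    F (Sum.elim (h ∘ A.orderEmbOfFin rfl) fun z => upper (κ z).1)]
  symm
  have hemb : ∀ i ∈ A, ∃ x, A.orderEmbOfFin rfl x = i := fun i hi => by
    have : i ∈ Set.range (A.orderEmbOfFin rfl) := by rw [Finset.range_orderEmbOfFin]; exact hi
    exact this
  refine Finset.sum_bij (fun x _ => Sum.elim (x.1 ∘ A.orderEmbOfFin rfl) fun z => upper (x.2 z).1) ?_ ?_ ?_ ?_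
  · rintro ⟨h, κ⟩ hx
    simp only [Finset.mem_product, Finset.mem_filter, Fintype.mem_piFinset, Finset.mem_Ico] at hx
    rw [Fintype.mem_piFinset]
    intro i
    rw [Finset.mem_Ico]
    rcases i with i | z
    · have h1 : A.orderEmbOfFin rfl i ∈ A := Finset.orderEmbOfFin_mem A rfl i
      have h2 : A.orderEmbOfFin rfl i ∈ Finset.univ.filter (p < h ·) := hx.1.2.symm ▸ h1
      exact ⟨(Finset.mem_filter.1 h2).2, (hx.1.1 _).2⟩
    · have h1 := (κ z).2
      have h2 := lower_lt_upper (κ z).1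
      have h3 := upper_lt (κ z).1
      simp only [Sum.elim_inr]
      omega
  · rintro ⟨h, κ⟩ hx ⟨h', κ'⟩ hx' heq
    simp only [Finset.mem_product, Finset.mem_filter, Fintype.mem_piFinset, Finset.mem_Ico] at hx hx'
    refine Prod.ext (funext fun i => ?_) (funext fun z => ?_)
    · by_cases hi : i ∈ A
      · obtain ⟨x, rfl⟩ := hemb i hi
        exact congrFun heq (Sum.inl x)
      · have h1 : ¬ p < h i := fun hc => hi (by rw [← hx.1.2]; simp [hc])
        have h2 : ¬ p < h' i := fun hc => hi (by rw [← hx'.1.2]; simp [hc])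
        have h3 := (hx.1.1 i).1
        have h4 := (hx'.1.1 i).1
        change h i = h' i
        omega
    · change κ z = κ' z
      have h1 : upper (κ z).1 = upper (κ' z).1 := congrFun heq (Sum.inr z)
      have h2 : lower (κ z).1 = lower (κ' z).1 := (κ z).2.trans (κ' z).2.symm
      unfold upper at h1
      unfold lower at h2
      exact Subtype.ext (Subtype.ext (Prod.ext (Fin.ext (by omega)) (Fin.ext (by omega))))
  · intro h' hh'
    rw [Fintype.mem_piFinset] at hh'
    simp only [Finset.mem_Ico] at hh'
    have hκ : ∀ z : Fin l, ∃ b : {q : OrdPair K // lower q = p}, upper b.1 = h' (Sum.inr z) := fun z => by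
      have h1 := hh' (Sum.inr z)
      refine ⟨⟨⟨(⟨h' (Sum.inr z) - 1, by omega⟩, ⟨p - 1, by omega⟩), ?_⟩, ?_⟩, ?_⟩
      · simp only [Fin.mk_lt_mk]
        omega
      · simp only [lower]
        omega
      · simp only [upper]
        omega
    choose κ hκ using hκ
    have hL : ∀ i : Fin N, ∃ t, (∀ x, A.orderEmbOfFin rfl x = i → t = h' (Sum.inl x)) ∧ (i ∉ A → t = p) := fun i => by
      by_cases hi : i ∈ A
      · obtain ⟨x, rfl⟩ := hemb i hi
        exact ⟨h' (Sum.inl x), fun y hy => by rw [(A.orderEmbOfFin rfl).injective hy], fun h => absurd hi h⟩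
      · exact ⟨p, fun x hx => absurd (hx ▸ Finset.orderEmbOfFin_mem A rfl x) hi, fun _ => rfl⟩
    choose h hh1 hh2 using hL
    refine ⟨(h, κ), ?_, ?_⟩
    · simp only [Finset.mem_product, Finset.mem_filter, Fintype.mem_piFinset, Finset.mem_Ico, Finset.mem_univ,
        and_true]
      refine ⟨fun i => ?_, ?_⟩
      · by_cases hi : i ∈ A
        · obtain ⟨x, rfl⟩ := hemb i hi
          have := hh' (Sum.inl x)
          rw [hh1 _ x rfl]
          omega
        · rw [hh2 i hi]
          omega
      · ext i
        rw [Finset.mem_filter]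
        by_cases hi : i ∈ A
        · obtain ⟨x, rfl⟩ := hemb i hi
          have := hh' (Sum.inl x)
          rw [hh1 _ x rfl]
          simp only [hi, iff_true, Finset.mem_univ, true_and]
          omega
        · rw [hh2 i hi]
          simp [hi]
    · funext i
      rcases i with x | z
      · exact hh1 _ x rfl
      · exact hκ z
  · rintro ⟨h, κ⟩ _
    rfl

end Stage

/-! ### The successive actions on the vacuum -/

section Coefficient
variable {K : ℕ} {p : ℕ}

/-- The coefficient of the term with `n` exchanged particles. -/
def coefficient (n : OrdPair K → ℕ) : ℂ :=
  ((∏ q, ((n q).factorial : ℂ)) * (2 * Real.pi : ℂ) ^ (∑ q, n q))⁻¹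

lemma two_pi_ne_zero' : (2 * Real.pi : ℂ) ≠ 0 := by
  exact_mod_cast Real.two_pi_pos.ne'

lemma coefficient_dropLevel (n : OrdPair K → ℕ) :
    ((∏ b : {q : OrdPair K // lower q = p}, (n b).factorial : ℕ) : ℂ)⁻¹ * coefficient (dropLevel p n) =
      (2 * Real.pi : ℂ) ^ (∑ b : {q : OrdPair K // lower q = p}, n b) * coefficient n := by
  have h1 : ∏ q, ((n q).factorial : ℂ) = ((∏ b : {q : OrdPair K // lower q = p}, (n b).factorial : ℕ) : ℂ) *
      ∏ q, ((dropLevel p n q).factorial : ℂ) := by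
    push_cast
    rw [prod_subtype_eq_prod_ite (fun q => ((n q).factorial : ℂ)), ← Finset.prod_mul_distrib]
    refine Finset.prod_congr rfl fun q _ => ?_
    unfold dropLevel
    split_ifs <;> simp
  have h2 : ∑ q, n q = ∑ b : {q : OrdPair K // lower q = p}, n b + ∑ q, dropLevel p n q := by
    rw [sum_subtype_eq_sum_ite, ← Finset.sum_add_distrib]
    refine Finset.sum_congr rfl fun q _ => ?_
    unfold dropLevel
    split_ifs <;> simp
  have h3 : ((∏ b : {q : OrdPair K // lower q = p}, (n b).factorial : ℕ) : ℂ) ≠ 0 := by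
    exact_mod_cast Finset.prod_ne_zero_iff.2 fun b _ => Nat.factorial_ne_zero _
  have h4 := pow_ne_zero (∑ b : {q : OrdPair K // lower q = p}, n b) two_pi_ne_zero'
  unfold coefficient
  rw [h1, h2, pow_add, mul_inv, mul_inv, mul_inv, mul_inv]
  field_simp

end Coefficient

section Stage
variable {Q : Model} {K N l p : ℕ} {O : ℕ → LocalOperator Q} {g : ℕ → 𝓢(ℝ × ℝ, ℂ)} {R : ℕ → ℕ}
  {h : Fin N → ℕ} {A : Finset (Fin N)}

/-- The emitted particles, labelled by the level at which they are absorbed. -/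
def emitted (n : OrdPair K → ℕ) {ν : {q : OrdPair K // lower q = p} → ℕ} (hν : (fun b => n b.1) = ν)
    (e : Fin l ≃ (b : {q : OrdPair K // lower q = p}) × Fin (ν b)) : Fin l ≃ {i : Label n // lower i.1 = p} :=
  (e.trans (Equiv.sigmaCongrRight fun b => finCongr (congrFun hν b).symm)).trans (emittedEquiv p n)

lemma sum_eq_of_equiv_sigma {B : Type*} [Fintype B] {ν : B → ℕ} (e : Fin l ≃ (b : B) × Fin (ν b)) : ∑ b, ν b = l := by
  have := Fintype.card_congr e
  simp only [Fintype.card_fin, Fintype.card_sigma] at this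
  exact this.symm

lemma sum_emitted_eq (hpK : p + 1 ≤ K + 2) (hA : ∀ i, i ∈ A ↔ p < h i) (hl : A.card + l = R (p + 1))
    (hR : R (K + 2) = 0) {n : OrdPair K → ℕ} (hn : n ∈ admissible K R p h) :
    ∑ b : {q : OrdPair K // lower q = p}, n b = l := by
  rw [mem_admissible] at hn
  rcases Nat.lt_or_ge (p + 1) (K + 2) with hlt | hge
  · have h1 := flux_succ hA hn.1
    rw [hn.2 (p + 1) (Nat.lt_succ_self p) hlt] at h1
    omega
  · obtain h1 : p + 1 = K + 2 := by omega
    rw [h1, hR] at hl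
    have h2 : ∑ b : {q : OrdPair K // lower q = p}, n b = 0 := Finset.sum_eq_zero fun b _ => by
      have h3 := lower_lt_upper b.1
      have h4 := upper_lt b.1
      have h5 := b.2
      omega
    omega

lemma addLevel_mem_admissible (hA : ∀ i, i ∈ A ↔ p < h i) (hl : A.card + l = R (p + 1))
    {ν : {q : OrdPair K // lower q = p} → ℕ} (e : Fin l ≃ (b : {q : OrdPair K // lower q = p}) × Fin (ν b))
    {n' : OrdPair K → ℕ} (hn' : n' ∈ admissible K R (p + 1)
      (Sum.elim (h ∘ A.orderEmbOfFin rfl) fun z => upper (e z).1.1)) :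
    addLevel p ν n' ∈ admissible K R p h ∧ dropLevel p (addLevel p ν n') = n' ∧
      (fun b : {q : OrdPair K // lower q = p} => addLevel p ν n' b.1) = ν := by
  have h0 := (mem_admissible.1 hn').1
  have h1 : dropLevel p (addLevel p ν n') = n' := dropLevel_addLevel ν fun q hq => h0 q (by omega)
  have h2 : (fun b : {q : OrdPair K // lower q = p} => addLevel p ν n' b.1) = ν :=
    funext fun b => addLevel_apply ν n' b
  refine ⟨(dropLevel_mem_admissible hA (fun q hq => ?_) (fun _ => ?_)
    (emitted (addLevel p ν n') h2 e)).1 ?_, h1, h2⟩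
  · unfold addLevel
    rw [dif_neg (by omega)]
    exact h0 q (by omega)
  · have h3 := sum_eq_of_equiv_sigma e
    rw [Finset.sum_congr rfl fun b _ => addLevel_apply ν n' b, h3, hl]
  · rw [h1]
    exact hn'

/-- The action of the operator `p` on a term of the expansion is given by an absolutely convergent integral. -/
lemma integrable_contractionKernel_mul_term (hp : 1 ≤ p) (hpK : p + 1 ≤ K + 2) (hh : ∀ i, p ≤ h i ∧ h i < K + 2)
    (hA : ∀ i, i ∈ A ↔ p < h i) (hl : A.card + l = R (p + 1)) {e : ℝ} (he : 0 < e) (he1 : e ≤ 1)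
    {α : Fin N → ℝ} (hα : Function.Injective α) (κ : Fin l → {q : OrdPair K // lower q = p}) {n' : OrdPair K → ℕ}
    (hn' : n' ∈ admissible K R (p + 1) (Sum.elim (h ∘ A.orderEmbOfFin rfl) fun z => upper (κ z).1)) :
    Integrable fun y => contractionKernel (O p) (g p) e α A y *
      term O g (p + 1) 0 (Sum.elim (h ∘ A.orderEmbOfFin rfl) fun z => upper (κ z).1) n' (rightRap α A y) := by
  obtain ⟨ν, E, hE⟩ := exists_equiv_sigma κ
  obtain rfl : (fun z => (E z).1) = κ := funext hE
  obtain ⟨h1, h2, h3⟩ := addLevel_mem_admissible hA hl E hn'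
  have := (integral_contractionKernel_mul_term (O := O) (g := g) hp hpK hh (mem_admissible.1 h1).1 hA
    (emitted _ h3 E) he he1 hα).1
  rw [h2] at this
  exact this

/-- The action of the operator `p`, at fixed levels of the particles before it. -/
lemma sum_emitted_levels (hp : 1 ≤ p) (hpK : p + 1 ≤ K + 2) (hR : R (K + 2) = 0)
    (hh : ∀ i, p ≤ h i ∧ h i < K + 2) (hA : ∀ i, i ∈ A ↔ p < h i) (hl : A.card + l = R (p + 1)) {e : ℝ}
    (he : 0 < e) (he1 : e ≤ 1) {α : Fin N → ℝ} (hα : Function.Injective α) :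
    ((l.factorial : ℕ) : ℂ)⁻¹ * ∑ κ : Fin l → {q : OrdPair K // lower q = p},
      ∑ n' ∈ admissible K R (p + 1) (Sum.elim (h ∘ A.orderEmbOfFin rfl) fun z => upper (κ z).1),
        coefficient n' * ∫ y, contractionKernel (O p) (g p) e α A y *
          term O g (p + 1) 0 (Sum.elim (h ∘ A.orderEmbOfFin rfl) fun z => upper (κ z).1) n' (rightRap α A y) =
      (2 * Real.pi : ℂ) ^ l *
        ∑ n ∈ admissible K R p h, coefficient n * term O g p (Function.update 0 p e) h n α := by
  classical
  rw [sum_eq_sum_piAntidiag _ (fun ν => ∑ n ∈ (admissible K R p h).filter fun n => (fun b => n b.1) = ν,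
    coefficient (dropLevel p n) * term O g p (Function.update 0 p e) h n α) fun ν E => ?_]
  · rw [← Finset.sum_fiberwise_of_maps_to (s := admissible K R p h) (t := Finset.piAntidiag Finset.univ l)
      (g := fun n => fun b : {q : OrdPair K // lower q = p} => n b.1) fun n hn => ?_, Finset.mul_sum]
    · refine Finset.sum_congr rfl fun ν hν => ?_
      rw [Finset.mul_sum, Finset.mul_sum]
      refine Finset.sum_congr rfl fun n hn => ?_
      obtain ⟨h1, rfl⟩ := Finset.mem_filter.1 hn
      rw [← mul_assoc, coefficient_dropLevel, sum_emitted_eq hpK hA hl hR h1, mul_assoc]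
    · rw [Finset.mem_piAntidiag]
      exact ⟨sum_emitted_eq hpK hA hl hR hn, fun _ _ => Finset.mem_univ _⟩
  · refine Finset.sum_nbij' (addLevel p ν) (dropLevel p) (fun n' hn' => ?_) (fun n hn => ?_) (fun n' hn' => ?_)
      (fun n hn => ?_) fun n' hn' => ?_
    · obtain ⟨h1, -, h3⟩ := addLevel_mem_admissible hA hl E hn'
      exact Finset.mem_filter.2 ⟨h1, h3⟩
    · obtain ⟨h1, h2⟩ := Finset.mem_filter.1 hn
      refine (dropLevel_mem_admissible hA (mem_admissible.1 h1).1 (fun _ => ?_) (emitted n h2 E)).2 h1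
      rw [sum_emitted_eq hpK hA hl hR h1, hl]
    · exact (addLevel_mem_admissible hA hl E hn').2.1
    · obtain ⟨h1, rfl⟩ := Finset.mem_filter.1 hn
      exact addLevel_dropLevel
    · obtain ⟨h1, h2, h3⟩ := addLevel_mem_admissible hA hl E hn'
      have := (integral_contractionKernel_mul_term (O := O) (g := g) hp hpK hh (mem_admissible.1 h1).1 hA
        (emitted _ h3 E) he he1 hα).2
      rw [← this, h2]
      rfl

variable {ι : Type*} [Fintype ι]

open scoped Classical in
/-- The action of the operators `p, p + 1, …` on the vacuum, up to a phase and to the factors which make it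
symmetric in the rapidities. -/
def expansion (K : ℕ) (O : ℕ → LocalOperator Q) (g : ℕ → 𝓢(ℝ × ℝ, ℂ)) (R : ℕ → ℕ) (p : ℕ) (ε : ℕ → ℝ)
    (α : ι → ℝ) : ℂ :=
  ∑ h ∈ Fintype.piFinset fun _ : ι => Finset.Ico p (K + 2), ∑ n ∈ admissible K R p h,
    coefficient n * term O g p ε h n α

lemma expansion_eq [DecidableEq ι] (ε : ℕ → ℝ) (α : ι → ℝ) : expansion K O g R p ε α =
    ∑ h ∈ Fintype.piFinset fun _ : ι => Finset.Ico p (K + 2), ∑ n ∈ admissible K R p h,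
      coefficient n * term O g p ε h n α := by
  unfold expansion
  congr!

lemma expansion_comp_equiv {ι' : Type*} [Fintype ι'] (e : ι' ≃ ι) (hp : 1 ≤ p) {ε : ℕ → ℝ} (hε : ε ∈ regBox 1 ∅)
    {α : ι → ℝ} (hα : Function.Injective α) : expansion K O g R p ε (α ∘ e) = expansion K O g R p ε α := by
  classical
  unfold expansion
  refine (Finset.sum_nbij' (fun h => h ∘ e) (fun h => h ∘ e.symm) (fun h hh => ?_) (fun h hh => ?_)
    (fun h _ => ?_) (fun h _ => ?_) fun h hh => ?_).symm
  · rw [Fintype.mem_piFinset] at hh ⊢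
    exact fun i => hh (e i)
  · rw [Fintype.mem_piFinset] at hh ⊢
    exact fun i => hh (e.symm i)
  · funext i; simp
  · funext i; simp
  · rw [admissible_comp_equiv]
    refine Finset.sum_congr rfl fun n hn => ?_
    rw [Fintype.mem_piFinset] at hh
    rw [term_comp_equiv e hp (fun i => Finset.mem_Ico.1 (hh i)) (mem_admissible.1 hn).1 hε hα]

/-- The action of the operator `p` on the expansion of the action of the following operators. -/
theorem sum_integral_contractionKernel_mul_expansion (hp : 1 ≤ p) (hpK : p + 1 ≤ K + 2) (hR : R (K + 2) = 0)
    {m : ℕ} (hm : R (p + 1) = m) {e : ℝ} (he : 0 < e) (he1 : e ≤ 1) {α : Fin N → ℝ} (hα : Function.Injective α) :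
    (∀ A : Finset (Fin N), A.card ≤ m → Integrable fun y : Fin (m - A.card) → ℝ =>
      contractionKernel (O p) (g p) e α A y * expansion K O g R (p + 1) 0 (rightRap α A y)) ∧
    (∑ A : Finset (Fin N), if A.card ≤ m then (2 * Real.pi : ℂ) ^ A.card / (2 * Real.pi : ℂ) ^ m *
      (((m - A.card).factorial : ℂ)⁻¹ * ∫ y : Fin (m - A.card) → ℝ,
        contractionKernel (O p) (g p) e α A y * expansion K O g R (p + 1) 0 (rightRap α A y)) else 0) =
      expansion K O g R p (Function.update 0 p e) α := by
  classical
  have hexp : ∀ (A : Finset (Fin N)) (y : Fin (m - A.card) → ℝ),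
      contractionKernel (O p) (g p) e α A y * expansion K O g R (p + 1) 0 (rightRap α A y) =
      ∑ h ∈ (Fintype.piFinset fun _ : Fin N => Finset.Ico p (K + 2)).filter
          (fun h => Finset.univ.filter (p < h ·) = A),
        ∑ κ : Fin (m - A.card) → {q : OrdPair K // lower q = p},
          ∑ n' ∈ admissible K R (p + 1) (Sum.elim (h ∘ A.orderEmbOfFin rfl) fun z => upper (κ z).1),
            coefficient n' * (contractionKernel (O p) (g p) e α A y *
              term O g (p + 1) 0 (Sum.elim (h ∘ A.orderEmbOfFin rfl) fun z => upper (κ z).1) n'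
                (rightRap α A y)) := by
    intro A y
    have h1 := sum_piFinset_eq (K := K) hp hpK A fun h' : Fin A.card ⊕ Fin (m - A.card) → ℕ =>
      ∑ n ∈ admissible K R (p + 1) h', coefficient n * term O g (p + 1) 0 h' n (rightRap α A y)
    rw [expansion_eq, h1]
    simp only [Finset.mul_sum]
    refine Finset.sum_congr rfl fun h _ => Finset.sum_congr rfl fun κ _ => Finset.sum_congr rfl fun n _ => ?_
    ring
  have hmem : ∀ {A : Finset (Fin N)} {h : Fin N → ℕ},
      h ∈ (Fintype.piFinset fun _ : Fin N => Finset.Ico p (K + 2)).filter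
          (fun h => Finset.univ.filter (p < h ·) = A) →
      (∀ i, p ≤ h i ∧ h i < K + 2) ∧ ∀ i, i ∈ A ↔ p < h i := by
    intro A h hh
    obtain ⟨h1, rfl⟩ := Finset.mem_filter.1 hh
    rw [Fintype.mem_piFinset] at h1
    exact ⟨fun i => Finset.mem_Ico.1 (h1 i), fun i => by simp⟩
  have hint : ∀ A : Finset (Fin N), A.card ≤ m →
      ∀ h ∈ (Fintype.piFinset fun _ : Fin N => Finset.Ico p (K + 2)).filter
          (fun h => Finset.univ.filter (p < h ·) = A),
      ∀ κ : Fin (m - A.card) → {q : OrdPair K // lower q = p},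
      ∀ n' ∈ admissible K R (p + 1) (Sum.elim (h ∘ A.orderEmbOfFin rfl) fun z => upper (κ z).1),
      Integrable fun y => coefficient n' * (contractionKernel (O p) (g p) e α A y *
              term O g (p + 1) 0 (Sum.elim (h ∘ A.orderEmbOfFin rfl) fun z => upper (κ z).1) n'
                (rightRap α A y)) := fun A hA h hh κ n' hn' =>
    (integrable_contractionKernel_mul_term hp hpK (hmem hh).1 (hmem hh).2
      (by rw [hm]; omega) he he1 hα κ hn').const_mul _
  constructor
  · intro A hA
    simp only [hexp]
    exact integrable_finsetSum _ fun h hh => integrable_finsetSum _ fun κ _ => integrable_finsetSum _ fun n' hn' =>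
      hint A hA h hh κ n' hn'
  · have hsum : ∀ A : Finset (Fin N), (if A.card ≤ m then (2 * Real.pi : ℂ) ^ A.card / (2 * Real.pi : ℂ) ^ m *
        (((m - A.card).factorial : ℂ)⁻¹ * ∫ y : Fin (m - A.card) → ℝ,
          contractionKernel (O p) (g p) e α A y * expansion K O g R (p + 1) 0 (rightRap α A y)) else 0) =
        ∑ h ∈ (Fintype.piFinset fun _ : Fin N => Finset.Ico p (K + 2)).filter
          (fun h => Finset.univ.filter (p < h ·) = A),
          ∑ n ∈ admissible K R p h, coefficient n * term O g p (Function.update 0 p e) h n α := by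
      intro A
      split_ifs with hA
      · simp only [hexp]
        rw [integral_finsetSum _ fun h hh => integrable_finsetSum _ fun κ _ => integrable_finsetSum _
          fun n' hn' => hint A hA h hh κ n' hn', Finset.mul_sum, Finset.mul_sum]
        refine Finset.sum_congr rfl fun h hh => ?_
        rw [integral_finsetSum _ fun κ _ => integrable_finsetSum _ fun n' hn' => hint A hA h hh κ n' hn']
        have h1 : ∀ κ : Fin (m - A.card) → {q : OrdPair K // lower q = p},
            (∫ y, ∑ n' ∈ admissible K R (p + 1) (Sum.elim (h ∘ A.orderEmbOfFin rfl) fun z => upper (κ z).1),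
              coefficient n' * (contractionKernel (O p) (g p) e α A y *
              term O g (p + 1) 0 (Sum.elim (h ∘ A.orderEmbOfFin rfl) fun z => upper (κ z).1) n'
                (rightRap α A y))) =
            ∑ n' ∈ admissible K R (p + 1) (Sum.elim (h ∘ A.orderEmbOfFin rfl) fun z => upper (κ z).1),
              coefficient n' * ∫ y, contractionKernel (O p) (g p) e α A y *
              term O g (p + 1) 0 (Sum.elim (h ∘ A.orderEmbOfFin rfl) fun z => upper (κ z).1) n'
                (rightRap α A y) := fun κ => by
          rw [integral_finsetSum _ fun n' hn' => hint A hA h hh κ n' hn']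
          simp only [integral_const_mul]
        simp only [h1]
        rw [sum_emitted_levels hp hpK hR (hmem hh).1 (hmem hh).2 (by rw [hm]; omega) he he1 hα, ← mul_assoc,
          div_mul_eq_mul_div, ← pow_add, Nat.add_sub_cancel' hA,
          div_self (pow_ne_zero _ two_pi_ne_zero'), one_mul]
      · -- more spectators than particles: there are no admissible families
        symm
        refine Finset.sum_eq_zero fun h hh => Finset.sum_eq_zero fun n hn => ?_
        exfalso
        obtain ⟨h1, h2⟩ := hmem hh
        rw [mem_admissible] at hn
        rcases Nat.lt_or_ge (p + 1) (K + 2) with hlt | hge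
        · have h3 := flux_succ h2 hn.1
          rw [hn.2 (p + 1) (Nat.lt_succ_self p) hlt, hm] at h3
          omega
        · have h3 : A = ∅ := Finset.eq_empty_of_forall_notMem fun i hi => by
            have := (h2 i).1 hi
            have := (h1 i).2
            omega
          rw [h3] at hA
          simp at hA
    simp only [hsum]
    rw [expansion_eq]
    exact Finset.sum_fiberwise _ (fun h : Fin N → ℕ => Finset.univ.filter (p < h ·)) _

end Stage

/-! ### The truncated vacuum expectation value -/

section Action
variable {Q : Model} {K N p : ℕ} {O : ℕ → LocalOperator Q} {g : ℕ → 𝓢(ℝ × ℝ, ℂ)} {R : ℕ → ℕ}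

lemma zero_mem_regBox : (0 : ℕ → ℝ) ∈ regBox 1 ∅ := fun _ => ⟨le_rfl, zero_le_one, fun h => h.elim⟩

lemma update_mem_regBox {e : ℝ} (h0 : 0 ≤ e) (h1 : e ≤ 1) : (Function.update 0 p e : ℕ → ℝ) ∈ regBox 1 ∅ := fun q => by
  by_cases hq : q = p
  · subst hq
    simp [h0, h1]
  · simp [Function.update_of_ne hq]

lemma tendsto_update_nhdsWithin :
    Tendsto (fun e : ℝ => (Function.update 0 p e : ℕ → ℝ)) (𝓝[>] 0) (𝓝[regBox 1 ∅] 0) := by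
  refine tendsto_nhdsWithin_iff.2 ⟨?_, ?_⟩
  · have h1 : Continuous fun e : ℝ => (Function.update 0 p e : ℕ → ℝ) := continuous_const.update p continuous_id
    have h2 := h1.tendsto 0
    rw [show (0 : ℝ) = (0 : ℕ → ℝ) p from rfl, Function.update_eq_self] at h2
    exact h2.mono_left nhdsWithin_le_nhds
  · filter_upwards [Ioc_mem_nhdsGT (zero_lt_one' ℝ)] with e he using update_mem_regBox he.1.le he.2

lemma tendsto_expansion (hp : 1 ≤ p) (α : Fin N → ℝ) :
    Tendsto (fun e : ℝ => expansion K O g R p (Function.update 0 p e) α) (𝓝[>] 0)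
      (𝓝 (expansion K O g R p 0 α)) := by
  classical
  simp only [expansion_eq]
  refine tendsto_finsetSum _ fun h hh => tendsto_finsetSum _ fun n hn => Tendsto.const_mul _ ?_
  unfold term
  refine Tendsto.const_mul _ ?_
  rw [Fintype.mem_piFinset] at hh
  have hJ := deformable_exchanged hp (fun i => Finset.mem_Ico.1 (hh i)) (mem_admissible.1 hn).1
  exact ((continuousOn_boundaryValue g hJ O one_pos le_rfl _) 0
    zero_mem_regBox).tendsto.comp tendsto_update_nhdsWithin

lemma pairProd_ne_zero {α : Fin N → ℝ} (hα : Function.Injective α) :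
    pairProd (pairF Q α) (List.finRange N) ≠ 0 :=
  pairProd_pairF_ne_zero hα (List.nodup_finRange N)

/-- The action of the operator `p` on the sector with `R (p + 1)` particles. -/
theorem isKernelAction_expansion (hp : 1 ≤ p) (hpK : p + 1 ≤ K + 2) (hR : R (K + 2) = 0) {m : ℕ}
    (hm : R (p + 1) = m) (c : ℂ) :
    IsKernelAction (O p) (g p)
      (fun β : Fin m → ℝ => c * expansion K O g R (p + 1) 0 β / pairProd (pairF Q β) (List.finRange m))
      (fun α : Fin N → ℝ => Complex.exp (-2 * Complex.I * Real.pi * N * (O p).omega) *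
        (c * expansion K O g R p 0 α) / pairProd (pairF Q α) (List.finRange N)) := by
  filter_upwards [ae_restrict_mem (measurableSet_orderedSector (m := N))] with α hα
  have hinj := injective_of_mem_orderedSector hα
  have key : ∀ e : ℝ, 0 < e → e ≤ 1 → _ := fun e he he1 => by
    obtain ⟨h1, h2⟩ := sum_integral_contractionKernel_mul_expansion (O := O) (g := g) hp hpK hR hm he he1 hinj
    have h3 := pairProd_mul_regularizedAction (O p) (g p)
      (fun β : Fin m → ℝ => c * expansion K O g R (p + 1) 0 β / pairProd (pairF Q β) (List.finRange m)) e hα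
      (fun A y => c * expansion K O g R (p + 1) 0 (rightRap α A y)) (fun A hA w y hy => by
        have h4 : Function.Injective (rightRap α A y) := by
          have h5 := hy.comp (Sum.map_injective.2 ⟨(A.orderEmbOfFin rfl).injective, Function.injective_id⟩)
          rwa [Sum.elim_comp_map, Function.comp_id] at h5
        rw [mul_div_cancel₀ _ (pairProd_ne_zero (h4.comp w.symm.injective)),
          expansion_comp_equiv w.symm (Nat.le_add_left 1 p) zero_mem_regBox h4])
      (fun A hA => by
        refine ((h1 A hA).const_mul c).congr (Eventually.of_forall fun y => ?_)
        ring)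
    have h4 : ∀ A : Finset (Fin N), (if A.card ≤ m then (2 * Real.pi : ℂ) ^ A.card / (2 * Real.pi : ℂ) ^ m *
        (((m - A.card).factorial : ℂ)⁻¹ * ∫ y : Fin (m - A.card) → ℝ, contractionKernel (O p) (g p) e α A y *
          (c * expansion K O g R (p + 1) 0 (rightRap α A y))) else 0) =
        c * (if A.card ≤ m then (2 * Real.pi : ℂ) ^ A.card / (2 * Real.pi : ℂ) ^ m *
        (((m - A.card).factorial : ℂ)⁻¹ * ∫ y : Fin (m - A.card) → ℝ, contractionKernel (O p) (g p) e α A y *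
          expansion K O g R (p + 1) 0 (rightRap α A y)) else 0) := fun A => by
      split_ifs
      · simp only [mul_left_comm _ c]
        rw [integral_const_mul]
        ring
      · rw [mul_zero]
    simp only [h4, ← Finset.mul_sum, h2] at h3
    exact h3
  constructor
  · filter_upwards [Ioc_mem_nhdsGT (zero_lt_one' ℝ)] with e he using (key e he.1 he.2).1
  · refine Tendsto.congr' ?_ (((tendsto_expansion hp α).const_mul c).const_mul
      (Complex.exp (-2 * Complex.I * Real.pi * N * (O p).omega)) |>.div_const _)
    filter_upwards [Ioc_mem_nhdsGT (zero_lt_one' ℝ)] with e he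
    rw [← (key e he.1 he.2).2, mul_div_cancel_left₀ _ (pairProd_ne_zero hinj)]

lemma isKernelAction_zero (O : LocalOperator Q) (g : 𝓢(ℝ × ℝ, ℂ)) {m n : ℕ} :
    IsKernelAction O g (0 : (Fin m → ℝ) → ℂ) (0 : (Fin n → ℝ) → ℂ) := by
  refine Eventually.of_forall fun α => ⟨Eventually.of_forall fun ε c => ?_, ?_⟩
  · unfold Contraction.integrand
    simp
  · unfold regularizedAction Contraction.integrand
    simp

/-- The Fock vector obtained by applying the operators `p, p + 1, …` to the vacuum. -/
def stageVector (K : ℕ) (O : ℕ → LocalOperator Q) (g : ℕ → 𝓢(ℝ × ℝ, ℂ)) (R : ℕ → ℕ) (p : ℕ) : FockVector :=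
  fun m α => if m = R p then (∏ q ∈ Finset.Ico p (K + 2), Complex.exp (-2 * Complex.I * Real.pi * R q * (O q).omega)) *
    expansion K O g R p 0 α / pairProd (pairF Q α) (List.finRange m) else 0

lemma isTruncatedAction_stageVector (hp : 1 ≤ p) (hpK : p + 1 ≤ K + 2) (hR : R (K + 2) = 0) :
    IsTruncatedAction (O p) (g p) (R p) (stageVector K O g R (p + 1)) (stageVector K O g R p) := by
  refine ⟨⟨fun m => if m = R (p + 1) then stageVector K O g R p (R p) else 0, fun m => ?_, ?_⟩, fun m hm => ?_⟩
  · by_cases hm : m = R (p + 1)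
    · have h1 := isKernelAction_expansion (O := O) (g := g) (N := R p) hp hpK hR hm.symm
        (∏ q ∈ Finset.Ico (p + 1) (K + 2), Complex.exp (-2 * Complex.I * Real.pi * R q * (O q).omega))
      have h2 : stageVector K O g R (p + 1) m = _ := funext fun α => if_pos hm
      have h3 : stageVector K O g R p (R p) = _ := funext fun α => if_pos rfl
      dsimp only
      rw [if_pos hm, h2, h3]
      rw [Finset.prod_eq_prod_Ico_succ_bot (by omega : p < K + 2)]
      simpa only [← mul_assoc] using h1
    · dsimp only
      rw [if_neg hm, show stageVector K O g R (p + 1) m = 0 from funext fun α => if_neg hm]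
      exact isKernelAction_zero _ _
  · refine Eventually.of_forall fun α => ?_
    have h1 := hasSum_single (f := fun m => (if m = R (p + 1) then stageVector K O g R p (R p) else 0) α) (R (p + 1))
      fun m hm => by simp only [if_neg hm, Pi.zero_apply]
    simpa using h1
  · funext α
    exact if_neg hm

lemma amp_self {Λ : Type*} [Fintype Λ] {hi lo : Λ → ℕ} (O : ℕ → LocalOperator Q) (g : ℕ → 𝓢(ℝ × ℝ, ℂ)) (p : ℕ)
    (ε : ℕ → ℝ) (γ : Λ → ℝ) : amp hi lo O g p p ε γ = 1 := by
  unfold amp ampH Model.smearProd ampA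
  simp

lemma term_last [IsEmpty (Fin N)] (h : Fin N → ℕ) (α : Fin N → ℝ) :
    term (K := K) O g (K + 2) 0 h 0 α = 1 := by
  classical
  have : IsEmpty (Label (0 : OrdPair K → ℕ)) := ⟨fun i => i.2.elim0⟩
  have hJ : Deformable (hiOf h (0 : OrdPair K → ℕ)) (loOf 0) (K + 2) (K + 2) (exchanged 0) ∅ :=
    ⟨fun i => isEmptyElim i, fun i => isEmptyElim i, fun i => isEmptyElim i, fun i => isEmptyElim i⟩
  have h1 : boundaryValue (hiOf h (0 : OrdPair K → ℕ)) (loOf 0) O g (K + 2) (K + 2) (exchanged 0) 0 (Sum.elim α 0) = 1 := by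
    rw [boundaryValue_congr_reg (ε' := 1) (fun q h1 h2 => absurd h1 (by omega)),
      boundaryValue_of_forall_not hJ one_pos le_rfl (ε := 1) (fun q => ⟨zero_le_one, le_rfl, fun h => h.elim⟩)
        (fun q => one_pos) (fun i => isEmptyElim i), amp_self]
  unfold term extFactor
  rw [h1]
  simp

lemma stageVector_last (hR : R (K + 2) = 0) : stageVector K O g R (K + 2) = vacuum := by
  classical
  funext m α
  unfold stageVector vacuum
  rw [hR]
  split_ifs with hm
  · subst hm
    have h1 : ∀ h : Fin 0 → ℕ, admissible K R (K + 2) h = {0} := fun h => by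
      ext n
      rw [mem_admissible, Finset.mem_singleton]
      constructor
      · rintro ⟨a, -⟩
        funext q
        have := lower_lt_upper q
        have := upper_lt q
        exact a q (by omega)
      · rintro rfl
        exact ⟨fun _ _ => rfl, fun t h1 h2 => by omega⟩
    rw [expansion_eq]
    simp only [h1, Finset.sum_singleton, term_last]
    simp [coefficient, pairProd]
  · rfl

end Action

/-! ### The integrand of the multiple integrals -/

section PairLists
variable {Q : Model} {Λ : Type*}

lemma pairProd_eq_of_pairwise {M : Type*} [CommMonoid M] [Fintype Λ] (f : Λ → Λ → M) {l : List Λ}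
    {r : Λ → Λ → Prop} [DecidableRel r] {P : Λ → Prop} [DecidablePred P] (hr : ∀ a b, r a b → ¬ r b a)
    (h : l.Pairwise r) (hP : ∀ a, a ∈ l ↔ P a) :
    pairProd f l = ∏ a, ∏ b, if P a ∧ P b ∧ r a b then f a b else 1 := by
  classical
  have hl : l.Nodup := h.imp fun {a b} hab => by
    rintro rfl
    exact hr _ _ hab hab
  have key : ∀ a ∈ l, ∀ b ∈ l, (l.idxOf a < l.idxOf b ↔ r a b) := by
    have h1 : ∀ a ∈ l, ∀ b ∈ l, l.idxOf a < l.idxOf b → r a b := fun a ha b hb hab => by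
      have := List.pairwise_iff_getElem.1 h _ _ (List.idxOf_lt_length_of_mem ha)
        (List.idxOf_lt_length_of_mem hb) hab
      rwa [List.getElem_idxOf, List.getElem_idxOf] at this
    refine fun a ha b hb => ⟨h1 a ha b hb, fun hab => ?_⟩
    rcases lt_trichotomy (l.idxOf a) (l.idxOf b) with h2 | h2 | h2
    · exact h2
    · obtain rfl := (List.idxOf_inj ha).1 h2
      exact absurd hab (hr _ _ hab)
    · exact absurd hab (hr _ _ (h1 b hb a ha h2))
  have h2 : ∀ a b, (if P a ∧ P b ∧ r a b then f a b else 1) =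
      if a ∈ l.toFinset ∧ b ∈ l.toFinset then (if l.idxOf a < l.idxOf b then f a b else 1) else 1 := fun a b => by
    simp only [List.mem_toFinset, ← hP]
    by_cases ha : a ∈ l
    · by_cases hb : b ∈ l
      · simp [ha, hb, key a ha b hb]
      · simp [hb]
    · simp [ha]
  simp only [h2]
  rw [prod_prod_ite_mem l.toFinset l.toFinset fun a b => if l.idxOf a < l.idxOf b then f a b else 1, pairProd_eq f hl]

lemma crossProd_eq_ite {M : Type*} [CommMonoid M] [Fintype Λ] (f : Λ → Λ → M) {l l' : List Λ} (hl : l.Nodup)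
    (hl' : l'.Nodup) {P P' : Λ → Prop} [DecidablePred P] [DecidablePred P'] (hP : ∀ a, a ∈ l ↔ P a)
    (hP' : ∀ a, a ∈ l' ↔ P' a) : crossProd f l l' = ∏ a, ∏ b, if P a ∧ P' b then f a b else 1 := by
  classical
  rw [crossProd_eq f hl hl', ← prod_prod_ite_mem]
  simp only [List.mem_toFinset, hP, hP']

lemma scattering_append [DecidableEq Λ] {v : Λ → ℝ} (hv : Function.Injective v) {l l' : List Λ} (h : (l ++ l').Nodup) :
    Q.scattering v (l ++ l') (l' ++ l) = crossProd (fun i j => Q.S ((v i : ℂ) - v j)) l l' := by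
  obtain ⟨hl, hl', hd⟩ := List.nodup_append'.1 h
  have h1 := scattering_mul_pairProd (Q := Q) v h List.perm_append_comm
  have h2 : crossProd (pairF Q v) l l' = crossProd (fun i j => Q.S ((v i : ℂ) - v j)) l l' * crossProd (pairF Q v) l' l := by
    rw [crossProd_eq _ hl hl', crossProd_eq _ hl hl', crossProd_eq _ hl' hl,
      Finset.prod_comm (s := l'.toFinset), ← Finset.prod_mul_distrib]
    refine Finset.prod_congr rfl fun a _ => ?_
    rw [← Finset.prod_mul_distrib]
    exact Finset.prod_congr rfl fun b _ => pairF_eq v a b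
  have h3 := pairProd_pairF_ne_zero (Q := Q) hv (List.nodup_append_comm.1 h)
  refine mul_right_cancel₀ h3 ?_
  rw [h1, pairProd_append, pairProd_append, h2]
  ring

end PairLists

section Blocks
variable {K : ℕ} {n : OrdPair K → ℕ}

/-- A numbering of the labels which is increasing on each block. -/
def labelRank (i : Label n) : ℕ := Nat.pair (Nat.pair (upper i.1) (lower i.1)) i.2

lemma labelRank_injective : Function.Injective (labelRank (n := n)) := by
  rintro ⟨⟨⟨b, a⟩, h⟩, j⟩ ⟨⟨⟨b', a'⟩, h'⟩, j'⟩ hij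
  simp only [labelRank, Nat.pair_eq_pair, upper, lower] at hij
  obtain rfl : b = b' := Fin.ext (by omega)
  obtain rfl : a = a' := Fin.ext (by omega)
  obtain rfl : j = j' := Fin.ext (by omega)
  rfl

lemma mem_block {b a : Fin (K + 1)} {i : Label n} : i ∈ block n b a ↔ i.1.1.1 = b ∧ i.1.1.2 = a := by
  unfold block
  split_ifs with h
  · rw [List.mem_map]
    constructor
    · rintro ⟨j, -, rfl⟩
      exact ⟨rfl, rfl⟩
    · obtain ⟨⟨⟨b', a'⟩, hq⟩, j⟩ := i
      rintro ⟨rfl, rfl⟩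
      exact ⟨j, List.mem_finRange j, rfl⟩
  · refine iff_of_false (List.not_mem_nil) ?_
    rintro ⟨rfl, rfl⟩
    exact h i.1.2

lemma pairwise_block (b a : Fin (K + 1)) : (block n b a).Pairwise fun i j => labelRank i < labelRank j := by
  unfold block
  split_ifs with h
  · rw [List.pairwise_map]
    exact (List.pairwise_lt_finRange _).imp fun {x y} hxy => Nat.pair_lt_pair_right _ hxy
  · exact List.Pairwise.nil

lemma nodup_block (b a : Fin (K + 1)) : (block n b a).Nodup :=
  (pairwise_block b a).imp fun h => by rintro rfl; exact lt_irrefl _ h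

lemma mem_incoming {p : Fin (K + 1)} {i : Label n} : i ∈ incoming n p ↔ upper i.1 = p + 1 := by
  unfold incoming
  simp only [List.mem_flatMap, List.mem_reverse, List.mem_finRange, true_and, mem_block, upper]
  constructor
  · rintro ⟨s, rfl, -⟩
    rfl
  · intro h
    exact ⟨i.1.1.2, Fin.ext (by omega), rfl⟩

lemma mem_outgoing {p : Fin (K + 1)} {i : Label n} : i ∈ outgoing n p ↔ lower i.1 = p + 1 := by
  unfold outgoing
  simp only [List.mem_flatMap, List.mem_reverse, List.mem_finRange, true_and, mem_block, lower]
  constructor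
  · rintro ⟨s, -, rfl⟩
    rfl
  · intro h
    exact ⟨i.1.1.1, rfl, Fin.ext (by omega)⟩

lemma pairwise_incoming (p : Fin (K + 1)) : (incoming n p).Pairwise fun i j =>
    lower j.1 < lower i.1 ∨ lower i.1 = lower j.1 ∧ labelRank j < labelRank i := by
  unfold incoming
  rw [List.pairwise_flatMap]
  refine ⟨fun s _ => ?_, ?_⟩
  · rw [List.pairwise_reverse]
    refine (pairwise_block p s).imp_of_mem fun {i j} hi hj hij => Or.inr ⟨?_, hij⟩
    rw [mem_block] at hi hj
    unfold lower
    rw [hi.2, hj.2]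
  · rw [List.pairwise_reverse]
    refine (List.pairwise_lt_finRange _).imp fun {s t} hst i hi j hj => Or.inl ?_
    rw [List.mem_reverse, mem_block] at hi hj
    unfold lower
    rw [hi.2, hj.2]
    exact Nat.add_lt_add_right hst 1

lemma pairwise_outgoing (p : Fin (K + 1)) : (outgoing n p).Pairwise fun i j =>
    upper j.1 < upper i.1 ∨ upper i.1 = upper j.1 ∧ labelRank i < labelRank j := by
  unfold outgoing
  rw [List.pairwise_flatMap]
  refine ⟨fun s _ => ?_, ?_⟩
  · refine (pairwise_block s p).imp_of_mem fun {i j} hi hj hij => Or.inr ⟨?_, hij⟩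
    rw [mem_block] at hi hj
    unfold upper
    rw [hi.1, hj.1]
  · rw [List.pairwise_reverse]
    refine (List.pairwise_lt_finRange _).imp fun {s t} hst i hi j hj => Or.inl ?_
    rw [mem_block] at hi hj
    unfold upper
    rw [hi.1, hj.1]
    exact Nat.add_lt_add_right hst 1

lemma prod_Ico_one_eq {M : Type*} [CommMonoid M] (f : ℕ → M) :
    ∏ q ∈ Finset.Ico 1 (K + 2), f q = ∏ s : Fin (K + 1), f (s + 1) := by
  rw [Finset.prod_Ico_eq_prod_range, Finset.prod_range]
  exact Finset.prod_congr rfl fun s _ => by rw [add_comm]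

/-- A family indexed by the operators, as a function of the level. -/
def atLevel {α : Type*} (f : Fin (K + 1) → α) (q : ℕ) : α := f (Fin.ofNat (K + 1) (q - 1))

lemma atLevel_succ {α : Type*} (f : Fin (K + 1) → α) (s : Fin (K + 1)) : atLevel f (s + 1) = f s := by
  unfold atLevel
  congr 1
  refine Fin.ext ?_
  simp [Fin.ofNat, Nat.mod_eq_of_lt s.2]

lemma upper_eq_iff {q : OrdPair K} {p : Fin (K + 1)} : upper q = p + 1 ↔ q.1.1 = p := by
  unfold upper
  rw [Fin.ext_iff]
  omega

lemma lower_eq_iff {q : OrdPair K} {p : Fin (K + 1)} : lower q = p + 1 ↔ q.1.2 = p := by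
  unfold lower
  rw [Fin.ext_iff]
  omega

variable {Q : Model} {γ : Label n → ℝ}

/-- The scattering factors `S` of the world lines which cross each other. -/
lemma totalScattering_eq (hγ : Function.Injective γ) : totalScattering Q γ = ∏ i, ∏ j,
    if lower j.1 < lower i.1 ∧ lower i.1 < upper j.1 ∧ upper j.1 < upper i.1 then Q.S ((γ i : ℂ) - γ j) else 1 := by
  have h1 : ∀ v p u s : Fin (K + 1), (if s < u ∧ u < p ∧ p < v then
      Q.scattering γ (block n v u ++ block n p s) (block n p s ++ block n v u) else 1) =
      ∏ i : Label n, ∏ j : Label n, if j.1.1.2 = s then (if i.1.1.2 = u then (if j.1.1.1 = p then (if i.1.1.1 = v then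
        (if lower j.1 < lower i.1 ∧ lower i.1 < upper j.1 ∧ upper j.1 < upper i.1 then
          Q.S ((γ i : ℂ) - γ j) else 1) else 1) else 1) else 1) else 1 := by
    intro v p u s
    split_ifs with hc
    · have hnd : (block n v u ++ block n p s).Nodup := List.nodup_append'.2 ⟨nodup_block _ _, nodup_block _ _,
        fun x hx hy => by
          rw [mem_block] at hx hy
          exact hc.2.2.ne (hy.1.symm.trans hx.1)⟩
      rw [scattering_append hγ hnd, crossProd_eq_ite _ (nodup_block _ _) (nodup_block _ _)
        (fun _ => mem_block) fun _ => mem_block]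
      refine Finset.prod_congr rfl fun i _ => Finset.prod_congr rfl fun j _ => ?_
      by_cases a1 : j.1.1.2 = s
      · by_cases a2 : i.1.1.2 = u
        · by_cases a3 : j.1.1.1 = p
          · by_cases a4 : i.1.1.1 = v
            · have h2 : lower j.1 < lower i.1 ∧ lower i.1 < upper j.1 ∧ upper j.1 < upper i.1 := by
                unfold lower upper
                rw [a1, a2, a3, a4]
                have := Fin.lt_def.1 hc.1
                have := Fin.lt_def.1 hc.2.1
                have := Fin.lt_def.1 hc.2.2
                omega
              rw [if_pos h2]
              simp [a1, a2, a3, a4]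
            · simp [a4]
          · simp [a3]
        · simp [a2]
      · simp [a1]
    · symm
      refine Finset.prod_eq_one fun i _ => Finset.prod_eq_one fun j _ => ?_
      split_ifs with a1 a2 a3 a4 h2
      · exfalso
        refine hc ?_
        unfold lower upper at h2
        rw [a1, a2, a3, a4] at h2
        simp only [Fin.lt_def]
        omega
      all_goals rfl
  unfold totalScattering
  simp only [h1]
  simp only [Finset.prod_comm (s := (Finset.univ : Finset (Fin (K + 1)))) (t := (Finset.univ : Finset (Label n)))]
  refine Finset.prod_congr rfl fun i _ => Finset.prod_congr rfl fun j _ => ?_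
  simp only [Finset.prod_ite_eq, Finset.mem_univ, if_true]

/-- The factors `F` and the `K`-transforms of the form factors. Particles with the same end points are ordered by
`labelRank`, in opposite directions at the two ends. -/
lemma totalFormFactor_eq (O : Fin (K + 1) → LocalOperator Q) (ε : Fin (K + 1) → ℝ) (γ : Label n → ℝ) :
    totalFormFactor O ε γ = (∏ i, ∏ j,
      (if upper i.1 = lower j.1 then
        Q.minimalFF ((γ i : ℂ) - γ j + Complex.I * (Real.pi - atLevel ε (upper i.1))) else 1) *
      (if upper i.1 = upper j.1 ∧ (lower j.1 < lower i.1 ∨ lower i.1 = lower j.1 ∧ labelRank j < labelRank i) then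
        Q.minimalFF ((γ i : ℂ) - γ j) else 1) *
      (if lower i.1 = lower j.1 ∧ (upper j.1 < upper i.1 ∨ upper i.1 = upper j.1 ∧ labelRank i < labelRank j) then
        Q.minimalFF ((γ i : ℂ) - γ j) else 1)) *
      ∏ q ∈ Finset.Ico 1 (K + 2), kTr (atLevel O q)
        (legRap (fun i : Label n => upper i.1) (fun i => lower i.1) q (atLevel ε q) fun i => (γ i : ℂ)) := by
  have h1 : ∀ p, (O p).shiftedFormFactor (ε p) ((incoming n p).map γ) ((outgoing n p).map γ) =
      (∏ i, ∏ j, if i.1.1.1 = p then (if upper i.1 = upper j.1 ∧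
        (lower j.1 < lower i.1 ∨ lower i.1 = lower j.1 ∧ labelRank j < labelRank i) then pairF Q γ i j else 1) else 1) *
      (∏ i, ∏ j, if i.1.1.2 = p then (if lower i.1 = lower j.1 ∧
        (upper j.1 < upper i.1 ∨ upper i.1 = upper j.1 ∧ labelRank i < labelRank j) then pairF Q γ i j else 1) else 1) *
      (∏ i, ∏ j, if i.1.1.1 = p then (if upper i.1 = lower j.1 then
        Q.minimalFF ((γ i : ℂ) - γ j + Complex.I * (Real.pi - ε p)) else 1) else 1) *
      kTr (O p) (legRap (fun i : Label n => upper i.1) (fun i => lower i.1) (p + 1) (ε p) fun i => (γ i : ℂ)) := by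
    intro p
    have hni : (incoming n p).Nodup := (pairwise_incoming p).imp fun h => by rintro rfl; omega
    have hno : (outgoing n p).Nodup := (pairwise_outgoing p).imp fun h => by rintro rfl; omega
    have hd : List.Disjoint (incoming n p) (outgoing n p) := fun i hi ho => by
      rw [mem_incoming] at hi
      rw [mem_outgoing] at ho
      have := lower_lt_upper i.1
      omega
    have k := kTransform_get_map (O p) (P := fun i : Label n => upper i.1 = p + 1 ∨ lower i.1 = p + 1)
      (L := incoming n p ++ outgoing n p) (List.nodup_append'.2 ⟨hni, hno, hd⟩)
      (fun x => by rw [List.mem_append, mem_incoming, mem_outgoing])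
      fun i => (γ i : ℂ) + if upper i.1 = p + 1 then Complex.I * (Real.pi - ε p) else 0
    have k2 : (incoming n p ++ outgoing n p).map
        (fun i => (γ i : ℂ) + if upper i.1 = p + 1 then Complex.I * (Real.pi - ε p) else 0) =
        (incoming n p).map (fun i => (γ i : ℂ) + Complex.I * (Real.pi - ε p)) ++
          (outgoing n p).map (fun i => (γ i : ℂ)) := by
      rw [List.map_append]
      congr 1
      · exact List.map_congr_left fun i hi => by rw [if_pos (mem_incoming.1 hi)]
      · refine List.map_congr_left fun i hi => ?_
        rw [if_neg fun h => hd (mem_incoming.2 h) hi, add_zero]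
    rw [k2] at k
    have k3 : kTr (O p) (fun i : {i : Label n // upper i.1 = p + 1 ∨ lower i.1 = p + 1} =>
        (γ i : ℂ) + if upper i.1.1 = p + 1 then Complex.I * (Real.pi - ε p) else 0) =
      kTr (O p) (legRap (fun i : Label n => upper i.1) (fun i => lower i.1) (p + 1) (ε p) fun i => (γ i : ℂ)) := by
      unfold legRap
      congr!
    rw [shiftedFormFactor_eq, ← k3]
    refine congrArg₂ _ (congrArg₂ _ (congrArg₂ _ ?_ ?_) ?_) ?_
    · rw [pairProd_eq_of_pairwise _ (fun a b => by omega) (pairwise_incoming p) fun _ => mem_incoming]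
      refine Finset.prod_congr rfl fun i _ => Finset.prod_congr rfl fun j _ => ?_
      rw [← ite_and]
      refine if_congr ?_ rfl rfl
      rw [← upper_eq_iff]
      omega
    · rw [pairProd_eq_of_pairwise _ (fun a b => by omega) (pairwise_outgoing p) fun _ => mem_outgoing]
      refine Finset.prod_congr rfl fun i _ => Finset.prod_congr rfl fun j _ => ?_
      rw [← ite_and]
      refine if_congr ?_ rfl rfl
      rw [← lower_eq_iff]
      omega
    · rw [crossProd_eq_ite _ hni hno (fun _ => mem_incoming) fun _ => mem_outgoing]
      refine Finset.prod_congr rfl fun i _ => Finset.prod_congr rfl fun j _ => ?_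
      rw [← ite_and]
      refine if_congr ?_ rfl rfl
      rw [← upper_eq_iff]
      omega
    · rw [k]
      congr!
  have h2 : ∀ i : Label n, atLevel ε (upper i.1) = ε i.1.1.1 := fun i => atLevel_succ ε i.1.1.1
  unfold totalFormFactor
  simp only [h1, h2]
  rw [Finset.prod_mul_distrib, Finset.prod_mul_distrib, Finset.prod_mul_distrib, prod_Ico_one_eq]
  simp only [atLevel_succ]
  refine congrArg₂ _ ?_ rfl
  simp only [Finset.prod_comm (s := (Finset.univ : Finset (Fin (K + 1)))) (t := (Finset.univ : Finset (Label n)))]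
  simp only [← Finset.prod_mul_distrib]
  refine Finset.prod_congr rfl fun i _ => Finset.prod_congr rfl fun j _ => ?_
  simp only [Finset.prod_mul_distrib, Finset.prod_ite_eq, Finset.mem_univ, if_true]
  unfold pairF
  ring

/-- The smearing function in terms of the momentum transferred at each operator. -/
lemma totalSmearing_eq (g : Fin (K + 1) → 𝓢(ℝ × ℝ, ℂ)) (γ : Label n → ℝ) :
    totalSmearing Q (fun x => ∏ s, g s (x s)) γ =
      ampH (fun i : Label n => upper i.1) (fun i => lower i.1) Q (atLevel g) 1 (K + 2) γ := by
  unfold ampH Model.smearProd totalSmearing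
  rw [prod_Ico_one_eq]
  simp only [atLevel_succ, momentumTransform_apply]
  rw [← integral_fintype_prod_volume_eq_prod]
  congr 1
  funext x
  rw [Finset.prod_mul_distrib, mul_comm, ← Complex.exp_sum, ← Complex.exp_sum]
  congr 2
  rw [← Finset.mul_sum, ← Finset.mul_sum, ← Complex.ofReal_sum, ← Complex.ofReal_sum]
  congr 2
  have h1 : ∀ s : Fin (K + 1), minkowski (Q.flow (flowCoeff (fun i : Label n => upper i.1) (fun i => lower i.1) (s + 1)) γ) (x s) =
      ∑ i : Label n, ((if i.1.1.1 = s then minkowski (Q.momentum (γ i)) (x s) else 0) -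
        if i.1.1.2 = s then minkowski (Q.momentum (γ i)) (x s) else 0) := by
    intro s
    unfold Model.flow flowCoeff minkowski
    rw [Prod.fst_sum, Prod.snd_sum, Finset.sum_mul, Finset.sum_mul, ← Finset.sum_sub_distrib]
    refine Finset.sum_congr rfl fun i _ => ?_
    simp only [upper_eq_iff, lower_eq_iff, Prod.smul_fst, Prod.smul_snd, smul_eq_mul]
    split_ifs <;> ring
  have h2 : ∀ q : OrdPair K, minkowski (Q.totalMomentum fun j => γ ⟨q, j⟩) (x q.1.1 - x q.1.2) =
      ∑ j : Fin (n q), (minkowski (Q.momentum (γ ⟨q, j⟩)) (x q.1.1) - minkowski (Q.momentum (γ ⟨q, j⟩)) (x q.1.2)) := by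
    intro q
    unfold Model.totalMomentum minkowski
    rw [Prod.fst_sum, Prod.snd_sum, Finset.sum_mul, Finset.sum_mul, ← Finset.sum_sub_distrib]
    refine Finset.sum_congr rfl fun i _ => ?_
    simp only [Prod.fst_sub, Prod.snd_sub]
    ring
  simp only [h1, h2]
  rw [Finset.sum_comm, Fintype.sum_sigma]
  refine Finset.sum_congr rfl fun q _ => Finset.sum_congr rfl fun j _ => ?_
  rw [Finset.sum_sub_distrib, Finset.sum_ite_eq, Finset.sum_ite_eq, if_pos (Finset.mem_univ _),
    if_pos (Finset.mem_univ _)]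

/-- The integrand of the multiple integrals is the amplitude of all operators. -/
theorem totalScattering_mul_totalSmearing_mul_totalFormFactor (O : Fin (K + 1) → LocalOperator Q)
    (g : Fin (K + 1) → 𝓢(ℝ × ℝ, ℂ)) (ε : Fin (K + 1) → ℝ) (hγ : Function.Injective γ) :
    totalScattering Q γ * totalSmearing Q (fun x => ∏ s, g s (x s)) γ * totalFormFactor O ε γ =
      amp (fun i : Label n => upper i.1) (fun i => lower i.1) (atLevel O) (atLevel g) 1 (K + 2) (atLevel ε) γ := by
  have h1 := extFactor_mul_ampA (hi := fun i : Label n => upper i.1) (lo := fun i => lower i.1)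
    (fun i => lower_lt_upper i.1) (atLevel O) (p := 1) (k := K + 2) le_rfl (fun i => upper_lt i.1) (atLevel ε) hγ
  have h2 : extFactor (fun i : Label n => upper i.1) (fun i => lower i.1) Q 1 γ = 1 :=
    Finset.prod_eq_one fun i _ => Finset.prod_eq_one fun j _ => if_neg fun h =>
      absurd h.2.2.1 (not_lt.2 (one_le_lower i.1))
  rw [h2, one_mul] at h1
  unfold amp
  rw [h1, totalSmearing_eq, totalScattering_eq hγ, totalFormFactor_eq]
  have e1 : ∀ a b c d : ℂ, a * b * (c * d) = b * (a * c * d) := fun _ _ _ _ => by ring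
  rw [e1]
  refine congrArg₂ _ rfl (congrArg₂ _ ?_ rfl)
  simp only [← Finset.prod_mul_distrib]
  refine prod_prod_eq_of_pairs _ (fun i j hij => ?_) fun i => ?_
  · have key : ∀ i j : Label n, (if lower j.1 < lower i.1 ∧ lower i.1 < upper j.1 ∧ upper j.1 < upper i.1 then
        Q.S ((γ i : ℂ) - γ j) else 1) * ((if upper i.1 = lower j.1 then
        Q.minimalFF ((γ i : ℂ) - γ j + Complex.I * (Real.pi - atLevel ε (upper i.1))) else 1) *
      (if upper i.1 = upper j.1 ∧ (lower j.1 < lower i.1 ∨ lower i.1 = lower j.1 ∧ labelRank j < labelRank i) then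
        Q.minimalFF ((γ i : ℂ) - γ j) else 1) *
      (if lower i.1 = lower j.1 ∧ (upper j.1 < upper i.1 ∨ upper i.1 = upper j.1 ∧ labelRank i < labelRank j) then
        Q.minimalFF ((γ i : ℂ) - γ j) else 1)) =
      pairAmp 1 (upper i.1) (lower i.1) (labelRank i) (upper j.1) (lower j.1) (labelRank j)
        (Q.minimalFF ((γ i : ℂ) - γ j))
        (Q.minimalFF ((γ i : ℂ) - γ j + Complex.I * (Real.pi - atLevel ε (upper i.1)))) (Q.S ((γ i : ℂ) - γ j)) := by
      intro i j
      have h3 := one_le_lower i.1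
      have h4 := lower_lt_upper i.1
      have h5 : 1 ≤ upper i.1 := h3.trans h4.le
      unfold pairAmp
      rw [if_neg (by omega : ¬ (1 ≤ upper i.1 ∧ 1 ≤ upper j.1 ∧ lower i.1 < 1 ∧ lower j.1 < 1 ∧
        (upper j.1 < upper i.1 ∨ upper i.1 = upper j.1 ∧
          (lower i.1 < lower j.1 ∨ lower i.1 = lower j.1 ∧ labelRank i < labelRank j)))), one_mul, mul_comm]
      simp only [h3, h5, true_and]
    rw [key, key, if_neg hij, if_neg hij.symm]
    exact pairAmp_mul_pairAmp le_rfl (lower_lt_upper i.1) (lower_lt_upper j.1) (labelRank_injective.ne hij) _ _ _ _ _ _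
  · have := lower_lt_upper i.1
    rw [if_pos rfl]
    simp (discharger := omega) only [if_neg, mul_one]

end Blocks

/-! ### The iterated limits -/

section Iterated
variable {Q : Model} {K : ℕ} {n : OrdPair K → ℕ}

lemma IsIteratedLimit.unique {Ψ : (Fin (K + 1) → ℝ) → (Label n → ℝ) → ℂ} : ∀ {j : ℕ} {ε : Fin (K + 1) → ℝ}
    {γ : Label n → ℝ} {v v' : ℂ}, IsIteratedLimit Ψ j ε γ v → IsIteratedLimit Ψ j ε γ v' → v = v'
  | 0, _, _, _, _, h, h' => tendsto_nhds_unique h h'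
  | j + 1, ε, γ, v, v', ⟨J, h1, h2⟩, ⟨J', h1', h2'⟩ => by
    refine tendsto_nhds_unique h2 (h2'.congr' ?_)
    filter_upwards [h1, h1'] with t ht ht'
    refine integral_congr_ae ?_
    filter_upwards [ht.1, ht'.1] with y hy hy' using hy'.unique hy

/-- The boundary value obtained by integrating over the particles absorbed by the operators with index larger
than `p`. -/
def innerValue (O : Fin (K + 1) → LocalOperator Q) (g : Fin (K + 1) → 𝓢(ℝ × ℝ, ℂ)) (n : OrdPair K → ℕ) (p : ℕ)
    (ε : ℕ → ℝ) (γ : Label n → ℝ) : ℂ :=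
  boundaryValue (fun i : Label n => upper i.1) (fun i => lower i.1) (atLevel O) (atLevel g) 1 (K + 2)
    (fun i => p < i.1.1.1) ε γ

lemma deformable_innerValue (n : OrdPair K → ℕ) (p : ℕ) : Deformable (fun i : Label n => upper i.1)
    (fun i => lower i.1) 1 (K + 2) (fun i => p < i.1.1.1) (Set.Icc 1 p) where
  lt i := lower_lt_upper i.1
  hi_lt i := upper_lt i.1
  le i _ := Nat.le_add_left _ _
  pinch i j hij _ := by
    have h1 := lower_lt_upper j.1
    simp only [upper, lower, Set.mem_Icc] at hij h1 ⊢
    omega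

/-- The regulators `ε` of the operators with index smaller than `p`, the regulator `t` of the operator `p`, and
`0` for the following operators. -/
def cutReg (p : ℕ) (ε : Fin (K + 1) → ℝ) (t : ℝ) : ℕ → ℝ :=
  atLevel fun s => if (s : ℕ) < p then ε s else if (s : ℕ) = p then t else 0

lemma cutReg_mem_regBox {p : ℕ} {ε : Fin (K + 1) → ℝ} {e t : ℝ} (hε : ∀ s : Fin (K + 1), (s : ℕ) < p → 0 < ε s ∧ ε s ≤ 1)
    (he : ∀ s : Fin (K + 1), (s : ℕ) < p → e ≤ ε s) (h0 : 0 ≤ t) (h1 : t ≤ 1) (hp : p < K + 1) :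
    cutReg p ε t ∈ regBox e (Set.Icc 1 p) := by
  intro q
  unfold cutReg atLevel
  set s := Fin.ofNat (K + 1) (q - 1) with hs
  dsimp only
  refine ⟨?_, ?_, fun hq => ?_⟩
  · split_ifs with h
    exacts [(hε s h).1.le, h0, le_rfl]
  · split_ifs with h
    exacts [(hε s h).2, h1, zero_le_one]
  · have h2 : (s : ℕ) = q - 1 := by
      rw [hs]
      exact Nat.mod_eq_of_lt (by have := hq.2; omega)
    have h3 : (s : ℕ) < p := by have := hq.1; have := hq.2; omega
    rw [if_pos h3]
    exact he s h3

lemma cutReg_succ {p : ℕ} (ε : Fin (K + 1) → ℝ) (t : ℝ) {s₀ : Fin (K + 1)} (hs : (s₀ : ℕ) = p) :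
    cutReg (p + 1) (Function.update ε s₀ t) 0 = cutReg p ε t := by
  unfold cutReg
  congr 1
  funext s
  by_cases h : s = s₀
  · subst h
    simp [hs]
  · have h2 : (s : ℕ) ≠ p := fun h' => h (Fin.ext (h'.trans hs.symm))
    rw [Function.update_of_ne h]
    split_ifs <;> first | rfl | omega

lemma continuous_cutReg (p : ℕ) (ε : Fin (K + 1) → ℝ) : Continuous (cutReg p ε) := by
  refine continuous_pi fun q => ?_
  unfold cutReg atLevel
  dsimp only
  split_ifs
  exacts [continuous_const, continuous_id, continuous_const]

lemma exists_lower_bound {p : ℕ} {ε : Fin (K + 1) → ℝ} (hε : ∀ s : Fin (K + 1), (s : ℕ) < p → 0 < ε s ∧ ε s ≤ 1) :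
    ∃ e : ℝ, 0 < e ∧ e ≤ 1 ∧ ∀ s : Fin (K + 1), (s : ℕ) < p → e ≤ ε s := by
  obtain ⟨s₀, -, hs₀⟩ := Finset.exists_min_image Finset.univ
    (fun s : Fin (K + 1) => if (s : ℕ) < p then ε s else 1) ⟨0, Finset.mem_univ _⟩
  refine ⟨_, ?_, ?_, fun s hs => (hs₀ s (Finset.mem_univ _)).trans (le_of_eq (if_pos hs))⟩
  · split_ifs with h
    exacts [(hε _ h).1, one_pos]
  · split_ifs with h
    exacts [(hε _ h).2, le_rfl]

/-- The boundary values are continuous in the regulator of the next operator, those of the preceding operators being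
fixed and positive. -/
lemma tendsto_innerValue (O : Fin (K + 1) → LocalOperator Q) (g : Fin (K + 1) → 𝓢(ℝ × ℝ, ℂ)) {p : ℕ}
    (hp : p < K + 1) {ε : Fin (K + 1) → ℝ} (hε : ∀ s : Fin (K + 1), (s : ℕ) < p → 0 < ε s ∧ ε s ≤ 1)
    (γ : Label n → ℝ) : Tendsto (fun t => innerValue O g n p (cutReg p ε t) γ) (𝓝[>] (0 : ℝ))
      (𝓝 (innerValue O g n p (cutReg p ε 0) γ)) := by
  obtain ⟨e, he, he1, hle⟩ := exists_lower_bound hε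
  refine ((continuousOn_boundaryValue (atLevel g) (deformable_innerValue n p) (atLevel O) he he1 γ) _
    (cutReg_mem_regBox hε hle le_rfl zero_le_one hp)).tendsto.comp (tendsto_nhdsWithin_iff.2 ⟨?_, ?_⟩)
  · exact ((continuous_cutReg p ε).tendsto 0).mono_left nhdsWithin_le_nhds
  · filter_upwards [Ioc_mem_nhdsGT (zero_lt_one' ℝ)] with t ht using cutReg_mem_regBox hε hle ht.1.le ht.2 hp

lemma setBlock_eq_glue (γ : Label n → ℝ) (b : Fin (K + 1)) (y : Block n b → ℝ) :
    setBlock γ b y = glue (fun i => i.1.1.1 = b) γ y := by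
  funext i
  unfold setBlock
  split_ifs with h
  · exact (glue_of_pos (J := fun i : Label n => i.1.1.1 = b) h).symm
  · exact (glue_of_neg (J := fun i : Label n => i.1.1.1 = b) h).symm

/-- Integration over the particles absorbed by one operator, with the regulators of the preceding operators fixed. -/
lemma innerValue_eq_integral (O : Fin (K + 1) → LocalOperator Q) (g : Fin (K + 1) → 𝓢(ℝ × ℝ, ℂ)) {p : ℕ}
    {b : Fin (K + 1)} (hb : (b : ℕ) = p + 1) {ε : Fin (K + 1) → ℝ}
    (hε : ∀ s : Fin (K + 1), (s : ℕ) < p + 1 → 0 < ε s ∧ ε s ≤ 1) (γ : Label n → ℝ) :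
    Integrable (fun y : Block n b → ℝ => innerValue O g n (p + 1) (cutReg (p + 1) ε 0) (setBlock γ b y)) ∧
      ∫ y : Block n b → ℝ, innerValue O g n (p + 1) (cutReg (p + 1) ε 0) (setBlock γ b y) =
        innerValue O g n p (cutReg (p + 1) ε 0) γ := by
  obtain ⟨e, he, he1, hle⟩ := exists_lower_bound hε
  have hbox : cutReg (p + 1) ε 0 ∈ regBox e (Set.Icc 1 p ∪ Set.Icc 1 (p + 1) ∪ Set.Ico 1 1) := by
    have h1 : (Set.Icc 1 p ∪ Set.Icc 1 (p + 1) ∪ Set.Ico 1 1 : Set ℕ) = Set.Icc 1 (p + 1) := by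
      ext q
      simp only [Set.mem_union, Set.mem_Icc, Set.mem_Ico]
      omega
    rw [h1]
    exact cutReg_mem_regBox hε hle le_rfl zero_le_one (hb ▸ b.2)
  have key := integral_amp_mul_boundaryValue (O := atLevel O) (J₁ := fun i : Label n => i.1.1.1 = b) (atLevel g)
    (deformable_innerValue n p) (deformable_innerValue n (p + 1)) le_rfl (by omega : 1 ≤ K + 2)
    (fun i => by rw [Fin.ext_iff]; omega) (fun i h => by rw [h]; omega) (fun i _ => Nat.le_add_left _ _)
    (Or.inl le_rfl) he he1 hbox γ
  simp only [amp_self, one_mul, ← setBlock_eq_glue] at key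
  unfold innerValue
  convert key

lemma cutReg_last (ε : Fin (K + 1) → ℝ) (t : ℝ) : cutReg K ε t = atLevel (Function.update ε (Fin.last K) t) := by
  unfold cutReg
  congr 1
  funext s
  by_cases h : s = Fin.last K
  · subst h
    simp
  · have h2 : (s : ℕ) < K := Fin.val_lt_last h
    rw [Function.update_of_ne h, if_pos h2]

lemma innerValue_last (O : Fin (K + 1) → LocalOperator Q) (g : Fin (K + 1) → 𝓢(ℝ × ℝ, ℂ)) {ε : Fin (K + 1) → ℝ}
    (hε : ∀ s : Fin (K + 1), (s : ℕ) < K → 0 < ε s ∧ ε s ≤ 1) {t : ℝ} (ht : 0 < t) (ht1 : t ≤ 1) (γ : Label n → ℝ) :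
    innerValue O g n K (cutReg K ε t) γ = amp (fun i : Label n => upper i.1) (fun i => lower i.1) (atLevel O)
      (atLevel g) 1 (K + 2) (atLevel (Function.update ε (Fin.last K) t)) γ := by
  obtain ⟨e, he, he1, hle⟩ := exists_lower_bound hε
  unfold innerValue
  rw [boundaryValue_of_forall_not (deformable_innerValue n K) he he1
    (cutReg_mem_regBox hε hle ht.le ht1 (Nat.lt_succ_self K)) (fun q => ?_)
    (fun i => not_lt.2 (Nat.lt_succ_iff.1 i.1.1.1.2)) γ, cutReg_last]
  rw [cutReg_last]
  unfold atLevel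
  set s := Fin.ofNat (K + 1) (q - 1)
  by_cases h : s = Fin.last K
  · rw [h, Function.update_self]
    exact ht
  · rw [Function.update_of_ne h]
    exact (hε s (Fin.val_lt_last h)).1

/-- The iterated limits exist, and are given by the boundary values. -/
theorem isIteratedLimit_innerValue (O : Fin (K + 1) → LocalOperator Q) (g : Fin (K + 1) → 𝓢(ℝ × ℝ, ℂ)) :
    ∀ (j : ℕ), j ≤ K → ∀ (ε : Fin (K + 1) → ℝ) (γ : Label n → ℝ),
      (∀ s : Fin (K + 1), (s : ℕ) < K - j → 0 < ε s ∧ ε s ≤ 1) →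
      Set.InjOn γ {i | (i.1.1.1 : ℕ) ≤ K - j} →
      IsIteratedLimit (fun ε (γ : Label n → ℝ) => totalScattering Q γ *
        totalSmearing Q (fun x => ∏ s, g s (x s)) γ * totalFormFactor O ε γ) j ε γ
        (innerValue O g n (K - j) (cutReg (K - j) ε 0) γ)
  | 0, _, ε, γ, hε, hγ => by
    have hinj : Function.Injective γ := fun i i' h => hγ (Nat.lt_succ_iff.1 i.1.1.1.2) (Nat.lt_succ_iff.1 i'.1.1.1.2) h
    refine (tendsto_innerValue O g (Nat.lt_succ_self K) hε γ).congr' ?_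
    filter_upwards [Ioc_mem_nhdsGT (zero_lt_one' ℝ)] with t ht
    rw [totalScattering_mul_totalSmearing_mul_totalFormFactor O g _ hinj, ← innerValue_last O g hε ht.1 ht.2]
  | j + 1, hj, ε, γ, hε, hγ => by
    have hp : K - j = K - (j + 1) + 1 := by omega
    have hlev : ((level K (j + 1) : Fin (K + 1)) : ℕ) = K - (j + 1) := rfl
    have hlev' : ((level K j : Fin (K + 1)) : ℕ) = K - (j + 1) + 1 := hp
    have hε' : ∀ t : ℝ, t ∈ Set.Ioc (0 : ℝ) 1 → ∀ s : Fin (K + 1), (s : ℕ) < K - (j + 1) + 1 →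
        0 < Function.update ε (level K (j + 1)) t s ∧ Function.update ε (level K (j + 1)) t s ≤ 1 := by
      intro t ht s hs
      by_cases h : s = level K (j + 1)
      · rw [h, Function.update_self]
        exact ht
      · rw [Function.update_of_ne h]
        refine hε s ?_
        have : (s : ℕ) ≠ K - (j + 1) := fun h' => h (Fin.ext h')
        omega
    refine ⟨fun t y => innerValue O g n (K - j) (cutReg (K - j) (Function.update ε (level K (j + 1)) t) 0)
      (setBlock γ (level K j) y), ?_, ?_⟩
    · filter_upwards [Ioc_mem_nhdsGT (zero_lt_one' ℝ)] with t ht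
      constructor
      · have h1 := ae_injOn_glue (J := fun i : Label n => i.1.1.1 = level K j) (γ := γ)
          (s := {i | (i.1.1.1 : ℕ) ≤ K - j}) (hγ.mono fun i hi => by
            have h2 : (i.1.1.1 : ℕ) ≠ K - j := fun h => hi.2 (Fin.ext h)
            have h3 : (i.1.1.1 : ℕ) ≤ K - j := hi.1
            change (i.1.1.1 : ℕ) ≤ K - (j + 1)
            omega)
        have h2 : ∀ᵐ y : Block n (level K j) → ℝ, Set.InjOn (setBlock γ (level K j) y) {i | (i.1.1.1 : ℕ) ≤ K - j} := by
          simp only [setBlock_eq_glue]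
          convert h1
        filter_upwards [h2] with y hy
        exact isIteratedLimit_innerValue O g j (by omega) _ _ (by rw [hp]; exact hε' t ht) hy
      · have := (innerValue_eq_integral O g hlev' (hε' t ht) γ).1
        rw [← hp] at this
        exact this
    · refine (tendsto_innerValue O g (by omega : K - (j + 1) < K + 1) hε γ).congr' ?_
      filter_upwards [Ioc_mem_nhdsGT (zero_lt_one' ℝ)] with t ht
      have := (innerValue_eq_integral O g hlev' (hε' t ht) γ).2
      rw [cutReg_succ ε t hlev, ← cutReg_succ ε t hlev, ← hp] at this
      rw [this, hp, cutReg_succ ε t hlev]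

/-- The multiple integrals are boundary values, which also are the terms of the expansion of the vacuum
expectation value. -/
theorem isSummand_term (O : Fin (K + 1) → LocalOperator Q) (g : Fin (K + 1) → 𝓢(ℝ × ℝ, ℂ)) (n : OrdPair K → ℕ)
    (h : Fin 0 → ℕ) (α : Fin 0 → ℝ) :
    IsSummand O (fun x => ∏ s, g s (x s)) n (term (atLevel O) (atLevel g) 1 0 h n α) := by
  have h1 := isIteratedLimit_innerValue O g (n := n) K le_rfl 0 0 (fun s hs => by omega) fun i hi => by
    have h2 : (i.1.1.2 : ℕ) < i.1.1.1 := i.1.2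
    have h3 : (i.1.1.1 : ℕ) ≤ K - K := hi
    omega
  have h2 : cutReg (K - K) (0 : Fin (K + 1) → ℝ) 0 = 0 := by
    funext q
    unfold cutReg atLevel
    dsimp only
    split_ifs <;> rfl
  rw [h2, Nat.sub_self] at h1
  have h3 : term (atLevel O) (atLevel g) 1 0 h n α = innerValue O g n 0 0 0 := by
    have hJ : Deformable (hiOf h n) (loOf n) 1 (K + 2) (exchanged n) ∅ :=
      deformable_exchanged le_rfl (fun i => i.elim0) fun q hq => absurd (one_le_lower q) (not_le.2 hq)
    have hrel : IsRelabelling (hiOf h n) (loOf n) (fun i : Label n => upper i.1) (fun i => lower i.1) 1 Sum.inr :=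
      { injective := Sum.inr_injective
        hi_eq := fun i => rfl
        lo_eq := fun i => rfl
        mem_range := fun i _ => by
          rcases i with i | i
          · exact i.elim0
          · exact ⟨i, rfl⟩ }
    have hJf : (exchanged n : Fin 0 ⊕ Label n → Prop) ∘ Sum.inr = fun i => 0 < (i.1.1.1 : ℕ) := by
      funext i
      refine propext (iff_of_true trivial ?_)
      have : (i.1.1.2 : ℕ) < i.1.1.1 := i.1.2
      omega
    have key := hrel.extFactor_mul_boundaryValue (Q := Q) hJ
      (by
        rw [hJf]
        have := deformable_innerValue n 0
        rwa [Set.Icc_eq_empty (by norm_num)] at this)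
      (fun i _ => by
        rcases i with i | i
        · exact i.elim0
        · exact one_le_lower i.1) (atLevel O) (atLevel g) le_rfl one_pos le_rfl zero_mem_regBox
      (γ := Sum.elim α 0) fun i hi => by
        rcases i with i | i
        · exact i.elim0
        · exact absurd trivial hi
    rw [hJf] at key
    unfold term
    rw [← key]
    unfold innerValue
    have h4 : extFactor (fun i : Label n => upper i.1) (fun i => lower i.1) Q 1 (Sum.elim α 0 ∘ Sum.inr) = 1 :=
      Finset.prod_eq_one fun i _ => Finset.prod_eq_one fun j _ => if_neg fun h =>
        absurd h.2.2.1 (not_lt.2 (one_le_lower i.1))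
    rw [h4, one_mul]
    rfl
  rw [h3]
  exact h1

end Iterated

/-! ### The vacuum expectation value as a sum over the exchanged particles -/

section Final
variable {Q : Model} {K : ℕ}

/-- The number `r` of particles in the truncated sectors, as a function of the level of the operator which
creates this sector. -/
def sectorSize (r : Fin K → ℕ) (q : ℕ) : ℕ := if h : 2 ≤ q ∧ q < K + 2 then r ⟨q - 2, by omega⟩ else 0

lemma sectorSize_succ (r : Fin K → ℕ) (p : Fin (K + 1)) :
    sectorSize r (p + 1) = (Fin.cons 0 r : Fin (K + 1) → ℕ) p := by
  refine Fin.cases ?_ (fun i => ?_) p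
  · exact dif_neg (by simp)
  · rw [Fin.cons_succ]
    exact dif_pos ⟨by simp, by simp⟩

lemma sectorSize_last (r : Fin K → ℕ) : sectorSize r (K + 2) = 0 := dif_neg (by omega)

lemma flux_eq {ι : Type*} [Fintype ι] [IsEmpty ι] (h : ι → ℕ) (n : OrdPair K → ℕ) (s : Fin (K + 1)) :
    flux h n (s + 1) = ∑ q : OrdPair K, if s ∈ Finset.Ioc q.1.2 q.1.1 then n q else 0 := by
  unfold flux
  rw [Fintype.sum_empty, zero_add]
  refine Finset.sum_congr rfl fun q _ => if_congr ?_ rfl rfl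
  rw [Finset.mem_Ioc, Fin.lt_def, Fin.le_def]
  unfold lower upper
  omega

lemma mem_admissible_iff_mem_truncationSet {ι : Type*} [Fintype ι] [IsEmpty ι] (r : Fin K → ℕ) (h : ι → ℕ)
    (n : OrdPair K → ℕ) : n ∈ admissible K (sectorSize r) 1 h ↔ n ∈ truncationSet r := by
  have hflux : ∀ p : Fin K, flux h n (p + 2) = ∑ q : OrdPair K,
      (if q.1.2 ≤ p.castSucc ∧ p.castSucc < q.1.1 then n q else 0) := fun p => by
    have h1 := flux_eq h n p.succ
    rw [Fin.val_succ] at h1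
    rw [h1]
    refine Finset.sum_congr rfl fun q _ => if_congr ?_ rfl rfl
    simp only [Finset.mem_Ioc, Fin.lt_def, Fin.le_def, Fin.val_succ, Fin.val_castSucc]
    omega
  rw [mem_admissible]
  constructor
  · rintro ⟨-, h2⟩ p
    rw [← hflux, h2 (p + 2) (by omega) (by omega)]
    have h3 : 2 ≤ (p : ℕ) + 2 ∧ (p : ℕ) + 2 < K + 2 := by omega
    rw [sectorSize, dif_pos h3]
    rfl
  · intro h2
    refine ⟨fun q hq => absurd (one_le_lower q) (not_le.2 hq), fun t ht htK => ?_⟩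
    have h3 := hflux ⟨t - 2, by omega⟩
    rw [h2 ⟨t - 2, by omega⟩] at h3
    have h4 : t - 2 + 2 = t := by omega
    simp only [h4] at h3
    rw [h3]
    rw [sectorSize, dif_pos ⟨(by omega : 2 ≤ t), htK⟩]

/-- The phase factors of the operators, in terms of those of the exchanged particles. -/
lemma prod_phase {ι : Type*} [Fintype ι] [IsEmpty ι] (O : Fin (K + 1) → LocalOperator Q) {R : ℕ → ℕ} {h : ι → ℕ}
    {n : OrdPair K → ℕ} (hR : R 1 = 0) (hn : n ∈ admissible K R 1 h) :
    ∏ q ∈ Finset.Ico 1 (K + 2), Complex.exp (-2 * Complex.I * Real.pi * R q * (atLevel O q).omega) =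
      ∏ q : OrdPair K, Complex.exp (-2 * Complex.I * Real.pi * n q * omegaSum O q) := by
  have h1 : ∀ s : Fin (K + 1), R (s + 1) = ∑ q : OrdPair K, if s ∈ Finset.Ioc q.1.2 q.1.1 then n q else 0 := fun s => by
    rw [← flux_eq h n s]
    rcases Nat.eq_zero_or_pos (s : ℕ) with h0 | h0
    · have h2 := flux_eq h n s
      rw [h0] at h2 ⊢
      rw [zero_add] at h2 ⊢
      rw [hR, h2]
      refine (Finset.sum_eq_zero fun q _ => if_neg ?_).symm
      rw [Finset.mem_Ioc, Fin.lt_def]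
      omega
    · exact ((mem_admissible.1 hn).2 (s + 1) (by omega) (by omega)).symm
  rw [prod_Ico_one_eq]
  simp only [atLevel_succ, h1]
  rw [← Complex.exp_sum, ← Complex.exp_sum]
  congr 1
  have h2 : ∀ s : Fin (K + 1), (-2 * Complex.I * Real.pi *
      ((∑ q : OrdPair K, if s ∈ Finset.Ioc q.1.2 q.1.1 then n q else 0 : ℕ) : ℂ) * (O s).omega) =
      ∑ q : OrdPair K, if s ∈ Finset.Ioc q.1.2 q.1.1 then -2 * Complex.I * Real.pi * n q * (O s).omega else 0 := by
    intro s
    push_cast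
    rw [Finset.mul_sum, Finset.sum_mul]
    refine Finset.sum_congr rfl fun q _ => ?_
    split_ifs <;> simp
  simp only [h2]
  rw [Finset.sum_comm]
  refine Finset.sum_congr rfl fun q _ => ?_
  unfold omegaSum
  rw [Finset.sum_ite_mem, Finset.univ_inter]
  push_cast
  rw [Finset.mul_sum]

/-- The truncated vacuum expectation value, as a sum of boundary values. -/
theorem isTruncatedExpectation_stageVector (O : Fin (K + 1) → LocalOperator Q) (g : Fin (K + 1) → 𝓢(ℝ × ℝ, ℂ))
    (r : Fin K → ℕ) : IsTruncatedExpectation O g r (stageVector K (atLevel O) (atLevel g) (sectorSize r) 1 0 ![]) := by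
  refine ⟨fun i => stageVector K (atLevel O) (atLevel g) (sectorSize r) (i + 1), ?_, fun p => ?_, rfl⟩
  · exact stageVector_last (sectorSize_last r)
  · have h1 := isTruncatedAction_stageVector (O := atLevel O) (g := atLevel g) (R := sectorSize r) (p := p + 1)
      (Nat.le_add_left 1 p) (by omega) (sectorSize_last r)
    rw [atLevel_succ, atLevel_succ, sectorSize_succ] at h1
    exact h1

/-- The vacuum component of the last vector, as a sum over the numbers of exchanged particles. -/
lemma stageVector_one (O : Fin (K + 1) → LocalOperator Q) (g : Fin (K + 1) → 𝓢(ℝ × ℝ, ℂ)) (r : Fin K → ℕ) :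
    stageVector K (atLevel O) (atLevel g) (sectorSize r) 1 0 ![] = ∑ n ∈ (truncationSet_finite r).toFinset,
      term (atLevel O) (atLevel g) 1 0 ![] n ![] / ((∏ q, ((n q).factorial : ℂ)) * (2 * Real.pi : ℂ) ^ (∑ q, n q)) *
        ∏ q, Complex.exp (-2 * Complex.I * Real.pi * n q * omegaSum O q) := by
  have hR : sectorSize r 1 = 0 := dif_neg (by omega)
  have hset : (truncationSet_finite r).toFinset = admissible K (sectorSize r) 1 (![] : Fin 0 → ℕ) := by
    ext n
    rw [Set.Finite.mem_toFinset, mem_admissible_iff_mem_truncationSet]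
  unfold stageVector
  rw [if_pos hR.symm, expansion_eq, hset]
  have h1 : (Fintype.piFinset fun _ : Fin 0 => Finset.Ico 1 (K + 2)) = {![]} := by
    refine Finset.eq_singleton_iff_unique_mem.2 ⟨?_, fun h _ => Subsingleton.elim _ _⟩
    rw [Fintype.mem_piFinset]
    exact fun i => i.elim0
  rw [h1, Finset.sum_singleton, Finset.mul_sum, List.finRange_zero, pairProd, div_one]
  refine Finset.sum_congr rfl fun n hn => ?_
  rw [prod_phase O hR hn, coefficient]
  ring

end Final

end SinhGordon

end

theorem mainTheorem4 (Q : SinhGordon.Model) (K : ℕ)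
    (O : Fin (K + 1) → SinhGordon.LocalOperator Q) (g : Fin (K + 1) → 𝓢(ℝ × ℝ, ℂ))
    (r : Fin K → ℕ) (I : (SinhGordon.OrdPair K → ℕ) → ℂ)
    (hI : ∀ n ∈ SinhGordon.truncationSet r,
      SinhGordon.IsSummand O (fun x => ∏ s, g s (x s)) n (I n)) :
    SinhGordon.IsTruncatedExpectation O g r
      (∑ n ∈ (SinhGordon.truncationSet_finite r).toFinset,
        I n / ((∏ q, ((n q).factorial : ℂ)) * (2 * Real.pi : ℂ) ^ (∑ q, n q)) *
          ∏ q, Complex.exp (-2 * Complex.I * Real.pi * n q * SinhGordon.omegaSum O q)) := by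
  have h := SinhGordon.isTruncatedExpectation_stageVector O g r
  rw [SinhGordon.stageVector_one] at h
  -- the iterated limits are unique
  have hterm : ∀ n ∈ (SinhGordon.truncationSet_finite r).toFinset,
      I n = SinhGordon.term (SinhGordon.atLevel O) (SinhGordon.atLevel g) 1 0 ![] n ![] := fun n hn =>
    (hI n ((SinhGordon.truncationSet_finite r).mem_toFinset.1 hn)).unique (SinhGordon.isSummand_term O g n ![] ![])
  rwa [Finset.sum_congr rfl fun n hn => by rw [hterm n hn]]
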